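/- **Problem.** An instance of MSPEC (Minimum Shared-Power Edge Cut) is a finite simple undirected graph $G=(V\cup\{s,t\},E)$, with $n=|V|$, $m=|E|$, $s\neq t$ and $s,t\notin V$, and a real weight $w_{u,v}\ge 0$ on each edge. A power assignment $p:V\to[0,\infty)$, extended by $p_s=p_t=0$, is feasible if removing all edges $(u,v)\in E$ with $p_u+p_v\ge w_{u,v}$ disconnects $s$ from $t$; its cost is $\sum_{v\in V}p_v$. Only instances that have a feasible assignment are considered. Let $\mathrm{OPT}$ be the minimum cost of a feasible assignment, and let $Z$ be the minimum cost of a feasible discrete assignment, i.e. one in which each $p_v$ is $0$ or the weight of an edge incident to $v$. For $\varepsilon>0$ let $\alpha=\varepsilon Z/(2n)$ and $c=\lceil 2n/\varepsilon\rceil$. Let $G'$ be the graph whose vertices are $s$, $t$ and, for each $v\in V$, the copies $v(0),\dots,v(c)$, where $v(0),\dots,v(c-1)$ are removable and $v(c)$ is not; $u(i)$ and $v(j)$ are adjacent iff $(u,v)\in E$ and $i\alpha+j\alpha<w_{u,v}$; for $x\in\{s,t\}$, $u(i)$ and $x$ are adjacent iff $(u,x)\in E$ and $i\alpha<w_{u,x}$;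 and $s,t$ are adjacent iff $(s,t)\in E$ and $0<w_{s,t}$. A cut is a set $K$ of removable copies that meets every $s$-$t$ walk in $G'$, and $p^K_v=\alpha\cdot|\{i: v(i)\in K\}|$. **Theorem.** 1. $\mathrm{OPT}$ and $Z$ are attained, and $Z/2\le \mathrm{OPT}\le Z$. 2. For every $\varepsilon>0$, $G'$ has a cut of minimum cardinality, and for every such cut $K$ the powers $p^K$ are feasible, with $\sum_v p^K_v=\alpha|K|\le(1+\varepsilon)\,\mathrm{OPT}$. 3. There is an algorithm that computes $Z$ from the instance in time $O(m^3/\log m)$. 4. (FPTAS.) There is a single algorithm that, given any instance and any $\varepsilon>0$, halts and outputs powers $p=p^K$ for some minimum-cardinality cut $K$ of $G'$; thus $p$ is feasible with $\sum_v p_v\le(1+\varepsilon)\,\mathrm{OPT}$. Its running time, including the computation of $Z$, is at most $C\left(n^3 m\,\min(\varepsilon,1)^{-2.5}+m^3/\log m\right)$, i.e. $O(n^3m\,\varepsilon^{-2.5}+m^3/\log m)$ for $0<\varepsilon\le1$. Both time bounds are for $m\ge2$, with absolute constants. Algorithms are programs of a real RAM: arrays of natural numbers and of reals with indirect addressing;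 the arithmetic operations $+,-$ on naturals and $+,-,\times,/$ on reals, conversion of a natural number to a real, comparisons, memory accesses and control steps each cost one step; there is no rounding operation. The input is $n$, $m$, the list of edges with their weights, and (in part 4) $\varepsilon$. -/

import Mathlib

open Finset

/-! ### The problem MSPEC -/

/-- The vertex set `V ∪ {s, t}` of an instance: the vertices in `V` and two terminals. -/
inductive Vertex (V : Type*) where
  | s : Vertex V
  | t : Vertex V
  | inner (v : V) : Vertex V

/-- An instance of the Minimum Shared-Power Edge Cut problem: a simple undirected graph on
`V ∪ {s, t}` with a non-negative real weight on each edge.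
(The values of `weight` off the edge set play no role.) -/
structure Instance (V : Type*) where
  graph : SimpleGraph (Vertex V)
  weight : Sym2 (Vertex V) → ℝ
  weight_nonneg : ∀ e ∈ graph.edgeSet, 0 ≤ weight e

/-- A power assignment on `V`, extended by `p_s = p_t = 0`. -/
def extendPower {V : Type*} (p : V → ℝ) : Vertex V → ℝ
  | .s => 0
  | .t => 0
  | .inner v => p v

namespace Instance

variable {V : Type*}

/-- The graph that is left when all edges `(x, y)` with `p_x + p_y ≥ w_{x,y}` are removed. -/
def remaining (I : Instance V) (p : V → ℝ) : SimpleGraph (Vertex V) where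
  Adj x y := I.graph.Adj x y ∧ extendPower p x + extendPower p y < I.weight s(x, y)
  symm := ⟨fun x y h => ⟨h.1.symm, by rw [Sym2.eq_swap, add_comm]; exact h.2⟩⟩
  loopless := ⟨fun x h => I.graph.loopless.irrefl x h.1⟩

/-- `p` is a feasible solution: it is non-negative and `s`, `t` get disconnected. -/
def IsFeasible (I : Instance V) (p : V → ℝ) : Prop :=
  (∀ v, 0 ≤ p v) ∧ ¬ (I.remaining p).Reachable Vertex.s Vertex.t

/-- The instance has a feasible solution. -/
def Solvable (I : Instance V) : Prop := ∃ p, I.IsFeasible p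

/-- `p` only uses the power `0` and, at each vertex, weights of edges incident to that vertex. -/
def IsDiscrete (I : Instance V) (p : V → ℝ) : Prop :=
  ∀ v, p v = 0 ∨ ∃ e ∈ I.graph.incidenceSet (Vertex.inner v), p v = I.weight e

variable [Fintype V]

/-- The power sums of feasible solutions. -/
def costs (I : Instance V) : Set ℝ := {c | ∃ p, I.IsFeasible p ∧ c = ∑ v, p v}

/-- The power sums of feasible solutions of the discrete problem. -/
def discreteCosts (I : Instance V) : Set ℝ :=
  {c | ∃ p, I.IsFeasible p ∧ I.IsDiscrete p ∧ c = ∑ v, p v}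

/-- The optimum `OPT` of the instance. -/
noncomputable def opt (I : Instance V) : ℝ := sInf I.costs

/-- The optimum `Z` of the discrete problem. -/
noncomputable def discreteOpt (I : Instance V) : ℝ := sInf I.discreteCosts

/-! ### The discretization -/

/-- The power `α = ε Z / (2 n)` that one copy of a vertex stands for. -/
noncomputable def unitPower (I : Instance V) (ε : ℝ) : ℝ :=
  ε * I.discreteOpt / (2 * Fintype.card V)

end Instance

/-- The number `c = ⌈2 n / ε⌉` of removable copies of each vertex. -/
noncomputable def copies (V : Type*) [Fintype V] (ε : ℝ) : ℕ := ⌈2 * (Fintype.card V : ℝ) / ε⌉₊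

/-- The vertices of the discretized graph: the copies `v(0), …, v(c)` of each `v ∈ V`,
and the terminals. -/
abbrev Copy (V : Type*) [Fintype V] (ε : ℝ) : Type _ := Vertex (V × Fin (copies V ε + 1))

/-- The vertex of the original graph that a vertex of the discretized graph is a copy of. -/
def Copy.base {V : Type*} [Fintype V] {ε : ℝ} : Copy V ε → Vertex V
  | .s => .s
  | .t => .t
  | .inner x => .inner x.1

/-- The index `i` of the copy `v(i)`; terminals have index `0`. -/
def Copy.level {V : Type*} [Fintype V] {ε : ℝ} : Copy V ε → ℕ
  | .s => 0
  | .t => 0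
  | .inner x => x.2

namespace Instance

variable {V : Type*} [Fintype V]

/-- The discretized graph: `(u(i), v(j))` is an edge iff `(u, v)` is one and `iα + jα < w_{u,v}`,
and similarly for edges at the terminals. -/
noncomputable def discretized (I : Instance V) (ε : ℝ) : SimpleGraph (Copy V ε) where
  Adj x y := I.graph.Adj (Copy.base x) (Copy.base y) ∧
    Copy.level x * I.unitPower ε + Copy.level y * I.unitPower ε
      < I.weight s(Copy.base x, Copy.base y)
  symm := ⟨fun x y h => ⟨h.1.symm, by rw [Sym2.eq_swap, add_comm]; exact h.2⟩⟩
  loopless := ⟨fun x h => I.graph.loopless.irrefl _ h.1⟩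

/-- `K` is an `s`-`t` vertex cut of the discretized graph consisting of removable copies, i.e. of
copies `v(i)` with `i < c`: every walk from `s` to `t` meets `K`. -/
def IsCut (I : Instance V) (ε : ℝ) (K : Finset (V × Fin (copies V ε + 1))) : Prop :=
  (∀ x ∈ K, x.2 ≠ Fin.last _) ∧
    ∀ q : (I.discretized ε).Walk Vertex.s Vertex.t, ∃ x ∈ K, Vertex.inner x ∈ q.support

/-- `K` is such a vertex cut of minimum cardinality. -/
def IsMinCut (I : Instance V) (ε : ℝ) (K : Finset (V × Fin (copies V ε + 1))) : Prop :=
  I.IsCut ε K ∧ ∀ L, I.IsCut ε L → #K ≤ #L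

/-- The powers read off from a vertex cut: `α` times the number of copies of `v` in `K`. -/
noncomputable def cutPower [DecidableEq V] (I : Instance V) (ε : ℝ)
    (K : Finset (V × Fin (copies V ε + 1))) (v : V) : ℝ :=
  #{x ∈ K | x.1 = v} * I.unitPower ε

end Instance

/-! ### The machine model: a real RAM with unit costs

The memory consists of arrays of natural numbers and arrays of real numbers. An array is named by
a numeral that is fixed in the program (so a program uses finitely many arrays), and its cells are
addressed by computed natural numbers. Each arithmetic operation, memory access, comparison and
control step counts as one step. There is no rounding of reals to integers, and no multiplication
of integers; the only constants are natural numbers. -/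

namespace RealRAM

structure State where
  nats : ℕ → ℕ → ℕ
  reals : ℕ → ℕ → ℝ

/-- Integer expressions; `sub` is truncated subtraction. -/
inductive NatExpr where
  | const (k : ℕ)
  | cell (a : ℕ) (i : NatExpr)
  | add (e f : NatExpr)
  | sub (e f : NatExpr)

inductive RealExpr where
  | const (k : ℕ)
  | ofNat (e : NatExpr)
  | cell (a : ℕ) (i : NatExpr)
  | add (e f : RealExpr)
  | sub (e f : RealExpr)
  | mul (e f : RealExpr)
  | div (e f : RealExpr)

inductive Test where
  | natLE (e f : NatExpr)
  | realLE (e f : RealExpr)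
  | not (b : Test)
  | and (b c : Test)

inductive Prog where
  | skip
  | setNat (a : ℕ) (i e : NatExpr)
  | setReal (a : ℕ) (i : NatExpr) (e : RealExpr)
  | seq (P Q : Prog)
  | ite (b : Test) (P Q : Prog)
  | while (b : Test) (P : Prog)

def NatExpr.eval (σ : State) : NatExpr → ℕ
  | const k => k
  | cell a i => σ.nats a (i.eval σ)
  | add e f => e.eval σ + f.eval σ
  | sub e f => e.eval σ - f.eval σ

def NatExpr.cost : NatExpr → ℕ
  | const _ => 1
  | cell _ i => i.cost + 1
  | add e f => e.cost + f.cost + 1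
  | sub e f => e.cost + f.cost + 1

/-- Division by zero returns zero. -/
noncomputable def RealExpr.eval (σ : State) : RealExpr → ℝ
  | const k => k
  | ofNat e => e.eval σ
  | cell a i => σ.reals a (i.eval σ)
  | add e f => e.eval σ + f.eval σ
  | sub e f => e.eval σ - f.eval σ
  | mul e f => e.eval σ * f.eval σ
  | div e f => e.eval σ / f.eval σ

def RealExpr.cost : RealExpr → ℕ
  | const _ => 1
  | ofNat e => e.cost + 1
  | cell _ i => i.cost + 1
  | add e f => e.cost + f.cost + 1
  | sub e f => e.cost + f.cost + 1
  | mul e f => e.cost + f.cost + 1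
  | div e f => e.cost + f.cost + 1

def Test.holds (σ : State) : Test → Prop
  | natLE e f => e.eval σ ≤ f.eval σ
  | realLE e f => e.eval σ ≤ f.eval σ
  | not b => ¬ b.holds σ
  | and b c => b.holds σ ∧ c.holds σ

def Test.cost : Test → ℕ
  | natLE e f => e.cost + f.cost + 1
  | realLE e f => e.cost + f.cost + 1
  | not b => b.cost + 1
  | and b c => b.cost + c.cost + 1

/-- Write the value `x` to cell `i` of the integer array `a`. -/
def State.writeNat (σ : State) (a i x : ℕ) : State :=
  { σ with nats := fun b j => if b = a ∧ j = i then x else σ.nats b j }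

/-- Write the value `x` to cell `i` of the real array `a`. -/
noncomputable def State.writeReal (σ : State) (a i : ℕ) (x : ℝ) : State :=
  { σ with reals := fun b j => if b = a ∧ j = i then x else σ.reals b j }

/-- `Run P σ T σ'`: started in the state `σ`, the program `P` halts after exactly `T` steps, in the
state `σ'`. -/
inductive Run : Prog → State → ℕ → State → Prop where
  | skip (σ : State) : Run .skip σ 1 σ
  | setNat (σ : State) (a : ℕ) (i e : NatExpr) :
      Run (.setNat a i e) σ (i.cost + e.cost + 1) (σ.writeNat a (i.eval σ) (e.eval σ))
  | setReal (σ : State) (a : ℕ) (i : NatExpr) (e : RealExpr) :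
      Run (.setReal a i e) σ (i.cost + e.cost + 1) (σ.writeReal a (i.eval σ) (e.eval σ))
  | seq {P Q : Prog} {σ σ₁ σ₂ : State} {T₁ T₂ : ℕ} :
      Run P σ T₁ σ₁ → Run Q σ₁ T₂ σ₂ → Run (.seq P Q) σ (T₁ + T₂) σ₂
  | iteTrue {b : Test} {P Q : Prog} {σ σ₁ : State} {T : ℕ} :
      b.holds σ → Run P σ T σ₁ → Run (.ite b P Q) σ (b.cost + T + 1) σ₁
  | iteFalse {b : Test} {P Q : Prog} {σ σ₁ : State} {T : ℕ} :
      ¬ b.holds σ → Run Q σ T σ₁ → Run (.ite b P Q) σ (b.cost + T + 1) σ₁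
  | whileFalse {b : Test} {P : Prog} {σ : State} :
      ¬ b.holds σ → Run (.while b P) σ (b.cost + 1) σ
  | whileTrue {b : Test} {P : Prog} {σ σ₁ σ₂ : State} {T₁ T₂ : ℕ} :
      b.holds σ → Run P σ T₁ σ₁ → Run (.while b P) σ₁ T₂ σ₂ →
      Run (.while b P) σ (b.cost + T₁ + T₂ + 1) σ₂

/-- The result and the running time are determined by the program and the initial state. -/
theorem Run.unique {P : Prog} {σ σ₁ σ₂ : State} {T₁ T₂ : ℕ}
    (h₁ : Run P σ T₁ σ₁) (h₂ : Run P σ T₂ σ₂) : T₁ = T₂ ∧ σ₁ = σ₂ := by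
  induction h₁ generalizing T₂ σ₂ with
  | skip | setNat | setReal => cases h₂; exact ⟨rfl, rfl⟩
  | seq _ _ ih₁ ih₂ =>
    cases h₂ with
    | seq a b =>
      obtain ⟨rfl, rfl⟩ := ih₁ a
      obtain ⟨rfl, rfl⟩ := ih₂ b
      exact ⟨rfl, rfl⟩
  | iteTrue hb _ ih =>
    cases h₂ with
    | iteTrue _ a => obtain ⟨rfl, rfl⟩ := ih a; exact ⟨rfl, rfl⟩
    | iteFalse hn _ => exact absurd hb hn
  | iteFalse hb _ ih =>
    cases h₂ with
    | iteTrue hp _ => exact absurd hp hb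
    | iteFalse _ a => obtain ⟨rfl, rfl⟩ := ih a; exact ⟨rfl, rfl⟩
  | whileFalse hb =>
    cases h₂ with
    | whileFalse _ => exact ⟨rfl, rfl⟩
    | whileTrue hp _ _ => exact absurd hp hb
  | whileTrue hb _ _ ih₁ ih₂ =>
    cases h₂ with
    | whileFalse hn => exact absurd hb hn
    | whileTrue _ a b =>
      obtain ⟨rfl, rfl⟩ := ih₁ a
      obtain ⟨rfl, rfl⟩ := ih₂ b
      exact ⟨rfl, rfl⟩

end RealRAM

/-! ### Input format -/

/-- The number by which a vertex is named in the input. -/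
def Vertex.code {n : ℕ} : Vertex (Fin n) → ℕ
  | .s => 0
  | .t => 1
  | .inner v => v + 2

namespace Instance

/-- `ends` lists the edges of the graph, each exactly once, in any order and orientation; so `m` is
the number of edges. -/
def IsEdgeList {n m : ℕ} (I : Instance (Fin n))
    (ends : Fin m → Vertex (Fin n) × Vertex (Fin n)) : Prop :=
  Function.Injective (fun k => s((ends k).1, (ends k).2)) ∧
    Set.range (fun k => s((ends k).1, (ends k).2)) = I.graph.edgeSet

/-- The initial memory. Integer array `0` holds `n` and `m`, integer arrays `1` and `2` hold the
names of the two endpoints of each edge, real array `0` holds the edge weights, and cell `0` of real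
array `1` holds `ε`. All other cells are zero. -/
noncomputable def input {n m : ℕ} (I : Instance (Fin n))
    (ends : Fin m → Vertex (Fin n) × Vertex (Fin n)) (ε : ℝ) : RealRAM.State where
  nats a i :=
    if a = 0 then (if i = 0 then n else if i = 1 then m else 0)
    else if h : i < m then
      (if a = 1 then (ends ⟨i, h⟩).1.code else if a = 2 then (ends ⟨i, h⟩).2.code else 0)
    else 0
  reals a i :=
    if h : a = 0 ∧ i < m then I.weight s((ends ⟨i, h.2⟩).1, (ends ⟨i, h.2⟩).2)
    else if a = 1 ∧ i = 0 then ε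
    else 0

end Instance

/-!
**The discretization.** Doubling a feasible assignment lets every removed edge be paid for by one of
its ends alone, after which each power can be rounded down to an incident weight
(`Instance.exists_discrete_le_two_mul`); hence `Z ≤ 2 OPT`. Rounding an optimal assignment up to
multiples of `α` costs at most `n α = ε Z / 2 ≤ ε OPT` (`Instance.exists_levels`). Choices of multiples
that are feasible correspond to cuts of the discretized graph: the first copies of each vertex form a
cut, and every cut contains such a cut (`Instance.IsCut.exists_levels`).

**One network for both algorithms.** To find `Z`, each vertex chooses one of the levels `0` and the
incident weights, and going up one level costs the difference; to find a minimum cut of the discretized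
graph, the levels are the multiples of `α`, and going up costs `1`. The structure `Levels` covers both.
Its network has an entry and an exit node for each level: the arc from entry to exit carries the price
of going up, and arcs of infinite capacity join consecutive levels and, for each edge and each level of
one end, the exit to the entry of the *highest* level of the other end that does not yet remove the
edge. So an edge needs only as many arcs as its end with fewer levels has levels. The levels read off
from a minimum cut of this network are a cheapest feasible choice (`Levels.isLeast_cost`).

**Maximum flow on a real RAM.** The network is solved by the push-relabel method, where the sink has
label `0`, active nodes are kept in linked lists by label, and excess is injected at the source in
quanta until some excess gets stuck at a node with label `N`; then there is a label that does not
occur, and the nodes above it form a minimum cut (`PR.Inv.cutCap_gap`). The number of steps is bounded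
by one potential function (`PR.potential`) with parameters `κ`, `K`, `R`.

* For `Z`, a single quantum that exceeds all finite cuts is injected (`R = 1`). In a network with
  `N` nodes and `M` arcs, the potential for `κ = 1` bounds the number of steps by
  `O(N² (M + N) / K + K N²)`: a node is among the highest active ones, of which there are at most `K`, or
  else a push lowers the number of pairs `(active node, node of no greater label)` by at least `K`. Here
  `N = O(m)`, and `M = O(m ^ 1.5)`, since the sum over the edges of the smaller degree of the two ends
  is `O(m ^ 1.5)` in a simple graph (`Levels.WF.edgeSize_le`). With `K` of the order `m ^ 0.75` this is
  `O(m ^ 2.75)`, hence `O(m³ / log m)` (`RealRAM.exists_ends_discreteProg`).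
* For the discretized graph, all finite capacities are integers and single units are injected, so that
  there is never more than one active node; the potential for `κ = 0`, `K = 1` gives `O(N (M + N))` with
  `N = O(min(n, m) / ε · n)` and `M = O(m n / ε)`, hence `O(n³ m / ε²)`, which is better than required
  (`RealRAM.exists_ends_approxProg`, `RealRAM.discretized_size_le`).

**Verification of programs.** `RealRAM.Ends P σ B Q` states total correctness with a time bound. Loops are
handled by a single rule, in which each iteration is paid for by a decrease of a potential
(`RealRAM.Ends.while_loop`), and `RealRAM.Frame` records which arrays a program leaves alone.
-/


/-! ### Rounding power assignments -/

namespace Instance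

variable {V : Type*}

theorem extendPower_nonneg {p : V → ℝ} (hp : ∀ v, 0 ≤ p v) (x : Vertex V) :
    0 ≤ extendPower p x := by
  cases x <;> simp [extendPower, hp]

theorem extendPower_mono {p q : V → ℝ} (h : ∀ v, p v ≤ q v) (x : Vertex V) :
    extendPower p x ≤ extendPower q x := by
  cases x <;> simp [extendPower, h]

theorem remaining_anti (I : Instance V) {p q : V → ℝ} (h : ∀ v, p v ≤ q v) :
    I.remaining q ≤ I.remaining p := by
  intro x y hxy
  exact ⟨hxy.1, (add_le_add (extendPower_mono h x) (extendPower_mono h y)).trans_lt hxy.2⟩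

theorem IsFeasible.mono {I : Instance V} {p q : V → ℝ} (hp : I.IsFeasible p)
    (h : ∀ v, p v ≤ q v) : I.IsFeasible q :=
  ⟨fun v => (hp.1 v).trans (h v), fun hr => hp.2 (hr.mono (I.remaining_anti h))⟩

/-- Feasibility is witnessed by a side `S` of a cut all of whose boundary edges are removed. -/
theorem isFeasible_iff (I : Instance V) (p : V → ℝ) : I.IsFeasible p ↔ (∀ v, 0 ≤ p v) ∧
    ∃ S : Set (Vertex V), Vertex.s ∈ S ∧ Vertex.t ∉ S ∧ ∀ x ∈ S, ∀ y ∉ S, I.graph.Adj x y →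
      I.weight s(x, y) ≤ extendPower p x + extendPower p y := by
  refine and_congr_right fun _ => ⟨fun h => ?_, ?_⟩
  · refine ⟨{x | (I.remaining p).Reachable Vertex.s x}, SimpleGraph.Reachable.refl _, h, ?_⟩
    intro x hx y hy hxy
    by_contra hlt
    have ha : (I.remaining p).Adj x y := ⟨hxy, not_le.1 hlt⟩
    exact hy (SimpleGraph.Reachable.trans hx ha.reachable)
  · rintro ⟨S, hs, ht, hS⟩ ⟨q⟩
    have key : ∀ {x y : Vertex V}, (I.remaining p).Walk x y → x ∈ S → y ∈ S := by
      intro x y q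
      induction q with
      | nil => exact id
      | cons h _ ih =>
        intro hx
        refine ih ?_
        by_contra hy
        exact absurd h.2 (not_lt.2 (hS _ hx _ hy h.1))
    exact ht (key q hs)

theorem finite_vertex [Finite V] : Finite (Vertex V) := by
  refine Finite.of_injective
    (fun x : Vertex V => (match x with
      | .s => none
      | .t => some none
      | .inner v => some (some v) : Option (Option V))) ?_
  intro x y h
  cases x <;> cases y <;> simp_all

variable [Fintype V]

theorem isClosed_feasible (I : Instance V) : IsClosed {p : V → ℝ | I.IsFeasible p} := by
  have := finite_vertex (V := V)
  have hcont : ∀ x : Vertex V, Continuous fun p : V → ℝ => extendPower p x := by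
    intro x
    cases x
    · exact continuous_const
    · exact continuous_const
    · exact continuous_apply _
  have : {p : V → ℝ | I.IsFeasible p} = {p | ∀ v, 0 ≤ p v} ∩
      ⋃ S : Set (Vertex V), {p | Vertex.s ∈ S ∧ Vertex.t ∉ S ∧ ∀ x ∈ S, ∀ y ∉ S,
        I.graph.Adj x y → I.weight s(x, y) ≤ extendPower p x + extendPower p y} := by
    ext p
    simp only [Set.mem_ofPred_eq, isFeasible_iff, Set.mem_inter_iff, Set.mem_iUnion]
  rw [this]
  refine IsClosed.inter ?_ (isClosed_iUnion_of_finite fun S => ?_)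
  · simp only [Set.ofPred_forall]
    exact isClosed_iInter fun v => isClosed_le continuous_const (continuous_apply v)
  · simp only [Set.ofPred_and, Set.ofPred_forall]
    refine isClosed_const.inter (IsClosed.inter (isClosed_iInter fun _ => isClosed_const) ?_)
    refine isClosed_iInter fun x => isClosed_iInter fun _ => isClosed_iInter fun y =>
      isClosed_iInter fun _ => isClosed_iInter fun _ => ?_
    exact isClosed_le continuous_const ((hcont x).add (hcont y))

theorem isLeast_opt (I : Instance V) (hI : I.Solvable) : IsLeast I.costs I.opt := by
  obtain ⟨p₀, hp₀⟩ := hI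
  -- Every assignment of cost at most that of `p₀` lies in a box, so the minimum may be taken there.
  let B : Set (V → ℝ) := Set.Icc 0 (fun _ => ∑ v, p₀ v) ∩ {p | I.IsFeasible p}
  have hB : IsCompact B := isCompact_Icc.inter_right I.isClosed_feasible
  have hbox : ∀ p, I.IsFeasible p → ∑ v, p v ≤ ∑ v, p₀ v → p ∈ B := fun p hp hle =>
    ⟨⟨fun v => hp.1 v, fun v =>
      (single_le_sum (fun u _ => hp.1 u) (mem_univ v)).trans hle⟩, hp⟩
  obtain ⟨p, hp, hmin⟩ := hB.exists_isMinOn ⟨p₀, hbox p₀ hp₀ le_rfl⟩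
    (f := fun p => ∑ v, p v) (continuous_finsetSum _ fun v _ => continuous_apply v).continuousOn
  have hleast : IsLeast I.costs (∑ v, p v) := by
    refine ⟨⟨p, hp.2, rfl⟩, ?_⟩
    rintro _ ⟨q, hq, rfl⟩
    rcases le_total (∑ v, q v) (∑ v, p₀ v) with h | h
    · exact hmin (hbox q hq h)
    · exact (hmin (hbox p₀ hp₀ le_rfl)).trans h
  rw [opt, hleast.csInf_eq]
  exact hleast

/-- Doubling a feasible assignment lets each removed edge be paid for by one endpoint alone, after
which all powers can be rounded down to incident weights. -/
theorem exists_discrete_le_two_mul (I : Instance V) {p : V → ℝ} (hp : I.IsFeasible p) :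
    ∃ q, I.IsFeasible q ∧ I.IsDiscrete q ∧ ∀ v, q v ≤ 2 * p v := by
  have := finite_vertex (V := V)
  have hmax : ∀ v, ∃ x, ((x = 0 ∨ ∃ e ∈ I.graph.incidenceSet (Vertex.inner v), x = I.weight e) ∧
      x ≤ 2 * p v) ∧ ∀ y, ((y = 0 ∨ ∃ e ∈ I.graph.incidenceSet (Vertex.inner v), y = I.weight e) ∧
      y ≤ 2 * p v) → y ≤ x := by
    intro v
    have hfin : {x : ℝ | (x = 0 ∨ ∃ e ∈ I.graph.incidenceSet (Vertex.inner v), x = I.weight e) ∧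
        x ≤ 2 * p v}.Finite := by
      refine ((Set.finite_singleton (0 : ℝ)).union
        ((Set.toFinite (I.graph.incidenceSet (Vertex.inner v))).image I.weight)).subset ?_
      rintro x ⟨rfl | ⟨e, he, rfl⟩, _⟩
      · exact Or.inl rfl
      · exact Or.inr ⟨e, he, rfl⟩
    obtain ⟨x, hx, h⟩ := Set.exists_max_image _ id hfin
      ⟨0, Or.inl rfl, by linarith [hp.1 v]⟩
    exact ⟨x, hx, fun y hy => h y hy⟩
  choose q hq hqmax using hmax
  have hq0 : ∀ v, 0 ≤ q v := fun v => hqmax v 0 ⟨Or.inl rfl, by linarith [hp.1 v]⟩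
  refine ⟨q, ⟨hq0, fun hr => hp.2 (hr.mono ?_)⟩, fun v => (hq v).1, fun v => (hq v).2⟩
  have key : ∀ x y, I.graph.Adj x y → I.weight s(x, y) ≤ 2 * extendPower p x →
      I.weight s(x, y) ≤ extendPower q x + extendPower q y := by
    intro x y hxy hle
    have hy := extendPower_nonneg hq0 y
    cases x with
    | s | t =>
      simp only [extendPower, mul_zero] at hle
      exact hle.trans (add_nonneg le_rfl hy)
    | inner v =>
      have := hqmax v (I.weight s(Vertex.inner v, y))
        ⟨Or.inr ⟨_, ⟨hxy, Sym2.mem_mk_left _ _⟩, rfl⟩, hle⟩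
      exact this.trans (le_add_of_nonneg_right hy)
  intro x y hxy
  refine ⟨hxy.1, ?_⟩
  by_contra hle
  refine absurd hxy.2 (not_lt.2 ?_)
  rcases le_total (extendPower p y) (extendPower p x) with h | h
  · exact key x y hxy.1 (by linarith)
  · have := key y x hxy.1.symm (by rw [Sym2.eq_swap]; linarith)
    rw [Sym2.eq_swap] at this
    linarith

theorem isLeast_discreteOpt (I : Instance V) (hI : I.Solvable) :
    IsLeast I.discreteCosts I.discreteOpt := by
  have := finite_vertex (V := V)
  obtain ⟨p, hp⟩ := hI
  obtain ⟨q, hq, hqd, _⟩ := I.exists_discrete_le_two_mul hp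
  have hfin : I.discreteCosts.Finite := by
    have : {p | I.IsDiscrete p}.Finite := by
      refine (Set.Finite.pi' (t := fun v => {0} ∪ I.weight '' I.graph.incidenceSet (.inner v))
        fun v => (Set.finite_singleton (0 : ℝ)).union
          ((Set.toFinite (I.graph.incidenceSet (Vertex.inner v))).image I.weight)).subset ?_
      intro p hp v
      rcases hp v with h | ⟨e, he, h⟩
      · exact Or.inl h
      · exact Or.inr ⟨e, he, h.symm⟩
    refine (this.image fun p => ∑ v, p v).subset ?_
    rintro _ ⟨p, _, hd, rfl⟩
    exact ⟨p, hd, rfl⟩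
  have hne : I.discreteCosts.Nonempty := ⟨_, q, hq, hqd, rfl⟩
  refine ⟨hne.csInf_mem hfin, fun c hc => csInf_le hfin.bddBelow hc⟩

theorem opt_le_discreteOpt (I : Instance V) (hI : I.Solvable) : I.opt ≤ I.discreteOpt := by
  obtain ⟨p, hp, _, h⟩ := (I.isLeast_discreteOpt hI).1
  exact (I.isLeast_opt hI).2 ⟨p, hp, h⟩

theorem discreteOpt_le_two_mul_opt (I : Instance V) (hI : I.Solvable) :
    I.discreteOpt ≤ 2 * I.opt := by
  obtain ⟨p, hp, h⟩ := (I.isLeast_opt hI).1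
  obtain ⟨q, hq, hqd, hle⟩ := I.exists_discrete_le_two_mul hp
  refine ((I.isLeast_discreteOpt hI).2 ⟨q, hq, hqd, rfl⟩).trans ?_
  rw [h, mul_sum]
  exact sum_le_sum fun v _ => hle v

/-! ### Cuts of the discretized graph -/

theorem opt_nonneg (I : Instance V) (hI : I.Solvable) : 0 ≤ I.opt := by
  obtain ⟨p, hp, h⟩ := (I.isLeast_opt hI).1
  rw [h]
  exact sum_nonneg fun v _ => hp.1 v

theorem unitPower_nonneg (I : Instance V) (hI : I.Solvable) {ε : ℝ} (hε : 0 < ε) :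
    0 ≤ I.unitPower ε := by
  have := (I.opt_nonneg hI).trans (I.opt_le_discreteOpt hI)
  unfold unitPower
  positivity

theorem discreteOpt_le_copies_mul_unitPower (I : Instance V) (hI : I.Solvable) {ε : ℝ}
    (hε : 0 < ε) (v : V) : I.discreteOpt ≤ copies V ε * I.unitPower ε := by
  have hn : (0 : ℝ) < Fintype.card V := by exact_mod_cast Fintype.card_pos_iff.2 ⟨v⟩
  have h : 2 * (Fintype.card V : ℝ) / ε ≤ copies V ε := Nat.le_ceil _
  calc I.discreteOpt = 2 * (Fintype.card V : ℝ) / ε * I.unitPower ε := by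
        unfold unitPower; field_simp
    _ ≤ _ := mul_le_mul_of_nonneg_right h (I.unitPower_nonneg hI hε)

/-- Rounding an optimal assignment up to multiples of `unitPower` costs at most `ε * opt`. -/
theorem exists_levels (I : Instance V) (hI : I.Solvable) {ε : ℝ} (hε : 0 < ε) :
    ∃ k : V → ℕ, (∀ v, k v ≤ copies V ε) ∧ I.IsFeasible (fun v => k v * I.unitPower ε) ∧
      ∑ v, (k v : ℝ) * I.unitPower ε ≤ (1 + ε) * I.opt := by
  obtain ⟨p, hp, h⟩ := (I.isLeast_opt hI).1
  have hZ := I.discreteOpt_le_two_mul_opt hI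
  have hα := I.unitPower_nonneg hI hε
  have hpv : ∀ v, p v ≤ copies V ε * I.unitPower ε := fun v =>
    ((single_le_sum (fun u _ => hp.1 u) (mem_univ v)).trans h.ge).trans
      ((I.opt_le_discreteOpt hI).trans (I.discreteOpt_le_copies_mul_unitPower hI hε v))
  have hle : ∀ v, p v ≤ (⌈p v / I.unitPower ε⌉₊ : ℝ) * I.unitPower ε := by
    intro v
    rcases hα.eq_or_lt with h0 | h0
    · have := hpv v
      rw [← h0] at this ⊢
      simpa using this
    · exact (div_le_iff₀ h0).1 (Nat.le_ceil _)
  refine ⟨fun v => ⌈p v / I.unitPower ε⌉₊, fun v => Nat.ceil_le.2 ?_, hp.mono hle, ?_⟩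
  · rcases hα.eq_or_lt with h0 | h0
    · simp [← h0]
    · exact (div_le_iff₀ h0).2 (hpv v)
  · have h1 : ∀ v, (⌈p v / I.unitPower ε⌉₊ : ℝ) * I.unitPower ε ≤ p v + I.unitPower ε := by
      intro v
      rcases hα.eq_or_lt with h0 | h0
      · simpa [← h0] using hp.1 v
      · have h2 := (Nat.ceil_lt_add_one (div_nonneg (hp.1 v) hα)).le
        calc _ ≤ (p v / I.unitPower ε + 1) * I.unitPower ε := mul_le_mul_of_nonneg_right h2 hα
          _ = _ := by field_simp
    have h3 : (Fintype.card V : ℝ) * I.unitPower ε ≤ ε * I.opt := by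
      rcases (Nat.zero_le (Fintype.card V)).eq_or_lt with h0 | h0
      · rw [← h0]
        simpa using mul_nonneg hε.le (I.opt_nonneg hI)
      · have h0' : (0 : ℝ) < Fintype.card V := by exact_mod_cast h0
        have : (Fintype.card V : ℝ) * I.unitPower ε = ε * (I.discreteOpt / 2) := by
          unfold unitPower; field_simp
        rw [this]
        exact mul_le_mul_of_nonneg_left (by linarith) hε.le
    calc _ ≤ ∑ v, (p v + I.unitPower ε) := sum_le_sum fun v _ => h1 v
      _ = I.opt + Fintype.card V * I.unitPower ε := by
        rw [sum_add_distrib, ← h, sum_const, nsmul_eq_mul, card_univ]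
      _ ≤ _ := by linarith

/-- The set of the first `k v` copies of each vertex `v`. -/
noncomputable def initialCopies (ε : ℝ) (k : V → ℕ) : Finset (V × Fin (copies V ε + 1)) :=
  {x | (x.2 : ℕ) < k x.1}

theorem card_initialCopies_filter [DecidableEq V] {ε : ℝ} {k : V → ℕ}
    (hk : ∀ v, k v ≤ copies V ε) (v : V) :
    #{x ∈ initialCopies ε k | x.1 = v} = k v := by
  rw [← card_range (k v)]
  refine card_bij (fun x _ => (x.2 : ℕ)) ?_ ?_ ?_
  · rintro ⟨u, i⟩ h
    rw [mem_filter, initialCopies, mem_filter] at h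
    obtain ⟨⟨-, h⟩, rfl⟩ := h
    exact mem_range.2 h
  · rintro ⟨u, i⟩ h ⟨u', i'⟩ h' e
    rw [mem_filter] at h h'
    exact Prod.ext (h.2.trans h'.2.symm) (Fin.ext e)
  · intro i hi
    have h1 := mem_range.1 hi
    have h2 := hk v
    refine ⟨(v, ⟨i, by omega⟩), ?_, rfl⟩
    rw [mem_filter, initialCopies, mem_filter]
    exact ⟨⟨mem_univ _, h1⟩, rfl⟩

theorem card_initialCopies [DecidableEq V] {ε : ℝ} {k : V → ℕ} (hk : ∀ v, k v ≤ copies V ε) :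
    #(initialCopies ε k) = ∑ v, k v := by
  rw [card_eq_sum_card_fiberwise (f := Prod.fst) (t := univ) fun _ _ => mem_coe.2 (mem_univ _)]
  exact sum_congr rfl fun v _ => card_initialCopies_filter hk v

theorem isCut_initialCopies (I : Instance V) (hI : I.Solvable) {ε : ℝ} (hε : 0 < ε) {k : V → ℕ}
    (hk : ∀ v, k v ≤ copies V ε) (hf : I.IsFeasible (fun v => k v * I.unitPower ε)) :
    I.IsCut ε (initialCopies ε k) := by
  refine ⟨fun x hx h => ?_, fun q => ?_⟩
  · have h1 : (x.2 : ℕ) < k x.1 := by simpa [initialCopies] using hx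
    rw [h] at h1
    exact absurd h1 (not_lt.2 (hk _))
  · by_contra! hq
    have hα := I.unitPower_nonneg hI hε
    have hlev : ∀ x : Copy V ε, (∀ y ∈ initialCopies ε k, Vertex.inner y ≠ x) →
        extendPower (fun v => k v * I.unitPower ε) (Copy.base x)
          ≤ Copy.level x * I.unitPower ε := by
      intro x hx
      cases x with
      | s => simp [Copy.base, Copy.level, extendPower]
      | t => simp [Copy.base, Copy.level, extendPower]
      | inner y =>
        have : k y.1 ≤ y.2 := by
          by_contra hlt
          exact hx y (by simpa [initialCopies] using not_le.1 hlt) rfl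
        exact mul_le_mul_of_nonneg_right (by exact_mod_cast this) hα
    have key : ∀ {x y : Copy V ε} (q : (I.discretized ε).Walk x y),
        (∀ z ∈ initialCopies ε k, Vertex.inner z ∉ q.support) →
        (I.remaining fun v => k v * I.unitPower ε).Reachable (Copy.base x) (Copy.base y) := by
      intro x y q
      induction q with
      | nil => exact fun _ => SimpleGraph.Reachable.refl _
      | @cons a b c h q' ih =>
        intro hz
        have ha := hlev a fun y hy e => hz y hy (by rw [e]; simp)
        have hb := hlev b fun y hy e => hz y hy (by rw [e]; simp)
        have hadj : (I.remaining fun v => k v * I.unitPower ε).Adj (Copy.base a) (Copy.base b) :=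
          ⟨h.1, (add_le_add ha hb).trans_lt h.2⟩
        refine hadj.reachable.trans (ih fun z hz' hmem => hz z hz' ?_)
        rw [SimpleGraph.Walk.support_cons]
        exact List.mem_cons_of_mem _ hmem
    exact hf.2 (key q hq)

/-- Any cut contains the initial copies up to the first one that it leaves at each vertex, and these
already yield a feasible assignment. -/
theorem IsCut.exists_levels {I : Instance V} (hI : I.Solvable) {ε : ℝ} (hε : 0 < ε)
    {K : Finset (V × Fin (copies V ε + 1))} (hK : I.IsCut ε K) :
    ∃ k : V → ℕ, (∀ v, k v ≤ copies V ε) ∧ I.IsFeasible (fun v => k v * I.unitPower ε) ∧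
      initialCopies ε k ⊆ K := by
  have hex : ∀ v, ∃ i : ℕ, ∃ h : i < copies V ε + 1, (v, ⟨i, h⟩) ∉ K := fun v =>
    ⟨copies V ε, Nat.lt_succ_self _, fun h => hK.1 _ h rfl⟩
  classical
  have hlt : ∀ v, Nat.find (hex v) < copies V ε + 1 := fun v => (Nat.find_spec (hex v)).1
  have hα := I.unitPower_nonneg hI hε
  refine ⟨fun v => Nat.find (hex v), fun v => Nat.lt_succ_iff.1 (hlt v),
    ⟨fun v => by positivity, ?_⟩, ?_⟩
  · rintro ⟨q⟩
    let f : Vertex V → Copy V ε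
      | .s => .s
      | .t => .t
      | .inner v => .inner (v, ⟨Nat.find (hex v), hlt v⟩)
    have hbase : ∀ x, Copy.base (f x) = x := by intro x; cases x <;> rfl
    have hlevel : ∀ x, (Copy.level (f x) : ℝ) * I.unitPower ε =
        extendPower (fun v => Nat.find (hex v) * I.unitPower ε) x := by
      intro x
      cases x <;> simp [f, Copy.level, extendPower]
    let F : (I.remaining fun v => Nat.find (hex v) * I.unitPower ε) →g I.discretized ε :=
      ⟨f, fun {x y} h => ⟨by rw [hbase, hbase]; exact h.1, by
        rw [hlevel, hlevel, hbase, hbase]; exact h.2⟩⟩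
    obtain ⟨x, hx, hmem⟩ := hK.2 (q.map F)
    rw [SimpleGraph.Walk.support_map, List.mem_map] at hmem
    obtain ⟨y, -, hy⟩ := hmem
    cases y with
    | s => cases hy
    | t => cases hy
    | inner v =>
      have : (v, ⟨Nat.find (hex v), hlt v⟩) = x := Vertex.inner.inj hy
      exact (Nat.find_spec (hex v)).2 (this ▸ hx)
  · rintro ⟨v, i⟩ hx
    have h1 : (i : ℕ) < Nat.find (hex v) := by simpa [initialCopies] using hx
    by_contra hn
    exact Nat.find_min (hex v) h1 ⟨i.2, hn⟩

theorem exists_isMinCut (I : Instance V) (hI : I.Solvable) {ε : ℝ} (hε : 0 < ε) :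
    ∃ K, I.IsMinCut ε K := by
  obtain ⟨k, hk, hf, _⟩ := I.exists_levels hI hε
  obtain ⟨K, hK, hmin⟩ := Set.exists_min_image {K | I.IsCut ε K} card (Set.toFinite _)
    ⟨_, I.isCut_initialCopies hI hε hk hf⟩
  exact ⟨K, hK, hmin⟩

/-- A minimum cut consists of initial copies of the vertices. -/
theorem IsMinCut.eq_initialCopies {I : Instance V} (hI : I.Solvable) {ε : ℝ} (hε : 0 < ε)
    {K : Finset (V × Fin (copies V ε + 1))} (hK : I.IsMinCut ε K) :
    ∃ k : V → ℕ, (∀ v, k v ≤ copies V ε) ∧ I.IsFeasible (fun v => k v * I.unitPower ε) ∧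
      K = initialCopies ε k := by
  obtain ⟨k, hk, hf, hsub⟩ := hK.1.exists_levels hI hε
  exact ⟨k, hk, hf, (eq_of_subset_of_card_le hsub
    (hK.2 _ (I.isCut_initialCopies hI hε hk hf))).symm⟩

theorem cutPower_initialCopies [DecidableEq V] (I : Instance V) {ε : ℝ} {k : V → ℕ}
    (hk : ∀ v, k v ≤ copies V ε) :
    I.cutPower ε (initialCopies ε k) = fun v => k v * I.unitPower ε := by
  funext v
  rw [cutPower, card_initialCopies_filter hk]

theorem IsMinCut.cutPower_spec [DecidableEq V] {I : Instance V} (hI : I.Solvable) {ε : ℝ}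
    (hε : 0 < ε) {K : Finset (V × Fin (copies V ε + 1))} (hK : I.IsMinCut ε K) :
    I.IsFeasible (I.cutPower ε K) ∧ ∑ v, I.cutPower ε K v = I.unitPower ε * #K ∧
      ∑ v, I.cutPower ε K v ≤ (1 + ε) * I.opt := by
  obtain ⟨k, hk, hf, rfl⟩ := hK.eq_initialCopies hI hε
  obtain ⟨l, hl, hlf, hle⟩ := I.exists_levels hI hε
  have hcard := hK.2 _ (I.isCut_initialCopies hI hε hl hlf)
  have hα := I.unitPower_nonneg hI hε
  rw [card_initialCopies hk, card_initialCopies hl] at hcard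
  rw [I.cutPower_initialCopies hk]
  refine ⟨hf, ?_, ?_⟩
  · rw [card_initialCopies hk, ← sum_mul, mul_comm]
    push_cast
    rfl
  · refine le_trans ?_ hle
    rw [← sum_mul, ← sum_mul]
    exact mul_le_mul_of_nonneg_right (by exact_mod_cast hcard) hα

/-- Feasible levels of minimum total number make up a minimum cut. -/
theorem isMinCut_initialCopies [DecidableEq V] (I : Instance V) (hI : I.Solvable) {ε : ℝ}
    (hε : 0 < ε) {k : V → ℕ} (hk : ∀ v, k v ≤ copies V ε) (hf : I.IsFeasible (fun v => k v * I.unitPower ε))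
    (hmin : ∀ l : V → ℕ, (∀ v, l v ≤ copies V ε) →
      I.IsFeasible (fun v => l v * I.unitPower ε) → ∑ v, k v ≤ ∑ v, l v) :
    I.IsMinCut ε (initialCopies ε k) := by
  refine ⟨I.isCut_initialCopies hI hε hk hf, fun L hL => ?_⟩
  obtain ⟨l, hl, hlf, hsub⟩ := hL.exists_levels hI hε
  calc _ = ∑ v, k v := card_initialCopies hk
    _ ≤ ∑ v, l v := hmin l hl hlf
    _ = #(initialCopies ε l) := (card_initialCopies hl).symm
    _ ≤ #L := card_le_card hsub

end Instance


/-! ### Reasoning about programs of the real RAM -/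

namespace RealRAM

theorem State.nats_writeNat (σ : State) (a i x b : ℕ) :
    (σ.writeNat a i x).nats b = if b = a then Function.update (σ.nats b) i x else σ.nats b := by
  funext j
  by_cases h : b = a <;> simp [State.writeNat, h, Function.update_apply]

theorem State.reals_writeReal (σ : State) (a i : ℕ) (x : ℝ) (b : ℕ) :
    (σ.writeReal a i x).reals b =
      if b = a then Function.update (σ.reals b) i x else σ.reals b := by
  funext j
  by_cases h : b = a <;> simp [State.writeReal, h, Function.update_apply]

@[simp] theorem State.reals_writeNat (σ : State) (a i x : ℕ) :
    (σ.writeNat a i x).reals = σ.reals := rfl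

@[simp] theorem State.nats_writeReal (σ : State) (a i : ℕ) (x : ℝ) :
    (σ.writeReal a i x).nats = σ.nats := rfl

@[simp] theorem State.nats_writeNat_same (σ : State) (a i x : ℕ) :
    (σ.writeNat a i x).nats a = Function.update (σ.nats a) i x := by
  simp [State.nats_writeNat]

@[simp] theorem State.reals_writeReal_same (σ : State) (a i : ℕ) (x : ℝ) :
    (σ.writeReal a i x).reals a = Function.update (σ.reals a) i x := by
  simp [State.reals_writeReal]

theorem State.nats_writeNat_ne (σ : State) {a b : ℕ} (i x : ℕ) (h : b ≠ a) :
    (σ.writeNat a i x).nats b = σ.nats b := by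
  simp [State.nats_writeNat, h]

theorem State.reals_writeReal_ne (σ : State) {a b : ℕ} (i : ℕ) (x : ℝ) (h : b ≠ a) :
    (σ.writeReal a i x).reals b = σ.reals b := by
  simp [State.reals_writeReal, h]

/-- Cell `0` of the integer array `a`, used as a variable. -/
abbrev NatExpr.var (a : ℕ) : NatExpr := .cell a (.const 0)

/-- Cell `0` of the real array `a`, used as a variable. -/
abbrev RealExpr.var (a : ℕ) : RealExpr := .cell a (.const 0)

/-- Assignment to an integer variable. -/
abbrev Prog.setN (a : ℕ) (e : NatExpr) : Prog := .setNat a (.const 0) e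

/-- Assignment to a real variable. -/
abbrev Prog.setR (a : ℕ) (e : RealExpr) : Prog := .setReal a (.const 0) e

/-- Sequential composition of a list of programs. -/
def Prog.block : List Prog → Prog
  | [] => .skip
  | [P] => P
  | P :: Q :: l => .seq P (Prog.block (Q :: l))

/-- Strict comparison of integers. -/
abbrev Test.natLT (e f : NatExpr) : Test := .not (.natLE f e)

/-- Strict comparison of reals. -/
abbrev Test.realLT (e f : RealExpr) : Test := .not (.realLE f e)

/-- Disjunction of tests. -/
abbrev Test.or (b c : Test) : Test := .not (.and (.not b) (.not c))

namespace Prog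

/-- The program contains no loop. -/
def loopFree : Prog → Bool
  | skip | setNat _ _ _ | setReal _ _ _ => true
  | seq P Q | ite _ P Q => P.loopFree && Q.loopFree
  | .while _ _ => false

/-- The result of a program without loops; loops get the junk value of `skip`. -/
noncomputable def exec : Prog → State → State
  | skip, σ => σ
  | setNat a i e, σ => σ.writeNat a (i.eval σ) (e.eval σ)
  | setReal a i e, σ => σ.writeReal a (i.eval σ) (e.eval σ)
  | seq P Q, σ => Q.exec (P.exec σ)
  | ite b P Q, σ => open Classical in if b.holds σ then P.exec σ else Q.exec σ
  | .while _ _, σ => σ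

/-- An upper bound on the running time of a program without loops; loops get the junk value `0`. -/
def maxCost : Prog → ℕ
  | skip => 1
  | setNat _ i e => i.cost + e.cost + 1
  | setReal _ i e => i.cost + e.cost + 1
  | seq P Q => P.maxCost + Q.maxCost
  | ite b P Q => b.cost + max P.maxCost Q.maxCost + 1
  | .while _ _ => 0

theorem exists_run_exec {P : Prog} (h : P.loopFree) (σ : State) :
    ∃ T, Run P σ T (P.exec σ) ∧ T ≤ P.maxCost := by
  induction P generalizing σ with
  | skip => exact ⟨_, .skip σ, le_rfl⟩
  | setNat a i e => exact ⟨_, .setNat σ a i e, le_rfl⟩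
  | setReal a i e => exact ⟨_, .setReal σ a i e, le_rfl⟩
  | seq P Q ihP ihQ =>
    simp only [loopFree, Bool.and_eq_true] at h
    obtain ⟨T₁, h₁, hT₁⟩ := ihP h.1 σ
    obtain ⟨T₂, h₂, hT₂⟩ := ihQ h.2 (P.exec σ)
    exact ⟨_, .seq h₁ h₂, add_le_add hT₁ hT₂⟩
  | ite b P Q ihP ihQ =>
    simp only [loopFree, Bool.and_eq_true] at h
    by_cases hb : b.holds σ
    · obtain ⟨T, h₁, hT⟩ := ihP h.1 σ
      refine ⟨_, .iteTrue hb (by simpa [exec, hb] using h₁), ?_⟩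
      simp only [maxCost]
      have := le_max_left P.maxCost Q.maxCost
      omega
    · obtain ⟨T, h₁, hT⟩ := ihQ h.2 σ
      refine ⟨_, .iteFalse hb (by simpa [exec, hb] using h₁), ?_⟩
      simp only [maxCost]
      have := le_max_right P.maxCost Q.maxCost
      omega
  | _ => simp [loopFree] at h

/-- The integer arrays that a program may write to. -/
def natWrites : Prog → List ℕ
  | skip | setReal _ _ _ => []
  | setNat a _ _ => [a]
  | seq P Q | ite _ P Q => P.natWrites ++ Q.natWrites
  | .while _ P => P.natWrites

/-- The real arrays that a program may write to. -/
def realWrites : Prog → List ℕ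
  | skip | setNat _ _ _ => []
  | setReal a _ _ => [a]
  | seq P Q | ite _ P Q => P.realWrites ++ Q.realWrites
  | .while _ P => P.realWrites

end Prog

/-- The states agree on all arrays that the program `P` does not write to. -/
structure Frame (P : Prog) (σ σ' : State) : Prop where
  nats : ∀ a, a ∉ P.natWrites → σ'.nats a = σ.nats a
  reals : ∀ a, a ∉ P.realWrites → σ'.reals a = σ.reals a

theorem Frame.refl (P : Prog) (σ : State) : Frame P σ σ := ⟨fun _ _ => rfl, fun _ _ => rfl⟩

theorem Frame.trans {P : Prog} {σ σ₁ σ₂ : State} (h₁ : Frame P σ σ₁) (h₂ : Frame P σ₁ σ₂) :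
    Frame P σ σ₂ :=
  ⟨fun a h => (h₂.nats a h).trans (h₁.nats a h), fun a h => (h₂.reals a h).trans (h₁.reals a h)⟩

theorem Frame.mono {P Q : Prog} {σ σ' : State} (h : Frame P σ σ')
    (hn : P.natWrites ⊆ Q.natWrites) (hr : P.realWrites ⊆ Q.realWrites) : Frame Q σ σ' :=
  ⟨fun a ha => h.nats a fun h' => ha (hn h'), fun a ha => h.reals a fun h' => ha (hr h')⟩

theorem Run.frame {P : Prog} {σ σ' : State} {T : ℕ} (h : Run P σ T σ') : Frame P σ σ' := by
  induction h with
  | skip σ => exact Frame.refl _ _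
  | setNat σ a i e =>
    refine ⟨fun b hb => ?_, fun _ _ => rfl⟩
    exact State.nats_writeNat_ne _ _ _ (by simpa [Prog.natWrites] using hb)
  | setReal σ a i e =>
    refine ⟨fun _ _ => rfl, fun b hb => ?_⟩
    exact State.reals_writeReal_ne _ _ _ (by simpa [Prog.realWrites] using hb)
  | seq _ _ ih₁ ih₂ =>
    exact (ih₁.mono (List.subset_append_left _ _) (List.subset_append_left _ _)).trans
      (ih₂.mono (List.subset_append_right _ _) (List.subset_append_right _ _))
  | iteTrue _ _ ih => exact ih.mono (List.subset_append_left _ _) (List.subset_append_left _ _)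
  | iteFalse _ _ ih => exact ih.mono (List.subset_append_right _ _) (List.subset_append_right _ _)
  | whileFalse _ => exact Frame.refl _ _
  | whileTrue _ _ _ ih₁ ih₂ =>
    exact Frame.trans (P := .while _ _) ⟨ih₁.nats, ih₁.reals⟩ ih₂

/-- Total correctness with a time bound: from `σ`, the program halts within `B` steps, in a state
with the property `Q`. -/
def Ends (P : Prog) (σ : State) (B : ℕ) (Q : State → Prop) : Prop :=
  ∃ T σ', Run P σ T σ' ∧ T ≤ B ∧ Q σ'

namespace Ends

variable {P Q : Prog} {σ : State} {B B' : ℕ} {R R' : State → Prop}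

theorem mono (h : Ends P σ B R) (hB : B ≤ B') (hR : ∀ σ', Frame P σ σ' → R σ' → R' σ') :
    Ends P σ B' R' := by
  obtain ⟨T, σ', hrun, hT, hR'⟩ := h
  exact ⟨T, σ', hrun, hT.trans hB, hR _ hrun.frame hR'⟩

theorem of_exec (hP : P.loopFree) (hB : P.maxCost ≤ B) (hR : R (P.exec σ)) : Ends P σ B R := by
  obtain ⟨T, hrun, hT⟩ := Prog.exists_run_exec hP σ
  exact ⟨T, _, hrun, hT.trans hB, hR⟩

theorem seq (h₁ : Ends P σ B fun σ' => Ends Q σ' B' R) : Ends (.seq P Q) σ (B + B') R := by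
  obtain ⟨T₁, σ₁, hrun₁, hT₁, T₂, σ₂, hrun₂, hT₂, hR⟩ := h₁
  exact ⟨_, σ₂, .seq hrun₁ hrun₂, add_le_add hT₁ hT₂, hR⟩

/-- The rule for loops: each iteration is paid for by a decrease of a potential `Φ`, in units of
`1 / K` steps. -/
theorem while_loop {b : Test} (K : ℕ) (hK : 0 < K) (Inv : State → Prop) (Φ : State → ℕ)
    (h₀ : Inv σ)
    (hstep : ∀ σ₁, Frame P σ σ₁ → Inv σ₁ → b.holds σ₁ → ∃ B₁, Ends P σ₁ B₁ fun σ₂ =>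
      Inv σ₂ ∧ K * (B₁ + b.cost + 1) + Φ σ₂ ≤ Φ σ₁)
    (hB : Φ σ + K * (b.cost + 1) ≤ K * B) :
    Ends (.while b P) σ B fun σ' => Inv σ' ∧ ¬ b.holds σ' := by
  suffices h : ∀ (N : ℕ) (σ₁ : State), Φ σ₁ ≤ N → Frame P σ σ₁ → Inv σ₁ →
      ∃ T σ', Run (.while b P) σ₁ T σ' ∧ K * T ≤ Φ σ₁ + K * (b.cost + 1) ∧ Inv σ' ∧
        ¬ b.holds σ' by
    obtain ⟨T, σ', hrun, hT, hR⟩ := h _ σ le_rfl (Frame.refl _ _) h₀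
    exact ⟨T, σ', hrun, Nat.le_of_mul_le_mul_left (hT.trans hB) hK, hR⟩
  intro N
  induction N using Nat.strong_induction_on with
  | _ N ih =>
    intro σ₁ hN hf hI
    by_cases hb : b.holds σ₁
    · obtain ⟨B₁, T₁, σ₂, hrun₁, hT₁, hI₂, hΦ⟩ := hstep σ₁ hf hI hb
      have hpos : 0 < K * (B₁ + b.cost + 1) := Nat.mul_pos hK (by omega)
      obtain ⟨T₂, σ', hrun₂, hT₂, hR⟩ :=
        ih (Φ σ₂) (by omega) σ₂ le_rfl (hf.trans hrun₁.frame) hI₂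
      refine ⟨_, σ', .whileTrue hb hrun₁ hrun₂, ?_, hR⟩
      have : K * T₁ ≤ K * B₁ := Nat.mul_le_mul_left _ hT₁
      simp only [mul_add, mul_one] at hΦ hT₂ ⊢
      omega
    · exact ⟨_, σ₁, .whileFalse hb, by omega, hI, hb⟩

end Ends

/-- `for i < lim do P`, with the counter in the integer variable `i`. -/
def Prog.forLoop (i : ℕ) (lim : NatExpr) (P : Prog) : Prog :=
  .seq (.setN i (.const 0))
    (.while (.natLT (.var i) lim) (.seq P (.setN i (.add (.var i) (.const 1)))))

theorem Ends.forLoop {i n B : ℕ} {lim : NatExpr} {P : Prog} {σ : State}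
    (Inv : ℕ → State → Prop) (cost : ℕ → ℕ) (hi : i ∉ P.natWrites)
    (hlim : ∀ σ', Frame (.forLoop i lim P) σ σ' → lim.eval σ' = n)
    (h₀ : Inv 0 (σ.writeNat i 0 0))
    (hstep : ∀ k σ₁, k < n → Frame (.forLoop i lim P) σ σ₁ → σ₁.nats i 0 = k → Inv k σ₁ →
      Ends P σ₁ (cost k) fun σ₂ => Inv (k + 1) (σ₂.writeNat i 0 (k + 1)))
    (hB : ∑ k ∈ range n, (cost k + (lim.cost + 12)) + (lim.cost + 12) ≤ B) :
    Ends (.forLoop i lim P) σ B fun σ' => Inv n σ' := by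
  set W : Prog := .seq P (.setN i (.add (.var i) (.const 1))) with hW
  set c := lim.cost + 12 with hc
  have hsub : ∀ {σ₁ σ₂ : State}, Frame W σ₁ σ₂ → Frame (.forLoop i lim P) σ₁ σ₂ := fun h =>
    h.mono (List.subset_append_right _ _) (List.subset_append_right _ _)
  have hf₀ : Frame (.forLoop i lim P) σ (σ.writeNat i 0 0) :=
    ⟨fun a ha => State.nats_writeNat_ne _ _ _ fun h =>
        ha (by simp [Prog.forLoop, Prog.natWrites, h]),
      fun _ _ => rfl⟩
  refine Ends.mono (B := 3 + (∑ k ∈ range n, (cost k + c) + (lim.cost + 8)))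
    (R := fun σ' => Inv n σ')
    (Ends.seq (Ends.of_exec rfl (by simp [Prog.maxCost, NatExpr.cost]) ?_)) (by omega)
    fun _ _ h => h
  show Ends _ (σ.writeNat i 0 0) _ _
  refine (Ends.while_loop (P := W) (b := .natLT (.var i) lim) (σ := σ.writeNat i 0 0) 1 one_pos
    (fun σ₁ => σ₁.nats i 0 ≤ n ∧ Inv (σ₁.nats i 0) σ₁)
    (fun σ₁ => ∑ k ∈ Ico (σ₁.nats i 0) n, (cost k + c)) ?_ ?_
    (B := ∑ k ∈ range n, (cost k + c) + (lim.cost + 8)) ?_).mono le_rfl ?_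
  · simpa using h₀
  · intro σ₁ hf₁ ⟨hle, hI⟩ hb
    have hl := hlim σ₁ (hf₀.trans (hsub hf₁))
    have hlt : σ₁.nats i 0 < n := by
      simpa [Test.holds, NatExpr.eval, hl] using hb
    refine ⟨cost (σ₁.nats i 0) + 6, ?_⟩
    obtain ⟨T, σ₂, hrun, hT, hI₂⟩ :=
      hstep _ σ₁ hlt (hf₀.trans (hsub hf₁)) rfl hI
    have hsame : σ₂.nats i 0 = σ₁.nats i 0 := by rw [hrun.frame.nats i hi]
    refine Ends.seq ⟨T, σ₂, hrun, hT, Ends.of_exec rfl (by simp [Prog.maxCost, NatExpr.cost]) ?_⟩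
    simp only [Prog.exec, NatExpr.eval, hsame, State.nats_writeNat_same, Function.update_self,
      Test.cost, NatExpr.cost]
    refine ⟨⟨by omega, hI₂⟩, ?_⟩
    rw [sum_eq_sum_Ico_succ_bot hlt]
    simp only [hc]
    omega
  · simp only [Test.cost, NatExpr.cost, State.nats_writeNat_same, Function.update_self, range_eq_Ico]
    omega
  · rintro σ' hf ⟨⟨hle, hI⟩, hb⟩
    have hl := hlim σ' (hf₀.trans (hsub ⟨hf.nats, hf.reals⟩))
    have : σ'.nats i 0 = n := by
      simp only [Test.holds, NatExpr.eval, hl, not_not] at hb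
      omega
    rwa [this] at hI

/-- The rule for counting loops with a uniform bound on the running time of the body. -/
theorem Ends.forLoop_const {i n B c : ℕ} {lim : NatExpr} {P : Prog} {σ : State}
    (Inv : ℕ → State → Prop) (hi : i ∉ P.natWrites)
    (hlim : ∀ σ', Frame (.forLoop i lim P) σ σ' → lim.eval σ' = n)
    (h₀ : Inv 0 (σ.writeNat i 0 0))
    (hstep : ∀ k σ₁, k < n → Frame (.forLoop i lim P) σ σ₁ → σ₁.nats i 0 = k → Inv k σ₁ →
      Ends P σ₁ c fun σ₂ => Inv (k + 1) (σ₂.writeNat i 0 (k + 1)))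
    (hB : (n + 1) * (c + (lim.cost + 12)) ≤ B) :
    Ends (.forLoop i lim P) σ B fun σ' => Inv n σ' :=
  Ends.forLoop Inv (fun _ => c) hi hlim h₀ hstep (by
    rw [sum_const, card_range, smul_eq_mul]
    refine le_trans ?_ hB
    rw [add_mul, one_mul]
    omega)

/-- The rule for counting loops whose body contains no loop. -/
theorem Ends.forLoop_exec {i n B : ℕ} {lim : NatExpr} {P : Prog} {σ : State}
    (Inv : ℕ → State → Prop) (hP : P.loopFree) (hi : i ∉ P.natWrites)
    (hlim : ∀ σ', Frame (.forLoop i lim P) σ σ' → lim.eval σ' = n)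
    (h₀ : Inv 0 (σ.writeNat i 0 0))
    (hstep : ∀ k σ₁, k < n → Frame (.forLoop i lim P) σ σ₁ → σ₁.nats i 0 = k → Inv k σ₁ →
      Inv (k + 1) ((P.exec σ₁).writeNat i 0 (k + 1)))
    (hB : (n + 1) * (P.maxCost + (lim.cost + 12)) ≤ B) :
    Ends (.forLoop i lim P) σ B fun σ' => Inv n σ' :=
  Ends.forLoop_const Inv hi hlim h₀
    (fun k σ₁ hk hf hi hI => Ends.of_exec hP le_rfl (hstep k σ₁ hk hf hi hI)) hB

end RealRAM


/-! ### Flow networks -/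

/-- A flow network in the representation that the program uses. The nodes are the numbers below `N`
and the arcs are the numbers `1, …, M`. The arc `a` has head `hd a` and reverse arc `rv a`; the arcs
with a given tail `v` form the list `fst v, nx (fst v), …` of decreasing numbers, closed by `0`. -/
structure Net where
  N : ℕ
  M : ℕ
  hd : ℕ → ℕ
  rv : ℕ → ℕ
  nx : ℕ → ℕ
  fst : ℕ → ℕ
  cap : ℕ → ℝ

namespace Net

/-- The tail of an arc is the head of its reverse. -/
def tl (G : Net) (a : ℕ) : ℕ := G.hd (G.rv a)

/-- The set of arcs. -/
def arcs (G : Net) : Finset ℕ := Icc 1 G.M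

/-- The arcs with tail `v`. -/
def out (G : Net) (v : ℕ) : Finset ℕ := {a ∈ G.arcs | G.tl a = v}

/-- The representation is consistent. -/
structure WF (G : Net) : Prop where
  rv_mem : ∀ a ∈ G.arcs, G.rv a ∈ G.arcs
  rv_rv : ∀ a ∈ G.arcs, G.rv (G.rv a) = a
  rv_ne : ∀ a ∈ G.arcs, G.rv a ≠ a
  hd_lt : ∀ a ∈ G.arcs, G.hd a < G.N
  cap_nonneg : ∀ a ∈ G.arcs, 0 ≤ G.cap a
  nx_lt : ∀ a ∈ G.arcs, G.nx a < a
  nx_tl : ∀ a ∈ G.arcs, G.nx a ≠ 0 → G.tl (G.nx a) = G.tl a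
  nx_gap : ∀ a ∈ G.arcs, ∀ b, G.nx a < b → b < a → G.tl b ≠ G.tl a
  fst_le : ∀ v < G.N, G.fst v ≤ G.M
  fst_tl : ∀ v < G.N, G.fst v ≠ 0 → G.tl (G.fst v) = v
  fst_gap : ∀ v < G.N, ∀ b, G.fst v < b → b ≤ G.M → G.tl b ≠ v

/-- The capacity of the cut `S`: the total capacity of the arcs that leave `S`. -/
noncomputable def cutCap (G : Net) (S : Set ℕ) : ℝ :=
  open Classical in ∑ a ∈ G.arcs with G.tl a ∈ S ∧ G.hd a ∉ S, G.cap a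

theorem mem_out {G : Net} {v a : ℕ} : a ∈ G.out v ↔ a ∈ G.arcs ∧ G.tl a = v := by
  simp [out]

variable {G : Net}

theorem sum_out (f : ℕ → ℕ → ℝ) (T : Finset ℕ) :
    ∑ v ∈ T, ∑ a ∈ G.out v, f v a = ∑ a ∈ G.arcs with G.tl a ∈ T, f (G.tl a) a := by
  rw [sum_sigma']
  refine sum_bij' (fun x _ => x.2) (fun a _ => ⟨G.tl a, a⟩) ?_ ?_ ?_ ?_ ?_
  · rintro ⟨v, a⟩ h
    simp only [mem_sigma, mem_out] at h
    simp only [mem_filter]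
    exact ⟨h.2.1, h.2.2 ▸ h.1⟩
  · intro a h
    simp only [mem_filter] at h
    simp only [mem_sigma, mem_out, and_true]
    exact ⟨h.2, h.1⟩
  · rintro ⟨v, a⟩ h
    simp only [mem_sigma, mem_out] at h
    simp [h.2.2]
  · intros; rfl
  · rintro ⟨v, a⟩ h
    simp only [mem_sigma, mem_out] at h
    simp [h.2.2]

variable (hG : G.WF)
include hG

theorem WF.tl_lt {a : ℕ} (ha : a ∈ G.arcs) : G.tl a < G.N := hG.hd_lt _ (hG.rv_mem a ha)

theorem WF.tl_rv {a : ℕ} (ha : a ∈ G.arcs) : G.tl (G.rv a) = G.hd a := by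
  rw [tl, hG.rv_rv a ha]

/-- The net flow out of the complement of `S` is what leaves it towards `S`. -/
theorem WF.sum_antisymm (f : ℕ → ℝ) (hf : ∀ a ∈ G.arcs, f (G.rv a) = - f a) (S : Set ℕ) :
    open Classical in
    ∑ a ∈ G.arcs with G.tl a ∉ S, f a = - ∑ a ∈ G.arcs with G.tl a ∈ S ∧ G.hd a ∉ S, f a := by
  classical
  rw [← sum_filter_add_sum_filter_not _ (fun a => G.hd a ∈ S)]
  have h0 : ∑ a ∈ {a ∈ {a ∈ G.arcs | G.tl a ∉ S} | ¬ G.hd a ∈ S}, f a = 0 := by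
    refine sum_involution (fun a _ => G.rv a) ?_ ?_ ?_ ?_
    · intro a ha
      simp only [mem_filter] at ha
      rw [hf a ha.1.1]
      ring
    · intro a ha _
      simp only [mem_filter] at ha
      exact hG.rv_ne a ha.1.1
    · intro a ha
      simp only [mem_filter] at ha ⊢
      exact ⟨⟨hG.rv_mem a ha.1.1, by rw [hG.tl_rv ha.1.1]; exact ha.2⟩, ha.1.2⟩
    · intro a ha
      simp only [mem_filter] at ha
      exact hG.rv_rv a ha.1.1
  rw [h0, add_zero, ← sum_neg_distrib]
  refine sum_bij' (fun a _ => G.rv a) (fun a _ => G.rv a) ?_ ?_ ?_ ?_ ?_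
  · intro a ha
    simp only [mem_filter] at ha ⊢
    exact ⟨hG.rv_mem a ha.1.1, by rw [hG.tl_rv ha.1.1]; exact ha.2, ha.1.2⟩
  · intro a ha
    simp only [mem_filter] at ha ⊢
    exact ⟨⟨hG.rv_mem a ha.1, by rw [hG.tl_rv ha.1]; exact ha.2.2⟩, ha.2.1⟩
  · intro a ha
    simp only [mem_filter] at ha
    exact hG.rv_rv a ha.1.1
  · intro a ha
    simp only [mem_filter] at ha
    exact hG.rv_rv a ha.1
  · intro a ha
    simp only [mem_filter] at ha
    rw [hf a ha.1.1, neg_neg]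

end Net

/-! ### Buckets of active nodes -/

/-- `l` is the linked list that starts with `h`, where a pointer to `v` is stored as `v + 1`. -/
def Linked (nxt : ℕ → ℕ) : ℕ → List ℕ → Prop
  | h, [] => h = 0
  | h, v :: l => h = v + 1 ∧ Linked nxt (nxt v) l

theorem Linked.update {nxt : ℕ → ℕ} {v x : ℕ} : ∀ {h : ℕ} {l : List ℕ}, v ∉ l → Linked nxt h l →
    Linked (Function.update nxt v x) h l
  | _, [], _, h => h
  | _, u :: l, hv, h => by
    rw [List.mem_cons, not_or] at hv
    refine ⟨h.1, ?_⟩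
    rw [Function.update_of_ne (Ne.symm hv.1)]
    exact Linked.update hv.2 h.2

/-- For each `i ≤ N`, the linked list `head i` contains the nodes in `A` with label `i`. -/
def Buckets (N : ℕ) (A : Finset ℕ) (d head nxt : ℕ → ℕ) : Prop :=
  ∀ i ≤ N, ∃ l : List ℕ, Linked nxt (head i) l ∧ l.Nodup ∧ ∀ v, v ∈ l ↔ v ∈ A ∧ d v = i

namespace Buckets

variable {N : ℕ} {A : Finset ℕ} {d head nxt : ℕ → ℕ} (hb : Buckets N A d head nxt)
include hb

theorem ne_of_head_eq_zero {i : ℕ} (hi : i ≤ N) (h : head i = 0) {v : ℕ} (hv : v ∈ A) :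
    d v ≠ i := by
  obtain ⟨l, hl, -, hmem⟩ := hb i hi
  intro hd
  have := (hmem v).2 ⟨hv, hd⟩
  cases l with
  | nil => simp at this
  | cons u l => have := hl.1; omega

theorem head_mem {i : ℕ} (hi : i ≤ N) (h : head i ≠ 0) :
    head i - 1 ∈ A ∧ d (head i - 1) = i := by
  obtain ⟨l, hl, -, hmem⟩ := hb i hi
  cases l with
  | nil => exact absurd hl h
  | cons u l =>
    rw [hl.1, Nat.add_sub_cancel]
    exact (hmem u).1 (by simp)

theorem pop {i v : ℕ} (hi : i ≤ N) (h : head i = v + 1) :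
    Buckets N (A.erase v) d (Function.update head i (nxt v)) nxt := by
  have hv := hb.head_mem hi (by omega)
  rw [h, Nat.add_sub_cancel] at hv
  intro j hj
  obtain ⟨l, hl, hnd, hmem⟩ := hb j hj
  by_cases hji : j = i
  · subst hji
    rw [Function.update_self]
    cases l with
    | nil => exact absurd (hl.symm.trans h) (by omega)
    | cons u l =>
      obtain rfl : u = v := by have := hl.1; omega
      rw [List.nodup_cons] at hnd
      refine ⟨l, hl.2, hnd.2, fun w => ?_⟩
      have := hmem w
      rw [List.mem_cons] at this
      rw [mem_erase]
      constructor
      · intro hw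
        exact ⟨⟨fun e => hnd.1 (e ▸ hw), (this.1 (Or.inr hw)).1⟩, (this.1 (Or.inr hw)).2⟩
      · rintro ⟨⟨hne, hA⟩, hd⟩
        exact (this.2 ⟨hA, hd⟩).resolve_left hne
  · rw [Function.update_of_ne hji]
    refine ⟨l, hl, hnd, fun w => ?_⟩
    rw [hmem, mem_erase]
    constructor
    · rintro ⟨hA, hd⟩
      exact ⟨⟨fun e => hji (by rw [← hd, e, hv.2]), hA⟩, hd⟩
    · rintro ⟨⟨-, hA⟩, hd⟩
      exact ⟨hA, hd⟩

theorem push {v : ℕ} (hv : v ∉ A) :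
    Buckets N (insert v A) d (Function.update head (d v) (v + 1))
      (Function.update nxt v (head (d v))) := by
  intro j hj
  obtain ⟨l, hl, hnd, hmem⟩ := hb j hj
  have hvl : v ∉ l := fun h => hv ((hmem v).1 h).1
  by_cases hji : j = d v
  · subst hji
    rw [Function.update_self]
    refine ⟨v :: l, ⟨rfl, ?_⟩, List.nodup_cons.2 ⟨hvl, hnd⟩, fun w => ?_⟩
    · rw [Function.update_self]
      exact hl.update hvl
    · rw [List.mem_cons, hmem, mem_insert]
      constructor
      · rintro (rfl | ⟨hA, hd⟩)
        · exact ⟨Or.inl rfl, rfl⟩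
        · exact ⟨Or.inr hA, hd⟩
      · rintro ⟨rfl | hA, hd⟩
        · exact Or.inl rfl
        · exact Or.inr ⟨hA, hd⟩
  · rw [Function.update_of_ne hji]
    refine ⟨l, hl.update hvl, hnd, fun w => ?_⟩
    rw [hmem, mem_insert]
    constructor
    · rintro ⟨hA, hd⟩
      exact ⟨Or.inr hA, hd⟩
    · rintro ⟨rfl | hA, hd⟩
      · exact absurd hd.symm hji
      · exact ⟨hA, hd⟩

theorem congr {A' : Finset ℕ} {d' : ℕ → ℕ} (hA : A' = A) (hd : ∀ v ∈ A, d' v = d v) :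
    Buckets N A' d' head nxt := by
  subst hA
  intro i hi
  obtain ⟨l, hl, hnd, hmem⟩ := hb i hi
  refine ⟨l, hl, hnd, fun v => (hmem v).trans (and_congr_right fun hv => ?_)⟩
  rw [hd v hv]

end Buckets

/-! ### The highest-label push-relabel algorithm -/

/-- The variable part of the memory of the push-relabel algorithm: excesses `e`, residual capacities
`r`, labels `d`, current arcs `cur`, the buckets of active nodes, an upper bound `D` on the labels of
active nodes, a flag that tells whether some excess can no longer reach the sink, and the number of
times that excess was injected at the source. -/
structure PR where
  e : ℕ → ℝ
  r : ℕ → ℝ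
  d : ℕ → ℕ
  cur : ℕ → ℕ
  head : ℕ → ℕ
  nxt : ℕ → ℕ
  D : ℕ
  stuck : ℕ
  rounds : ℕ

namespace PR

open Function (update)

/-- The active nodes: those with positive excess and label less than `N`, except the sink `1`. -/
noncomputable def act (N : ℕ) (p : PR) : Finset ℕ :=
  open Classical in {v ∈ range N | v ≠ 1 ∧ 0 < p.e v ∧ p.d v < N}

theorem mem_act {N : ℕ} {p : PR} {v : ℕ} :
    v ∈ p.act N ↔ v < N ∧ v ≠ 1 ∧ 0 < p.e v ∧ p.d v < N := by
  simp [act]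

/-- The invariant of the algorithm, for the source `s` and the amount `q` per injection. -/
structure Inv (G : Net) (s : ℕ) (q : ℝ) (p : PR) : Prop where
  excess : ∀ v < G.N, p.e v = (if v = s then p.rounds * q else 0) -
    ∑ a ∈ G.out v, (G.cap a - p.r a)
  r_nonneg : ∀ a ∈ G.arcs, 0 ≤ p.r a
  r_add : ∀ a ∈ G.arcs, p.r a + p.r (G.rv a) = G.cap a + G.cap (G.rv a)
  e_nonneg : ∀ v < G.N, 0 ≤ p.e v
  d_le : ∀ v < G.N, p.d v ≤ G.N
  d_pos : ∀ v < G.N, v ≠ 1 → 1 ≤ p.d v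
  d_sink : p.d 1 = 0
  valid : ∀ a ∈ G.arcs, 0 < p.r a → p.d (G.tl a) ≤ p.d (G.hd a) + 1
  cur_le : ∀ v < G.N, p.cur v ≤ G.M
  cur_tl : ∀ v < G.N, p.cur v ≠ 0 → G.tl (p.cur v) = v
  cur_gap : ∀ a ∈ G.arcs, p.cur (G.tl a) < a → 0 < p.r a → p.d (G.tl a) ≤ p.d (G.hd a)
  stuck_zero : p.stuck = 0 → ∀ v < G.N, p.d v < G.N
  stuck_ne_zero : p.stuck ≠ 0 → ∃ v < G.N, p.d v = G.N
  e_pos : ∀ v < G.N, p.d v = G.N → 0 < p.e v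
  D_le : p.D ≤ G.N
  le_D : ∀ v ∈ p.act G.N, p.d v ≤ p.D
  buckets : Buckets G.N (p.act G.N) p.d p.head p.nxt

/-- Pass to the next lower bucket. -/
def lower (p : PR) : PR := { p with D := p.D - 1 }

/-- Pass over the current arc `a` of `v`. -/
def advance (G : Net) (p : PR) (v a : ℕ) : PR := { p with cur := update p.cur v (G.nx a) }

/-- Inject `q` units of excess at the source. -/
noncomputable def inject (s : ℕ) (q : ℝ) (p : PR) : PR :=
  { p with
    e := update p.e s (p.e s + q)
    D := p.d s
    nxt := update p.nxt s (p.head (p.d s))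
    head := update p.head (p.d s) (s + 1)
    rounds := p.rounds + 1 }

/-- Increase the label of the first node `v` of bucket `D` and move it to the next bucket, if its new
label is less than `N`. -/
def relabel (G : Net) (p : PR) (v : ℕ) : PR :=
  { p with
    d := update p.d v (p.d v + 1)
    cur := update p.cur v (G.fst v)
    D := p.D + 1
    nxt := if p.D + 1 < G.N then update p.nxt v (update p.head p.D (p.nxt v) (p.D + 1)) else p.nxt
    head := if p.D + 1 < G.N then update (update p.head p.D (p.nxt v)) (p.D + 1) (v + 1)
      else update p.head p.D (p.nxt v)
    stuck := if p.D + 1 < G.N then p.stuck else 1 }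

/-- The amount of flow that is pushed along the arc `a` with tail `v`. -/
noncomputable def amount (p : PR) (v a : ℕ) : ℝ := if p.r a ≤ p.e v then p.r a else p.e v

/-- Push flow from `v` along the arc `a`, as much as possible. -/
noncomputable def push (G : Net) (p : PR) (v a : ℕ) : PR :=
  let w := G.hd a
  let δ := p.amount v a
  let e' := update (update p.e v (p.e v - δ)) w (p.e w + δ)
  let head' := if w ≠ 1 ∧ p.e w ≤ 0 then update p.head (p.D - 1) (w + 1) else p.head
  let nxt' := if w ≠ 1 ∧ p.e w ≤ 0 then update p.nxt w (p.head (p.D - 1)) else p.nxt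
  { p with
    e := e'
    r := update (update p.r a (p.r a - δ)) (G.rv a) (p.r (G.rv a) + δ)
    cur := if p.r a ≤ p.e v then update p.cur v (G.nx a) else p.cur
    nxt := nxt'
    head := if p.e v - δ ≤ 0 then update head' p.D (nxt' v) else head' }

/-- The total number of possible passes over arcs and relabelings. -/
def scans (G : Net) (p : PR) : ℕ :=
  ∑ v ∈ range G.N, ((G.N - p.d v) * (#(G.out v) + 1) + #{a ∈ G.out v | a ≤ p.cur v})

/-- A bound on the number of changes of the variable `D` until the next injection. -/
def phases (G : Net) (p : PR) : ℕ := p.D + 2 * ∑ v ∈ range G.N, (G.N - p.d v)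

/-- The number of active nodes with label `D`. -/
noncomputable def top (G : Net) (p : PR) : ℕ := #{v ∈ p.act G.N | p.d v = p.D}

/-- The number of pairs of an active node and a node whose label is not greater. -/
noncomputable def pairs (G : Net) (p : PR) : ℕ :=
  ∑ v ∈ p.act G.N, #{u ∈ range G.N | p.d u ≤ p.d v}

/-- The potential that pays for the steps, in units of `1 / K` steps. A phase is a period in which
`D` does not change. In a phase with at most `K` active nodes at the top label, the non-saturating
pushes are paid for by the term `min K top`; as long as there are more of them, a non-saturating push
decreases `pairs` by at least `K`. With `κ = 0` the term `pairs` is dropped: that works if there are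
never more than `K` active nodes. At most `R` injections are allowed for. -/
noncomputable def potential (G : Net) (κ K R : ℕ) (p : PR) : ℕ :=
  κ * (p.pairs G + G.N * p.scans G) + K * (p.scans G + min K (p.top G) + (K + 1) * p.phases G) +
    (R - p.rounds) * (κ * G.N + K * ((K + 1) * G.N + K + 1))

variable {G : Net} {s : ℕ} {q : ℝ} {p : PR}

theorem card_filter_label_le (d : ℕ → ℕ) (i : ℕ) : #{u ∈ range G.N | d u ≤ i} ≤ G.N :=
  (card_filter_le _ _).trans (card_range _).le

/-! #### Passing to the next bucket -/

theorem Inv.lower (hI : p.Inv G s q) (h0 : p.head p.D = 0) : p.lower.Inv G s q := by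
  refine { hI with D_le := (Nat.sub_le _ _).trans hI.D_le, le_D := fun v hv => ?_ }
  have h1 := hI.le_D v hv
  have h2 := hI.buckets.ne_of_head_eq_zero hI.D_le h0 hv
  show p.d v ≤ p.D - 1
  omega

/-- The term `phases` pays for the step and for the new value of `min K top`. -/
theorem potential_lower (hD : p.D ≠ 0) (κ K R : ℕ) :
    p.lower.potential G κ K R + K ≤ p.potential G κ K R := by
  have h1 : p.lower.pairs G = p.pairs G := rfl
  have h2 : p.lower.scans G = p.scans G := rfl
  have h3 : p.lower.phases G + 1 = p.phases G := by
    simp only [phases, PR.lower]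
    omega
  have h4 : p.lower.rounds = p.rounds := rfl
  have h5 : min K (p.lower.top G) ≤ K := min_le_left _ _
  have h6 : K * (p.scans G + min K (p.lower.top G) + (K + 1) * p.lower.phases G) + K ≤
      K * (p.scans G + min K (p.top G) + (K + 1) * p.phases G) := by
    rw [← h3, ← Nat.mul_succ]
    refine Nat.mul_le_mul_left _ ?_
    rw [mul_add (K + 1), Nat.succ_eq_add_one]
    omega
  unfold potential
  rw [h1, h2, h4]
  omega

/-! #### Passing over an arc -/

theorem act_relabel {v : ℕ} (hv : v ∈ p.act G.N) (hd : p.d v = p.D) :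
    (p.relabel G v).act G.N = if p.D + 1 < G.N then p.act G.N else (p.act G.N).erase v := by
  ext u
  have hu : (p.relabel G v).e u = p.e u := rfl
  have hd' : (p.relabel G v).d u = if u = v then p.d v + 1 else p.d u := by
    simp [relabel, Function.update_apply]
  rw [mem_act, hu, hd']
  rw [mem_act] at hv
  by_cases huv : u = v
  · subst huv
    rw [if_pos rfl]
    split_ifs with h
    · rw [mem_act]
      constructor <;> rintro ⟨h1, h2, h3, h4⟩ <;> exact ⟨h1, h2, h3, by omega⟩
    · simp only [mem_erase, ne_eq, not_true_eq_false, false_and, iff_false]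
      rintro ⟨-, -, -, h4⟩
      omega
  · rw [if_neg huv]
    split_ifs with h
    · rw [mem_act]
    · rw [mem_erase, mem_act]
      simp [huv]

theorem Inv.potential_relabel (hI : p.Inv G s q) {v : ℕ} (hh : p.head p.D = v + 1)
    (κ K R : ℕ) :
    (p.relabel G v).potential G κ K R + K ≤ p.potential G κ K R := by
  obtain ⟨hv, hd⟩ := hI.buckets.head_mem hI.D_le (by omega)
  rw [hh, Nat.add_sub_cancel] at hv hd
  have hv' := mem_act.1 hv
  have hvr := mem_range.2 hv'.1
  have hdu : ∀ u, (p.relabel G v).d u = if u = v then p.d v + 1 else p.d u := fun u => by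
    simp [PR.relabel, Function.update_apply]
  have hsub : (p.relabel G v).act G.N ⊆ p.act G.N := by
    rw [act_relabel hv hd]; split_ifs
    · exact Subset.rfl
    · exact erase_subset _ _
  have h1 : (p.relabel G v).pairs G ≤ p.pairs G + G.N := by
    unfold pairs
    refine (sum_le_sum_of_subset hsub).trans ?_
    rw [← add_sum_erase _ _ hv, ← add_sum_erase _ _ hv]
    have : ∑ u ∈ (p.act G.N).erase v, #{w ∈ range G.N | (p.relabel G v).d w ≤ (p.relabel G v).d u}
        ≤ ∑ u ∈ (p.act G.N).erase v, #{w ∈ range G.N | p.d w ≤ p.d u} := by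
      refine sum_le_sum fun u hu => card_le_card fun w hw => ?_
      rw [mem_filter] at hw ⊢
      refine ⟨hw.1, ?_⟩
      have h2 := hw.2
      rw [hdu, hdu, if_neg (ne_of_mem_erase hu)] at h2
      split_ifs at h2 with h
      · rw [h]; omega
      · exact h2
    have h3 := card_filter_label_le (G := G) (p.relabel G v).d ((p.relabel G v).d v)
    omega
  have h2 : (p.relabel G v).scans G + 1 ≤ p.scans G := by
    unfold scans
    rw [← add_sum_erase _ _ hvr, ← add_sum_erase _ _ hvr, sum_congr rfl (g := fun v =>
      (G.N - p.d v) * (#(G.out v) + 1) + #{a ∈ G.out v | a ≤ p.cur v}) fun u hu => ?_]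
    · have h3 : #{a ∈ G.out v | a ≤ (p.relabel G v).cur v} ≤ #(G.out v) := card_filter_le _ _
      have h4 : (G.N - p.d v) = (G.N - (p.relabel G v).d v) + 1 := by
        rw [hdu, if_pos rfl]; omega
      rw [h4, add_mul, one_mul]
      omega
    · rw [mem_erase] at hu
      rw [hdu, if_neg hu.1]
      simp only [PR.relabel, Function.update_of_ne hu.1]
  have h3 : (p.relabel G v).phases G + 1 = p.phases G := by
    unfold phases
    rw [← add_sum_erase _ _ hvr, ← add_sum_erase _ _ hvr, sum_congr rfl (g := fun v =>
      G.N - p.d v) fun u hu => ?_]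
    · rw [hdu, if_pos rfl]
      simp only [PR.relabel]
      omega
    · rw [mem_erase] at hu
      rw [hdu, if_neg hu.1]
  have h4 : (p.relabel G v).rounds = p.rounds := rfl
  have h5 : min K ((p.relabel G v).top G) ≤ K := min_le_left _ _
  have h6 : κ * ((p.relabel G v).pairs G + G.N * (p.relabel G v).scans G) ≤
      κ * (p.pairs G + G.N * p.scans G) := by
    refine Nat.mul_le_mul_left _ ?_
    have := Nat.mul_le_mul_left G.N h2
    rw [mul_add, mul_one] at this
    omega
  have h7 : K * ((p.relabel G v).scans G + min K ((p.relabel G v).top G) +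
      (K + 1) * (p.relabel G v).phases G) + K ≤
      K * (p.scans G + min K (p.top G) + (K + 1) * p.phases G) := by
    rw [← h3, ← Nat.mul_succ]
    refine Nat.mul_le_mul_left _ ?_
    rw [mul_add (K + 1), Nat.succ_eq_add_one]
    omega
  unfold potential
  rw [h4]
  omega

variable (hG : G.WF)
include hG

theorem card_out_filter_nx {v a : ℕ} (ha : a ∈ G.out v) :
    #{b ∈ G.out v | b ≤ G.nx a} + 1 = #{b ∈ G.out v | b ≤ a} := by
  have : {b ∈ G.out v | b ≤ a} = insert a {b ∈ G.out v | b ≤ G.nx a} := by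
    ext b
    rw [mem_insert, mem_filter, mem_filter]
    rw [Net.mem_out] at ha
    have hlt := hG.nx_lt a ha.1
    constructor
    · rintro ⟨hb, hle⟩
      rcases hle.eq_or_lt with h | h
      · exact Or.inl h
      · refine Or.inr ⟨hb, ?_⟩
        by_contra hn
        exact hG.nx_gap a ha.1 b (by omega) h ((Net.mem_out.1 hb).2.trans ha.2.symm)
    · rintro (rfl | ⟨hb, hle⟩)
      · exact ⟨Net.mem_out.2 ha, le_rfl⟩
      · exact ⟨hb, by omega⟩
  rw [this, card_insert_of_notMem]
  rw [mem_filter]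
  rw [Net.mem_out] at ha
  have := hG.nx_lt a ha.1
  omega

theorem scans_advance {v a : ℕ} (hv : v < G.N) (ha : a ∈ G.out v) (hc : p.cur v = a) :
    (p.advance G v a).scans G + 1 = p.scans G := by
  have hv' := mem_range.2 hv
  unfold scans
  rw [← add_sum_erase _ _ hv', ← add_sum_erase _ _ hv', sum_congr rfl (g := fun v =>
    (G.N - p.d v) * (#(G.out v) + 1) + #{a ∈ G.out v | a ≤ p.cur v}) fun u hu => ?_]
  · simp only [advance, Function.update_self]
    rw [hc, ← card_out_filter_nx hG ha]
    omega
  · rw [mem_erase] at hu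
    simp only [advance, Function.update_of_ne hu.1]

/-- The conditions on current arcs are preserved when an arc is passed over that does not allow a
push any more. -/
theorem Inv.cur_advance (hI : p.Inv G s q) {v a : ℕ} (ha : a ∈ G.out v) (hc : p.cur v = a) :
    (∀ u < G.N, update p.cur v (G.nx a) u ≤ G.M) ∧
    (∀ u < G.N, update p.cur v (G.nx a) u ≠ 0 → G.tl (update p.cur v (G.nx a) u) = u) ∧
    ∀ b ∈ G.arcs, b ≠ a → update p.cur v (G.nx a) (G.tl b) < b → p.cur (G.tl b) < b := by
  rw [Net.mem_out] at ha
  have hlt := hG.nx_lt a ha.1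
  have ham := (mem_Icc.1 ha.1).2
  refine ⟨fun u hu => ?_, fun u hu hne => ?_, fun b hb hba hlt' => ?_⟩
  · by_cases huv : u = v
    · rw [huv, Function.update_self]; omega
    · rw [Function.update_of_ne huv]; exact hI.cur_le u hu
  · by_cases huv : u = v
    · rw [huv, Function.update_self] at hne ⊢
      rw [hG.nx_tl a ha.1 hne, ha.2]
    · rw [Function.update_of_ne huv] at hne ⊢
      exact hI.cur_tl u hu hne
  · by_cases hbv : G.tl b = v
    · rw [hbv, Function.update_self] at hlt'
      rw [hbv, hc]
      by_contra hn
      exact hG.nx_gap a ha.1 b hlt' (by omega) (hbv.trans ha.2.symm)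
    · rwa [Function.update_of_ne hbv] at hlt'

theorem Inv.advance (hI : p.Inv G s q) {v a : ℕ} (ha : a ∈ G.out v) (hc : p.cur v = a)
    (hna : ¬ (0 < p.r a ∧ p.d v = p.d (G.hd a) + 1)) : (p.advance G v a).Inv G s q := by
  obtain ⟨h1, h2, h3⟩ := hI.cur_advance hG ha hc
  refine { hI with cur_le := h1, cur_tl := h2, cur_gap := fun b hb hlt hr => ?_ }
  by_cases hba : b = a
  · subst hba
    have h4 := hI.valid b hb hr
    rw [Net.mem_out] at ha
    show p.d (G.tl b) ≤ p.d (G.hd b)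
    rw [ha.2] at h4 ⊢
    by_contra hn
    exact hna ⟨hr, by omega⟩
  · exact hI.cur_gap b hb (h3 b hb hba hlt) hr

theorem potential_advance {v a : ℕ} (hv : v < G.N) (ha : a ∈ G.out v) (hc : p.cur v = a)
    (κ K R : ℕ) : (p.advance G v a).potential G κ K R + K ≤ p.potential G κ K R := by
  have h2 := scans_advance hG hv ha hc
  unfold potential
  rw [← h2]
  have h1 : (p.advance G v a).pairs G = p.pairs G := rfl
  have h3 : (p.advance G v a).phases G = p.phases G := rfl
  have h4 : (p.advance G v a).rounds = p.rounds := rfl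
  have h5 : (p.advance G v a).top G = p.top G := rfl
  rw [h1, h3, h4, h5]
  simp only [mul_add, mul_one]
  omega

/-! #### Relabeling -/

theorem Inv.relabel (hI : p.Inv G s q) {v : ℕ} (hh : p.head p.D = v + 1) (hc : p.cur v = 0) :
    (p.relabel G v).Inv G s q := by
  obtain ⟨hv, hd⟩ := hI.buckets.head_mem hI.D_le (by omega)
  rw [hh, Nat.add_sub_cancel] at hv hd
  have hv' := mem_act.1 hv
  have hdu : ∀ u, (p.relabel G v).d u = if u = v then p.d v + 1 else p.d u := fun u => by
    simp [PR.relabel, Function.update_apply]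
  have hle : ∀ u, p.d u ≤ (p.relabel G v).d u := fun u => by
    rw [hdu]; split_ifs with h
    · rw [h]; omega
    · exact le_rfl
  have hact := act_relabel hv hd
  have hsub : (p.relabel G v).act G.N ⊆ p.act G.N := by
    rw [hact]; split_ifs
    · exact Subset.rfl
    · exact erase_subset _ _
  refine { hI with
    d_le := fun u hu => ?_, d_pos := fun u hu h1 => (hI.d_pos u hu h1).trans (hle u)
    d_sink := ?_, valid := fun a ha hr => ?_, cur_le := fun u hu => ?_, cur_tl := fun u hu hne => ?_
    cur_gap := fun a ha hlt hr => ?_, stuck_zero := fun h0 u hu => ?_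
    stuck_ne_zero := fun h0 => ?_, e_pos := fun u hu hN => ?_
    D_le := ?_, le_D := fun u hu => ?_, buckets := ?_ }
  · rw [hdu]; split_ifs with h
    · omega
    · exact hI.d_le u hu
  · rw [hdu, if_neg (Ne.symm hv'.2.1)]; exact hI.d_sink
  · rw [hdu]; split_ifs with h
    · -- All arcs of `v` have been passed over, so no residual arc leads to a lower label.
      have := hI.cur_gap a ha (by rw [h, hc]; exact (mem_Icc.1 ha).1) hr
      rw [h] at this
      exact Nat.succ_le_succ (this.trans (hle _))
    · exact (hI.valid a ha hr).trans (Nat.succ_le_succ (hle _))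
  · simp only [PR.relabel, Function.update_apply]; split_ifs with h
    · rw [h] at hu; exact hG.fst_le v hu
    · exact hI.cur_le u hu
  · simp only [PR.relabel, Function.update_apply] at hne ⊢; split_ifs at hne ⊢ with h
    · rw [h] at hu ⊢; exact hG.fst_tl v hu hne
    · exact hI.cur_tl u hu hne
  · by_cases h : G.tl a = v
    · simp only [PR.relabel, h, Function.update_self] at hlt
      exact absurd h (hG.fst_gap v hv'.1 a hlt (mem_Icc.1 ha).2)
    · simp only [PR.relabel, Function.update_of_ne h] at hlt
      rw [hdu, if_neg h]
      exact (hI.cur_gap a ha hlt hr).trans (hle _)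
  · have h0' : p.D + 1 < G.N ∧ p.stuck = 0 := by
      simp only [PR.relabel] at h0; split_ifs at h0 with h
      exact ⟨h, h0⟩
    rw [hdu]; split_ifs with h
    · omega
    · exact hI.stuck_zero h0'.2 u hu
  · by_cases h : p.D + 1 < G.N
    · have h1 : p.stuck ≠ 0 := by simpa [PR.relabel, h] using h0
      obtain ⟨u, hu, huN⟩ := hI.stuck_ne_zero h1
      exact ⟨u, hu, by rw [hdu, if_neg (by rintro rfl; omega), huN]⟩
    · exact ⟨v, hv'.1, by rw [hdu, if_pos rfl]; have := hI.D_le; omega⟩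
  · rw [hdu] at hN; split_ifs at hN with h
    · rw [h]; exact hv'.2.2.1
    · exact hI.e_pos u hu hN
  · show p.D + 1 ≤ G.N
    omega
  · have := hI.le_D u (hsub hu)
    rw [hdu]
    show _ ≤ p.D + 1
    split_ifs <;> omega
  · have hpop := hI.buckets.pop hI.D_le hh
    have hpop' : Buckets G.N ((p.act G.N).erase v) (p.relabel G v).d
        (update p.head p.D (p.nxt v)) p.nxt :=
      hpop.congr rfl fun u hu => by rw [hdu, if_neg (ne_of_mem_erase hu)]
    by_cases h : p.D + 1 < G.N
    · have hpush := hpop'.push (v := v) (notMem_erase _ _)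
      rw [hdu, if_pos rfl, hd, insert_erase hv] at hpush
      rw [hact, if_pos h]
      simpa [PR.relabel, h] using hpush
    · rw [hact, if_neg h]
      simpa [PR.relabel, h] using hpop'

end PR


namespace PR

open Function (update)

variable {G : Net} {s : ℕ} {q : ℝ} {p : PR}

/-! #### Injecting excess at the source -/

theorem Inv.act_eq_empty (hI : p.Inv G s q) (hD : p.D = 0) : p.act G.N = ∅ := by
  refine eq_empty_of_forall_notMem fun v hv => ?_
  have h1 := hI.le_D v hv
  have h2 := mem_act.1 hv
  have h3 := hI.d_pos v h2.1 h2.2.1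
  omega

/-- As long as no excess is stuck, between two injections all excess is at the sink. -/
theorem Inv.e_eq_zero (hI : p.Inv G s q) (hD : p.D = 0) (hst : p.stuck = 0) {v : ℕ} (hv : v < G.N)
    (h1 : v ≠ 1) : p.e v = 0 := by
  by_contra hne
  have : v ∈ p.act G.N := mem_act.2
    ⟨hv, h1, lt_of_le_of_ne (hI.e_nonneg v hv) (Ne.symm hne), hI.stuck_zero hst v hv⟩
  rw [hI.act_eq_empty hD] at this
  exact notMem_empty _ this

theorem Inv.act_inject (hI : p.Inv G s q) (hD : p.D = 0) (hst : p.stuck = 0) (hs : s < G.N)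
    (hs1 : s ≠ 1) (hq : 0 < q) : (p.inject s q).act G.N = {s} := by
  ext v
  rw [mem_act, mem_singleton]
  have hev : (p.inject s q).e v = if v = s then p.e s + q else p.e v := by
    simp [inject, Function.update_apply]
  constructor
  · rintro ⟨h1, h2, h3, -⟩
    by_contra hne
    rw [hev, if_neg hne, hI.e_eq_zero hD hst h1 h2] at h3
    exact lt_irrefl _ h3
  · rintro rfl
    refine ⟨hs, hs1, ?_, hI.stuck_zero hst v hs⟩
    rw [hev, if_pos rfl, hI.e_eq_zero hD hst hs hs1]
    simpa using hq

theorem Inv.inject (hI : p.Inv G s q) (hD : p.D = 0) (hst : p.stuck = 0) (hs : s < G.N)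
    (hs1 : s ≠ 1) (hq : 0 < q) : (p.inject s q).Inv G s q := by
  have hact := hI.act_inject hD hst hs hs1 hq
  have hev : ∀ v, (p.inject s q).e v = if v = s then p.e s + q else p.e v := fun v => by
    simp [PR.inject, Function.update_apply]
  refine { hI with
    excess := fun v hv => ?_, e_nonneg := fun v hv => ?_, e_pos := fun v hv hN => ?_
    D_le := hI.d_le s hs, le_D := fun v hv => ?_, buckets := ?_ }
  · rw [hev]
    simp only [PR.inject]
    split_ifs with h
    · rw [← h, hI.excess v hv, if_pos h]
      push_cast
      ring
    · rw [hI.excess v hv, if_neg h]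
  · rw [hev]
    split_ifs
    · exact add_nonneg (hI.e_nonneg s hs) hq.le
    · exact hI.e_nonneg v hv
  · exact absurd hN (hI.stuck_zero hst v hv).ne
  · rw [hact, mem_singleton] at hv
    rw [hv]
    exact le_rfl
  · have := hI.buckets.push (v := s) (by rw [hI.act_eq_empty hD]; exact notMem_empty _)
    rw [hI.act_eq_empty hD] at this
    rw [hact]
    exact this

/-- An injection is paid for by the term for the remaining injections. -/
theorem Inv.potential_inject (hI : p.Inv G s q) (hD : p.D = 0) (hst : p.stuck = 0) (hs : s < G.N)
    (hs1 : s ≠ 1) (hq : 0 < q) {κ K R : ℕ} (hR : p.rounds < R) :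
    (p.inject s q).potential G κ K R + K ≤ p.potential G κ K R := by
  have h1 : (p.inject s q).pairs G ≤ G.N := by
    unfold pairs
    rw [hI.act_inject hD hst hs hs1 hq, sum_singleton]
    exact card_filter_label_le _ _
  have h2 : (p.inject s q).scans G = p.scans G := rfl
  have h3 : (p.inject s q).phases G ≤ p.phases G + G.N := by
    have := hI.d_le s hs
    simp only [phases, PR.inject]
    omega
  have h4 : (p.inject s q).rounds = p.rounds + 1 := rfl
  have h5 : min K ((p.inject s q).top G) ≤ K := min_le_left _ _
  obtain ⟨j, hj⟩ : ∃ j, R = p.rounds + 1 + j := ⟨R - (p.rounds + 1), by omega⟩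
  have h6 : κ * ((p.inject s q).pairs G + G.N * p.scans G) ≤
      κ * (p.pairs G + G.N * p.scans G) + κ * G.N := by
    rw [← mul_add]
    exact Nat.mul_le_mul_left _ (by omega)
  have h7 : K * (p.scans G + min K ((p.inject s q).top G) + (K + 1) * (p.inject s q).phases G) + K ≤
      K * (p.scans G + min K (p.top G) + (K + 1) * p.phases G) + K * ((K + 1) * G.N + K + 1) := by
    rw [← mul_add, ← Nat.mul_succ]
    refine Nat.mul_le_mul_left _ ?_
    have := Nat.mul_le_mul_left (K + 1) h3
    rw [mul_add (K + 1)] at this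
    omega
  have h8 : R - p.rounds = j + 1 := by omega
  have h9 : R - (p.rounds + 1) = j := by omega
  unfold potential
  rw [h2, h4, h8, h9, add_mul j, one_mul]
  generalize j * _ = J at *
  generalize K * (p.scans G + min K ((p.inject s q).top G) + _) = a at *
  generalize K * (p.scans G + min K (p.top G) + _) = b at *
  generalize K * ((K + 1) * G.N + K + 1) = c at *
  omega

/-! #### Pushing flow -/

theorem amount_le_r (p : PR) (v a : ℕ) : p.amount v a ≤ p.r a := by
  unfold amount; split_ifs with h
  · exact le_rfl
  · exact (not_le.1 h).le

theorem amount_le_e (p : PR) (v a : ℕ) : p.amount v a ≤ p.e v := by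
  unfold amount; split_ifs with h
  · exact h
  · exact le_rfl

theorem amount_pos {v a : ℕ} (hr : 0 < p.r a) (he : 0 < p.e v) : 0 < p.amount v a := by
  unfold amount; split_ifs <;> assumption

variable (hG : G.WF)
include hG

theorem sum_out_push {v a : ℕ} (ha : a ∈ G.out v) (u : ℕ) :
    ∑ b ∈ G.out u, (G.cap b - (p.push G v a).r b) = ∑ b ∈ G.out u, (G.cap b - p.r b) +
      ((if u = v then p.amount v a else 0) - if u = G.hd a then p.amount v a else 0) := by
  rw [Net.mem_out] at ha
  have hr : ∀ b, (p.push G v a).r b = p.r b +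
      ((if b = G.rv a then p.amount v a else 0) - if b = a then p.amount v a else 0) := by
    intro b
    have := hG.rv_ne a ha.1
    simp only [push, Function.update_apply]
    by_cases h1 : b = G.rv a
    · rw [if_pos h1, if_pos h1, if_neg (by rw [h1]; exact this), h1]; ring
    · by_cases h2 : b = a
      · rw [if_neg h1, if_pos h2, if_neg h1, if_pos h2, h2]; ring
      · rw [if_neg h1, if_neg h2, if_neg h1, if_neg h2]; ring
  have h1 : (u = v) ↔ a ∈ G.out u := by
    rw [Net.mem_out, ha.2]
    simp [ha.1, eq_comm]
  have h2 : (u = G.hd a) ↔ G.rv a ∈ G.out u := by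
    rw [Net.mem_out, hG.tl_rv ha.1]
    simp [hG.rv_mem a ha.1, eq_comm]
  simp only [hr, h1, h2]
  rw [← sum_ite_eq' (G.out u) a (fun _ => p.amount v a),
    ← sum_ite_eq' (G.out u) (G.rv a) (fun _ => p.amount v a), ← sum_sub_distrib, ← sum_add_distrib]
  refine sum_congr rfl fun b _ => ?_
  ring

omit hG in
theorem e_push {v a : ℕ} (hne : G.hd a ≠ v) (u : ℕ) : (p.push G v a).e u = p.e u -
    ((if u = v then p.amount v a else 0) - if u = G.hd a then p.amount v a else 0) := by
  simp only [push, Function.update_apply]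
  by_cases h1 : u = G.hd a
  · rw [if_pos h1, if_neg (by rw [h1]; exact hne), if_pos h1, h1]; ring
  · by_cases h2 : u = v
    · rw [if_neg h1, if_pos h2, if_pos h2, if_neg h1, h2]; ring
    · rw [if_neg h1, if_neg h2, if_neg h2, if_neg h1]; ring

omit hG in
theorem hd_ne_of_label {v a : ℕ} (hd : p.d v = p.d (G.hd a) + 1) : G.hd a ≠ v := by
  rintro h
  rw [h] at hd
  omega

theorem Inv.mem_act_push (hI : p.Inv G s q) {v a : ℕ} (hv : v ∈ p.act G.N) (ha : a ∈ G.out v)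
    (hr : 0 < p.r a) (hd : p.d v = p.d (G.hd a) + 1) (u : ℕ) : u ∈ (p.push G v a).act G.N ↔
      (u = v ∧ 0 < p.e v - p.amount v a) ∨
        (u ≠ v ∧ ((u = G.hd a ∧ G.hd a ≠ 1) ∨ u ∈ p.act G.N)) := by
  rw [Net.mem_out] at ha
  have hv' := mem_act.1 hv
  have hne := hd_ne_of_label hd
  have hδ := amount_pos hr hv'.2.2.1
  rw [mem_act, e_push hne, mem_act]
  show (u < G.N ∧ u ≠ 1 ∧ _ ∧ p.d u < G.N) ↔ _
  by_cases h1 : u = v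
  · subst h1
    rw [if_pos rfl, if_neg (Ne.symm hne), sub_zero]
    exact ⟨fun h => Or.inl ⟨rfl, h.2.2.1⟩,
      fun h => ⟨hv'.1, hv'.2.1, (h.resolve_right fun h => h.1 rfl).2, hv'.2.2.2⟩⟩
  · by_cases h2 : u = G.hd a
    · subst h2
      have h3 := hG.hd_lt a ha.1
      have h4 : p.d (G.hd a) < G.N := by omega
      have h5 := hI.e_nonneg _ h3
      rw [if_neg h1, if_pos rfl]
      refine ⟨fun h => Or.inr ⟨h1, Or.inl ⟨rfl, h.2.1⟩⟩, ?_⟩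
      rintro (h | ⟨-, h | h⟩)
      · exact absurd h.1 h1
      · exact ⟨h3, h.2, by linarith, h4⟩
      · exact ⟨h3, h.2.1, by linarith, h4⟩
    · rw [if_neg h1, if_neg h2, sub_self, sub_zero]
      exact ⟨fun h => Or.inr ⟨h1, Or.inr h⟩,
        fun h => (h.resolve_left fun h => h1 h.1).2.resolve_left fun h => h2 h.1⟩

theorem Inv.push (hI : p.Inv G s q) {v a : ℕ} (hh : p.head p.D = v + 1) (ha : a ∈ G.out v)
    (hc : p.cur v = a) (hr : 0 < p.r a) (hd : p.d v = p.d (G.hd a) + 1) :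
    (p.push G v a).Inv G s q := by
  obtain ⟨hv, hdD⟩ := hI.buckets.head_mem hI.D_le (by omega)
  rw [hh, Nat.add_sub_cancel] at hv hdD
  have hv' := mem_act.1 hv
  have ha' := Net.mem_out.1 ha
  have hne := hd_ne_of_label hd
  have hδ := amount_pos hr hv'.2.2.1
  have hδr := amount_le_r p v a
  have hδe := amount_le_e p v a
  have hw := hG.hd_lt a ha'.1
  have hrv := hG.rv_ne a ha'.1
  have hmem := hI.mem_act_push hG hv ha hr hd
  have hru : ∀ b, (p.push G v a).r b = if b = G.rv a then p.r (G.rv a) + p.amount v a else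
      if b = a then p.r a - p.amount v a else p.r b := fun b => by
    simp only [PR.push, Function.update_apply]
  have hpos : ∀ b ∈ G.arcs, 0 < (p.push G v a).r b → b = G.rv a ∨ (b = a ∧ p.e v < p.r a) ∨
      (b ≠ a ∧ 0 < p.r b) := by
    intro b hb hrb
    rw [hru] at hrb
    split_ifs at hrb with h1 h2
    · exact Or.inl h1
    · refine Or.inr (Or.inl ⟨h2, ?_⟩)
      by_contra hle
      rw [amount, if_pos (not_lt.1 hle), sub_self] at hrb
      exact lt_irrefl _ hrb
    · exact Or.inr (Or.inr ⟨h2, hrb⟩)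
  have hcur : (∀ u < G.N, (p.push G v a).cur u ≤ G.M) ∧
      (∀ u < G.N, (p.push G v a).cur u ≠ 0 → G.tl ((p.push G v a).cur u) = u) ∧
      ∀ b ∈ G.arcs, (b = a → p.e v < p.r a) → (p.push G v a).cur (G.tl b) < b →
        p.cur (G.tl b) < b := by
    obtain ⟨h1, h2, h3⟩ := hI.cur_advance hG ha hc
    by_cases h : p.r a ≤ p.e v
    · simp only [PR.push, if_pos h]
      exact ⟨h1, h2, fun b hb hba => h3 b hb fun e => absurd (hba e) (not_lt.2 h)⟩
    · simp only [PR.push, if_neg h]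
      exact ⟨hI.cur_le, hI.cur_tl, fun _ _ _ h => h⟩
  refine { hI with
    excess := fun u hu => ?_, r_nonneg := fun b hb => ?_, r_add := fun b hb => ?_
    e_nonneg := fun u hu => ?_, valid := fun b hb hrb => ?_, cur_le := hcur.1, cur_tl := hcur.2.1
    cur_gap := fun b hb hlt hrb => ?_, e_pos := fun u hu hN => ?_
    le_D := fun u hu => ?_, buckets := ?_ }
  · rw [e_push hne, sum_out_push hG ha, hI.excess u hu]
    show _ = (if u = s then (p.rounds : ℝ) * q else 0) - _
    ring
  · rw [hru]
    have h1 := hI.r_nonneg _ (hG.rv_mem a ha'.1)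
    have h2 := hI.r_nonneg b hb
    split_ifs <;> linarith
  · have h1 : G.rv b = G.rv a ↔ b = a :=
      ⟨fun h => by rw [← hG.rv_rv b hb, h, hG.rv_rv a ha'.1], fun h => by rw [h]⟩
    have h2 : G.rv b = a ↔ b = G.rv a :=
      ⟨fun h => by rw [← h, hG.rv_rv b hb], fun h => by rw [h, hG.rv_rv a ha'.1]⟩
    rw [hru, hru]
    simp only [h1, h2]
    have h3 := hI.r_add b hb
    by_cases h4 : b = a
    · subst h4
      rw [if_neg (Ne.symm hrv), if_pos rfl, if_pos rfl]
      linarith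
    · by_cases h5 : b = G.rv a
      · subst h5
        rw [if_pos rfl, if_neg h4, if_pos rfl]
        rw [hG.rv_rv a ha'.1] at h3 ⊢
        linarith
      · rw [if_neg h5, if_neg h4, if_neg h4, if_neg h5, h3]
  · rw [e_push hne]
    have h1 := hI.e_nonneg u hu
    by_cases h2 : u = v
    · subst h2
      rw [if_pos rfl, if_neg (Ne.symm hne)]
      linarith
    · rw [if_neg h2]
      split_ifs <;> linarith
  · show p.d (G.tl b) ≤ p.d (G.hd b) + 1
    rcases hpos b hb hrb with rfl | ⟨rfl, -⟩ | ⟨-, h⟩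
    · rw [hG.tl_rv ha'.1]
      show _ ≤ p.d (G.tl a) + 1
      rw [ha'.2]
      omega
    · exact hI.valid b hb hr
    · exact hI.valid b hb h
  · show p.d (G.tl b) ≤ p.d (G.hd b)
    rcases hpos b hb hrb with rfl | ⟨rfl, h⟩ | ⟨hba, h⟩
    · rw [hG.tl_rv ha'.1]
      show _ ≤ p.d (G.tl a)
      rw [ha'.2]
      omega
    · exact hI.cur_gap b hb (hcur.2.2 b hb (fun _ => h) hlt) hr
    · exact hI.cur_gap b hb (hcur.2.2 b hb (fun e => absurd e hba) hlt) h
  · have h1 := hI.e_pos u hu hN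
    have hN' : p.d u = G.N := hN
    rw [e_push hne, if_neg (by rintro rfl; omega)]
    split_ifs <;> linarith
  · rw [hmem] at hu
    show p.d u ≤ p.D
    rcases hu with ⟨rfl, -⟩ | ⟨-, ⟨rfl, -⟩ | h⟩
    · exact hdD.le
    · omega
    · exact hI.le_D u h
  · -- The bucket operations: first `hd a` is inserted if it was inactive, then `v` is removed if
    -- no excess is left there.
    have hwact : ¬ (G.hd a ≠ 1 ∧ p.e (G.hd a) ≤ 0) → G.hd a ≠ 1 → G.hd a ∈ p.act G.N := by
      intro h h1
      exact mem_act.2 ⟨hw, h1, not_le.1 fun h2 => h ⟨h1, h2⟩, by omega⟩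
    have hdw : p.d (G.hd a) = p.D - 1 := by omega
    have hD : p.D - 1 ≠ p.D := by omega
    let A₂ := if G.hd a ≠ 1 ∧ p.e (G.hd a) ≤ 0 then insert (G.hd a) (p.act G.N) else p.act G.N
    have hA₂ : ∀ u, u ∈ A₂ ↔ (u = G.hd a ∧ G.hd a ≠ 1) ∨ u ∈ p.act G.N := by
      intro u
      simp only [A₂]
      split_ifs with h
      · rw [mem_insert]
        exact or_congr_left ⟨fun e => ⟨e, h.1⟩, fun e => e.1⟩
      · exact ⟨Or.inr, fun h' => h'.elim (fun e => e.1 ▸ hwact h e.2) id⟩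
    let head₂ := if G.hd a ≠ 1 ∧ p.e (G.hd a) ≤ 0 then update p.head (p.D - 1) (G.hd a + 1)
      else p.head
    let nxt₂ := if G.hd a ≠ 1 ∧ p.e (G.hd a) ≤ 0 then update p.nxt (G.hd a) (p.head (p.D - 1))
      else p.nxt
    have hB₂ : Buckets G.N A₂ p.d head₂ nxt₂ ∧ head₂ p.D = v + 1 := by
      simp only [A₂, head₂, nxt₂]
      split_ifs with h
      · have := hI.buckets.push (v := G.hd a) fun h' => absurd h.2 (not_le.2 (mem_act.1 h').2.2.1)
        rw [hdw] at this
        exact ⟨this, by rw [Function.update_of_ne hD.symm]; exact hh⟩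
      · exact ⟨hI.buckets, hh⟩
    show Buckets G.N _ p.d (if p.e v - p.amount v a ≤ 0 then update head₂ p.D (nxt₂ v) else head₂)
      nxt₂
    split_ifs with h
    · refine (hB₂.1.pop hI.D_le hB₂.2).congr ?_ fun _ _ => rfl
      ext u
      rw [hmem, mem_erase, hA₂]
      exact ⟨fun h' => h'.resolve_left fun h'' => absurd h (not_le.2 h''.2), Or.inr⟩
    · refine hB₂.1.congr ?_ fun _ _ => rfl
      ext u
      rw [hmem, hA₂]
      constructor
      · rintro (⟨rfl, -⟩ | ⟨-, h'⟩)
        · exact Or.inr hv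
        · exact h'
      · intro h'
        by_cases huv : u = v
        · exact Or.inl ⟨huv, not_le.1 h⟩
        · exact Or.inr ⟨huv, h'⟩

/-- A push is paid for by the potential: a saturating one by `scans`, since the current arc is passed;
a non-saturating one by `min K top` if there are at most `K` active nodes with the highest label, and
otherwise by `pairs`: the head of the arc forms fewer pairs than its tail, and the difference is the
number of nodes with the label of the tail, which exceeds `K`. -/
theorem Inv.potential_push (hI : p.Inv G s q) {v a κ K R : ℕ} (hh : p.head p.D = v + 1)
    (ha : a ∈ G.out v) (hc : p.cur v = a) (hr : 0 < p.r a) (hd : p.d v = p.d (G.hd a) + 1)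
    (hκ : 1 ≤ κ ∨ p.top G ≤ K) :
    (p.push G v a).potential G κ K R + K ≤ p.potential G κ K R := by
  obtain ⟨hv, hdD⟩ := hI.buckets.head_mem hI.D_le (by omega)
  rw [hh, Nat.add_sub_cancel] at hv hdD
  have hv' := mem_act.1 hv
  have hmem := hI.mem_act_push hG hv ha hr hd
  have h3 : (p.push G v a).phases G = p.phases G := rfl
  have h4 : (p.push G v a).rounds = p.rounds := rfl
  by_cases hsat : p.r a ≤ p.e v
  · have h1 : (p.push G v a).pairs G ≤ p.pairs G + G.N := by
      have hsub : (p.push G v a).act G.N ⊆ insert (G.hd a) (p.act G.N) := fun u hu => by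
        rw [hmem] at hu
        rw [mem_insert]
        rcases hu with ⟨rfl, -⟩ | ⟨-, ⟨rfl, -⟩ | h⟩
        · exact Or.inr hv
        · exact Or.inl rfl
        · exact Or.inr h
      unfold pairs
      refine (sum_le_sum_of_subset hsub).trans ?_
      show ∑ u ∈ insert (G.hd a) (p.act G.N), #{w ∈ range G.N | p.d w ≤ p.d u} ≤ _
      by_cases hw : G.hd a ∈ p.act G.N
      · rw [insert_eq_of_mem hw]
        omega
      · rw [sum_insert hw]
        have := card_filter_label_le (G := G) p.d (p.d (G.hd a))
        omega
    have h2 : (p.push G v a).scans G + 1 = p.scans G := by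
      rw [← scans_advance hG hv'.1 ha hc]
      simp only [scans, PR.push, PR.advance, if_pos hsat]
      rfl
    have h5 : (p.push G v a).top G ≤ p.top G := by
      refine card_le_card fun u hu => ?_
      rw [mem_filter, hmem] at hu
      rw [mem_filter]
      have h6 : p.d u = p.D := hu.2
      refine ⟨?_, h6⟩
      rcases hu.1 with ⟨rfl, -⟩ | ⟨-, ⟨rfl, -⟩ | h⟩
      · exact hv
      · omega
      · exact h
    have h6 : κ * ((p.push G v a).pairs G + G.N * (p.push G v a).scans G) ≤
        κ * (p.pairs G + G.N * p.scans G) := by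
      refine Nat.mul_le_mul_left _ ?_
      rw [← h2, mul_add G.N, mul_one]
      omega
    have h7 : K * ((p.push G v a).scans G + min K ((p.push G v a).top G) +
        (K + 1) * p.phases G) + K ≤ K * (p.scans G + min K (p.top G) + (K + 1) * p.phases G) := by
      rw [← Nat.mul_succ]
      refine Nat.mul_le_mul_left _ ?_
      have := min_le_min_left K h5
      omega
    unfold potential
    rw [h3, h4]
    omega
  · have hδ : p.amount v a = p.e v := if_neg hsat
    have h2 : (p.push G v a).scans G = p.scans G := by
      simp only [scans, PR.push, if_neg hsat]
    have hmem' : ∀ u, u ∈ (p.push G v a).act G.N →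
        (u = G.hd a ∨ u ∈ (p.act G.N).erase v) := by
      intro u hu
      rw [hmem, hδ, sub_self] at hu
      rw [mem_erase]
      rcases hu with ⟨-, h⟩ | ⟨h1, ⟨h2, -⟩ | h⟩
      · exact absurd h (lt_irrefl _)
      · exact Or.inl h2
      · exact Or.inr ⟨h1, h⟩
    have h1 : (p.push G v a).pairs G + #{u ∈ range G.N | p.d u = p.D} ≤ p.pairs G := by
      have hsub : (p.push G v a).act G.N ⊆ insert (G.hd a) ((p.act G.N).erase v) := fun u hu =>
        mem_insert.2 (hmem' u hu)
      have hsplit : #{u ∈ range G.N | p.d u ≤ p.d v} =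
          #{u ∈ range G.N | p.d u ≤ p.d (G.hd a)} + #{u ∈ range G.N | p.d u = p.D} := by
        rw [← card_union_of_disjoint]
        · congr 1
          ext u
          simp only [mem_filter, mem_union]
          rw [← and_or_left]
          refine and_congr_right fun _ => ?_
          omega
        · refine disjoint_filter.2 fun u _ h => ?_
          omega
      unfold pairs
      rw [← add_sum_erase _ _ hv, hsplit]
      have := sum_le_sum_of_subset (f := fun u => #{w ∈ range G.N | p.d w ≤ p.d u}) hsub
      change ∑ u ∈ (p.push G v a).act G.N, #{w ∈ range G.N | p.d w ≤ p.d u} ≤ _ at this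
      change ∑ u ∈ (p.push G v a).act G.N, #{w ∈ range G.N | p.d w ≤ p.d u} + _ ≤ _
      by_cases hw : G.hd a ∈ (p.act G.N).erase v
      · rw [insert_eq_of_mem hw] at this
        omega
      · rw [sum_insert hw] at this
        omega
    have hvt : v ∈ {u ∈ p.act G.N | p.d u = p.D} := mem_filter.2 ⟨hv, hdD⟩
    have h5 : (p.push G v a).top G + 1 ≤ p.top G := by
      unfold top
      rw [← card_erase_add_one hvt]
      refine Nat.succ_le_succ (card_le_card fun u hu => ?_)
      rw [mem_filter] at hu
      have h6 : p.d u = p.D := hu.2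
      rw [mem_erase, mem_filter]
      rcases hmem' u hu.1 with rfl | h
      · omega
      · rw [mem_erase] at h
        exact ⟨h.1, h.2, h6⟩
    have h8 : p.top G ≤ #{u ∈ range G.N | p.d u = p.D} := by
      refine card_le_card fun u hu => ?_
      rw [mem_filter] at hu ⊢
      exact ⟨mem_range.2 (mem_act.1 hu.1).1, hu.2⟩
    unfold potential
    rw [h2, h3, h4]
    by_cases hK : p.top G ≤ K
    · have h6 : κ * ((p.push G v a).pairs G + G.N * p.scans G) ≤
          κ * (p.pairs G + G.N * p.scans G) := Nat.mul_le_mul_left _ (by omega)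
      have h7 : K * (p.scans G + min K ((p.push G v a).top G) + (K + 1) * p.phases G) + K ≤
          K * (p.scans G + min K (p.top G) + (K + 1) * p.phases G) := by
        rw [← Nat.mul_succ]
        refine Nat.mul_le_mul_left _ ?_
        rw [min_eq_right hK, min_eq_right (by omega)]
        omega
      omega
    · have hκ' := hκ.resolve_right hK
      have h6 : κ * ((p.push G v a).pairs G + G.N * p.scans G) + K ≤
          κ * (p.pairs G + G.N * p.scans G) := by
        have h9 : κ * ((p.push G v a).pairs G + G.N * p.scans G + K) ≤
          κ * (p.pairs G + G.N * p.scans G) := Nat.mul_le_mul_left _ (by omega)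
        have h10 : K ≤ κ * K := Nat.le_mul_of_pos_left K hκ'
        rw [mul_add] at h9
        omega
      have h7 : K * (p.scans G + min K ((p.push G v a).top G) + (K + 1) * p.phases G) ≤
          K * (p.scans G + min K (p.top G) + (K + 1) * p.phases G) := by
        refine Nat.mul_le_mul_left _ ?_
        have := min_le_min_left K (Nat.le_of_succ_le h5)
        omega
      omega

end PR


namespace PR

open Function (update)

variable {G : Net} {s : ℕ} {q : ℝ} {p : PR}

/-! #### Integral flows with at most one unit of excess -/

/-- All quantities are integers, and there is at most one unit of excess outside the sink. -/
structure IsUnit (G : Net) (p : PR) : Prop where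
  r_int : ∀ a ∈ G.arcs, ∃ z : ℤ, p.r a = z
  e_int : ∀ v < G.N, ∃ z : ℤ, p.e v = z
  sum_le : ∑ v ∈ (range G.N).erase 1, p.e v ≤ 1

/-- There is at most one active node, since each has an excess of at least `1`. -/
theorem IsUnit.top_le (hU : p.IsUnit G) (hI : p.Inv G s q) : p.top G ≤ 1 := by
  have h1 : ((p.act G.N).card : ℝ) ≤ 1 := by
    calc ((p.act G.N).card : ℝ) = ∑ v ∈ p.act G.N, (1 : ℝ) := by simp
      _ ≤ ∑ v ∈ p.act G.N, p.e v := by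
        refine sum_le_sum fun v hv => ?_
        rw [mem_act] at hv
        obtain ⟨z, hz⟩ := hU.e_int v hv.1
        have := hv.2.2.1
        rw [hz] at this ⊢
        exact_mod_cast Int.add_one_le_of_lt (by exact_mod_cast this : (0 : ℤ) < z)
      _ ≤ ∑ v ∈ (range G.N).erase 1, p.e v := by
        refine sum_le_sum_of_subset_of_nonneg (fun v hv => ?_) fun v hv _ => ?_
        · rw [mem_act] at hv
          exact mem_erase.2 ⟨hv.2.1, mem_range.2 hv.1⟩
        · exact hI.e_nonneg v (mem_range.1 (mem_of_mem_erase hv))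
      _ ≤ 1 := hU.sum_le
  exact (card_filter_le _ _).trans (by exact_mod_cast h1)

theorem IsUnit.inject (hU : p.IsUnit G) (hI : p.Inv G s q) (hD : p.D = 0) (hst : p.stuck = 0)
    (hs : s < G.N) (hs1 : s ≠ 1) : (p.inject s 1).IsUnit G := by
  have hev : ∀ v, (p.inject s 1).e v = if v = s then p.e s + 1 else p.e v := fun v => by
    simp [PR.inject, Function.update_apply]
  refine ⟨hU.r_int, fun v hv => ?_, ?_⟩
  · rw [hev]
    split_ifs
    · obtain ⟨z, hz⟩ := hU.e_int s hs
      exact ⟨z + 1, by rw [hz]; push_cast; rfl⟩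
    · exact hU.e_int v hv
  · have h0 : ∀ v ∈ (range G.N).erase 1, (p.inject s 1).e v = if v = s then 1 else 0 := by
      intro v hv
      rw [mem_erase, mem_range] at hv
      rw [hev, hI.e_eq_zero hD hst hs hs1, hI.e_eq_zero hD hst hv.2 hv.1, zero_add]
    rw [sum_congr rfl h0, sum_ite_eq']
    split_ifs <;> norm_num

theorem IsUnit.push (hU : p.IsUnit G) (hG : G.WF) {v a : ℕ} (hv : v ∈ p.act G.N)
    (ha : a ∈ G.out v) (hr : 0 < p.r a) (hd : p.d v = p.d (G.hd a) + 1) :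
    (p.push G v a).IsUnit G := by
  rw [Net.mem_out] at ha
  have hv' := mem_act.1 hv
  have hne := hd_ne_of_label hd
  obtain ⟨δ, hδ⟩ : ∃ z : ℤ, p.amount v a = z := by
    unfold amount
    split_ifs
    · exact hU.r_int a ha.1
    · exact hU.e_int v hv'.1
  have hδ0 := amount_pos hr hv'.2.2.1
  refine ⟨fun b hb => ?_, fun u hu => ?_, ?_⟩
  · simp only [PR.push, Function.update_apply, hδ]
    split_ifs
    · obtain ⟨z, hz⟩ := hU.r_int _ (hG.rv_mem a ha.1)
      exact ⟨z + δ, by rw [hz]; push_cast; rfl⟩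
    · obtain ⟨z, hz⟩ := hU.r_int a ha.1
      exact ⟨z - δ, by rw [hz]; push_cast; rfl⟩
    · exact hU.r_int b hb
  · rw [e_push hne, hδ]
    obtain ⟨z, hz⟩ := hU.e_int u hu
    refine ⟨z - ((if u = v then δ else 0) - if u = G.hd a then δ else 0), ?_⟩
    rw [hz]
    split_ifs <;> push_cast <;> ring
  · simp only [e_push hne, sum_sub_distrib, sum_ite_eq']
    have h1 := hU.sum_le
    rw [if_pos (mem_erase.2 ⟨hv'.2.1, mem_range.2 hv'.1⟩)]
    split_ifs <;> linarith

/-! #### The result of the algorithm -/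

variable (hG : G.WF)
include hG

/-- The excess outside a set of nodes is what was injected there and what has entered. -/
theorem Inv.sum_excess (hI : p.Inv G s q) (S : Set ℕ) (hs : s < G.N) : open Classical in
    ∑ v ∈ range G.N with v ∉ S, p.e v = (if s ∉ S then p.rounds * q else 0) +
      ∑ a ∈ G.arcs with G.tl a ∈ S ∧ G.hd a ∉ S, (G.cap a - p.r a) := by
  classical
  have h1 : ∀ v ∈ {v ∈ range G.N | v ∉ S}, p.e v = (if v = s then p.rounds * q else 0) -
      ∑ a ∈ G.out v, (G.cap a - p.r a) := fun v hv =>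
    hI.excess v (mem_range.1 (mem_filter.1 hv).1)
  have h2 : {a ∈ G.arcs | G.tl a ∈ {v ∈ range G.N | v ∉ S}} = {a ∈ G.arcs | G.tl a ∉ S} := by
    refine filter_congr fun a ha => ?_
    rw [mem_filter, mem_range]
    exact and_iff_right (hG.tl_lt ha)
  rw [sum_congr rfl h1, sum_sub_distrib, sum_ite_eq',
    Net.sum_out (fun _ a => G.cap a - p.r a), h2,
    hG.sum_antisymm (fun a => G.cap a - p.r a) (fun a ha => by have := hI.r_add a ha; linarith)]
  simp only [mem_filter, mem_range, hs, true_and, sub_neg_eq_add]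

theorem Inv.sum_excess_univ (hI : p.Inv G s q) (hs : s < G.N) :
    ∑ v ∈ range G.N, p.e v = p.rounds * q := by
  have := hI.sum_excess hG ∅ hs
  simpa using this

/-- The value of a preflow is at most the capacity of any cut. -/
theorem Inv.e_sink_le (hI : p.Inv G s q) {S : Set ℕ} (hs : s < G.N) (hsS : s ∈ S) (h1 : 1 < G.N)
    (h1S : 1 ∉ S) : p.e 1 ≤ G.cutCap S := by
  classical
  have h := hI.sum_excess hG S hs
  rw [if_neg (not_not.2 hsS), zero_add] at h
  calc p.e 1 ≤ ∑ v ∈ range G.N with v ∉ S, p.e v := by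
        refine single_le_sum (fun v hv => hI.e_nonneg v (mem_range.1 (mem_filter.1 hv).1)) ?_
        exact mem_filter.2 ⟨mem_range.2 h1, h1S⟩
    _ = _ := h
    _ ≤ G.cutCap S := by
      unfold Net.cutCap
      refine sum_le_sum fun a ha => ?_
      have := hI.r_nonneg a (mem_filter.1 ha).1
      linarith

/-- As long as no excess is stuck, between two injections the sink holds all that was injected; so the
number of injections is bounded in terms of the capacity of any cut. -/
theorem Inv.rounds_mul_le (hI : p.Inv G s q) (hD : p.D = 0) (hst : p.stuck = 0) {S : Set ℕ}
    (hs : s < G.N) (hsS : s ∈ S) (h1 : 1 < G.N) (h1S : 1 ∉ S) :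
    p.rounds * q ≤ G.cutCap S := by
  rw [← hI.sum_excess_univ hG hs, sum_eq_single 1 (fun v hv hv1 =>
    hI.e_eq_zero hD hst (mem_range.1 hv) hv1) fun h => absurd (mem_range.2 h1) h]
  exact hI.e_sink_le hG hs hsS h1 h1S

omit hG in
/-- At the end, the node with the stuck excess has label `N`, so that one of the labels `1, …, N - 1`
does not occur. -/
theorem Inv.exists_gap (hI : p.Inv G s q) (hst : p.stuck ≠ 0) (h1 : 1 < G.N) :
    ∃ g ≤ G.N, ∀ v < G.N, p.d v ≠ g := by
  by_contra! h
  obtain ⟨u, hu, huN⟩ := hI.stuck_ne_zero hst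
  have hsurj : range (G.N + 1) ⊆ (range G.N).image p.d := by
    intro g hg
    rw [mem_range] at hg
    rw [mem_image]
    rcases Nat.eq_zero_or_pos g with rfl | h0
    · exact ⟨1, mem_range.2 h1, hI.d_sink⟩
    · obtain ⟨v, hv, hvg⟩ := h g (by omega)
      exact ⟨v, mem_range.2 hv, hvg⟩
  have h2 := (card_le_card hsurj).trans card_image_le
  rw [card_range, card_range] at h2
  omega

/-- The nodes above a gap in the labels form a minimum cut, whose capacity is the excess of the
sink. -/
theorem Inv.cutCap_gap (hI : p.Inv G s q) (hD : p.D = 0) (hst : p.stuck ≠ 0) (hs : s < G.N)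
    (h1 : 1 < G.N) {g : ℕ} (hg : ∀ v < G.N, p.d v ≠ g) (hgN : g ≤ G.N) :
    s ∈ {v | g < p.d v} ∧ 1 ∉ {v | g < p.d v} ∧ G.cutCap {v | g < p.d v} = p.e 1 := by
  classical
  obtain ⟨S, hS⟩ : ∃ S : Set ℕ, S = {v | g < p.d v} := ⟨_, rfl⟩
  rw [← hS]
  have h1S : 1 ∉ S := by simp [hS, hI.d_sink]
  have hout : ∑ a ∈ G.arcs with G.tl a ∈ S ∧ G.hd a ∉ S, (G.cap a - p.r a) = G.cutCap S := by
    refine sum_congr rfl fun a ha => ?_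
    rw [mem_filter] at ha
    obtain ⟨ha, ht, hh⟩ := ha
    have h2 := hg _ (hG.hd_lt a ha)
    -- The arc skips the label `g`, so it goes down by at least two and cannot be residual.
    have h3 : ¬ 0 < p.r a := by
      intro hr
      have := hI.valid a ha hr
      simp only [hS, Set.mem_ofPred_eq] at ht hh
      omega
    have := hI.r_nonneg a ha
    linarith
  have hcap : 0 ≤ G.cutCap S := sum_nonneg fun a ha => hG.cap_nonneg a (mem_filter.1 ha).1
  have hzero : ∀ v < G.N, v ∉ S → v ≠ 1 → p.e v = 0 := by
    intro v hv hvS hv1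
    by_contra hne
    have hpos := lt_of_le_of_ne (hI.e_nonneg v hv) (Ne.symm hne)
    have h2 : ¬ p.d v < G.N := fun h => by
      have : v ∈ p.act G.N := mem_act.2 ⟨hv, hv1, hpos, h⟩
      rw [hI.act_eq_empty hD] at this
      exact notMem_empty _ this
    have h3 := hg v hv
    simp only [hS, Set.mem_ofPred_eq] at hvS
    omega
  have hsum := hI.sum_excess hG S hs
  rw [hout] at hsum
  have hsS : s ∈ S := by
    -- Otherwise no excess could have entered `S`, but the stuck node is there.
    by_contra hsS
    rw [if_pos hsS] at hsum
    have h2 := hI.sum_excess_univ hG hs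
    rw [← sum_filter_add_sum_filter_not _ (fun v => v ∈ S)] at h2
    obtain ⟨u, hu, huN⟩ := hI.stuck_ne_zero hst
    have h3 : p.e u ≤ ∑ v ∈ range G.N with v ∈ S, p.e v := by
      refine single_le_sum (fun v hv => hI.e_nonneg v (mem_range.1 (mem_filter.1 hv).1)) ?_
      refine mem_filter.2 ⟨mem_range.2 hu, ?_⟩
      have := hg u hu
      simp only [hS, Set.mem_ofPred_eq]
      omega
    have h4 := hI.e_pos u hu huN
    linarith
  refine ⟨hsS, h1S, ?_⟩
  rw [if_neg (not_not.2 hsS), zero_add] at hsum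
  rw [← hsum]
  refine sum_eq_single 1 (fun v hv hv1 => ?_) fun h => absurd ?_ h
  · rw [mem_filter, mem_range] at hv
    exact hzero v hv.1 hv.2 hv1
  · exact mem_filter.2 ⟨mem_range.2 h1, h1S⟩

/-! #### The initial state -/

theorem Inv.init (he : ∀ v < G.N, p.e v = 0) (hr : ∀ a ∈ G.arcs, p.r a = G.cap a)
    (hd : ∀ v < G.N, p.d v = if v = 1 then 0 else 1) (hcur : ∀ v < G.N, p.cur v = G.fst v)
    (hhead : ∀ i ≤ G.N, p.head i = 0) (hD : p.D = 0) (hst : p.stuck = 0) (hrounds : p.rounds = 0)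
    (h1 : 1 < G.N) : p.Inv G s q where
  excess v hv := by
    rw [he v hv, hrounds, sum_eq_zero fun a ha => by rw [hr a (Net.mem_out.1 ha).1, sub_self]]
    simp
  r_nonneg a ha := by rw [hr a ha]; exact hG.cap_nonneg a ha
  r_add a ha := by rw [hr a ha, hr _ (hG.rv_mem a ha)]
  e_nonneg v hv := (he v hv).ge
  d_le v hv := by rw [hd v hv]; split_ifs <;> omega
  d_pos v hv hv1 := by rw [hd v hv, if_neg hv1]
  d_sink := by rw [hd 1 h1, if_pos rfl]
  valid a ha _ := by rw [hd _ (hG.tl_lt ha)]; split_ifs <;> omega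
  cur_le v hv := by rw [hcur v hv]; exact hG.fst_le v hv
  cur_tl v hv := by rw [hcur v hv]; exact hG.fst_tl v hv
  cur_gap a ha hlt := by
    rw [hcur _ (hG.tl_lt ha)] at hlt
    exact absurd rfl (hG.fst_gap _ (hG.tl_lt ha) a hlt (mem_Icc.1 ha).2)
  stuck_zero _ v hv := by rw [hd v hv]; split_ifs <;> omega
  stuck_ne_zero h := absurd hst h
  e_pos v hv h := by rw [hd v hv] at h; split_ifs at h <;> omega
  D_le := by omega
  le_D v hv := by
    rw [mem_act] at hv
    exact absurd (he v hv.1) hv.2.2.1.ne'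
  buckets i hi := by
    refine ⟨[], hhead i hi, List.nodup_nil, fun v => ?_⟩
    rw [mem_act]
    simp only [List.not_mem_nil, false_iff, not_and]
    rintro ⟨hv, -, h, -⟩
    exact absurd (he v hv) h.ne'

omit hG in
theorem act_eq_empty_of_e (he : ∀ v < G.N, p.e v = 0) : p.act G.N = ∅ :=
  eq_empty_of_forall_notMem fun v hv => by
    rw [mem_act] at hv
    exact absurd (he v hv.1) hv.2.2.1.ne'

theorem sum_card_out : ∑ v ∈ range G.N, #(G.out v) = G.M := by
  have := card_eq_sum_card_fiberwise (f := G.tl) (s := G.arcs) (t := range G.N)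
    fun a ha => mem_coe.2 (mem_range.2 (hG.tl_lt ha))
  rw [Net.arcs, Nat.card_Icc] at this
  exact this.symm

theorem scans_le : p.scans G ≤ G.N * (G.M + G.N) + G.M := by
  have h : p.scans G ≤ ∑ v ∈ range G.N, (G.N * (#(G.out v) + 1) + #(G.out v)) :=
    sum_le_sum fun v _ => add_le_add (Nat.mul_le_mul_right _ (Nat.sub_le _ _)) (card_filter_le _ _)
  rw [sum_add_distrib, ← mul_sum, sum_add_distrib, sum_card_out hG, sum_const, card_range,
    smul_eq_mul, mul_one] at h
  exact h

/-- Without active nodes, the terms `pairs` and `top` vanish. -/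
theorem potential_init_le (he : ∀ v < G.N, p.e v = 0) (hD : p.D = 0) (κ K R : ℕ) :
    p.potential G κ K R ≤ κ * (G.N * (G.N * (G.M + G.N) + G.M)) +
      K * (G.N * (G.M + G.N) + G.M + (K + 1) * (2 * (G.N * G.N))) +
      R * (κ * G.N + K * ((K + 1) * G.N + K + 1)) := by
  have h1 : p.pairs G = 0 := by rw [pairs, act_eq_empty_of_e he, sum_empty]
  have h2 : p.top G = 0 := by rw [top, act_eq_empty_of_e he, filter_empty, card_empty]
  have h3 : p.phases G ≤ 2 * (G.N * G.N) := by
    rw [phases, hD, zero_add]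
    refine Nat.mul_le_mul_left _ ((sum_le_sum fun v _ => Nat.sub_le _ _).trans ?_)
    rw [sum_const, card_range, smul_eq_mul]
  have h4 := scans_le (p := p) hG
  unfold potential
  rw [h1, h2, zero_add, min_eq_right (Nat.zero_le _), add_zero]
  gcongr
  exact Nat.sub_le _ _

end PR


/-! ### Cuts for power levels -/

/-- A problem in which each vertex `x` of a graph chooses one of the levels `0, …, L x`. The vertices
that are used are `vl 0, …, vl (n - 1)`, and the terminals are `0` and `1`. The levels of all vertices
are numbered consecutively: level `j` of `x` has the number `base x + j` and stands for the power
`lev (base x + j)`, and `cap (base x + j)` is the price of going up from it. The highest level of each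
vertex is marked by `top`. The edges are `(x e, y e)` with weight `w e` for `e < m`. The number `B` is
used as an infinite capacity. -/
structure Levels where
  n : ℕ
  vl : ℕ → ℕ
  base : ℕ → ℕ
  L : ℕ → ℕ
  top : ℕ → ℕ
  lev : ℕ → ℝ
  cap : ℕ → ℝ
  H : ℕ
  B : ℝ
  m : ℕ
  x : ℕ → ℕ
  y : ℕ → ℕ
  w : ℕ → ℝ

/-- The step relation of the graph that is left by the powers `P`. -/
def leftStep (m : ℕ) (x y : ℕ → ℕ) (w P : ℕ → ℝ) (a b : ℕ) : Prop :=
  ∃ e < m, ((x e = a ∧ y e = b) ∨ (x e = b ∧ y e = a)) ∧ P a + P b < w e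

namespace Levels

/-- The vertex is in the list of used vertices. -/
def Used (D : Levels) (a : ℕ) : Prop := ∃ i < D.n, D.vl i = a

/-- `a`, `b` are the ends of edge number `e`. -/
def Ends (D : Levels) (e a b : ℕ) : Prop := (D.x e = a ∧ D.y e = b) ∨ (D.x e = b ∧ D.y e = a)

/-- The data are consistent. -/
structure WF (D : Levels) : Prop where
  two_le : 2 ≤ D.n
  vl_zero : D.vl 0 = 0
  vl_one : D.vl 1 = 1
  vl_inj : ∀ i < D.n, ∀ j < D.n, D.vl i = D.vl j → i = j
  used_x : ∀ e < D.m, D.Used (D.x e)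
  used_y : ∀ e < D.m, D.Used (D.y e)
  base_eq : ∀ i < D.n, D.base (D.vl i) = ∑ j ∈ range i, (D.L (D.vl j) + 1)
  H_eq : D.H = ∑ j ∈ range D.n, (D.L (D.vl j) + 1)
  L_zero : D.L 0 = 0
  L_one : D.L 1 = 0
  top_eq : ∀ a, D.Used a → ∀ j ≤ D.L a, D.top (D.base a + j) = if j = D.L a then 1 else 0
  lev_mono : ∀ a, D.Used a → ∀ j i, j ≤ i → i ≤ D.L a → D.lev (D.base a + j) ≤ D.lev (D.base a + i)
  cap_nonneg : ∀ h < D.H, 0 ≤ D.cap h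
  sum_cap_lt : ∑ h ∈ range D.H, (if D.top h = 0 then D.cap h else 0) < D.B

/-- The choice `k` of levels separates the terminals. -/
def Feasible (D : Levels) (k : ℕ → ℕ) : Prop :=
  (∀ a, D.Used a → k a ≤ D.L a) ∧
    ¬ Relation.ReflTransGen (leftStep D.m D.x D.y D.w fun a => D.lev (D.base a + k a)) 0 1

/-- The price of the choice `k` of levels. -/
def cost (D : Levels) (k : ℕ → ℕ) : ℝ :=
  ∑ i ∈ range D.n, ∑ j ∈ range (k (D.vl i)), D.cap (D.base (D.vl i) + j)

/-- The arcs of the network at level number `h`. The network has an entry node `h` and an exit node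
`H + h` for each level number `h`; the entry nodes of a vertex are reached downwards, and the exit
nodes upwards. -/
noncomputable def nodeArcs (D : Levels) (h : ℕ) : List (ℕ × ℕ × ℝ) :=
  if D.top h = 0 then [(h, D.H + h, D.cap h), (h + 1, h, D.B), (D.H + h, D.H + (h + 1), D.B)]
  else [(h, D.H + h, D.B)]

/-- A list of arcs that represents the edges: it contains only arcs from the exit node of a level `j`
to the entry node of a level `i` at the other end that together do not remove the edge, and all such
arcs are obtained from those in the list by passing to lower `j` and `i`. -/
structure EdgeArcs (D : Levels) (l : List (ℕ × ℕ × ℝ)) (E : ℕ → Prop) : Prop where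
  sound : ∀ t ∈ l, ∃ e < D.m, ∃ a b j i, D.Ends e a b ∧ j ≤ D.L a ∧ i ≤ D.L b ∧
    t = (D.H + (D.base a + j), D.base b + i, D.B) ∧
    D.lev (D.base a + j) + D.lev (D.base b + i) < D.w e
  complete : ∀ e < D.m, E e → ∀ a b j i, D.Ends e a b → j ≤ D.L a → i ≤ D.L b →
    D.lev (D.base a + j) + D.lev (D.base b + i) < D.w e →
    ∃ j' i', j ≤ j' ∧ j' ≤ D.L a ∧ i ≤ i' ∧ i' ≤ D.L b ∧
      (D.H + (D.base a + j'), D.base b + i', D.B) ∈ l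

variable {D : Levels} (hD : D.WF)
include hD

theorem WF.used_zero : D.Used 0 := ⟨0, by have := hD.two_le; omega, hD.vl_zero⟩

theorem WF.used_one : D.Used 1 := ⟨1, by have := hD.two_le; omega, hD.vl_one⟩

theorem WF.used_ends {e a b : ℕ} (he : e < D.m) (h : D.Ends e a b) : D.Used a ∧ D.Used b := by
  rcases h with ⟨rfl, rfl⟩ | ⟨rfl, rfl⟩
  · exact ⟨hD.used_x e he, hD.used_y e he⟩
  · exact ⟨hD.used_y e he, hD.used_x e he⟩

theorem WF.base_zero : D.base 0 = 0 := by
  have := hD.base_eq 0 (by have := hD.two_le; omega)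
  rwa [hD.vl_zero, range_zero, sum_empty] at this

theorem WF.base_one : D.base 1 = 1 := by
  have := hD.base_eq 1 (by have := hD.two_le; omega)
  rwa [hD.vl_one, sum_range_one, hD.vl_zero, hD.L_zero] at this

/-- A sum over all level numbers can be taken vertex by vertex. -/
theorem WF.sum_range_H {M : Type*} [AddCommMonoid M] (f : ℕ → M) : ∑ h ∈ range D.H, f h =
    ∑ i ∈ range D.n, ∑ j ∈ range (D.L (D.vl i) + 1), f (D.base (D.vl i) + j) := by
  have key : ∀ i ≤ D.n, ∑ h ∈ range (∑ j ∈ range i, (D.L (D.vl j) + 1)), f h =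
      ∑ i ∈ range i, ∑ j ∈ range (D.L (D.vl i) + 1), f (D.base (D.vl i) + j) := by
    intro i
    induction i with
    | zero => simp
    | succ i ih =>
      intro hi
      rw [sum_range_succ (n := i), sum_range_succ (n := i), ← ih (by omega), hD.base_eq i (by omega),
        sum_range_add]
  rw [hD.H_eq, key _ le_rfl]

theorem WF.base_add_lt {i i' : ℕ} (h : i < i') (hi' : i' < D.n) :
    D.base (D.vl i) + D.L (D.vl i) + 1 ≤ D.base (D.vl i') := by
  rw [hD.base_eq i (by omega), hD.base_eq i' hi', add_assoc,
    ← sum_range_succ (fun j => D.L (D.vl j) + 1)]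
  exact sum_le_sum_of_subset (range_subset_range.2 h)

theorem WF.lt_H {a j : ℕ} (ha : D.Used a) (hj : j ≤ D.L a) : D.base a + j < D.H := by
  obtain ⟨i, hi, rfl⟩ := ha
  have : ∑ j ∈ range (i + 1), (D.L (D.vl j) + 1) ≤ D.H := by
    rw [hD.H_eq]
    exact sum_le_sum_of_subset (range_subset_range.2 hi)
  rw [sum_range_succ, ← hD.base_eq i hi] at this
  omega

theorem WF.base_add_inj {a b j i : ℕ} (ha : D.Used a) (hb : D.Used b) (hj : j ≤ D.L a)
    (hi : i ≤ D.L b) (h : D.base a + j = D.base b + i) : a = b ∧ j = i := by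
  obtain ⟨k, hk, rfl⟩ := ha
  obtain ⟨l, hl, rfl⟩ := hb
  rcases lt_trichotomy k l with hkl | rfl | hkl
  · have := hD.base_add_lt hkl hl
    omega
  · exact ⟨rfl, by omega⟩
  · have := hD.base_add_lt hkl hk
    omega

theorem WF.exists_level {h : ℕ} (hh : h < D.H) : ∃ a j, D.Used a ∧ j ≤ D.L a ∧
    h = D.base a + j := by
  by_contra! hne
  have := hD.sum_range_H (fun h' => if h' = h then 1 else 0)
  rw [sum_ite_eq', if_pos (mem_range.2 hh), sum_eq_zero fun i hi => sum_eq_zero fun j hj => ?_]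
    at this
  · exact one_ne_zero this
  · rw [mem_range] at hi hj
    exact if_neg (Ne.symm (hne _ j ⟨i, hi, rfl⟩ (by omega)))

theorem WF.cap_base_nonneg {a j : ℕ} (ha : D.Used a) (hj : j ≤ D.L a) :
    0 ≤ D.cap (D.base a + j) := hD.cap_nonneg _ (hD.lt_H ha hj)

theorem WF.B_pos : 0 < D.B := by
  refine lt_of_le_of_lt (sum_nonneg fun h hh => ?_) hD.sum_cap_lt
  split_ifs
  · exact hD.cap_nonneg h (mem_range.1 hh)
  · exact le_rfl

theorem WF.cost_lt {k : ℕ → ℕ} (hk : ∀ a, D.Used a → k a ≤ D.L a) : D.cost k < D.B := by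
  refine lt_of_le_of_lt ?_ hD.sum_cap_lt
  rw [hD.sum_range_H]
  refine sum_le_sum fun i hi => ?_
  have hu : D.Used (D.vl i) := ⟨i, mem_range.1 hi, rfl⟩
  have hki := hk _ hu
  calc ∑ j ∈ range (k (D.vl i)), D.cap (D.base (D.vl i) + j)
      = ∑ j ∈ range (k (D.vl i)), (if D.top (D.base (D.vl i) + j) = 0 then
          D.cap (D.base (D.vl i) + j) else 0) := by
        refine sum_congr rfl fun j hj => ?_
        rw [mem_range] at hj
        rw [hD.top_eq _ hu j (by omega), if_neg (by omega : ¬ j = D.L (D.vl i)), if_pos rfl]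
    _ ≤ _ := by
        refine sum_le_sum_of_subset_of_nonneg (range_subset_range.2 (by omega)) fun j hj _ => ?_
        rw [mem_range] at hj
        split_ifs
        · exact hD.cap_base_nonneg hu (by omega)
        · exact le_rfl

end Levels

/-- The capacity of the cut `S` in a network given by a list of arcs `(tail, head, capacity)`. -/
noncomputable def listCap (l : List (ℕ × ℕ × ℝ)) (S : Set ℕ) : ℝ :=
  open Classical in (l.map fun t => if t.1 ∈ S ∧ t.2.1 ∉ S then t.2.2 else 0).sum

theorem listCap_append (l l' : List (ℕ × ℕ × ℝ)) (S : Set ℕ) :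
    listCap (l ++ l') S = listCap l S + listCap l' S := by
  simp [listCap]

theorem listCap_nonneg {l : List (ℕ × ℕ × ℝ)} (hl : ∀ t ∈ l, 0 ≤ t.2.2) (S : Set ℕ) :
    0 ≤ listCap l S := by
  refine List.sum_nonneg fun c hc => ?_
  obtain ⟨t, ht, rfl⟩ := List.mem_map.1 hc
  split_ifs
  · exact hl t ht
  · exact le_rfl

theorem le_listCap {l : List (ℕ × ℕ × ℝ)} (hl : ∀ t ∈ l, 0 ≤ t.2.2) {S : Set ℕ} {t : ℕ × ℕ × ℝ}
    (ht : t ∈ l) (h₁ : t.1 ∈ S) (h₂ : t.2.1 ∉ S) : t.2.2 ≤ listCap l S := by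
  classical
  refine List.single_le_sum (fun c hc => ?_) _ (List.mem_map.2 ⟨t, ht, if_pos ⟨h₁, h₂⟩⟩)
  obtain ⟨t', ht', rfl⟩ := List.mem_map.1 hc
  split_ifs
  · exact hl t' ht'
  · exact le_rfl

theorem listCap_flatMap_range (f : ℕ → List (ℕ × ℕ × ℝ)) (n : ℕ) (S : Set ℕ) :
    listCap ((List.range n).flatMap f) S = ∑ h ∈ range n, listCap (f h) S := by
  induction n with
  | zero => simp [listCap]
  | succ n ih =>
    rw [List.range_succ, List.flatMap_append, listCap_append, ih, sum_range_succ]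
    simp

namespace Levels

/-- The network of the problem, given the arcs `l` for the edges. -/
noncomputable def arcList (D : Levels) (l : List (ℕ × ℕ × ℝ)) : List (ℕ × ℕ × ℝ) :=
  (List.range D.H).flatMap D.nodeArcs ++ l

variable {D : Levels} {l : List (ℕ × ℕ × ℝ)}

theorem mem_arcList_nodeArcs {h : ℕ} (hh : h < D.H) {t : ℕ × ℕ × ℝ} (ht : t ∈ D.nodeArcs h) :
    t ∈ D.arcList l :=
  List.mem_append_left _ (List.mem_flatMap.2 ⟨h, List.mem_range.2 hh, ht⟩)

variable (hD : D.WF) (hl : D.EdgeArcs l fun _ => True)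
include hD hl

theorem arcList_nonneg : ∀ t ∈ D.arcList l, 0 ≤ t.2.2 := by
  intro t ht
  have hB := hD.B_pos.le
  rcases List.mem_append.1 ht with ht | ht
  · obtain ⟨h, hh, ht⟩ := List.mem_flatMap.1 ht
    have := hD.cap_nonneg h (List.mem_range.1 hh)
    unfold nodeArcs at ht
    split_ifs at ht
    · simp only [List.mem_cons, List.not_mem_nil, or_false] at ht
      rcases ht with rfl | rfl | rfl <;> assumption
    · simp only [List.mem_cons, List.not_mem_nil, or_false] at ht
      subst ht
      exact hB
  · obtain ⟨e, -, a, b, j, i, -, -, -, rfl, -⟩ := hl.sound t ht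
    exact hB

/-- A set of nodes that contains the source, but not the sink, and that is left neither from an entry
node to the exit node at a highest level nor from an exit node to an entry node along an edge that is
not removed. This holds for the source side of a cut without arcs of infinite capacity. -/
structure Closed (D : Levels) (S : Set ℕ) : Prop where
  source : D.H ∈ S
  sink : 1 ∉ S
  top : ∀ a, D.Used a → D.base a + D.L a ∈ S → D.H + (D.base a + D.L a) ∈ S
  edge : ∀ e < D.m, ∀ a b j i, D.Ends e a b → j ≤ D.L a → i ≤ D.L b →
    D.lev (D.base a + j) + D.lev (D.base b + i) < D.w e →
    D.H + (D.base a + j) ∈ S → D.base b + i ∈ S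

theorem closed_of_listCap_lt {S : Set ℕ} (h₀ : D.H ∈ S) (h₁ : 1 ∉ S)
    (hS : listCap (D.arcList l) S < D.B) : D.Closed S := by
  have key : ∀ u v, (u, v, D.B) ∈ D.arcList l → u ∈ S → v ∈ S := by
    intro u v ht hu
    by_contra hv
    exact absurd (le_listCap (arcList_nonneg hD hl) ht hu hv) (not_le.2 hS)
  have hdown : ∀ a, D.Used a → ∀ j < D.L a, D.base a + (j + 1) ∈ S → D.base a + j ∈ S := by
    intro a ha j hj
    refine key _ _ (mem_arcList_nodeArcs (hD.lt_H ha hj.le) ?_)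
    rw [nodeArcs, hD.top_eq a ha j hj.le, if_neg hj.ne, if_pos rfl]
    simp [add_assoc]
  have hup : ∀ a, D.Used a → ∀ j < D.L a, D.H + (D.base a + j) ∈ S →
      D.H + (D.base a + (j + 1)) ∈ S := by
    intro a ha j hj
    refine key _ _ (mem_arcList_nodeArcs (hD.lt_H ha hj.le) ?_)
    rw [nodeArcs, hD.top_eq a ha j hj.le, if_neg hj.ne, if_pos rfl]
    simp [add_assoc]
  have hdown' : ∀ a, D.Used a → ∀ i ≤ D.L a, ∀ j ≤ i, D.base a + i ∈ S → D.base a + j ∈ S := by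
    intro a ha i
    induction i with
    | zero => intro _ j hj h; rwa [Nat.le_zero.1 hj]
    | succ i ih =>
      intro hi j hj h
      rcases hj.eq_or_lt with rfl | hlt
      · exact h
      · exact ih (by omega) j (by omega) (hdown a ha i (by omega) h)
  have hup' : ∀ a, D.Used a → ∀ i ≤ D.L a, ∀ j ≤ i, D.H + (D.base a + j) ∈ S →
      D.H + (D.base a + i) ∈ S := by
    intro a ha i
    induction i with
    | zero => intro _ j hj h; rwa [← Nat.le_zero.1 hj]
    | succ i ih =>
      intro hi j hj h
      rcases hj.eq_or_lt with rfl | hlt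
      · exact h
      · exact hup a ha i (by omega) (ih (by omega) j (by omega) h)
  refine ⟨h₀, h₁, fun a ha => ?_, fun e he a b j i hab hj hi hlt hS => ?_⟩
  · refine key _ _ (mem_arcList_nodeArcs (hD.lt_H ha le_rfl) ?_)
    rw [nodeArcs, hD.top_eq a ha _ le_rfl, if_pos rfl, if_neg one_ne_zero]
    simp
  · obtain ⟨ha, hb⟩ := hD.used_ends he hab
    obtain ⟨j', i', hjj, hj', hii, hi', ht⟩ := hl.complete e he trivial a b j i hab hj hi hlt
    exact hdown' b hb i' hi' i hii (key _ _ (List.mem_append_right _ ht) (hup' a ha j' hj' j hjj hS))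

omit hD hl in
theorem Closed.le_L {S : Set ℕ} (hS : D.Closed S) {k : ℕ → ℕ}
    (hk : ∀ a, D.Used a → ∀ j < k a, D.base a + j ∈ S ∧ D.H + (D.base a + j) ∉ S) :
    ∀ a, D.Used a → k a ≤ D.L a := by
  intro a ha
  by_contra hlt
  obtain ⟨h1, h2⟩ := hk a ha (D.L a) (not_le.1 hlt)
  exact h2 (hS.top a ha h1)

omit hl in
/-- In a closed cut, the level of a vertex is read off as the first at which the entry node is not
separated from the exit node. The levels that are read off are feasible. -/
theorem Closed.feasible {S : Set ℕ} (hS : D.Closed S) {k : ℕ → ℕ}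
    (hk : ∀ a, D.Used a → ∀ j < k a, D.base a + j ∈ S ∧ D.H + (D.base a + j) ∉ S)
    (hk' : ∀ a, D.Used a → D.base a + k a ∈ S → D.H + (D.base a + k a) ∈ S) : D.Feasible k := by
  have hle := hS.le_L hk
  refine ⟨hle, fun hr => ?_⟩
  -- All vertices that can be reached from `0` have the exit node of their level in `S`.
  have key : ∀ z, Relation.ReflTransGen
      (leftStep D.m D.x D.y D.w fun a => D.lev (D.base a + k a)) 0 z →
      z ≠ 1 ∧ D.Used z ∧ D.H + (D.base z + k z) ∈ S := by
    intro z hz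
    induction hz with
    | refl =>
      refine ⟨zero_ne_one, hD.used_zero, ?_⟩
      have := hle 0 hD.used_zero
      rw [hD.L_zero] at this
      rw [hD.base_zero, Nat.le_zero.1 this]
      exact hS.source
    | @tail b c _ hbc ih =>
      obtain ⟨e, he, hab, hlt⟩ := hbc
      have hc := (hD.used_ends he hab).2
      have hin := hS.edge e he b c _ _ hab (hle b ih.2.1) (hle c hc) hlt ih.2.2
      refine ⟨?_, hc, hk' c hc hin⟩
      rintro rfl
      have := hle 1 hc
      rw [hD.L_one] at this
      rw [hD.base_one, Nat.le_zero.1 this] at hin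
      exact hS.sink hin
  exact (key 1 hr).1 rfl

theorem Closed.cost_le {S : Set ℕ} (hS : D.Closed S) {k : ℕ → ℕ}
    (hk : ∀ a, D.Used a → ∀ j < k a, D.base a + j ∈ S ∧ D.H + (D.base a + j) ∉ S) :
    D.cost k ≤ listCap (D.arcList l) S := by
  classical
  have hle := hS.le_L hk
  have hnn : ∀ h < D.H, ∀ t ∈ D.nodeArcs h, 0 ≤ t.2.2 := fun h hh t ht =>
    arcList_nonneg hD hl t (mem_arcList_nodeArcs hh ht)
  rw [arcList, listCap_append, listCap_flatMap_range]
  refine le_add_of_le_of_nonneg ?_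
    (listCap_nonneg (fun t ht => arcList_nonneg hD hl t (List.mem_append_right _ ht)) S)
  rw [hD.sum_range_H]
  refine sum_le_sum fun i hi => ?_
  have hu : D.Used (D.vl i) := ⟨i, mem_range.1 hi, rfl⟩
  have hki := hle _ hu
  refine (sum_le_sum fun j hj => ?_).trans (sum_le_sum_of_subset_of_nonneg
    (range_subset_range.2 (by omega : k (D.vl i) ≤ D.L (D.vl i) + 1)) fun j hj _ =>
      listCap_nonneg (hnn _ (hD.lt_H hu (by rw [mem_range] at hj; omega))) S)
  rw [mem_range] at hj
  obtain ⟨h1, h2⟩ := hk _ hu j hj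
  refine le_listCap (t := (D.base (D.vl i) + j, D.H + (D.base (D.vl i) + j), _))
    (hnn _ (hD.lt_H hu (by omega))) ?_ h1 h2
  rw [nodeArcs, hD.top_eq _ hu j (by omega), if_neg (by omega : ¬ j = D.L (D.vl i)), if_pos rfl]
  simp

/-- Feasible levels yield a cut: an entry node is on the source side if the level can be reached by an
edge that is left, and an exit node if the vertex can be reached and the level is at least the chosen
one. -/
theorem Feasible.exists_cut {k : ℕ → ℕ} (hk : D.Feasible k) :
    ∃ S : Set ℕ, D.H ∈ S ∧ 1 ∉ S ∧ listCap (D.arcList l) S ≤ D.cost k := by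
  classical
  set P : ℕ → ℝ := fun a => D.lev (D.base a + k a) with hP
  set R : ℕ → Prop := Relation.ReflTransGen (leftStep D.m D.x D.y D.w P) 0 with hR
  have hRu : ∀ z, R z → D.Used z := by
    intro z hz
    cases hz with
    | refl => exact hD.used_zero
    | tail _ h =>
      obtain ⟨e, he, hab, -⟩ := h
      exact (hD.used_ends he hab).2
  -- The entry node `i` of `b` is on the source side if an edge from a reached vertex to `b` is left at
  -- the level `i` of `b`.
  let inS : ℕ → ℕ → Prop := fun b i => ∃ e < D.m, ∃ a, D.Ends e a b ∧ R a ∧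
    P a + D.lev (D.base b + i) < D.w e
  obtain ⟨S, hSdef⟩ : ∃ S : Set ℕ, S = {u |
    (∃ b i, D.Used b ∧ i ≤ D.L b ∧ u = D.base b + i ∧ inS b i) ∨
    ∃ a j, D.Used a ∧ j ≤ D.L a ∧ u = D.H + (D.base a + j) ∧ R a ∧ k a ≤ j} := ⟨_, rfl⟩
  have hin : ∀ b i, D.Used b → i ≤ D.L b → (D.base b + i ∈ S ↔ inS b i) := by
    intro b i hb hi
    rw [hSdef]
    constructor
    · rintro (⟨b', i', hb', hi', h, hs⟩ | ⟨a, j, _, _, h, _⟩)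
      · obtain ⟨rfl, rfl⟩ := hD.base_add_inj hb hb' hi hi' h
        exact hs
      · have := hD.lt_H hb hi
        omega
    · exact fun h => Or.inl ⟨b, i, hb, hi, rfl, h⟩
  have hout : ∀ a j, D.Used a → j ≤ D.L a → (D.H + (D.base a + j) ∈ S ↔ R a ∧ k a ≤ j) := by
    intro a j ha hj
    rw [hSdef]
    constructor
    · rintro (⟨b, i, hb, hi, h, _⟩ | ⟨a', j', ha', hj', h, hs⟩)
      · have := hD.lt_H hb hi
        omega
      · obtain ⟨rfl, rfl⟩ := hD.base_add_inj ha ha' hj hj' (Nat.add_left_cancel h)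
        exact hs
    · exact fun h => Or.inr ⟨a, j, ha, hj, rfl, h⟩
  have hreach : ∀ b i, D.Used b → i ≤ D.L b → k b ≤ i → inS b i → R b := by
    rintro b i hb hi hki ⟨e, he, a, hab, hRa, hlt⟩
    refine Relation.ReflTransGen.tail hRa ⟨e, he, hab, lt_of_le_of_lt ?_ hlt⟩
    have := hD.lev_mono b hb _ _ hki hi
    simp only [hP]
    linarith
  have hzero : ∀ (u v : ℕ) (c : ℝ), (u ∈ S → v ∈ S) →
      (if u ∈ S ∧ v ∉ S then c else 0) = 0 := fun u v c h => if_neg fun h' => h'.2 (h h'.1)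
  refine ⟨S, ?_, ?_, ?_⟩
  · have h0 := (hout 0 0 hD.used_zero (Nat.zero_le _)).2
      ⟨Relation.ReflTransGen.refl, by have := hk.1 0 hD.used_zero; rwa [hD.L_zero] at this⟩
    rwa [hD.base_zero] at h0
  · intro h1
    have h1' : D.base 1 + 0 ∈ S := by rwa [hD.base_one]
    have h2 := (hin 1 0 hD.used_one (Nat.zero_le _)).1 h1'
    have h3 := hk.1 1 hD.used_one
    rw [hD.L_one] at h3
    exact hk.2 (hreach 1 0 hD.used_one (Nat.zero_le _) h3 h2)
  · -- No arc for an edge leaves `S`, so only the arcs at the levels contribute.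
    have hl0 : listCap l S = 0 := by
      refine List.sum_eq_zero fun c hc => ?_
      obtain ⟨t, ht, rfl⟩ := List.mem_map.1 hc
      obtain ⟨e, he, a, b, j, i, hab, hj, hi, rfl, hlt⟩ := hl.sound t ht
      obtain ⟨ha, hb⟩ := hD.used_ends he hab
      refine hzero _ _ _ fun h => ?_
      rw [hout a j ha hj] at h
      rw [hin b i hb hi]
      refine ⟨e, he, a, hab, h.1, lt_of_le_of_lt ?_ hlt⟩
      have := hD.lev_mono a ha _ _ h.2 hj
      simp only [hP]
      linarith
    rw [arcList, listCap_append, listCap_flatMap_range, hl0, add_zero, hD.sum_range_H]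
    refine sum_le_sum fun i hi => ?_
    have hu : D.Used (D.vl i) := ⟨i, mem_range.1 hi, rfl⟩
    set a := D.vl i
    have hka := hk.1 a hu
    have hpiece : ∀ j ∈ range (D.L a + 1), listCap (D.nodeArcs (D.base a + j)) S ≤
        if j < k a then D.cap (D.base a + j) else 0 := by
      intro j hj
      have hj' : j ≤ D.L a := by rw [mem_range] at hj; omega
      have hint : ¬ j < k a → D.base a + j ∈ S → D.H + (D.base a + j) ∈ S := by
        intro hjk h
        rw [hin a j hu hj'] at h
        rw [hout a j hu hj']
        exact ⟨hreach a j hu hj' (not_lt.1 hjk) h, not_lt.1 hjk⟩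
      rw [nodeArcs, hD.top_eq a hu j hj']
      by_cases hjL : j = D.L a
      · rw [if_pos hjL, if_neg one_ne_zero, if_neg (by omega : ¬ j < k a)]
        simp only [listCap, List.map_cons, List.map_nil, List.sum_cons, List.sum_nil, add_zero]
        exact (hzero _ _ _ (hint (by omega))).le
      · rw [if_neg hjL, if_pos rfl]
        simp only [listCap, List.map_cons, List.map_nil, List.sum_cons, List.sum_nil, add_zero]
        have hdown : D.base a + j + 1 ∈ S → D.base a + j ∈ S := by
          intro h
          have h' : D.base a + (j + 1) ∈ S := by rwa [← add_assoc]
          rw [hin a (j + 1) hu (by omega)] at h'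
          rw [hin a j hu hj']
          obtain ⟨e, he, b, hb, hRb, hlt⟩ := h'
          refine ⟨e, he, b, hb, hRb, lt_of_le_of_lt ?_ hlt⟩
          have := hD.lev_mono a hu j (j + 1) (by omega) (by omega)
          linarith
        have hup : D.H + (D.base a + j) ∈ S → D.H + (D.base a + j + 1) ∈ S := by
          intro h
          rw [hout a j hu hj'] at h
          have := (hout a (j + 1) hu (by omega)).2 ⟨h.1, by omega⟩
          rwa [← add_assoc (D.base a)] at this
        rw [hzero _ _ _ hdown, hzero _ _ _ hup, add_zero, add_zero]
        by_cases hjk : j < k a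
        · rw [if_pos hjk]
          split_ifs
          · exact le_rfl
          · exact hD.cap_base_nonneg hu hj'
        · rw [if_neg hjk, hzero _ _ _ (hint hjk)]
    refine (sum_le_sum hpiece).trans ?_
    rw [← sum_filter]
    refine sum_le_sum_of_subset_of_nonneg (fun j hj => ?_) fun j hj _ => ?_
    · rw [mem_filter] at hj
      exact mem_range.2 hj.2
    · rw [mem_range] at hj
      exact hD.cap_base_nonneg hu (by omega)

/-- The levels that are read off from a minimum cut are a cheapest feasible choice. -/
theorem isLeast_cost {S : Set ℕ} {c : ℝ} (h₀ : D.H ∈ S) (h₁ : 1 ∉ S)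
    (hc : listCap (D.arcList l) S = c)
    (hmin : ∀ S' : Set ℕ, D.H ∈ S' → 1 ∉ S' → c ≤ listCap (D.arcList l) S')
    (hex : ∃ k, D.Feasible k) : D.Closed S ∧ (∀ k, D.Feasible k → c ≤ D.cost k) ∧
      (∀ k, (∀ a, D.Used a → ∀ j < k a, D.base a + j ∈ S ∧ D.H + (D.base a + j) ∉ S) →
        (∀ a, D.Used a → D.base a + k a ∈ S → D.H + (D.base a + k a) ∈ S) →
        D.Feasible k ∧ D.cost k = c) ∧ ∃ k, D.Feasible k ∧ D.cost k = c := by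
  classical
  have hle : ∀ k, D.Feasible k → c ≤ D.cost k := by
    intro k hk
    obtain ⟨S', h1, h2, h3⟩ := hk.exists_cut hD hl
    exact (hmin S' h1 h2).trans h3
  obtain ⟨k, hk⟩ := hex
  have hcl := closed_of_listCap_lt hD hl h₀ h₁
    (hc.symm ▸ (hle k hk).trans_lt (hD.cost_lt hk.1))
  have hread : ∀ k, (∀ a, D.Used a → ∀ j < k a, D.base a + j ∈ S ∧ D.H + (D.base a + j) ∉ S) →
        (∀ a, D.Used a → D.base a + k a ∈ S → D.H + (D.base a + k a) ∈ S) →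
        D.Feasible k ∧ D.cost k = c := fun k h1 h2 =>
    ⟨hcl.feasible hD h1 h2, le_antisymm (hc ▸ hcl.cost_le hD hl h1) (hle k (hcl.feasible hD h1 h2))⟩
  refine ⟨hcl, hle, hread, ?_⟩
  have hex : ∀ a, ∃ j, D.Used a → D.base a + j ∈ S → D.H + (D.base a + j) ∈ S :=
    fun a => ⟨D.L a, fun ha => hcl.top a ha⟩
  refine ⟨fun a => Nat.find (hex a), hread _ (fun a _ j hj => ?_) fun a => Nat.find_spec (hex a)⟩
  have := Nat.find_min (hex a) hj
  push Not at this
  exact this.2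

end Levels


/-! ### The memory layout of the program -/

/-! Integer arrays. Those from `nSize` to `nEndB` hold the input. The vertices that occur are listed in
`nUsed`, with length `nCount` and marks in `nMark`; `nBase`, `nLast`, `nHigh` and `nTop` describe their
levels, and those from `nHd` to `nArcs` and `nNodes` the network. Then come the labels `nDist`, the
buckets `nHead` and `nNxt` and the state of the push-relabel algorithm, and the variables of the
programs. -/

notation "nSize" => (0 : ℕ)
notation "nEndA" => (1 : ℕ)
notation "nEndB" => (2 : ℕ)
notation "nMark" => (3 : ℕ)
notation "nUsed" => (4 : ℕ)
notation "nCount" => (5 : ℕ)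
notation "nBase" => (6 : ℕ)
notation "nLast" => (7 : ℕ)
notation "nHigh" => (8 : ℕ)
notation "nTop" => (9 : ℕ)
notation "nHd" => (10 : ℕ)
notation "nRv" => (11 : ℕ)
notation "nNx" => (12 : ℕ)
notation "nFst" => (13 : ℕ)
notation "nCur" => (14 : ℕ)
notation "nArcs" => (15 : ℕ)
notation "nDist" => (16 : ℕ)
notation "nHead" => (17 : ℕ)
notation "nNxt" => (18 : ℕ)
notation "nMax" => (19 : ℕ)
notation "nStuck" => (20 : ℕ)
notation "nRounds" => (21 : ℕ)
notation "nV" => (22 : ℕ)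
notation "nA" => (23 : ℕ)
notation "nW" => (24 : ℕ)
notation "nI" => (25 : ℕ)
notation "nJ" => (26 : ℕ)
notation "nK" => (27 : ℕ)
notation "nX" => (28 : ℕ)
notation "nY" => (29 : ℕ)
notation "nPos" => (30 : ℕ)
notation "nSeen" => (31 : ℕ)
notation "nGap" => (32 : ℕ)
notation "nCopies" => (33 : ℕ)
notation "nNodes" => (34 : ℕ)

/-! Real arrays. The first two hold the input, and `rOut` receives the result. The levels and the prices
of going up from them are in `rLev` and `rCap`, the residual capacities in `rRes`, and the excesses in
`rExc`; `rInf` is the infinite capacity, `rQuant` the amount of excess that is injected at a time, and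
`rUnit` the unit power. -/

notation "rWeight" => (0 : ℕ)
notation "rEps" => (1 : ℕ)
notation "rOut" => (2 : ℕ)
notation "rLev" => (3 : ℕ)
notation "rCap" => (4 : ℕ)
notation "rRes" => (5 : ℕ)
notation "rExc" => (6 : ℕ)
notation "rDelta" => (7 : ℕ)
notation "rInf" => (8 : ℕ)
notation "rQuant" => (9 : ℕ)
notation "rBest" => (10 : ℕ)
notation "rUnit" => (11 : ℕ)

/-! ### The push-relabel program -/

namespace RealRAM

/-- The network that is stored in the memory. The original capacities `cap` are not stored: the
program only keeps the residual ones. -/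
def netOf (σ : State) (cap : ℕ → ℝ) : Net where
  N := σ.nats nNodes 0
  M := σ.nats nArcs 0
  hd := σ.nats nHd
  rv := σ.nats nRv
  nx := σ.nats nNx
  fst := σ.nats nFst
  cap := cap

/-- The state of the push-relabel algorithm that is stored in the memory. -/
def prOf (σ : State) : PR where
  e := σ.reals rExc
  r := σ.reals rRes
  d := σ.nats nDist
  cur := σ.nats nCur
  head := σ.nats nHead
  nxt := σ.nats nNxt
  D := σ.nats nMax 0
  stuck := σ.nats nStuck 0
  rounds := σ.nats nRounds 0

/-- Inject `rQuant` units of excess at the source. -/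
def injectProg : Prog := .block [
  .setReal rExc (.var nHigh) (.add (.cell rExc (.var nHigh)) (.var rQuant)),
  .setN nMax (.cell nDist (.var nHigh)),
  .setNat nNxt (.var nHigh) (.cell nHead (.var nMax)),
  .setNat nHead (.var nMax) (.add (.var nHigh) (.const 1)),
  .setN nRounds (.add (.var nRounds) (.const 1))]

/-- Increase the label of the current node, and move the node to the next bucket. -/
def relabelProg : Prog := .block [
  .setNat nHead (.var nMax) (.cell nNxt (.var nV)),
  .setNat nDist (.var nV) (.add (.cell nDist (.var nV)) (.const 1)),
  .setNat nCur (.var nV) (.cell nFst (.var nV)),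
  .setN nMax (.add (.var nMax) (.const 1)),
  .ite (.natLT (.var nMax) (.var nNodes))
    (.block [
      .setNat nNxt (.var nV) (.cell nHead (.var nMax)),
      .setNat nHead (.var nMax) (.add (.var nV) (.const 1))])
    (.setN nStuck (.const 1))]

/-- Push flow along the current arc. -/
def pushProg : Prog := .block [
  .ite (.realLE (.cell rRes (.var nA)) (.cell rExc (.var nV)))
    (.block [
      .setR rDelta (.cell rRes (.var nA)),
      .setNat nCur (.var nV) (.cell nNx (.var nA))])
    (.setR rDelta (.cell rExc (.var nV))),
  .ite (.and (.not (.and (.natLE (.var nW) (.const 1)) (.natLE (.const 1) (.var nW))))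
      (.realLE (.cell rExc (.var nW)) (.const 0)))
    (.block [
      .setNat nNxt (.var nW) (.cell nHead (.sub (.var nMax) (.const 1))),
      .setNat nHead (.sub (.var nMax) (.const 1)) (.add (.var nW) (.const 1))])
    .skip,
  .setReal rExc (.var nV) (.sub (.cell rExc (.var nV)) (.var rDelta)),
  .setReal rExc (.var nW) (.add (.cell rExc (.var nW)) (.var rDelta)),
  .setReal rRes (.var nA) (.sub (.cell rRes (.var nA)) (.var rDelta)),
  .setReal rRes (.cell nRv (.var nA)) (.add (.cell rRes (.cell nRv (.var nA))) (.var rDelta)),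
  .ite (.realLE (.cell rExc (.var nV)) (.const 0))
    (.setNat nHead (.var nMax) (.cell nNxt (.var nV)))
    .skip]

/-- One step of the push-relabel algorithm. -/
def stepProg : Prog :=
  .ite (.natLE (.var nMax) (.const 0)) injectProg
    (.ite (.natLE (.cell nHead (.var nMax)) (.const 0))
      (.setN nMax (.sub (.var nMax) (.const 1)))
      (.block [
        .setN nV (.sub (.cell nHead (.var nMax)) (.const 1)),
        .setN nA (.cell nCur (.var nV)),
        .ite (.natLE (.var nA) (.const 0)) relabelProg
          (.block [
            .setN nW (.cell nHd (.var nA)),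
            .ite (.and (.realLT (.const 0) (.cell rRes (.var nA)))
                (.and (.natLE (.cell nDist (.var nV)) (.add (.cell nDist (.var nW)) (.const 1)))
                  (.natLE (.add (.cell nDist (.var nW)) (.const 1)) (.cell nDist (.var nV)))))
              pushProg
              (.setNat nCur (.var nV) (.cell nNx (.var nA)))])]))

/-- The main loop of the push-relabel algorithm. -/
def flowProg : Prog :=
  .while (.not (.and (.natLE (.var nMax) (.const 0)) (.natLE (.const 1) (.var nStuck)))) stepProg

open Function (update)

variable {σ : State}

theorem prOf_inject (hD : σ.nats nMax 0 = 0) :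
    prOf (stepProg.exec σ) = (prOf σ).inject (σ.nats nHigh 0) (σ.reals rQuant 0) := by
  simp [stepProg, injectProg, Prog.block, Prog.exec, Test.holds, NatExpr.eval, RealExpr.eval, hD,
    prOf, PR.inject, State.nats_writeNat_ne, State.reals_writeReal_ne]

theorem prOf_lower (hD : σ.nats nMax 0 ≠ 0) (h0 : σ.nats nHead (σ.nats nMax 0) = 0) :
    prOf (stepProg.exec σ) = (prOf σ).lower := by
  simp [stepProg, Prog.exec, Test.holds, NatExpr.eval, hD, h0,
    prOf, PR.lower, State.nats_writeNat_ne]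

theorem prOf_relabel (cap : ℕ → ℝ) (hD : σ.nats nMax 0 ≠ 0) {v : ℕ}
    (h0 : σ.nats nHead (σ.nats nMax 0) = v + 1) (hc : σ.nats nCur v = 0) :
    prOf (stepProg.exec σ) = (prOf σ).relabel (netOf σ cap) v := by
  by_cases h : σ.nats nMax 0 + 1 < σ.nats nNodes 0
  · simp [stepProg, relabelProg, Prog.block, Prog.exec, Test.holds, NatExpr.eval, hD, h0, hc,
      prOf, netOf, PR.relabel, State.nats_writeNat_ne, h]
  · simp [stepProg, relabelProg, Prog.block, Prog.exec, Test.holds, NatExpr.eval, hD, h0, hc,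
      prOf, netOf, PR.relabel, State.nats_writeNat_ne, h]

theorem prOf_advance (cap : ℕ → ℝ) (hD : σ.nats nMax 0 ≠ 0) {v a : ℕ}
    (h0 : σ.nats nHead (σ.nats nMax 0) = v + 1) (hc : σ.nats nCur v = a) (ha : a ≠ 0)
    (hna : ¬ (0 < σ.reals rRes a ∧ σ.nats nDist v = σ.nats nDist (σ.nats nHd a) + 1)) :
    prOf (stepProg.exec σ) = (prOf σ).advance (netOf σ cap) v a := by
  have hna' : ¬ (0 < σ.reals rRes a ∧ σ.nats nDist v ≤ σ.nats nDist (σ.nats nHd a) + 1 ∧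
      σ.nats nDist (σ.nats nHd a) < σ.nats nDist v) := fun h => hna ⟨h.1, by omega⟩
  subst hc
  simp [stepProg, Prog.block, Prog.exec, Test.holds, NatExpr.eval, RealExpr.eval, hD, h0, ha,
    prOf, netOf, PR.advance, State.nats_writeNat_ne, hna']

theorem prOf_push (cap : ℕ → ℝ) (hD : σ.nats nMax 0 ≠ 0) {v a : ℕ}
    (h0 : σ.nats nHead (σ.nats nMax 0) = v + 1) (hc : σ.nats nCur v = a) (ha : a ≠ 0)
    (hr : 0 < σ.reals rRes a) (hd : σ.nats nDist v = σ.nats nDist (σ.nats nHd a) + 1)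
    (hrv : σ.nats nRv a ≠ a) :
    prOf (stepProg.exec σ) = (prOf σ).push (netOf σ cap) v a := by
  have hne : σ.nats nHd a ≠ v := by
    rintro h
    rw [h] at hd
    omega
  have h1 : σ.nats nDist v ≤ σ.nats nDist (σ.nats nHd a) + 1 := hd.le
  have h2 : σ.nats nDist (σ.nats nHd a) < σ.nats nDist v := by omega
  have hstep : stepProg.exec σ = pushProg.exec
      (((σ.writeNat nV 0 v).writeNat nA 0 a).writeNat nW 0 (σ.nats nHd a)) := by
    subst hc
    simp [stepProg, Prog.block, Prog.exec, Test.holds, NatExpr.eval, RealExpr.eval, hD, h0, ha,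
      State.nats_writeNat_ne, hr, h1, h2]
  rw [hstep]
  set w := σ.nats nHd a with hw
  have hw1 : (w ≤ 1 ∧ 1 ≤ w) ↔ w = 1 := by omega
  clear_value w
  by_cases hsat : σ.reals rRes a ≤ σ.reals rExc v <;>
  by_cases hact : w ≠ 1 ∧ σ.reals rExc w ≤ 0 <;>
  by_cases hpop : σ.reals rExc v ≤ σ.reals rRes a <;>
  simp [pushProg, Prog.block, Prog.exec, Test.holds, NatExpr.eval, RealExpr.eval,
    prOf, netOf, PR.push, PR.amount, State.nats_writeNat_ne, State.reals_writeReal_ne, hsat, hact,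
    hpop, hw.symm, hne, hne.symm, hrv, hw1, -not_and, -not_le]

/-- The loop invariant of the push-relabel program. -/
structure FlowInv (G : Net) (s : ℕ) (q : ℝ) (κ : ℕ) (σ : State) : Prop where
  inv : (prOf σ).Inv G s q
  unit : 1 ≤ κ ∨ (prOf σ).IsUnit G

/-- Each step preserves the invariant and lowers the potential by at least `K`. The finite cut `S` bounds
the number of injections. -/
theorem FlowInv.step {σ : State} {cap : ℕ → ℝ} {κ K R : ℕ} (hG : (netOf σ cap).WF)
    (hs : σ.nats nHigh 0 < σ.nats nNodes 0) (hs1 : σ.nats nHigh 0 ≠ 1)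
    (h1 : 1 < σ.nats nNodes 0) (hq : 0 < σ.reals rQuant 0)
    (hκ : 1 ≤ κ ∨ σ.reals rQuant 0 = 1) (hK : 0 < K) {S : Set ℕ} (hsS : σ.nats nHigh 0 ∈ S)
    (h1S : 1 ∉ S) (hR : (netOf σ cap).cutCap S < R * σ.reals rQuant 0)
    (hI : FlowInv (netOf σ cap) (σ.nats nHigh 0) (σ.reals rQuant 0) κ σ)
    (hb : ¬ (σ.nats nMax 0 = 0 ∧ σ.nats nStuck 0 ≠ 0)) :
    FlowInv (netOf σ cap) (σ.nats nHigh 0) (σ.reals rQuant 0) κ (stepProg.exec σ) ∧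
      (prOf (stepProg.exec σ)).potential (netOf σ cap) κ K R + K ≤
        (prOf σ).potential (netOf σ cap) κ K R := by
  set G := netOf σ cap with hGdef
  set s := σ.nats nHigh 0
  set q := σ.reals rQuant 0
  have hunit : ∀ p : PR, p.r = (prOf σ).r → p.e = (prOf σ).e → 1 ≤ κ ∨ p.IsUnit G := by
    intro p hr he
    refine hI.unit.imp_right fun h => ⟨?_, ?_, ?_⟩
    · rw [hr]; exact h.r_int
    · rw [he]; exact h.e_int
    · rw [he]; exact h.sum_le
  by_cases hD : σ.nats nMax 0 = 0
  · have hst : σ.nats nStuck 0 = 0 := by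
      by_contra h
      exact hb ⟨hD, h⟩
    have hrounds : (prOf σ).rounds < R := by
      have := (hI.inv.rounds_mul_le hG hD hst hs hsS h1 h1S).trans_lt hR
      exact_mod_cast lt_of_mul_lt_mul_right this hq.le
    refine ⟨⟨?_, ?_⟩, ?_⟩
    · rw [prOf_inject hD]
      exact hI.inv.inject hD hst hs hs1 hq
    · rw [prOf_inject hD]
      rcases hκ with h | h
      · exact Or.inl h
      · refine hI.unit.imp_right fun hU => ?_
        have h' : σ.reals rQuant 0 = 1 := h
        rw [h']
        exact hU.inject hI.inv hD hst hs hs1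
    · rw [prOf_inject hD]
      exact hI.inv.potential_inject hD hst hs hs1 hq hrounds
  by_cases h0 : σ.nats nHead (σ.nats nMax 0) = 0
  · rw [prOf_lower hD h0]
    refine ⟨⟨?_, ?_⟩, PR.potential_lower hD κ K R⟩
    · rw [prOf_lower hD h0]
      exact hI.inv.lower h0
    · exact hunit _ (by rw [prOf_lower hD h0]; rfl) (by rw [prOf_lower hD h0]; rfl)
  obtain ⟨v, hv⟩ : ∃ v, σ.nats nHead (σ.nats nMax 0) = v + 1 :=
    ⟨_, (Nat.succ_pred_eq_of_ne_zero h0).symm⟩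
  obtain ⟨hvA, -⟩ := hI.inv.buckets.head_mem hI.inv.D_le h0
  have hvA' : v ∈ (prOf σ).act G.N := by
    have : (prOf σ).head (prOf σ).D - 1 = v := by
      show σ.nats nHead (σ.nats nMax 0) - 1 = v
      omega
    rwa [this] at hvA
  have hvN := (PR.mem_act.1 hvA').1
  by_cases hc : σ.nats nCur v = 0
  · have h := prOf_relabel cap hD hv hc
    rw [h]
    refine ⟨⟨?_, ?_⟩, hI.inv.potential_relabel hv κ K R⟩
    · rw [h]; exact hI.inv.relabel hG hv hc
    · exact hunit _ (by rw [h]; rfl) (by rw [h]; rfl)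
  have ha : σ.nats nCur v ∈ G.out v := Net.mem_out.2
    ⟨mem_Icc.2 ⟨Nat.one_le_iff_ne_zero.2 hc, hI.inv.cur_le v hvN⟩, hI.inv.cur_tl v hvN hc⟩
  have ha' := (Net.mem_out.1 ha).1
  by_cases hadm : 0 < σ.reals rRes (σ.nats nCur v) ∧
      σ.nats nDist v = σ.nats nDist (σ.nats nHd (σ.nats nCur v)) + 1
  · have h := prOf_push cap hD hv rfl hc hadm.1 hadm.2 (hG.rv_ne _ ha')
    rw [h]
    refine ⟨⟨?_, ?_⟩, hI.inv.potential_push hG hv ha rfl hadm.1 hadm.2 ?_⟩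
    · rw [h]; exact hI.inv.push hG hv ha rfl hadm.1 hadm.2
    · rw [h]
      exact hI.unit.imp_right fun hU => hU.push hG hvA' ha hadm.1 hadm.2
    · exact hI.unit.imp_right fun hU => (hU.top_le hI.inv).trans hK
  · have h := prOf_advance cap hD hv rfl hc hadm
    rw [h]
    refine ⟨⟨?_, ?_⟩, PR.potential_advance hG hvN ha rfl κ K R⟩
    · rw [h]; exact hI.inv.advance hG ha rfl hadm
    · exact hunit _ (by rw [h]; rfl) (by rw [h]; rfl)

/-- The push-relabel program computes a preflow without active nodes. -/
theorem ends_flowProg {σ : State} {cap : ℕ → ℝ} {κ K R B : ℕ} (hG : (netOf σ cap).WF)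
    (hs : σ.nats nHigh 0 < σ.nats nNodes 0) (hs1 : σ.nats nHigh 0 ≠ 1)
    (h1 : 1 < σ.nats nNodes 0) (hq : 0 < σ.reals rQuant 0)
    (hκ : 1 ≤ κ ∨ σ.reals rQuant 0 = 1) (hK : 0 < K) {S : Set ℕ} (hsS : σ.nats nHigh 0 ∈ S)
    (h1S : 1 ∉ S) (hR : (netOf σ cap).cutCap S < R * σ.reals rQuant 0)
    (hI : FlowInv (netOf σ cap) (σ.nats nHigh 0) (σ.reals rQuant 0) κ σ)
    (hB : 200 * ((prOf σ).potential (netOf σ cap) κ K R + K) ≤ K * B) :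
    Ends flowProg σ B fun σ' =>
      (prOf σ').Inv (netOf σ cap) (σ.nats nHigh 0) (σ.reals rQuant 0) ∧
        σ'.nats nMax 0 = 0 ∧ σ'.nats nStuck 0 ≠ 0 := by
  refine (Ends.while_loop K hK
    (fun σ' => FlowInv (netOf σ cap) (σ.nats nHigh 0) (σ.reals rQuant 0) κ σ')
    (fun σ' => 200 * (prOf σ').potential (netOf σ cap) κ K R) hI ?_ ?_).mono le_rfl ?_ (B := B)
  · intro σ₁ hf hI₁ hb
    have hnet : netOf σ cap = netOf σ₁ cap := by
      simp only [netOf]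
      rw [hf.nats nNodes (by decide), hf.nats nArcs (by decide), hf.nats nHd (by decide),
        hf.nats nRv (by decide), hf.nats nNx (by decide), hf.nats nFst (by decide)]
    have hH := hf.nats nHigh (by decide)
    have hN := hf.nats nNodes (by decide)
    have hQ := hf.reals rQuant (by decide)
    rw [hnet] at hG hR hI₁ ⊢
    rw [← hH] at hs hs1 hsS hI₁ ⊢
    rw [← hN] at hs h1
    rw [← hQ] at hq hκ hR hI₁ ⊢
    have hstep := FlowInv.step hG hs hs1 h1 hq hκ hK hsS h1S hR hI₁ (by
      simp only [Test.holds, NatExpr.eval] at hb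
      omega)
    refine ⟨stepProg.maxCost, Ends.of_exec (by decide) le_rfl ⟨hstep.1, ?_⟩⟩
    have hcost : stepProg.maxCost + Test.cost (.not (.and (.natLE (.var nMax) (.const 0))
        (.natLE (.const 1) (.var nStuck)))) + 1 ≤ 200 := by decide
    have h2 := Nat.mul_le_mul_left K hcost
    have h3 := hstep.2
    omega
  · have hcost : Test.cost (.not (.and (.natLE (.var nMax) (.const 0))
        (.natLE (.const 1) (.var nStuck)))) + 1 ≤ 200 := by decide
    have h2 := Nat.mul_le_mul_left K hcost
    omega
  · rintro σ' - ⟨hI', hb⟩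
    simp only [Test.holds, NatExpr.eval, not_not] at hb
    exact ⟨hI'.inv, by omega, by omega⟩

end RealRAM


/-! ### Building the network -/

namespace Net

open Function (update)

/-- Add an arc `M + 1` from `u` to `v` of capacity `c`, and its reverse `M + 2` of capacity `0`. -/
noncomputable def addArc (G : Net) (u v : ℕ) (c : ℝ) : Net where
  N := G.N
  M := G.M + 2
  hd := update (update G.hd (G.M + 1) v) (G.M + 2) u
  rv := update (update G.rv (G.M + 1) (G.M + 2)) (G.M + 2) (G.M + 1)
  nx := update (update G.nx (G.M + 1) (G.fst u)) (G.M + 2) (update G.fst u (G.M + 1) v)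
  fst := update (update G.fst u (G.M + 1)) v (G.M + 2)
  cap := update (update G.cap (G.M + 1) c) (G.M + 2) 0

variable {G : Net} {u v : ℕ} {c : ℝ}

theorem arcs_addArc : (G.addArc u v c).arcs = insert (G.M + 2) (insert (G.M + 1) G.arcs) := by
  ext a
  simp only [arcs, addArc, mem_Icc, mem_insert]
  omega

theorem addArc_of_le {a : ℕ} (ha : a ≤ G.M) : (G.addArc u v c).hd a = G.hd a ∧
    (G.addArc u v c).rv a = G.rv a ∧ (G.addArc u v c).nx a = G.nx a ∧
    (G.addArc u v c).cap a = G.cap a := by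
  have h1 : a ≠ G.M + 1 := by omega
  have h2 : a ≠ G.M + 2 := by omega
  simp [addArc, h1, h2]

theorem tl_addArc_first : (G.addArc u v c).tl (G.M + 1) = u := by
  simp [tl, addArc]

theorem tl_addArc_second : (G.addArc u v c).tl (G.M + 2) = v := by
  simp [tl, addArc]

theorem hd_addArc_first : (G.addArc u v c).hd (G.M + 1) = v := by
  simp [addArc]

theorem hd_addArc_second : (G.addArc u v c).hd (G.M + 2) = u := by
  simp [addArc]

theorem WF.tl_addArc (hG : G.WF) {a : ℕ} (ha : a ∈ G.arcs) :
    (G.addArc u v c).tl a = G.tl a := by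
  rw [tl, (addArc_of_le (mem_Icc.1 ha).2).2.1, (addArc_of_le (mem_Icc.1 (hG.rv_mem a ha)).2).1, tl]

theorem fst_addArc (w : ℕ) : (G.addArc u v c).fst w =
    if w = v then G.M + 2 else if w = u then G.M + 1 else G.fst w := by
  simp [addArc, Function.update_apply]

theorem WF.addArc (hG : G.WF) (hu : u < G.N) (hv : v < G.N) (hc : 0 ≤ c) :
    (G.addArc u v c).WF := by
  have hmem : ∀ a ∈ (G.addArc u v c).arcs, a = G.M + 2 ∨ a = G.M + 1 ∨ a ∈ G.arcs := by
    intro a ha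
    rwa [arcs_addArc, mem_insert, mem_insert] at ha
  have hmem' : ∀ a ∈ G.arcs, a ∈ (G.addArc u v c).arcs := by
    intro a ha
    rw [arcs_addArc]
    exact mem_insert_of_mem (mem_insert_of_mem ha)
  have hle : ∀ {a}, a ∈ G.arcs → a ≤ G.M := fun ha => (mem_Icc.1 ha).2
  have hrv1 : (G.addArc u v c).rv (G.M + 1) = G.M + 2 := by simp [Net.addArc]
  have hrv2 : (G.addArc u v c).rv (G.M + 2) = G.M + 1 := by simp [Net.addArc]
  have hnx1 : (G.addArc u v c).nx (G.M + 1) = G.fst u := by simp [Net.addArc]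
  have hnx2 : (G.addArc u v c).nx (G.M + 2) = if v = u then G.M + 1 else G.fst v := by
    simp [Net.addArc, Function.update_apply]
  have hgap : ∀ w < G.N, ∀ b, G.fst w < b → b ≤ G.M → (G.addArc u v c).tl b ≠ w := by
    intro w hw b h1 h2
    rw [hG.tl_addArc (mem_Icc.2 ⟨by omega, h2⟩)]
    exact hG.fst_gap w hw b h1 h2
  have hftl : ∀ w < G.N, G.fst w ≠ 0 → (G.addArc u v c).tl (G.fst w) = w := by
    intro w hw h
    rw [hG.tl_addArc (mem_Icc.2 ⟨by omega, hG.fst_le w hw⟩)]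
    exact hG.fst_tl w hw h
  refine ⟨?_, ?_, ?_, ?_, ?_, ?_, ?_, ?_, ?_, ?_, ?_⟩
  · intro a ha
    rcases hmem a ha with rfl | rfl | ha
    · rw [hrv2, arcs_addArc]; simp
    · rw [hrv1, arcs_addArc]; simp
    · rw [(addArc_of_le (hle ha)).2.1]
      exact hmem' _ (hG.rv_mem a ha)
  · intro a ha
    rcases hmem a ha with rfl | rfl | ha
    · rw [hrv2, hrv1]
    · rw [hrv1, hrv2]
    · rw [(addArc_of_le (hle ha)).2.1, (addArc_of_le (hle (hG.rv_mem a ha))).2.1, hG.rv_rv a ha]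
  · intro a ha
    rcases hmem a ha with rfl | rfl | ha
    · rw [hrv2]; omega
    · rw [hrv1]; omega
    · rw [(addArc_of_le (hle ha)).2.1]
      exact hG.rv_ne a ha
  · intro a ha
    rcases hmem a ha with rfl | rfl | ha
    · rw [hd_addArc_second]; exact hu
    · rw [hd_addArc_first]; exact hv
    · rw [(addArc_of_le (hle ha)).1]
      exact hG.hd_lt a ha
  · intro a ha
    rcases hmem a ha with rfl | rfl | ha
    · simp [Net.addArc]
    · simpa [Net.addArc] using hc
    · rw [(addArc_of_le (hle ha)).2.2.2]
      exact hG.cap_nonneg a ha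
  · intro a ha
    rcases hmem a ha with rfl | rfl | ha
    · rw [hnx2]
      have := hG.fst_le v hv
      split_ifs <;> omega
    · rw [hnx1]
      have := hG.fst_le u hu
      omega
    · rw [(addArc_of_le (hle ha)).2.2.1]
      exact hG.nx_lt a ha
  · intro a ha hne
    rcases hmem a ha with rfl | rfl | ha
    · rw [hnx2] at hne ⊢
      rw [tl_addArc_second]
      split_ifs at hne ⊢ with h
      · rw [tl_addArc_first, h]
      · exact hftl v hv hne
    · rw [hnx1] at hne ⊢
      rw [tl_addArc_first]
      exact hftl u hu hne
    · rw [(addArc_of_le (hle ha)).2.2.1] at hne ⊢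
      have h1 := hG.nx_lt a ha
      have h2 := hle ha
      rw [hG.tl_addArc ha, hG.tl_addArc (mem_Icc.2 ⟨by omega, by omega⟩)]
      exact hG.nx_tl a ha hne
  · intro a ha b h1 h2
    rcases hmem a ha with rfl | rfl | ha
    · rw [hnx2] at h1
      rw [tl_addArc_second]
      split_ifs at h1 with h
      · omega
      · rcases (Nat.lt_succ_iff.1 h2).eq_or_lt with rfl | h3
        · rw [tl_addArc_first]
          exact fun e => h e.symm
        · exact hgap v hv b h1 (by omega)
    · rw [hnx1] at h1
      rw [tl_addArc_first]
      exact hgap u hu b h1 (by omega)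
    · rw [(addArc_of_le (hle ha)).2.2.1] at h1
      have h3 := hle ha
      rw [hG.tl_addArc ha, hG.tl_addArc (mem_Icc.2 ⟨by omega, by omega⟩)]
      exact hG.nx_gap a ha b h1 h2
  · intro w hw
    have := hG.fst_le w hw
    rw [fst_addArc]
    show _ ≤ G.M + 2
    split_ifs <;> omega
  · intro w hw hne
    rw [fst_addArc] at hne ⊢
    split_ifs at hne ⊢ with h1 h2
    · rw [tl_addArc_second, h1]
    · rw [tl_addArc_first, h2]
    · exact hftl w hw hne
  · intro w hw b h1 h2
    have hb : b = G.M + 2 ∨ b = G.M + 1 ∨ b ≤ G.M := by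
      have : b ≤ G.M + 2 := h2
      omega
    rw [fst_addArc] at h1
    have := hG.fst_le w hw
    split_ifs at h1 with h3 h4
    · omega
    · rcases hb with rfl | rfl | hb
      · rw [tl_addArc_second]; exact fun e => h3 e.symm
      · omega
      · omega
    · rcases hb with rfl | rfl | hb
      · rw [tl_addArc_second]; exact fun e => h3 e.symm
      · rw [tl_addArc_first]; exact fun e => h4 e.symm
      · exact hgap w hw b h1 hb

theorem WF.sum_addArc (hG : G.WF) (F : ℕ → ℕ → ℝ → ℝ) :
    ∑ a ∈ (G.addArc u v c).arcs, F ((G.addArc u v c).tl a) ((G.addArc u v c).hd a)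
      ((G.addArc u v c).cap a) =
    ∑ a ∈ G.arcs, F (G.tl a) (G.hd a) (G.cap a) + (F u v c + F v u 0) := by
  have h1 : G.M + 1 ∉ G.arcs := by simp [arcs]
  have h2 : G.M + 2 ∉ insert (G.M + 1) G.arcs := by simp [arcs]
  have h3 : (G.addArc u v c).cap (G.M + 1) = c := by simp [Net.addArc]
  have h4 : (G.addArc u v c).cap (G.M + 2) = 0 := by simp [Net.addArc]
  rw [arcs_addArc, sum_insert h2, sum_insert h1, tl_addArc_first, tl_addArc_second, hd_addArc_first,
    hd_addArc_second, h3, h4, sum_congr rfl (g := fun a => F (G.tl a) (G.hd a) (G.cap a)) ?_]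
  · ring
  · intro a ha
    have := addArc_of_le (u := u) (v := v) (c := c) (mem_Icc.1 ha).2
    rw [hG.tl_addArc ha, this.1, this.2.2.2]

end Net

namespace RealRAM

open Function (update)

/-- The memory holds a network with the arcs in the list `l`. -/
structure Rep (σ : State) (l : List (ℕ × ℕ × ℝ)) : Prop where
  wf : (netOf σ (σ.reals rRes)).WF
  sum_arcs : ∀ F : ℕ → ℕ → ℝ → ℝ, ∑ a ∈ (netOf σ (σ.reals rRes)).arcs,
    F ((netOf σ (σ.reals rRes)).tl a) (σ.nats nHd a) (σ.reals rRes a) =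
      (l.map fun t => F t.1 t.2.1 t.2.2 + F t.2.1 t.1 0).sum
  cur_eq : ∀ v < σ.nats nNodes 0, σ.nats nCur v = σ.nats nFst v
  card : σ.nats nArcs 0 = 2 * l.length

theorem Rep.cutCap {σ : State} {l : List (ℕ × ℕ × ℝ)} (h : Rep σ l) (S : Set ℕ) :
    (netOf σ (σ.reals rRes)).cutCap S = listCap l S := by
  classical
  have := h.sum_arcs fun u v c => if u ∈ S ∧ v ∉ S then c else 0
  simp only [ite_self, add_zero] at this
  unfold Net.cutCap listCap
  rw [sum_filter]
  exact this

theorem Rep.congr {σ σ' : State} {l : List (ℕ × ℕ × ℝ)} (h : Rep σ l)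
    (hn : ∀ a ∈ [nNodes, nArcs, nHd, nRv, nNx, nFst, nCur], σ'.nats a = σ.nats a)
    (hr : σ'.reals rRes = σ.reals rRes) : Rep σ' l := by
  have hnet : netOf σ' (σ'.reals rRes) = netOf σ (σ.reals rRes) := by
    simp only [netOf]
    rw [hn nNodes (by decide), hn nArcs (by decide), hn nHd (by decide), hn nRv (by decide),
      hn nNx (by decide), hn nFst (by decide), hr]
  refine ⟨hnet ▸ h.wf, ?_, ?_, ?_⟩
  · rw [hnet, hn nHd (by decide), hr]
    exact h.sum_arcs
  · rw [hn nNodes (by decide), hn nCur (by decide), hn nFst (by decide)]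
    exact h.cur_eq
  · rw [hn nArcs (by decide)]
    exact h.card

/-- Add an arc from `u` to `v` of capacity `c`, and its reverse. -/
def addArcProg (u v : NatExpr) (c : RealExpr) : Prog := .block [
  .setN nV u,
  .setN nW v,
  .setR rDelta c,
  .setNat nHd (.add (.var nArcs) (.const 1)) (.var nW),
  .setNat nHd (.add (.var nArcs) (.const 2)) (.var nV),
  .setNat nRv (.add (.var nArcs) (.const 1)) (.add (.var nArcs) (.const 2)),
  .setNat nRv (.add (.var nArcs) (.const 2)) (.add (.var nArcs) (.const 1)),
  .setReal rRes (.add (.var nArcs) (.const 1)) (.var rDelta),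
  .setReal rRes (.add (.var nArcs) (.const 2)) (.const 0),
  .setNat nNx (.add (.var nArcs) (.const 1)) (.cell nFst (.var nV)),
  .setNat nFst (.var nV) (.add (.var nArcs) (.const 1)),
  .setNat nCur (.var nV) (.add (.var nArcs) (.const 1)),
  .setNat nNx (.add (.var nArcs) (.const 2)) (.cell nFst (.var nW)),
  .setNat nFst (.var nW) (.add (.var nArcs) (.const 2)),
  .setNat nCur (.var nW) (.add (.var nArcs) (.const 2)),
  .setN nArcs (.add (.var nArcs) (.const 2))]

theorem Rep.addArc {σ : State} {l : List (ℕ × ℕ × ℝ)} (h : Rep σ l) {u v : NatExpr}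
    {c : RealExpr} {a b : ℕ} {r : ℝ} (hu : u.eval σ = a) (hv : v.eval (σ.writeNat nV 0 a) = b)
    (hc : c.eval ((σ.writeNat nV 0 a).writeNat nW 0 b) = r) (ha : a < σ.nats nNodes 0)
    (hb : b < σ.nats nNodes 0) (hr : 0 ≤ r) :
    Rep ((addArcProg u v c).exec σ) (l ++ [(a, b, r)]) := by
  set σ' := (addArcProg u v c).exec σ with hσ'
  have hnet : netOf σ' (σ'.reals rRes) = (netOf σ (σ.reals rRes)).addArc a b r := by
    simp [hσ', addArcProg, Prog.block, Prog.exec, NatExpr.eval, RealExpr.eval, hu, hv, hc, netOf,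
      Net.addArc, State.nats_writeNat_ne, State.reals_writeReal_ne]
  have hcur : σ'.nats nCur = update (update (σ.nats nCur) a (σ.nats nArcs 0 + 1)) b
      (σ.nats nArcs 0 + 2) := by
    simp [hσ', addArcProg, Prog.block, Prog.exec, NatExpr.eval, hu, hv, hc,
      State.nats_writeNat_ne]
  have hfst : σ'.nats nFst = update (update (σ.nats nFst) a (σ.nats nArcs 0 + 1)) b
      (σ.nats nArcs 0 + 2) := congrArg Net.fst hnet
  have hM : σ'.nats nArcs 0 = σ.nats nArcs 0 + 2 := congrArg Net.M hnet
  have hN : σ'.nats nNodes 0 = σ.nats nNodes 0 := congrArg Net.N hnet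
  refine ⟨hnet ▸ h.wf.addArc ha hb hr, ?_, ?_, ?_⟩
  · intro F
    have h1 := h.wf.sum_addArc (u := a) (v := b) (c := r) F
    rw [← hnet] at h1
    rw [List.map_append, List.sum_append, ← h.sum_arcs F]
    simp only [List.map_cons, List.map_nil, List.sum_cons, List.sum_nil, add_zero]
    exact h1
  · intro w hw
    rw [hN] at hw
    have := h.cur_eq w hw
    rw [hcur, hfst]
    simp only [Function.update_apply]
    rw [this]
  · rw [hM, h.card, List.length_append]
    simp only [List.length_cons, List.length_nil]
    omega

theorem Frame.exec {P : Prog} (hP : P.loopFree) (σ : State) : Frame P σ (P.exec σ) := by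
  obtain ⟨T, hrun, -⟩ := Prog.exists_run_exec hP σ
  exact hrun.frame

end RealRAM


namespace RealRAM

open Function (update)

theorem Ends.block_cons {P Q : Prog} {l : List Prog} {σ : State} {B B' : ℕ} {R : State → Prop}
    (h : Ends P σ B fun σ' => Ends (.block (Q :: l)) σ' B' R) :
    Ends (.block (P :: Q :: l)) σ (B + B') R := Ends.seq h

/-- The level data that are stored in the memory. -/
def levelsOf (σ : State) : Levels where
  n := σ.nats nCount 0
  vl := σ.nats nUsed
  base := σ.nats nBase
  L := σ.nats nLast
  top := σ.nats nTop
  lev := σ.reals rLev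
  cap := σ.reals rCap
  H := σ.nats nHigh 0
  B := σ.reals rInf 0
  m := σ.nats nSize 1
  x := σ.nats nEndA
  y := σ.nats nEndB
  w := σ.reals rWeight

theorem Frame.levelsOf_eq {P : Prog} {σ σ' : State} (h : Frame P σ σ')
    (hn : ∀ a ∈ [nCount, nUsed, nBase, nLast, nTop, nHigh, nSize, nEndA, nEndB],
      a ∉ P.natWrites)
    (hr : ∀ a ∈ [rLev, rCap, rInf, rWeight], a ∉ P.realWrites) : levelsOf σ' = levelsOf σ := by
  simp only [levelsOf]
  rw [h.nats nCount (hn _ (by decide)), h.nats nUsed (hn _ (by decide)),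
    h.nats nBase (hn _ (by decide)), h.nats nLast (hn _ (by decide)),
    h.nats nTop (hn _ (by decide)), h.nats nHigh (hn _ (by decide)),
    h.nats nSize (hn _ (by decide)), h.nats nEndA (hn _ (by decide)),
    h.nats nEndB (hn _ (by decide)), h.reals rLev (hr _ (by decide)),
    h.reals rCap (hr _ (by decide)), h.reals rInf (hr _ (by decide)),
    h.reals rWeight (hr _ (by decide))]

/-! #### Clearing the memory -/

/-- Clear the lists of arcs, the excesses and the buckets, and set all labels to `1`. -/
def clearProg : Prog := .forLoop nI (.add (.var nNodes) (.const 1)) (.block [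
  .setNat nFst (.var nI) (.const 0),
  .setNat nCur (.var nI) (.const 0),
  .setReal rExc (.var nI) (.const 0),
  .setNat nDist (.var nI) (.const 1),
  .setNat nHead (.var nI) (.const 0)])

theorem ends_clearProg (σ : State) {N : ℕ} (hN : σ.nats nNodes 0 = N) :
    Ends clearProg σ (60 * (N + 2)) fun σ' => ∀ v ≤ N, σ'.nats nFst v = 0 ∧ σ'.nats nCur v = 0 ∧
      σ'.reals rExc v = 0 ∧ σ'.nats nDist v = 1 ∧ σ'.nats nHead v = 0 := by
  refine (Ends.forLoop_exec (n := N + 1) (B := 60 * (N + 2)) (fun k σ' => ∀ v < k,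
    σ'.nats nFst v = 0 ∧ σ'.nats nCur v = 0 ∧ σ'.reals rExc v = 0 ∧ σ'.nats nDist v = 1 ∧
      σ'.nats nHead v = 0) (by decide) (by decide) ?_ ?_ ?_ ?_).mono le_rfl
      fun σ' _ h v hv => h v (by omega)
  · intro σ' hf
    simp only [NatExpr.eval]
    rw [hf.nats nNodes (by decide), hN]
  · intro v hv
    omega
  · intro k σ₁ _ _ hk hI v hv
    have := hI v
    by_cases hvk : v = k
    · simp [Prog.block, Prog.exec, NatExpr.eval, RealExpr.eval, State.nats_writeNat_ne, hk, hvk]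
    · have := this (by omega)
      simp [Prog.block, Prog.exec, NatExpr.eval, RealExpr.eval, State.nats_writeNat_ne, hk, hvk, this]
  · have : Prog.maxCost (.block [
      .setNat nFst (.var nI) (.const 0),
      .setNat nCur (.var nI) (.const 0),
      .setReal rExc (.var nI) (.const 0),
      .setNat nDist (.var nI) (.const 1),
      .setNat nHead (.var nI) (.const 0)]) +
        (NatExpr.cost (.add (.var nNodes) (.const 1)) + 12) ≤ 60 := by decide
    rw [mul_comm]
    exact Nat.mul_le_mul_right _ this

/-! #### The arcs at the levels -/

/-- Add the arcs at the current level number. -/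
def nodeBody : Prog :=
  .ite (.natLE (.cell nTop (.var nI)) (.const 0))
    (.block [
      addArcProg (.var nI) (.add (.var nHigh) (.var nI)) (.cell rCap (.var nI)),
      addArcProg (.add (.var nI) (.const 1)) (.var nI) (.var rInf),
      addArcProg (.add (.var nHigh) (.var nI)) (.add (.var nHigh) (.add (.var nI) (.const 1)))
        (.var rInf)])
    (addArcProg (.var nI) (.add (.var nHigh) (.var nI)) (.var rInf))

/-- Add the arcs at all level numbers. -/
def nodeProg : Prog := .forLoop nI (.var nHigh) nodeBody

theorem Rep.nodeBody {σ : State} {l : List (ℕ × ℕ × ℝ)} (h : Rep σ l) (hD : (levelsOf σ).WF)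
    (hN : σ.nats nNodes 0 = σ.nats nHigh 0 + σ.nats nHigh 0) {k : ℕ} (hk : σ.nats nI 0 = k)
    (hkH : k < σ.nats nHigh 0) :
    Rep (nodeBody.exec σ) (l ++ (levelsOf σ).nodeArcs k) := by
  have hB : 0 ≤ σ.reals rInf 0 := hD.B_pos.le
  have hcap : 0 ≤ σ.reals rCap k := hD.cap_nonneg k hkH
  by_cases htop : σ.nats nTop k = 0
  · have hk1 : k + 1 < σ.nats nHigh 0 := by
      obtain ⟨a, j, ha, hj, hka⟩ := hD.exists_level (h := k) hkH
      have h1 := hD.top_eq a ha j hj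
      rw [← hka] at h1
      have h2 : j ≠ (levelsOf σ).L a := by
        rintro h3
        rw [if_pos h3] at h1
        exact one_ne_zero (h1.symm.trans htop)
      have h3 := hD.lt_H ha (show j + 1 ≤ (levelsOf σ).L a by omega)
      show k + 1 < (levelsOf σ).H
      omega
    have hexec : RealRAM.nodeBody.exec σ =
        (addArcProg (.add (.var nHigh) (.var nI)) (.add (.var nHigh) (.add (.var nI) (.const 1)))
          (.var rInf)).exec ((addArcProg (.add (.var nI) (.const 1)) (.var nI) (.var rInf)).exec
            ((addArcProg (.var nI) (.add (.var nHigh) (.var nI)) (.cell rCap (.var nI))).exec σ)) := by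
      simp [RealRAM.nodeBody, Prog.exec, Prog.block, Test.holds, NatExpr.eval, hk, htop]
    have hlist : (levelsOf σ).nodeArcs k = [(k, σ.nats nHigh 0 + k, σ.reals rCap k),
        (k + 1, k, σ.reals rInf 0),
        (σ.nats nHigh 0 + k, σ.nats nHigh 0 + (k + 1), σ.reals rInf 0)] := if_pos htop
    rw [hexec, hlist]
    set σ₁ := (addArcProg (.var nI) (.add (.var nHigh) (.var nI)) (.cell rCap (.var nI))).exec σ
      with hσ₁
    have hf₁ : Frame _ σ σ₁ := Frame.exec (by decide) σ
    set σ₂ := (addArcProg (.add (.var nI) (.const 1)) (.var nI) (.var rInf)).exec σ₁ with hσ₂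
    have hf₂ : Frame _ σ₁ σ₂ := Frame.exec (by decide) σ₁
    have hI₁ : σ₁.nats nI 0 = k := by rw [hf₁.nats nI (by decide), hk]
    have hI₂ : σ₂.nats nI 0 = k := by rw [hf₂.nats nI (by decide), hI₁]
    have hN₁ : σ₁.nats nNodes 0 = σ.nats nNodes 0 := by rw [hf₁.nats nNodes (by decide)]
    have hN₂ : σ₂.nats nNodes 0 = σ.nats nNodes 0 := by rw [hf₂.nats nNodes (by decide), hN₁]
    have hR₁ : σ₁.reals rInf 0 = σ.reals rInf 0 := by rw [hf₁.reals rInf (by decide)]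
    have hR₂ : σ₂.reals rInf 0 = σ.reals rInf 0 := by rw [hf₂.reals rInf (by decide), hR₁]
    have hH₂ : σ₂.nats nHigh 0 = σ.nats nHigh 0 := by
      rw [hf₂.nats nHigh (by decide), hf₁.nats nHigh (by decide)]
    have h₁ : Rep σ₁ (l ++ [(k, σ.nats nHigh 0 + k, σ.reals rCap k)]) :=
      h.addArc (by simp [NatExpr.eval, hk]) (by simp [NatExpr.eval, hk, State.nats_writeNat_ne])
        (by simp [RealExpr.eval, NatExpr.eval, hk, State.nats_writeNat_ne]) (by omega) (by omega)
        hcap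
    have h₂ : Rep σ₂ ((l ++ [(k, σ.nats nHigh 0 + k, σ.reals rCap k)]) ++
        [(k + 1, k, σ.reals rInf 0)]) :=
      h₁.addArc (by simp [NatExpr.eval, hI₁])
        (by simp [NatExpr.eval, hI₁, State.nats_writeNat_ne])
        (by simp [RealExpr.eval, NatExpr.eval, hR₁]) (by omega) (by omega) hB
    have h₃ := h₂.addArc (u := .add (.var nHigh) (.var nI))
      (v := .add (.var nHigh) (.add (.var nI) (.const 1))) (c := .var rInf)
      (a := σ.nats nHigh 0 + k) (b := σ.nats nHigh 0 + (k + 1)) (r := σ.reals rInf 0)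
      (by simp [NatExpr.eval, hI₂, hH₂])
      (by simp [NatExpr.eval, hI₂, hH₂, State.nats_writeNat_ne])
      (by simp [RealExpr.eval, NatExpr.eval, hR₂]) (by omega) (by omega) hB
    simpa using h₃
  · have hexec : RealRAM.nodeBody.exec σ =
        (addArcProg (.var nI) (.add (.var nHigh) (.var nI)) (.var rInf)).exec σ := by
      simp [RealRAM.nodeBody, Prog.exec, Test.holds, NatExpr.eval, hk, htop]
    have hlist : (levelsOf σ).nodeArcs k = [(k, σ.nats nHigh 0 + k, σ.reals rInf 0)] :=
      if_neg htop
    rw [hexec, hlist]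
    exact h.addArc (by simp [NatExpr.eval, hk])
      (by simp [NatExpr.eval, hk, State.nats_writeNat_ne])
      (by simp [RealExpr.eval, NatExpr.eval]) (by omega) (by omega) hB

theorem ends_nodeProg {σ : State} (h : Rep σ []) (hD : (levelsOf σ).WF)
    (hN : σ.nats nNodes 0 = σ.nats nHigh 0 + σ.nats nHigh 0) :
    Ends nodeProg σ (500 * (σ.nats nHigh 0 + 1)) fun σ' =>
      Rep σ' ((List.range (σ.nats nHigh 0)).flatMap (levelsOf σ).nodeArcs) := by
  refine Ends.forLoop_exec (n := σ.nats nHigh 0)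
    (fun k σ' => Rep σ' ((List.range k).flatMap (levelsOf σ).nodeArcs)) (by decide) (by decide)
    ?_ ?_ ?_ ?_
  · intro σ' hf
    simp only [NatExpr.eval]
    rw [hf.nats nHigh (by decide)]
  · exact h.congr (fun a ha => State.nats_writeNat_ne _ _ _ (by revert a; decide)) rfl
  · intro k σ₁ hk hf hkI hI
    have hlev : levelsOf σ₁ = levelsOf σ := hf.levelsOf_eq (by decide) (by decide)
    have hH := hf.nats nHigh (by decide)
    have := hI.nodeBody (hlev ▸ hD) (by rw [hf.nats nNodes (by decide), hH]; exact hN) hkI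
      (by rw [hH]; exact hk)
    rw [List.range_succ, List.flatMap_append, List.flatMap_singleton]
    rw [hlev] at this
    exact this.congr (fun a ha => State.nats_writeNat_ne _ _ _ (by revert a; decide)) rfl
  · rw [mul_comm]
    refine Nat.mul_le_mul_right _ ?_
    decide

/-! #### The arcs for the edges -/

/-- Find the first level of the vertex `nY` that, together with the level `nJ` of `nX`, removes the
current edge. -/
def searchProg : Prog :=
  .while (.and (.natLE (.var nPos) (.cell nLast (.var nY)))
      (.realLT (.add (.cell rLev (.add (.cell nBase (.var nX)) (.var nJ)))
        (.cell rLev (.add (.cell nBase (.var nY)) (.var nPos)))) (.cell rWeight (.var nI))))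
    (.setN nPos (.add (.var nPos) (.const 1)))

/-- Add the arcs for the current edge that belong to the level `nJ` of `nX`. -/
def levelBody : Prog := .block [
  .setN nPos (.const 0),
  searchProg,
  .ite (.natLE (.var nPos) (.const 0)) .skip (.block [
    addArcProg (.add (.var nHigh) (.add (.cell nBase (.var nX)) (.var nJ)))
      (.add (.cell nBase (.var nY)) (.sub (.var nPos) (.const 1))) (.var rInf),
    addArcProg (.add (.var nHigh) (.add (.cell nBase (.var nY)) (.sub (.var nPos) (.const 1))))
      (.add (.cell nBase (.var nX)) (.var nJ)) (.var rInf)])]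

/-- Add the arcs for the current edge, after its ends have been ordered by their numbers of levels. -/
def edgeBody : Prog := .block [
  .setN nX (.cell nEndA (.var nI)),
  .setN nY (.cell nEndB (.var nI)),
  .ite (.natLE (.cell nLast (.var nX)) (.cell nLast (.var nY))) .skip
    (.block [.setN nX (.cell nEndB (.var nI)), .setN nY (.cell nEndA (.var nI))]),
  .forLoop nJ (.add (.cell nLast (.var nX)) (.const 1)) levelBody]

/-- Add the arcs for all edges. -/
def edgeProg : Prog := .forLoop nI (.cell nSize (.const 1)) edgeBody

/-- Levels `j` of `a` and `i` of `b` together do not remove the edge number `e`. -/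
def Left (D : Levels) (e a b j i : ℕ) : Prop :=
  D.lev (D.base a + j) + D.lev (D.base b + i) < D.w e

theorem ends_searchProg {σ : State} {e a b j : ℕ} (he : σ.nats nI 0 = e) (ha : σ.nats nX 0 = a)
    (hb : σ.nats nY 0 = b) (hj : σ.nats nJ 0 = j) (h0 : σ.nats nPos 0 = 0) :
    Ends searchProg σ (60 * (σ.nats nLast b + 2)) fun σ' => ∃ p ≤ σ.nats nLast b + 1,
      σ'.nats nPos 0 = p ∧ (∀ i < p, Left (levelsOf σ) e a b j i) ∧
        (p ≤ σ.nats nLast b → ¬ Left (levelsOf σ) e a b j p) := by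
  refine (Ends.while_loop 1 one_pos
    (fun σ' => σ'.nats nPos 0 ≤ σ.nats nLast b + 1 ∧
      ∀ i < σ'.nats nPos 0, Left (levelsOf σ) e a b j i)
    (fun σ' => 60 * (σ.nats nLast b + 1 - σ'.nats nPos 0)) ?_ ?_ ?_).mono le_rfl ?_
    (B := 60 * (σ.nats nLast b + 2))
  · rw [h0]
    exact ⟨Nat.zero_le _, fun i hi => absurd hi (Nat.not_lt_zero i)⟩
  · intro σ₁ hf ⟨hle, hI⟩ ht
    simp only [Test.holds, NatExpr.eval, RealExpr.eval] at ht
    rw [hf.nats nLast (by decide), hf.nats nY (by decide), hf.nats nX (by decide),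
      hf.nats nJ (by decide), hf.nats nI (by decide), hf.nats nBase (by decide),
      hf.reals rLev (by decide), hf.reals rWeight (by decide), ha, hb, hj, he, not_le] at ht
    refine ⟨_, Ends.of_exec (by decide) le_rfl ⟨⟨?_, ?_⟩, ?_⟩⟩
    · simp [Prog.exec, NatExpr.eval]
      omega
    · intro i hi
      simp only [Prog.exec, NatExpr.eval, State.nats_writeNat_same, Function.update_self] at hi
      rcases (Nat.lt_succ_iff.1 hi).eq_or_lt with rfl | h
      · exact ht.2
      · exact hI i h
    · simp [Prog.exec, Prog.maxCost, Test.cost, RealExpr.cost, NatExpr.eval, NatExpr.cost]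
      omega
  · simp [Test.cost, RealExpr.cost, NatExpr.cost, h0]
    omega
  · rintro σ' hf ⟨⟨hle, hI⟩, ht⟩
    refine ⟨_, hle, rfl, hI, fun hp hlt => ht ?_⟩
    simp only [Test.holds, NatExpr.eval, RealExpr.eval]
    rw [hf.nats nLast (by decide), hf.nats nY (by decide), hf.nats nX (by decide),
      hf.nats nJ (by decide), hf.nats nI (by decide), hf.nats nBase (by decide),
      hf.reals rLev (by decide), hf.reals rWeight (by decide), ha, hb, hj, he, not_le]
    exact ⟨hp, hlt⟩

/-- The arcs in `l` represent the edge number `e` with the ends `a`, `b`, as far as the levels of `a`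
below `n` are concerned. -/
structure LevelArcs (D : Levels) (e a b n : ℕ) (l : List (ℕ × ℕ × ℝ)) : Prop where
  sound : ∀ t ∈ l, ∃ j i, j ≤ D.L a ∧ i ≤ D.L b ∧ Left D e a b j i ∧
    (t = (D.H + (D.base a + j), D.base b + i, D.B) ∨
      t = (D.H + (D.base b + i), D.base a + j, D.B))
  complete : ∀ j < n, ∀ i ≤ D.L b, Left D e a b j i → ∃ i', i ≤ i' ∧ i' ≤ D.L b ∧
    (D.H + (D.base a + j), D.base b + i', D.B) ∈ l ∧
    (D.H + (D.base b + i'), D.base a + j, D.B) ∈ l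
  length_le : l.length ≤ 2 * n

theorem ends_levelBody {σ : State} {l l' : List (ℕ × ℕ × ℝ)} {e a b j : ℕ} (h : Rep σ (l ++ l'))
    (hD : (levelsOf σ).WF) (hN : σ.nats nNodes 0 = σ.nats nHigh 0 + σ.nats nHigh 0)
    (he : σ.nats nI 0 = e) (ha : σ.nats nX 0 = a) (hb : σ.nats nY 0 = b) (hj : σ.nats nJ 0 = j)
    (hua : (levelsOf σ).Used a) (hub : (levelsOf σ).Used b) (hja : j ≤ σ.nats nLast a)
    (hl : LevelArcs (levelsOf σ) e a b j l') :
    Ends levelBody σ (400 * (σ.nats nLast b + 2)) fun σ' => ∃ l'', Rep σ' (l ++ l'') ∧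
      LevelArcs (levelsOf σ) e a b (j + 1) l'' := by
  set D := levelsOf σ with hDdef
  refine Ends.mono (B := 3 + (60 * (σ.nats nLast b + 2) + 300)) ?_ (by omega) fun _ _ h => h
  refine Ends.block_cons (Ends.of_exec (by decide) (by decide) ?_)
  set σ₁ := Prog.exec (.setN nPos (.const 0)) σ with hσ₁
  have hf₁ : Frame _ σ σ₁ := Frame.exec (by decide) σ
  have hlev₁ : levelsOf σ₁ = D := hf₁.levelsOf_eq (by decide) (by decide)
  have hL₁ := hf₁.nats nLast (by decide)
  rw [← hL₁]
  refine Ends.block_cons ((ends_searchProg (σ := σ₁) (e := e) (a := a) (b := b) (j := j) ?_ ?_ ?_ ?_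
    ?_).mono le_rfl ?_)
  · rw [hf₁.nats nI (by decide), he]
  · rw [hf₁.nats nX (by decide), ha]
  · rw [hf₁.nats nY (by decide), hb]
  · rw [hf₁.nats nJ (by decide), hj]
  · simp [hσ₁, Prog.exec, NatExpr.eval]
  rintro σ₂ hf₂ ⟨p, hp, hpos, hlt, hnlt⟩
  rw [hlev₁] at hlt hnlt
  rw [hL₁] at hp hnlt
  have hall : ∀ i ≤ D.L b, Left D e a b j i → i < p := by
    intro i hi hil
    by_contra hpi
    refine hnlt ((not_lt.1 hpi).trans hi) (lt_of_le_of_lt ?_ hil)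
    have := hD.lev_mono b hub p i (not_lt.1 hpi) hi
    linarith
  have hlev₂ : levelsOf σ₂ = D := (hf₂.levelsOf_eq (by decide) (by decide)).trans hlev₁
  have hr₂ : Rep σ₂ (l ++ l') := by
    refine h.congr (fun x hx => ?_) ?_
    · exact (hf₂.nats x (by revert x; decide)).trans (hf₁.nats x (by revert x; decide))
    · exact (hf₂.reals _ (by decide)).trans (hf₁.reals _ (by decide))
  refine Ends.of_exec (by decide) (by decide) ?_
  by_cases hp0 : p = 0
  · have hexec : Prog.exec (.block [.ite (.natLE (.var nPos) (.const 0)) .skip (.block [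
      addArcProg (.add (.var nHigh) (.add (.cell nBase (.var nX)) (.var nJ)))
        (.add (.cell nBase (.var nY)) (.sub (.var nPos) (.const 1))) (.var rInf),
      addArcProg (.add (.var nHigh) (.add (.cell nBase (.var nY)) (.sub (.var nPos) (.const 1))))
        (.add (.cell nBase (.var nX)) (.var nJ)) (.var rInf)])]) σ₂ = σ₂ := by
      simp [Prog.exec, Prog.block, Test.holds, NatExpr.eval, hpos, hp0]
    rw [hexec]
    refine ⟨l', hr₂, hl.sound, fun j' hj' i hi hil => ?_, by have := hl.length_le; omega⟩
    rcases (Nat.lt_succ_iff.1 hj').eq_or_lt with rfl | h'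
    · have := hall i hi hil
      omega
    · exact hl.complete j' h' i hi hil
  · set P₁ := addArcProg (.add (.var nHigh) (.add (.cell nBase (.var nX)) (.var nJ)))
        (.add (.cell nBase (.var nY)) (.sub (.var nPos) (.const 1))) (.var rInf) with hP₁
    set P₂ := addArcProg
        (.add (.var nHigh) (.add (.cell nBase (.var nY)) (.sub (.var nPos) (.const 1))))
        (.add (.cell nBase (.var nX)) (.var nJ)) (.var rInf) with hP₂
    have hexec : Prog.exec (.block [.ite (.natLE (.var nPos) (.const 0)) .skip
        (.block [P₁, P₂])]) σ₂ = P₂.exec (P₁.exec σ₂) := by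
      simp [Prog.exec, Prog.block, Test.holds, NatExpr.eval, hpos, hp0]
    rw [hexec]
    set σ₃ := P₁.exec σ₂ with hσ₃
    have hf₃ : Frame _ σ₂ σ₃ := Frame.exec (by rw [hP₁]; decide) σ₂
    have hlev₃ : levelsOf σ₃ = D :=
      (hf₃.levelsOf_eq (by rw [hP₁]; decide) (by rw [hP₁]; decide)).trans hlev₂
    have hX₂ : σ₂.nats nX 0 = a := by
      rw [hf₂.nats nX (by decide), hf₁.nats nX (by decide), ha]
    have hY₂ : σ₂.nats nY 0 = b := by
      rw [hf₂.nats nY (by decide), hf₁.nats nY (by decide), hb]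
    have hJ₂ : σ₂.nats nJ 0 = j := by
      rw [hf₂.nats nJ (by decide), hf₁.nats nJ (by decide), hj]
    have hX₃ : σ₃.nats nX 0 = a := by rw [hf₃.nats nX (by rw [hP₁]; decide), hX₂]
    have hY₃ : σ₃.nats nY 0 = b := by rw [hf₃.nats nY (by rw [hP₁]; decide), hY₂]
    have hJ₃ : σ₃.nats nJ 0 = j := by rw [hf₃.nats nJ (by rw [hP₁]; decide), hJ₂]
    have hpos₃ : σ₃.nats nPos 0 = p := by rw [hf₃.nats nPos (by rw [hP₁]; decide), hpos]
    have hN₂ : σ₂.nats nNodes 0 = D.H + D.H := by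
      rw [hf₂.nats nNodes (by decide), hf₁.nats nNodes (by decide)]
      exact hN
    have hN₃ : σ₃.nats nNodes 0 = D.H + D.H := by
      rw [hf₃.nats nNodes (by rw [hP₁]; decide), hN₂]
    have hH₂ : σ₂.nats nHigh 0 = D.H := congrArg Levels.H hlev₂
    have hH₃ : σ₃.nats nHigh 0 = D.H := congrArg Levels.H hlev₃
    have hB₂ : σ₂.reals rInf 0 = D.B := congrArg Levels.B hlev₂
    have hB₃ : σ₃.reals rInf 0 = D.B := congrArg Levels.B hlev₃
    have hb₂ : σ₂.nats nBase = D.base := congrArg Levels.base hlev₂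
    have hb₃ : σ₃.nats nBase = D.base := congrArg Levels.base hlev₃
    have hpb : p - 1 ≤ D.L b := by
      have : p ≤ D.L b + 1 := hp
      omega
    have hlta := hD.lt_H hua (show j ≤ D.L a from hja)
    have hltb := hD.lt_H hub hpb
    have hr₃ : Rep σ₃ ((l ++ l') ++ [(D.H + (D.base a + j), D.base b + (p - 1), D.B)]) :=
      hr₂.addArc (by simp [NatExpr.eval, hX₂, hJ₂, hH₂, hb₂])
        (by simp [NatExpr.eval, hY₂, hpos, hb₂, State.nats_writeNat_ne])
        (by simp [RealExpr.eval, NatExpr.eval, hB₂]) (by omega) (by omega) hD.B_pos.le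
    have hr₄ : Rep (P₂.exec σ₃) (((l ++ l') ++ [(D.H + (D.base a + j), D.base b + (p - 1), D.B)]) ++
        [(D.H + (D.base b + (p - 1)), D.base a + j, D.B)]) :=
      hr₃.addArc (by simp [NatExpr.eval, hY₃, hpos₃, hH₃, hb₃])
        (by simp [NatExpr.eval, hX₃, hJ₃, hb₃, State.nats_writeNat_ne])
        (by simp [RealExpr.eval, NatExpr.eval, hB₃]) (by omega) (by omega) hD.B_pos.le
    refine ⟨l' ++ [(D.H + (D.base a + j), D.base b + (p - 1), D.B),
      (D.H + (D.base b + (p - 1)), D.base a + j, D.B)], by simpa using hr₄, ?_, ?_, ?_⟩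
    · intro t ht
      rcases List.mem_append.1 ht with ht | ht
      · exact hl.sound t ht
      · simp only [List.mem_cons, List.not_mem_nil, or_false] at ht
        exact ⟨j, p - 1, hja, hpb, hlt _ (by omega), ht⟩
    · intro j' hj' i hi hil
      rcases (Nat.lt_succ_iff.1 hj').eq_or_lt with rfl | h'
      · have := hall i hi hil
        exact ⟨p - 1, by omega, hpb, by simp, by simp⟩
      · obtain ⟨i', h1, h2, h3, h4⟩ := hl.complete j' h' i hi hil
        exact ⟨i', h1, h2, List.mem_append_left _ h3, List.mem_append_left _ h4⟩
    · have := hl.length_le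
      simp only [List.length_append, List.length_cons, List.length_nil]
      omega

end RealRAM


namespace RealRAM

open Function (update)

theorem LevelArcs.edgeArcs {D : Levels} {e a b : ℕ} {l l' : List (ℕ × ℕ × ℝ)}
    (hl : D.EdgeArcs l fun e' => e' < e) (hl' : LevelArcs D e a b (D.L a + 1) l') (he : e < D.m)
    (hab : D.Ends e a b) : D.EdgeArcs (l ++ l') fun e' => e' < e + 1 := by
  have hba : D.Ends e b a := hab.symm
  refine ⟨fun t ht => ?_, fun e' he' hlt a' b' j i hab' hj hi hw => ?_⟩
  · rcases List.mem_append.1 ht with ht | ht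
    · exact hl.sound t ht
    · obtain ⟨j, i, hj, hi, hleft, rfl | rfl⟩ := hl'.sound t ht
      · exact ⟨e, he, a, b, j, i, hab, hj, hi, rfl, hleft⟩
      · refine ⟨e, he, b, a, i, j, hba, hi, hj, rfl, ?_⟩
        rw [add_comm]
        exact hleft
  · rcases (Nat.lt_succ_iff.1 hlt).eq_or_lt with rfl | hlt
    · have hcase : (a' = a ∧ b' = b) ∨ (a' = b ∧ b' = a) := by
        rcases hab with ⟨rfl, rfl⟩ | ⟨rfl, rfl⟩ <;> rcases hab' with ⟨rfl, rfl⟩ | ⟨rfl, rfl⟩ <;> simp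
      rcases hcase with ⟨rfl, rfl⟩ | ⟨rfl, rfl⟩
      · obtain ⟨i', h1, h2, h3, -⟩ := hl'.complete j (by omega) i hi hw
        exact ⟨j, i', le_rfl, hj, h1, h2, List.mem_append_right _ h3⟩
      · obtain ⟨i', h1, h2, -, h4⟩ := hl'.complete i (by omega) j hj (by
          rw [Left, add_comm]
          exact hw)
        exact ⟨i', i, h1, h2, le_rfl, hi, List.mem_append_right _ h4⟩
    · obtain ⟨j', i', h1, h2, h3, h4, h5⟩ := hl.complete e' he' hlt a' b' j i hab' hj hi hw
      exact ⟨j', i', h1, h2, h3, h4, List.mem_append_left _ h5⟩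

theorem ends_edgeBody {σ : State} {l : List (ℕ × ℕ × ℝ)} {e Λ : ℕ} (h : Rep σ l)
    (hD : (levelsOf σ).WF) (hN : σ.nats nNodes 0 = σ.nats nHigh 0 + σ.nats nHigh 0)
    (he : σ.nats nI 0 = e) (hem : e < σ.nats nSize 1)
    (hΛ : ∀ a, (levelsOf σ).Used a → σ.nats nLast a ≤ Λ) :
    Ends edgeBody σ (500 * ((Λ + 2) *
        (min (σ.nats nLast (σ.nats nEndA e)) (σ.nats nLast (σ.nats nEndB e)) + 2))) fun σ' =>
      ∃ l', Rep σ' (l ++ l') ∧ ∃ a b, (levelsOf σ).Ends e a b ∧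
        σ.nats nLast a = min (σ.nats nLast (σ.nats nEndA e)) (σ.nats nLast (σ.nats nEndB e)) ∧
        LevelArcs (levelsOf σ) e a b (σ.nats nLast a + 1) l' := by
  set D := levelsOf σ with hDdef
  set A := σ.nats nEndA e with hA
  set B := σ.nats nEndB e with hB
  obtain ⟨a, b, hab, hmin, hX, hY⟩ : ∃ a b, D.Ends e a b ∧
      σ.nats nLast a = min (σ.nats nLast A) (σ.nats nLast B) ∧
      (if σ.nats nLast A ≤ σ.nats nLast B then A else B) = a ∧
      (if σ.nats nLast A ≤ σ.nats nLast B then B else A) = b := by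
    by_cases hle : σ.nats nLast A ≤ σ.nats nLast B
    · exact ⟨A, B, Or.inl ⟨rfl, rfl⟩, by rw [min_eq_left hle], by simp [hle], by simp [hle]⟩
    · exact ⟨B, A, Or.inr ⟨rfl, rfl⟩, by rw [min_eq_right (not_le.1 hle).le], by simp [hle],
        by simp [hle]⟩
  obtain ⟨hua, hub⟩ := hD.used_ends hem hab
  refine Ends.mono (B := 5 + (5 + (60 + (σ.nats nLast a + 1 + 1) * (400 * (Λ + 2) + 17)))) ?_ ?_
    fun _ _ h => h
  swap
  · rw [← hmin]
    generalize σ.nats nLast a = x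
    nlinarith [Nat.zero_le (Λ * x), Nat.zero_le x, Nat.zero_le Λ]
  refine Ends.block_cons (Ends.of_exec (by decide) (by decide) ?_)
  refine Ends.block_cons (Ends.of_exec (by decide) (by decide) ?_)
  refine Ends.block_cons (Ends.of_exec (by decide) (by decide) ?_)
  set P₀ : Prog := .seq (.setN nX (.cell nEndA (.var nI))) (.seq (.setN nY (.cell nEndB (.var nI)))
    (.ite (.natLE (.cell nLast (.var nX)) (.cell nLast (.var nY))) .skip
    (.block [.setN nX (.cell nEndB (.var nI)), .setN nY (.cell nEndA (.var nI))]))) with hP₀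
  change Ends _ (P₀.exec σ) _ _
  have hf : Frame P₀ σ (P₀.exec σ) := Frame.exec (by rw [hP₀]; decide) σ
  have hx : (P₀.exec σ).nats nX 0 = a := by
    rw [← hX]
    simp only [hP₀, Prog.exec, Prog.block, Test.holds, NatExpr.eval, State.nats_writeNat]
    by_cases hle : σ.nats nLast A ≤ σ.nats nLast B <;> simp [he, ← hA, ← hB, hle,
      State.nats_writeNat]
  have hy : (P₀.exec σ).nats nY 0 = b := by
    rw [← hY]
    simp only [hP₀, Prog.exec, Prog.block, Test.holds, NatExpr.eval, State.nats_writeNat]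
    by_cases hle : σ.nats nLast A ≤ σ.nats nLast B <;> simp [he, ← hA, ← hB, hle,
      State.nats_writeNat]
  set σ₁ := P₀.exec σ with hσ₁
  have hlev : levelsOf σ₁ = D := hf.levelsOf_eq (by rw [hP₀]; decide) (by rw [hP₀]; decide)
  have hr : Rep σ₁ l := h.congr (fun x hx => hf.nats x (by rw [hP₀]; revert x; decide))
    (hf.reals _ (by rw [hP₀]; decide))
  have hL₁ : σ₁.nats nLast = σ.nats nLast := hf.nats nLast (by rw [hP₀]; decide)
  have hI₁ : σ₁.nats nI 0 = e := by rw [hf.nats nI (by rw [hP₀]; decide), he]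
  have hN₁ : σ₁.nats nNodes 0 = σ₁.nats nHigh 0 + σ₁.nats nHigh 0 := by
    rw [hf.nats nNodes (by rw [hP₀]; decide), hf.nats nHigh (by rw [hP₀]; decide), hN]
  refine (Ends.forLoop_const (n := σ.nats nLast a + 1) (c := 400 * (Λ + 2)) (fun k σ' =>
    ∃ l', Rep σ' (l ++ l') ∧ LevelArcs D e a b k l') (by decide) ?_ ?_ ?_ ?_).mono le_rfl ?_
  · intro σ' hf'
    simp only [NatExpr.eval]
    rw [hf'.nats nLast (by decide), hf'.nats nX (by decide), hx, hL₁]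
  · refine ⟨[], ?_, ⟨by simp, fun j hj => absurd hj (Nat.not_lt_zero j), by simp⟩⟩
    rw [List.append_nil]
    exact hr.congr (fun x hx => State.nats_writeNat_ne _ _ _ (by revert x; decide)) rfl
  · rintro k σ₂ hk hf₂ hkI ⟨l', hr₂, hl'⟩
    have hlev₂ : levelsOf σ₂ = D := (hf₂.levelsOf_eq (by decide) (by decide)).trans hlev
    have hL₂ : σ₂.nats nLast = σ.nats nLast := (hf₂.nats nLast (by decide)).trans hL₁
    have := ends_levelBody (e := e) (a := a) (b := b) (j := k) hr₂ (by rw [hlev₂]; exact hD)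
      (by rw [hf₂.nats nNodes (by decide), hf₂.nats nHigh (by decide), hN₁])
      (by rw [hf₂.nats nI (by decide), hI₁]) (by rw [hf₂.nats nX (by decide), hx])
      (by rw [hf₂.nats nY (by decide), hy]) hkI (by rw [hlev₂]; exact hua)
      (by rw [hlev₂]; exact hub) (by rw [hL₂]; omega) (by rw [hlev₂]; exact hl')
    rw [hlev₂, hL₂] at this
    refine this.mono ?_ ?_
    · have := hΛ b hub
      omega
    · rintro σ₃ - ⟨l'', hr₃, hl''⟩
      exact ⟨l'', hr₃.congr (fun x hx => State.nats_writeNat_ne _ _ _ (by revert x; decide)) rfl,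
        hl''⟩
  · refine Nat.mul_le_mul_left _ ?_
    simp [NatExpr.cost]
  · rintro σ₂ - ⟨l', hr₂, hl'⟩
    exact ⟨l', hr₂, a, b, hab, hmin, hl'⟩

/-- The number of pairs of an edge and a level of the end of the edge with fewer levels. -/
def _root_.Levels.edgeSize (D : Levels) (n : ℕ) : ℕ :=
  ∑ e ∈ range n, (min (D.L (D.x e)) (D.L (D.y e)) + 1)

theorem ends_edgeProg {σ : State} {l : List (ℕ × ℕ × ℝ)} {Λ : ℕ} (h : Rep σ l)
    (hD : (levelsOf σ).WF) (hN : σ.nats nNodes 0 = σ.nats nHigh 0 + σ.nats nHigh 0)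
    (hΛ : ∀ a, (levelsOf σ).Used a → σ.nats nLast a ≤ Λ) :
    Ends edgeProg σ (2000 * ((Λ + 2) * ((levelsOf σ).edgeSize (σ.nats nSize 1) + 1))) fun σ' =>
      ∃ l', Rep σ' (l ++ l') ∧ (levelsOf σ).EdgeArcs l' (fun _ => True) ∧
        l'.length ≤ 2 * (levelsOf σ).edgeSize (σ.nats nSize 1) := by
  set D := levelsOf σ with hDdef
  refine (Ends.forLoop (n := σ.nats nSize 1) (fun k σ' => ∃ l', Rep σ' (l ++ l') ∧
    D.EdgeArcs l' (fun e => e < k) ∧ l'.length ≤ 2 * D.edgeSize k)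
    (fun k => 500 * ((Λ + 2) * (min (D.L (D.x k)) (D.L (D.y k)) + 2))) (by decide) ?_ ?_ ?_
    ?_).mono le_rfl ?_
  · intro σ' hf'
    simp only [NatExpr.eval]
    rw [hf'.nats nSize (by decide)]
  · refine ⟨[], ?_, ⟨by simp, fun e _ hj => absurd hj (Nat.not_lt_zero e)⟩, by simp⟩
    rw [List.append_nil]
    exact h.congr (fun x hx => State.nats_writeNat_ne _ _ _ (by revert x; decide)) rfl
  · rintro k σ₂ hk hf₂ hkI ⟨l', hr₂, hl', hlen⟩
    have hlev₂ : levelsOf σ₂ = D := hf₂.levelsOf_eq (by decide) (by decide)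
    have hL₂ : σ₂.nats nLast = σ.nats nLast := hf₂.nats nLast (by decide)
    have := ends_edgeBody (Λ := Λ) hr₂ (by rw [hlev₂]; exact hD)
      (by rw [hf₂.nats nNodes (by decide), hf₂.nats nHigh (by decide), hN]) hkI
      (by rw [hf₂.nats nSize (by decide)]; exact hk) (by rw [hlev₂, hL₂]; exact hΛ)
    rw [hlev₂, hL₂, hf₂.nats nEndA (by decide), hf₂.nats nEndB (by decide)] at this
    refine this.mono le_rfl ?_
    rintro σ₃ - ⟨l'', hr₃, a, b, hab, hmin, hl''⟩
    refine ⟨l' ++ l'', ?_, hl''.edgeArcs hl' hk hab, ?_⟩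
    · rw [← List.append_assoc]
      exact hr₃.congr (fun x hx => State.nats_writeNat_ne _ _ _ (by revert x; decide)) rfl
    · have := hl''.length_le
      rw [hmin] at this
      rw [List.length_append, Levels.edgeSize, sum_range_succ, ← Levels.edgeSize]
      change _ ≤ 2 * (_ + (min (σ.nats nLast (σ.nats nEndA k)) (σ.nats nLast (σ.nats nEndB k)) + 1))
      omega
  · have : ∀ k ∈ range (σ.nats nSize 1), 500 * ((Λ + 2) * (min (D.L (D.x k)) (D.L (D.y k)) + 2)) +
        (NatExpr.cost (.cell nSize (.const 1)) + 12) ≤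
        2000 * (Λ + 2) * (min (D.L (D.x k)) (D.L (D.y k)) + 1) := by
      intro k _
      simp only [NatExpr.cost]
      generalize min (D.L (D.x k)) (D.L (D.y k)) = x
      nlinarith [Nat.zero_le (Λ * x), Nat.zero_le x, Nat.zero_le Λ]
    have h1 := sum_le_sum this
    rw [← mul_sum, ← Levels.edgeSize] at h1
    simp only [NatExpr.cost] at h1 ⊢
    nlinarith
  · rintro σ₂ - ⟨l', hr₂, hl', hlen⟩
    exact ⟨l', hr₂, ⟨hl'.sound, fun e he _ => hl'.complete e he he⟩, hlen⟩

end RealRAM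


namespace RealRAM

open Function (update)

/-! ### Solving a problem with levels -/

theorem Rep.nil {σ : State} (hM : σ.nats nArcs 0 = 0)
    (hfst : ∀ v < σ.nats nNodes 0, σ.nats nFst v = 0)
    (hcur : ∀ v < σ.nats nNodes 0, σ.nats nCur v = 0) : Rep σ [] := by
  have hno : (netOf σ (σ.reals rRes)).arcs = ∅ := by
    simp [Net.arcs, netOf, hM]
  have hno' : ∀ a, a ∉ (netOf σ (σ.reals rRes)).arcs := by simp [hno]
  refine ⟨⟨fun a ha => absurd ha (hno' a), fun a ha => absurd ha (hno' a),
    fun a ha => absurd ha (hno' a), fun a ha => absurd ha (hno' a), fun a ha => absurd ha (hno' a),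
    fun a ha => absurd ha (hno' a), fun a ha => absurd ha (hno' a), fun a ha => absurd ha (hno' a),
    fun v hv => ?_, fun v hv h => ?_, fun v hv b h1 h2 => ?_⟩, fun F => ?_, fun v hv => ?_, ?_⟩
  · have := hfst v hv
    exact this.trans_le (Nat.zero_le _)
  · exact absurd (hfst v hv) h
  · have h2 : b ≤ σ.nats nArcs 0 := h2
    omega
  · rw [hno]
    simp
  · rw [hfst v hv, hcur v hv]
  · simp [hM]

/-- If all capacities in the list are integers, then so are those in the network. -/
theorem Rep.int {σ : State} {l : List (ℕ × ℕ × ℝ)} (h : Rep σ l)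
    (hl : ∀ t ∈ l, ∃ z : ℤ, t.2.2 = z) :
    ∀ a ∈ (netOf σ (σ.reals rRes)).arcs, ∃ z : ℤ, σ.reals rRes a = z := by
  classical
  have := h.sum_arcs fun _ _ c => if ∃ z : ℤ, c = z then 0 else 1
  rw [List.sum_eq_zero, sum_eq_zero_iff_of_nonneg] at this
  · intro a ha
    by_contra hne
    have := this a ha
    rw [if_neg hne] at this
    exact one_ne_zero this
  · intro a _
    split_ifs <;> norm_num
  · intro x hx
    obtain ⟨t, ht, rfl⟩ := List.mem_map.1 hx
    rw [if_pos (hl t ht), if_pos ⟨0, by simp⟩, add_zero]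

theorem _root_.Levels.length_nodeArcs_le (D : Levels) (n : ℕ) :
    ((List.range n).flatMap D.nodeArcs).length ≤ 3 * n := by
  induction n with
  | zero => simp
  | succ n ih =>
    rw [List.range_succ, List.flatMap_append, List.length_append, List.flatMap_singleton]
    have : (D.nodeArcs n).length ≤ 3 := by
      unfold Levels.nodeArcs
      split_ifs <;> simp
    omega

/-- Build the network of a problem with levels, and find a minimum cut. -/
def solveProg : Prog := .block [
  .setN nNodes (.add (.var nHigh) (.var nHigh)),
  .setN nArcs (.const 0),
  .setN nMax (.const 0),
  .setN nStuck (.const 0),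
  .setN nRounds (.const 0),
  clearProg,
  .setNat nDist (.const 1) (.const 0),
  nodeProg,
  edgeProg,
  flowProg]

/-- The distance labels `d` describe a minimum cut of value `c` of the problem `D`: it is obtained from
any label that does not occur. -/
structure CutLabels (D : Levels) (d : ℕ → ℕ) (c : ℝ) : Prop where
  le_cost : ∀ k, D.Feasible k → c ≤ D.cost k
  exists_cost : ∃ k, D.Feasible k ∧ D.cost k = c
  exists_gap : ∃ g ≤ 2 * D.H, ∀ v < 2 * D.H, d v ≠ g
  closed : ∀ g ≤ 2 * D.H, (∀ v < 2 * D.H, d v ≠ g) → D.Closed {v | g < d v}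
  read : ∀ g ≤ 2 * D.H, (∀ v < 2 * D.H, d v ≠ g) → ∀ k : ℕ → ℕ,
    (∀ a, D.Used a → ∀ j < k a, g < d (D.base a + j) ∧ ¬ g < d (D.H + (D.base a + j))) →
    (∀ a, D.Used a → g < d (D.base a + k a) → g < d (D.H + (D.base a + k a))) →
    D.Feasible k ∧ D.cost k = c

/-- A bound on the potential of the initial state of the push-relabel algorithm, in a network with
`N` nodes and at most `M` arcs. -/
def flowBound (κ K R N M : ℕ) : ℕ :=
  κ * (N * (N * (M + N) + M)) + K * (N * (M + N) + M + (K + 1) * (2 * (N * N))) +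
    R * (κ * N + K * ((K + 1) * N + K + 1))

/-- The cost of building the network and of finding a minimum cut. There are two cases: for `1 ≤ κ` the
capacities are arbitrary; for `κ = 0` they have to be integers, and single units are injected. -/
theorem ends_solveProg {σ : State} {κ K R B Λ : ℕ} (hD : (levelsOf σ).WF)
    (hex : ∃ k, (levelsOf σ).Feasible k) (hq : 0 < σ.reals rQuant 0)
    (hR : σ.reals rInf 0 ≤ R * σ.reals rQuant 0)
    (hκ : 1 ≤ κ ∨ (σ.reals rQuant 0 = 1 ∧ (∃ z : ℤ, σ.reals rInf 0 = z) ∧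
      ∀ h < σ.nats nHigh 0, ∃ z : ℤ, σ.reals rCap h = z)) (hK : 0 < K)
    (hΛ : ∀ a, (levelsOf σ).Used a → σ.nats nLast a ≤ Λ)
    (hB : 200 * (flowBound κ K R (2 * (levelsOf σ).H)
      (6 * (levelsOf σ).H + 4 * (levelsOf σ).edgeSize (σ.nats nSize 1)) + K) ≤ K * B) :
    Ends solveProg σ (1000 * ((levelsOf σ).H + 1) +
        2000 * ((Λ + 2) * ((levelsOf σ).edgeSize (σ.nats nSize 1) + 1)) + B) fun σ' =>
      CutLabels (levelsOf σ) (σ'.nats nDist) (σ'.reals rExc 1) ∧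
        σ'.nats nNodes 0 = 2 * (levelsOf σ).H := by
  set D := levelsOf σ with hDdef
  set E := D.edgeSize (σ.nats nSize 1) with hE
  have hH2 : 1 < D.H := by
    have := hD.lt_H hD.used_one (Nat.zero_le _)
    rw [hD.base_one] at this
    exact this
  refine Ends.mono (B := 8 + (3 + (3 + (3 + (3 + (60 * (2 * D.H + 2) + (3 + (500 * (D.H + 1) +
    (2000 * ((Λ + 2) * (E + 1)) + B))))))))) ?_ (by omega) fun _ _ h => h
  refine Ends.block_cons (Ends.of_exec (by decide) (by decide) ?_)
  refine Ends.block_cons (Ends.of_exec (by decide) (by decide) ?_)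
  refine Ends.block_cons (Ends.of_exec (by decide) (by decide) ?_)
  refine Ends.block_cons (Ends.of_exec (by decide) (by decide) ?_)
  refine Ends.block_cons (Ends.of_exec (by decide) (by decide) ?_)
  set P₀ : Prog := .seq (.setN nNodes (.add (.var nHigh) (.var nHigh)))
    (.seq (.setN nArcs (.const 0)) (.seq (.setN nMax (.const 0)) (.seq (.setN nStuck (.const 0))
      (.setN nRounds (.const 0))))) with hP₀
  change Ends _ (P₀.exec σ) _ _
  set σ₁ := P₀.exec σ with hσ₁
  have hf₁ : Frame P₀ σ σ₁ := Frame.exec (by rw [hP₀]; decide) σ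
  have hlev₁ : levelsOf σ₁ = D := hf₁.levelsOf_eq (by rw [hP₀]; decide) (by rw [hP₀]; decide)
  have hN₁ : σ₁.nats nNodes 0 = 2 * D.H := by
    rw [two_mul]
    simp [hσ₁, hP₀, Prog.exec, NatExpr.eval, State.nats_writeNat, hDdef, levelsOf]
  have hA₁ : σ₁.nats nArcs 0 = 0 := by
    simp [hσ₁, hP₀, Prog.exec, NatExpr.eval, State.nats_writeNat]
  have hM₁ : σ₁.nats nMax 0 = 0 := by
    simp [hσ₁, hP₀, Prog.exec, NatExpr.eval, State.nats_writeNat]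
  have hS₁ : σ₁.nats nStuck 0 = 0 := by
    simp [hσ₁, hP₀, Prog.exec, NatExpr.eval, State.nats_writeNat]
  have hR₁ : σ₁.nats nRounds 0 = 0 := by
    simp [hσ₁, hP₀, Prog.exec, NatExpr.eval, State.nats_writeNat]
  have hq₁ : σ₁.reals rQuant = σ.reals rQuant := hf₁.reals _ (by rw [hP₀]; decide)
  clear_value σ₁
  refine Ends.block_cons ((ends_clearProg σ₁ hN₁).mono le_rfl ?_)
  intro σ₂ hf₂ hclear
  have hlev₂ : levelsOf σ₂ = D := (hf₂.levelsOf_eq (by decide) (by decide)).trans hlev₁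
  refine Ends.block_cons (Ends.of_exec (by decide) (by decide) ?_)
  set P₃ : Prog := .setNat nDist (.const 1) (.const 0) with hP₃
  set σ₃ := P₃.exec σ₂ with hσ₃
  have hf₃ : Frame P₃ σ₂ σ₃ := Frame.exec (by rw [hP₃]; decide) σ₂
  have hlev₃ : levelsOf σ₃ = D := (hf₃.levelsOf_eq (by decide) (by decide)).trans hlev₂
  have hN₃ : σ₃.nats nNodes 0 = 2 * D.H := by
    rw [hf₃.nats nNodes (by decide), hf₂.nats nNodes (by decide), hN₁]
  have hH₃ : σ₃.nats nHigh 0 = D.H := congrArg Levels.H hlev₃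
  have hNH₃ : σ₃.nats nNodes 0 = σ₃.nats nHigh 0 + σ₃.nats nHigh 0 := by rw [hN₃, hH₃, two_mul]
  have hrep₃ : Rep σ₃ [] := by
    refine Rep.nil ?_ ?_ ?_
    · rw [hf₃.nats nArcs (by decide), hf₂.nats nArcs (by decide), hA₁]
    · intro v hv
      rw [hN₃] at hv
      rw [hf₃.nats nFst (by decide)]
      exact (hclear v hv.le).1
    · intro v hv
      rw [hN₃] at hv
      rw [hf₃.nats nCur (by decide)]
      exact (hclear v hv.le).2.1
  have hd₃ : ∀ v < 2 * D.H, σ₃.nats nDist v = if v = 1 then 0 else 1 := by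
    intro v hv
    have := (hclear v hv.le).2.2.2.1
    simp only [hσ₃, hP₃, Prog.exec, NatExpr.eval, State.nats_writeNat_same, Function.update_apply,
      this]
  have he₃ : ∀ v < 2 * D.H, σ₃.reals rExc v = 0 := by
    intro v hv
    rw [hf₃.reals rExc (by decide)]
    exact (hclear v hv.le).2.2.1
  have hh₃ : ∀ v ≤ 2 * D.H, σ₃.nats nHead v = 0 := by
    intro v hv
    rw [hf₃.nats nHead (by decide)]
    exact (hclear v hv).2.2.2.2
  have hM₃ : σ₃.nats nMax 0 = 0 := by
    rw [hf₃.nats nMax (by decide), hf₂.nats nMax (by decide), hM₁]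
  have hS₃ : σ₃.nats nStuck 0 = 0 := by
    rw [hf₃.nats nStuck (by decide), hf₂.nats nStuck (by decide), hS₁]
  have hR₃ : σ₃.nats nRounds 0 = 0 := by
    rw [hf₃.nats nRounds (by decide), hf₂.nats nRounds (by decide), hR₁]
  have hq₃ : σ₃.reals rQuant = σ.reals rQuant := by
    rw [hf₃.reals rQuant (by decide), hf₂.reals rQuant (by decide), hq₁]
  clear_value σ₃
  have hnode := ends_nodeProg hrep₃ (by rw [hlev₃]; exact hD) hNH₃
  rw [hlev₃, hH₃] at hnode
  refine Ends.block_cons (hnode.mono le_rfl ?_)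
  intro σ₄ hf₄ hrep₄
  have hlev₄ : levelsOf σ₄ = D := (hf₄.levelsOf_eq (by decide) (by decide)).trans hlev₃
  have hedge := ends_edgeProg (Λ := Λ) hrep₄ (by rw [hlev₄]; exact hD)
    (by rw [hf₄.nats nNodes (by decide), hf₄.nats nHigh (by decide), hNH₃])
    (by rw [hlev₄]; intro a ha; rw [show σ₄.nats nLast = σ.nats nLast from congrArg Levels.L hlev₄]
        exact hΛ a ha)
  rw [hlev₄, show σ₄.nats nSize 1 = σ.nats nSize 1 from congrArg Levels.m hlev₄] at hedge
  refine Ends.block_cons (hedge.mono le_rfl ?_)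
  rintro σ₅ hf₅ ⟨l', hrep, hl', hlen⟩
  have hlev₅ : levelsOf σ₅ = D := (hf₅.levelsOf_eq (by decide) (by decide)).trans hlev₄
  have hrep : Rep σ₅ (D.arcList l') := hrep
  have hN₅ : σ₅.nats nNodes 0 = 2 * D.H := by
    rw [hf₅.nats nNodes (by decide), hf₄.nats nNodes (by decide), hN₃]
  have hH₅ : σ₅.nats nHigh 0 = D.H := congrArg Levels.H hlev₅
  have hq₅ : σ₅.reals rQuant = σ.reals rQuant := by
    rw [hf₅.reals rQuant (by decide), hf₄.reals rQuant (by decide), hq₃]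
  have hd₅ : σ₅.nats nDist = σ₃.nats nDist := by
    rw [hf₅.nats nDist (by decide), hf₄.nats nDist (by decide)]
  have he₅ : σ₅.reals rExc = σ₃.reals rExc := by
    rw [hf₅.reals rExc (by decide), hf₄.reals rExc (by decide)]
  have hh₅ : σ₅.nats nHead = σ₃.nats nHead := by
    rw [hf₅.nats nHead (by decide), hf₄.nats nHead (by decide)]
  have hM₅ : σ₅.nats nMax 0 = 0 := by
    rw [hf₅.nats nMax (by decide), hf₄.nats nMax (by decide), hM₃]
  have hS₅ : σ₅.nats nStuck 0 = 0 := by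
    rw [hf₅.nats nStuck (by decide), hf₄.nats nStuck (by decide), hS₃]
  have hR₅ : σ₅.nats nRounds 0 = 0 := by
    rw [hf₅.nats nRounds (by decide), hf₄.nats nRounds (by decide), hR₃]
  set cap := σ₅.reals rRes with hcap
  set G := netOf σ₅ cap with hG
  have hGN : G.N = 2 * D.H := hN₅
  have h1N : 1 < G.N := by omega
  have hHN : D.H < G.N := by omega
  have hGM : G.M ≤ 6 * D.H + 4 * E := by
    have h1 : G.M = 2 * (D.arcList l').length := hrep.card
    have h2 := D.length_nodeArcs_le D.H
    rw [Levels.arcList, List.length_append] at h1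
    omega
  have hinit : (prOf σ₅).Inv G D.H (σ.reals rQuant 0) := by
    refine PR.Inv.init hrep.wf (fun v hv => ?_) (fun a _ => rfl) (fun v hv => ?_)
      (fun v hv => hrep.cur_eq v hv) (fun i hi => ?_) hM₅ hS₅ hR₅ h1N
    · show σ₅.reals rExc v = 0
      rw [he₅]
      exact he₃ v (hGN ▸ hv)
    · show σ₅.nats nDist v = _
      rw [hd₅]
      exact hd₃ v (hGN ▸ hv)
    · show σ₅.nats nHead i = 0
      rw [hh₅]
      exact hh₃ i (hGN ▸ hi)
  have hunit : 1 ≤ κ ∨ (prOf σ₅).IsUnit G := by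
    refine hκ.imp_right fun ⟨_, ⟨z, hz⟩, hint⟩ => ⟨?_, ?_, ?_⟩
    · refine hrep.int fun t ht => ?_
      rcases List.mem_append.1 ht with ht | ht
      · obtain ⟨h, hh, ht⟩ := List.mem_flatMap.1 ht
        have hh' := hint h (List.mem_range.1 hh)
        unfold Levels.nodeArcs at ht
        split_ifs at ht
        · simp only [List.mem_cons, List.not_mem_nil, or_false] at ht
          rcases ht with rfl | rfl | rfl
          · exact hh'
          · exact ⟨z, hz⟩
          · exact ⟨z, hz⟩
        · simp only [List.mem_cons, List.not_mem_nil, or_false] at ht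
          rw [ht]
          exact ⟨z, hz⟩
      · obtain ⟨e, _, a, b, j, i, _, _, _, rfl, _⟩ := hl'.sound t ht
        exact ⟨z, hz⟩
    · intro v hv
      refine ⟨0, ?_⟩
      show σ₅.reals rExc v = _
      rw [he₅, he₃ v (hGN ▸ hv), Int.cast_zero]
    · rw [sum_eq_zero]
      · exact zero_le_one
      · intro v hv
        show σ₅.reals rExc v = 0
        rw [he₅, he₃ v (hGN ▸ mem_range.1 (mem_of_mem_erase hv))]
  obtain ⟨k₀, hk₀⟩ := hex
  obtain ⟨S₀, hS₀H, hS₀1, hS₀⟩ := hk₀.exists_cut hD hl'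
  have hflow := ends_flowProg (σ := σ₅) (cap := cap) (κ := κ) (K := K) (R := R) (B := B) (S := S₀)
    hrep.wf (by rw [hH₅]; exact hHN) (by rw [hH₅]; omega) h1N (by rw [hq₅]; exact hq)
    (by rw [hq₅]; exact hκ.imp_right fun h => h.1) hK (by rw [hH₅]; exact hS₀H) hS₀1 (by
      rw [hq₅]
      refine lt_of_lt_of_le ?_ hR
      rw [hrep.cutCap]
      exact hS₀.trans_lt (hD.cost_lt hk₀.1)) (by rw [hq₅, hH₅]; exact ⟨hinit, hunit⟩) (by
      refine le_trans (Nat.mul_le_mul_left _ (Nat.add_le_add_right ?_ _)) hB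
      refine (PR.potential_init_le hrep.wf (fun v hv => ?_) hM₅ κ K R).trans ?_
      · show σ₅.reals rExc v = 0
        rw [he₅]
        exact he₃ v (hGN ▸ hv)
      · rw [flowBound, hGN]
        gcongr)
  rw [hH₅, hq₅] at hflow
  refine hflow.mono le_rfl ?_
  rintro σ₆ hf₆ ⟨hI, hD₆, hS₆⟩
  refine ⟨?_, by rw [hf₆.nats nNodes (by decide), hN₅]⟩
  have hmin : ∀ S' : Set ℕ, D.H ∈ S' → 1 ∉ S' → σ₆.reals rExc 1 ≤ listCap (D.arcList l') S' := by
    intro S' h1 h2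
    rw [← hrep.cutCap]
    exact hI.e_sink_le hrep.wf hHN h1 h1N h2
  have hgap : ∀ g ≤ 2 * D.H, (∀ v < 2 * D.H, σ₆.nats nDist v ≠ g) → _ := fun g hg hne => by
    obtain ⟨h1, h2, h3⟩ := hI.cutCap_gap hrep.wf hD₆ hS₆ hHN h1N (g := g) (hGN ▸ hne) (hGN ▸ hg)
    rw [hrep.cutCap] at h3
    exact Levels.isLeast_cost hD hl' h1 h2 h3 hmin ⟨k₀, hk₀⟩
  obtain ⟨g, hg, hgne⟩ := hI.exists_gap hS₆ h1N
  rw [hGN] at hg hgne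
  have hmain := hgap g hg hgne
  exact ⟨hmain.2.1, hmain.2.2.2, ⟨g, hg, hgne⟩, fun g hg hne => (hgap g hg hne).1,
    fun g hg hne k h1 h2 => (hgap g hg hne).2.2.1 k h1 h2⟩

end RealRAM


/-! ### Reading the input -/

namespace RealRAM

open Function (update)

/-- The memory holds a list of the elements of `A`, headed by `0` and `1`, and marks for them. -/
structure UsedList (σ : State) (A : Set ℕ) : Prop where
  two_le : 2 ≤ σ.nats nCount 0
  zero : σ.nats nUsed 0 = 0
  one : σ.nats nUsed 1 = 1
  inj : ∀ i < σ.nats nCount 0, ∀ j < σ.nats nCount 0, σ.nats nUsed i = σ.nats nUsed j → i = j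
  mem_iff : ∀ v, v ∈ A ↔ ∃ i < σ.nats nCount 0, σ.nats nUsed i = v
  mark_iff : ∀ v, v ∈ A ↔ σ.nats nMark v ≠ 0

theorem UsedList.congr {σ σ' : State} {A : Set ℕ} (h : UsedList σ A)
    (hn : ∀ a ∈ [nCount, nUsed, nMark], σ'.nats a = σ.nats a) : UsedList σ' A := by
  obtain ⟨h1, h2, h3, h4, h5, h6⟩ := h
  rw [← hn nCount (by decide), ← hn nUsed (by decide)] at *
  rw [← hn nMark (by decide)] at h6
  exact ⟨h1, h2, h3, h4, h5, h6⟩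

/-- Append the value of `e` to the list, unless it is there. -/
def visitProg (e : NatExpr) : Prog := .block [
  .setN nX e,
  .ite (.natLE (.cell nMark (.var nX)) (.const 0)) (.block [
    .setNat nMark (.var nX) (.const 1),
    .setNat nUsed (.var nCount) (.var nX),
    .setN nCount (.add (.var nCount) (.const 1))]) .skip]

theorem UsedList.visit {σ : State} {A : Set ℕ} (h : UsedList σ A) {e : NatExpr} {v : ℕ}
    (hv : e.eval σ = v) : UsedList ((visitProg e).exec σ) (insert v A) ∧
      ((visitProg e).exec σ).nats nCount 0 ≤ σ.nats nCount 0 + 1 := by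
  by_cases hm : σ.nats nMark v = 0
  · have hvA : v ∉ A := fun h' => (h.mark_iff v).1 h' hm
    have h1 : ((visitProg e).exec σ).nats nCount 0 = σ.nats nCount 0 + 1 := by
      simp [visitProg, Prog.block, Prog.exec, NatExpr.eval, hv, Test.holds, hm, State.nats_writeNat]
    have h2 : ((visitProg e).exec σ).nats nUsed = update (σ.nats nUsed) (σ.nats nCount 0) v := by
      simp [visitProg, Prog.block, Prog.exec, NatExpr.eval, hv, Test.holds, hm, State.nats_writeNat]
    have h3 : ((visitProg e).exec σ).nats nMark = update (σ.nats nMark) v 1 := by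
      simp [visitProg, Prog.block, Prog.exec, NatExpr.eval, hv, Test.holds, hm, State.nats_writeNat]
    have hlt := h.two_le
    have hold : ∀ i < σ.nats nCount 0, update (σ.nats nUsed) (σ.nats nCount 0) v i =
        σ.nats nUsed i := fun i hi => Function.update_of_ne (by omega) _ _
    have hne : ∀ i < σ.nats nCount 0, σ.nats nUsed i ≠ v := fun i hi he =>
      hvA ((h.mem_iff v).2 ⟨i, hi, he⟩)
    refine ⟨⟨?_, ?_, ?_, ?_, ?_, ?_⟩, h1.le⟩
    · omega
    · rw [h2, hold 0 (by omega), h.zero]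
    · rw [h2, hold 1 (by omega), h.one]
    · rw [h1, h2]
      intro i hi j hj hij
      rcases (Nat.lt_succ_iff.1 hi).eq_or_lt with rfl | hi <;>
        rcases (Nat.lt_succ_iff.1 hj).eq_or_lt with rfl | hj
      · rfl
      · rw [Function.update_self, hold j hj] at hij
        exact absurd hij.symm (hne j hj)
      · rw [Function.update_self, hold i hi] at hij
        exact absurd hij (hne i hi)
      · rw [hold i hi, hold j hj] at hij
        exact h.inj i hi j hj hij
    · intro u
      rw [h1, h2, Set.mem_insert_iff, h.mem_iff]
      constructor
      · rintro (rfl | ⟨i, hi, rfl⟩)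
        · exact ⟨_, Nat.lt_succ_self _, Function.update_self _ _ _⟩
        · exact ⟨i, hi.trans (Nat.lt_succ_self _), hold i hi⟩
      · rintro ⟨i, hi, rfl⟩
        rcases (Nat.lt_succ_iff.1 hi).eq_or_lt with rfl | hi
        · exact Or.inl (Function.update_self _ _ _)
        · exact Or.inr ⟨i, hi, (hold i hi).symm⟩
    · intro u
      rw [h3, Set.mem_insert_iff, h.mark_iff, Function.update_apply]
      split_ifs with huv <;> simp [huv]
  · have hvA : v ∈ A := (h.mark_iff v).2 hm
    rw [Set.insert_eq_of_mem hvA]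
    have h1 : (visitProg e).exec σ = σ.writeNat nX 0 v := by
      simp [visitProg, Prog.block, Prog.exec, NatExpr.eval, hv, Test.holds, hm, State.nats_writeNat]
    rw [h1]
    refine ⟨h.congr fun a ha => State.nats_writeNat_ne _ _ _ (by revert a; decide), ?_⟩
    rw [State.nats_writeNat_ne _ _ _ (by decide)]
    exact Nat.le_succ _

/-- List the ends of the edges, after the terminals, without repetitions. -/
def collectProg : Prog := .block [
  .setNat nMark (.const 0) (.const 1),
  .setNat nMark (.const 1) (.const 1),
  .setNat nUsed (.const 0) (.const 0),
  .setNat nUsed (.const 1) (.const 1),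
  .setN nCount (.const 2),
  .forLoop nI (.cell nSize (.const 1))
    (.seq (visitProg (.cell nEndA (.var nI))) (visitProg (.cell nEndB (.var nI))))]

theorem ends_collectProg {σ : State} (hmark : ∀ v, σ.nats nMark v = 0) :
    Ends collectProg σ (200 * (σ.nats nSize 1 + 1)) fun σ' =>
      UsedList σ' {v | v = 0 ∨ v = 1 ∨ ∃ e < σ.nats nSize 1, σ.nats nEndA e = v ∨
        σ.nats nEndB e = v} ∧ σ'.nats nCount 0 ≤ 2 * σ.nats nSize 1 + 2 := by
  refine Ends.mono (B := 3 + (3 + (3 + (3 + (3 + 150 * (σ.nats nSize 1 + 1)))))) ?_ (by omega)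
    fun _ _ h => h
  refine Ends.block_cons (Ends.of_exec (by decide) (by decide) ?_)
  refine Ends.block_cons (Ends.of_exec (by decide) (by decide) ?_)
  refine Ends.block_cons (Ends.of_exec (by decide) (by decide) ?_)
  refine Ends.block_cons (Ends.of_exec (by decide) (by decide) ?_)
  refine Ends.block_cons (Ends.of_exec (by decide) (by decide) ?_)
  set P₀ : Prog := .seq (.setNat nMark (.const 0) (.const 1))
    (.seq (.setNat nMark (.const 1) (.const 1)) (.seq (.setNat nUsed (.const 0) (.const 0))
    (.seq (.setNat nUsed (.const 1) (.const 1)) (.setN nCount (.const 2))))) with hP₀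
  change Ends _ (P₀.exec σ) _ _
  set σ₁ := P₀.exec σ with hσ₁
  have hf₁ : Frame P₀ σ σ₁ := Frame.exec (by rw [hP₀]; decide) σ
  have h₁ : UsedList σ₁ {v | v = 0 ∨ v = 1} := by
    have hc : σ₁.nats nCount 0 = 2 := by
      simp [hσ₁, hP₀, Prog.exec, NatExpr.eval, State.nats_writeNat]
    have hu0 : σ₁.nats nUsed 0 = 0 := by
      simp [hσ₁, hP₀, Prog.exec, NatExpr.eval, State.nats_writeNat]
    have hu1 : σ₁.nats nUsed 1 = 1 := by
      simp [hσ₁, hP₀, Prog.exec, NatExpr.eval, State.nats_writeNat]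
    refine ⟨hc.ge, hu0, hu1, ?_, ?_, ?_⟩
    · rw [hc]
      intro i hi j hj hij
      interval_cases i <;> interval_cases j <;> simp_all
    · intro v
      rw [hc]
      constructor
      · rintro (rfl | rfl)
        · exact ⟨0, by omega, hu0⟩
        · exact ⟨1, by omega, hu1⟩
      · rintro ⟨i, hi, rfl⟩
        interval_cases i
        · exact Or.inl hu0
        · exact Or.inr hu1
    · intro v
      by_cases h0 : v = 0 <;> by_cases h1 : v = 1 <;>
        simp [hσ₁, hP₀, Prog.exec, NatExpr.eval, State.nats_writeNat, hmark, h0, h1]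
  have hc₁ : σ₁.nats nCount 0 = 2 := by
    simp [hσ₁, hP₀, Prog.exec, NatExpr.eval, State.nats_writeNat]
  have hm₁ : σ₁.nats nSize = σ.nats nSize := hf₁.nats _ (by rw [hP₀]; decide)
  have hx₁ : σ₁.nats nEndA = σ.nats nEndA := hf₁.nats _ (by rw [hP₀]; decide)
  have hy₁ : σ₁.nats nEndB = σ.nats nEndB := hf₁.nats _ (by rw [hP₀]; decide)
  clear_value σ₁
  refine Ends.forLoop_exec (n := σ.nats nSize 1) (fun k σ' => UsedList σ' {v | v = 0 ∨ v = 1 ∨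
    ∃ e < k, σ.nats nEndA e = v ∨ σ.nats nEndB e = v} ∧ σ'.nats nCount 0 ≤ 2 * k + 2)
    (by decide) (by decide) ?_ ?_ ?_ ?_
  · intro σ' hf
    simp only [NatExpr.eval]
    rw [hf.nats nSize (by decide), hm₁]
  · refine ⟨?_, ?_⟩
    · refine UsedList.congr (σ := σ₁) ?_ fun a ha =>
        State.nats_writeNat_ne _ _ _ (by revert a; decide)
      simpa using h₁
    · rw [State.nats_writeNat_ne _ _ _ (by decide), hc₁]
  · rintro k σ₂ hk hf₂ hkI ⟨hI, hcount⟩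
    obtain ⟨h2, h3⟩ := hI.visit (e := .cell nEndA (.var nI)) (v := σ.nats nEndA k) (by
      simp only [NatExpr.eval]
      rw [hf₂.nats nEndA (by decide), hx₁, hkI])
    have hf₃ : Frame _ σ₂ ((visitProg (.cell nEndA (.var nI))).exec σ₂) :=
      Frame.exec (by decide) _
    obtain ⟨h4, h5⟩ := h2.visit (e := .cell nEndB (.var nI)) (v := σ.nats nEndB k) (by
      simp only [NatExpr.eval]
      rw [hf₃.nats nEndB (by decide), hf₃.nats nI (by decide), hf₂.nats nEndB (by decide), hy₁,
        hkI])
    refine ⟨?_, ?_⟩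
    · refine UsedList.congr (σ := Prog.exec _ _) ?_ fun a ha =>
        State.nats_writeNat_ne _ _ _ (by revert a; decide)
      suffices hset : {v | v = 0 ∨ v = 1 ∨ ∃ e < k + 1, σ.nats nEndA e = v ∨ σ.nats nEndB e = v} =
          insert (σ.nats nEndB k) (insert (σ.nats nEndA k)
            {v | v = 0 ∨ v = 1 ∨ ∃ e < k, σ.nats nEndA e = v ∨ σ.nats nEndB e = v}) by
        rw [hset]
        exact h4
      ext v
      rw [Set.mem_insert_iff, Set.mem_insert_iff]
      change (v = 0 ∨ v = 1 ∨ ∃ e < k + 1, σ.nats nEndA e = v ∨ σ.nats nEndB e = v) ↔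
        v = σ.nats nEndB k ∨ v = σ.nats nEndA k ∨
          (v = 0 ∨ v = 1 ∨ ∃ e < k, σ.nats nEndA e = v ∨ σ.nats nEndB e = v)
      constructor
      · rintro (h | h | ⟨e, he, h⟩)
        · simp [h]
        · simp [h]
        · rcases (Nat.lt_succ_iff.1 he).eq_or_lt with rfl | he
          · rcases h with h | h <;> simp [h]
          · exact Or.inr (Or.inr (Or.inr (Or.inr ⟨e, he, h⟩)))
      · rintro (h | h | h | h | ⟨e, he, h⟩)
        · exact Or.inr (Or.inr ⟨k, by omega, Or.inr h.symm⟩)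
        · exact Or.inr (Or.inr ⟨k, by omega, Or.inl h.symm⟩)
        · exact Or.inl h
        · exact Or.inr (Or.inl h)
        · exact Or.inr (Or.inr ⟨e, by omega, h⟩)
    · rw [State.nats_writeNat_ne _ _ _ (by decide)]
      simp only [Prog.exec]
      omega
  · rw [mul_comm]
    refine Nat.mul_le_mul_right _ ?_
    decide

end RealRAM

/-! ### Creating the levels -/

namespace Levels

open Function (update)

/-- The data for the levels of `a` are consistent. -/
structure BlockWF (D : Levels) (a : ℕ) : Prop where
  top_eq : ∀ j ≤ D.L a, D.top (D.base a + j) = if j = D.L a then 1 else 0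
  mono : ∀ j i, j ≤ i → i ≤ D.L a → D.lev (D.base a + j) ≤ D.lev (D.base a + i)
  cap_nonneg : ∀ j ≤ D.L a, 0 ≤ D.cap (D.base a + j)
  terminal : a ≤ 1 → D.L a = 0

/-- The data for the levels of `a` are the same in `D` and `D'`. -/
structure SameBlock (D D' : Levels) (a : ℕ) : Prop where
  base : D'.base a = D.base a
  L : D'.L a = D.L a
  top : ∀ j ≤ D.L a, D'.top (D.base a + j) = D.top (D.base a + j)
  lev : ∀ j ≤ D.L a, D'.lev (D.base a + j) = D.lev (D.base a + j)
  cap : ∀ j ≤ D.L a, D'.cap (D.base a + j) = D.cap (D.base a + j)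

/-- `D'` arises from `D` when the levels of `a` are added at the end. -/
structure AddBlock (D D' : Levels) (a : ℕ) : Prop where
  vl : D'.vl = D.vl
  m : D'.m = D.m
  x : D'.x = D.x
  y : D'.y = D.y
  w : D'.w = D.w
  base_eq : D'.base a = D.H
  base : ∀ b, b ≠ a → D'.base b = D.base b
  L : ∀ b, b ≠ a → D'.L b = D.L b
  H : D'.H = D.H + (D'.L a + 1)
  top : ∀ h < D.H, D'.top h = D.top h
  lev : ∀ h < D.H, D'.lev h = D.lev h
  cap : ∀ h < D.H, D'.cap h = D.cap h
  B : D'.B = D.B + ∑ j ∈ range (D'.L a), D'.cap (D.H + j)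
  wf : D'.BlockWF a

/-- The levels of the first `i` vertices have been created. -/
structure PartialWF (D : Levels) (i : ℕ) : Prop where
  base_eq : ∀ i' < i, D.base (D.vl i') = ∑ j ∈ range i', (D.L (D.vl j) + 1)
  H_eq : D.H = ∑ j ∈ range i, (D.L (D.vl j) + 1)
  block : ∀ i' < i, D.BlockWF (D.vl i')
  B_eq : D.B = 1 + ∑ h ∈ range D.H, if D.top h = 0 then D.cap h else 0

variable {D D' : Levels}

theorem BlockWF.congr {a : ℕ} (h : D.BlockWF a) (hs : SameBlock D D' a) : D'.BlockWF a := by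
  refine ⟨?_, ?_, ?_, fun ha => hs.L.trans (h.terminal ha)⟩
  · rw [hs.L, hs.base]
    intro j hj
    rw [hs.top j hj, h.top_eq j hj]
  · rw [hs.L, hs.base]
    intro j i hji hi
    rw [hs.lev j (by omega), hs.lev i hi]
    exact h.mono j i hji hi
  · rw [hs.L, hs.base]
    intro j hj
    rw [hs.cap j hj]
    exact h.cap_nonneg j hj

theorem PartialWF.sameBlock {i : ℕ} (h : D.PartialWF i) (hA : AddBlock D D' (D.vl i))
    (hinj : ∀ i' < i, D.vl i' ≠ D.vl i) {i' : ℕ} (hi' : i' < i) : SameBlock D D' (D.vl i') := by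
  have hlt : ∀ j ≤ D.L (D.vl i'), D.base (D.vl i') + j < D.H := by
    intro j hj
    have : ∑ j ∈ range (i' + 1), (D.L (D.vl j) + 1) ≤ D.H := by
      rw [h.H_eq]
      exact sum_le_sum_of_subset (range_subset_range.2 hi')
    rw [sum_range_succ, ← h.base_eq i' hi'] at this
    omega
  exact ⟨hA.base _ (hinj i' hi'), hA.L _ (hinj i' hi'), fun j hj => hA.top _ (hlt j hj),
    fun j hj => hA.lev _ (hlt j hj), fun j hj => hA.cap _ (hlt j hj)⟩

theorem PartialWF.add {i : ℕ} (h : D.PartialWF i) (hA : AddBlock D D' (D.vl i))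
    (hinj : ∀ i' < i, D.vl i' ≠ D.vl i) : D'.PartialWF (i + 1) := by
  have hsum : ∀ k ≤ i, ∑ j ∈ range k, (D'.L (D'.vl j) + 1) = ∑ j ∈ range k, (D.L (D.vl j) + 1) := by
    intro k hk
    refine sum_congr rfl fun j hj => ?_
    rw [hA.vl, hA.L _ (hinj j ((mem_range.1 hj).trans_le hk))]
  refine ⟨?_, ?_, ?_, ?_⟩
  · intro i' hi'
    rw [hsum i' (by omega), hA.vl]
    rcases (Nat.lt_succ_iff.1 hi').eq_or_lt with rfl | hlt
    · rw [hA.base_eq, h.H_eq]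
    · rw [hA.base _ (hinj i' hlt), h.base_eq i' hlt]
  · rw [sum_range_succ, hsum i le_rfl, ← h.H_eq, hA.vl, hA.H]
  · intro i' hi'
    rw [hA.vl]
    rcases (Nat.lt_succ_iff.1 hi').eq_or_lt with rfl | hlt
    · exact hA.wf
    · exact (h.block i' hlt).congr (h.sameBlock hA hinj hlt)
  · rw [hA.H, sum_range_add, hA.B]
    have h1 : ∑ h ∈ range D.H, (if D'.top h = 0 then D'.cap h else 0) =
        ∑ h ∈ range D.H, (if D.top h = 0 then D.cap h else 0) := by
      refine sum_congr rfl fun h hh => ?_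
      rw [hA.top h (mem_range.1 hh), hA.cap h (mem_range.1 hh)]
    have h2 : ∑ j ∈ range (D'.L (D.vl i) + 1),
        (if D'.top (D.H + j) = 0 then D'.cap (D.H + j) else 0) =
        ∑ j ∈ range (D'.L (D.vl i)), D'.cap (D.H + j) := by
      rw [sum_range_succ, ← hA.base_eq, hA.wf.top_eq _ le_rfl, if_pos rfl, if_neg one_ne_zero,
        add_zero]
      refine sum_congr rfl fun j hj => ?_
      rw [mem_range] at hj
      rw [hA.wf.top_eq _ hj.le, if_neg hj.ne, if_pos rfl]
    rw [h1, h2, h.B_eq, add_assoc]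

end Levels

namespace RealRAM

open Function (update)

/-- Create the levels of the vertices in the list, by a program `P` for a single vertex. -/
def levelsProg (P : Prog) : Prog := .block [
  .setR rInf (.const 1),
  .setN nHigh (.const 0),
  .forLoop nI (.var nCount) P]

/-- If the program `P` creates the levels of a single vertex, then `levelsProg P` creates a well-formed
problem. A further property `Q` of the levels of single vertices can be carried along. -/
theorem ends_levelsProg {P : Prog} {σ : State} (Q : Levels → ℕ → Prop) (cost : ℕ → ℕ) {B : ℕ}
    (hu : UsedList σ {v | v = 0 ∨ v = 1 ∨ ∃ e < σ.nats nSize 1, σ.nats nEndA e = v ∨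
        σ.nats nEndB e = v})
    (hI : nI ∉ P.natWrites)
    (hn : ∀ a ∈ [nCount, nUsed, nSize, nEndA, nEndB], a ∉ P.natWrites)
    (hQ : ∀ D D' : Levels, ∀ a, Levels.SameBlock D D' a → D'.m = D.m → D'.x = D.x → D'.y = D.y →
      D'.w = D.w → Q D a → Q D' a)
    (hP : ∀ i < σ.nats nCount 0, ∀ σ₁, Frame (levelsProg P) σ σ₁ → σ₁.nats nI 0 = i →
      Ends P σ₁ (cost i) fun σ₂ => (levelsOf σ₁).AddBlock (levelsOf σ₂) (σ.nats nUsed i) ∧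
        Q (levelsOf σ₂) (σ.nats nUsed i))
    (hB : ∑ i ∈ range (σ.nats nCount 0), (cost i + 14) + 20 ≤ B) :
    Ends (levelsProg P) σ B fun σ' => (levelsOf σ').WF ∧ (∀ a, (levelsOf σ').Used a →
      Q (levelsOf σ') a) ∧ (levelsOf σ').B = 1 + ∑ h ∈ range (levelsOf σ').H,
        if (levelsOf σ').top h = 0 then (levelsOf σ').cap h else 0 := by
  have hw1 : (levelsProg P).natWrites = nHigh :: nI :: (P.natWrites ++ [nI]) := rfl
  have hw2 : (levelsProg P).realWrites = rInf :: (P.realWrites ++ []) := by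
    rfl
  refine Ends.mono (B := 3 + (3 + (∑ i ∈ range (σ.nats nCount 0), (cost i + 14) + 14)))
    (R := fun σ' => (levelsOf σ').PartialWF (σ.nats nCount 0) ∧ ∀ i < σ.nats nCount 0,
      Q (levelsOf σ') (σ.nats nUsed i)) ?_ (by omega) ?_
  · refine Ends.block_cons (Ends.of_exec (by decide) (by decide) ?_)
    refine Ends.block_cons (Ends.of_exec (by decide) (by decide) ?_)
    set σ₁ := Prog.exec (.setN nHigh (.const 0)) (Prog.exec (.setR rInf (.const 1)) σ) with hσ₁
    have hf₁ : Frame (.seq (.setR rInf (.const 1)) (.setN nHigh (.const 0))) σ σ₁ :=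
      Frame.exec (P := .seq (.setR rInf (.const 1)) (.setN nHigh (.const 0))) (by decide) σ
    have hH₁ : σ₁.nats nHigh 0 = 0 := by
      simp [hσ₁, Prog.exec, NatExpr.eval]
    have hB₁ : σ₁.reals rInf 0 = 1 := by
      simp [hσ₁, Prog.exec, NatExpr.eval, RealExpr.eval]
    have hf₁' : Frame (levelsProg P) σ σ₁ := hf₁.mono
      (by simp [hw1, Prog.natWrites]) (by simp [hw2, Prog.realWrites])
    have hc₁ : σ₁.nats nCount = σ.nats nCount := hf₁.nats _ (by decide)
    have hu₁ : σ₁.nats nUsed = σ.nats nUsed := hf₁.nats _ (by decide)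
    have hcw : nCount ∉ (Prog.forLoop nI (.var nCount) P).natWrites := by
      have := hn nCount (by decide)
      simp [Prog.forLoop, Prog.natWrites, this]
    have huw : nUsed ∉ (Prog.forLoop nI (.var nCount) P).natWrites := by
      have := hn nUsed (by decide)
      simp [Prog.forLoop, Prog.natWrites, this]
    clear_value σ₁
    refine Ends.forLoop (n := σ.nats nCount 0) (fun i σ' => (levelsOf σ').PartialWF i ∧
      ∀ i' < i, Q (levelsOf σ') (σ.nats nUsed i')) cost hI ?_ ?_ ?_ ?_
    · intro σ' hf
      simp only [NatExpr.eval]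
      rw [hf.nats nCount hcw, hc₁]
    · have : levelsOf (σ₁.writeNat nI 0 0) = levelsOf σ₁ := by
        simp [levelsOf, State.nats_writeNat]
      rw [this]
      have hH : (levelsOf σ₁).H = 0 := hH₁
      refine ⟨⟨fun i hi => absurd hi (Nat.not_lt_zero i), ?_, fun i hi =>
        absurd hi (Nat.not_lt_zero i), ?_⟩, fun i hi => absurd hi (Nat.not_lt_zero i)⟩
      · simp [hH]
      · rw [hH]
        have : (levelsOf σ₁).B = 1 := hB₁
        simp [this]
    · rintro i σ₂ hi hf₂ hiI ⟨hwf, hQi⟩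
      have hf₂' : Frame (levelsProg P) σ σ₂ := hf₁'.trans (hf₂.mono
        (by simp [hw1, Prog.forLoop, Prog.natWrites]) (by simp [hw2, Prog.forLoop, Prog.realWrites]))
      have hu₂ : σ₂.nats nUsed = σ.nats nUsed := (hf₂.nats _ huw).trans hu₁
      refine (hP i hi σ₂ hf₂' hiI).mono le_rfl ?_
      rintro σ₃ - ⟨hA, hQ₃⟩
      have : levelsOf (σ₃.writeNat nI 0 (i + 1)) = levelsOf σ₃ := by
        simp [levelsOf, State.nats_writeNat]
      rw [this]
      have hvi : (levelsOf σ₂).vl i = σ.nats nUsed i := congrFun hu₂ i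
      rw [← hvi] at hA
      have hinj : ∀ i' < i, (levelsOf σ₂).vl i' ≠ (levelsOf σ₂).vl i := by
        intro i' hi' h
        have h : σ₂.nats nUsed i' = σ₂.nats nUsed i := h
        rw [hu₂] at h
        have := hu.inj i' (by omega) i hi h
        omega
      refine ⟨hwf.add hA hinj, fun i' hi' => ?_⟩
      rcases (Nat.lt_succ_iff.1 hi').eq_or_lt with rfl | hlt
      · exact hQ₃
      · have hs := hwf.sameBlock hA hinj hlt
        rw [show (levelsOf σ₂).vl i' = σ.nats nUsed i' from congrFun hu₂ i'] at hs
        exact hQ _ _ _ hs hA.m hA.x hA.y hA.w (hQi i' hlt)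
    · exact le_rfl
  · rintro σ' hf ⟨hwf, hQ'⟩
    have hfr : ∀ a ∈ [nCount, nUsed, nSize, nEndA, nEndB], σ'.nats a = σ.nats a := by
      intro a ha
      refine hf.nats a ?_
      have h1 := hn a ha
      rw [hw1]
      simp only [List.mem_cons, List.mem_append, List.not_mem_nil, or_false, not_or]
      refine ⟨?_, ?_, h1, ?_⟩ <;> (clear h1; revert a; decide)
    have hn' : (levelsOf σ').n = σ.nats nCount 0 := congrFun (hfr nCount (by decide)) 0
    have hvl : (levelsOf σ').vl = σ.nats nUsed := hfr nUsed (by decide)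
    have hm : (levelsOf σ').m = σ.nats nSize 1 := congrFun (hfr nSize (by decide)) 1
    have hx : (levelsOf σ').x = σ.nats nEndA := hfr nEndA (by decide)
    have hy : (levelsOf σ').y = σ.nats nEndB := hfr nEndB (by decide)
    have hblock : ∀ a, (levelsOf σ').Used a → (levelsOf σ').BlockWF a := by
      rintro a ⟨i, hi, rfl⟩
      exact hwf.block i (hn' ▸ hi)
    have hused : ∀ v, (v = 0 ∨ v = 1 ∨ ∃ e < σ.nats nSize 1, σ.nats nEndA e = v ∨
        σ.nats nEndB e = v) → (levelsOf σ').Used v := by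
      intro v hv
      obtain ⟨i, hi, hiv⟩ := (hu.mem_iff v).1 hv
      exact ⟨i, hn'.symm ▸ hi, by rw [hvl]; exact hiv⟩
    refine ⟨⟨?_, ?_, ?_, ?_, ?_, ?_, ?_, ?_, ?_, ?_, ?_, ?_, ?_, ?_⟩, ?_, hwf.B_eq⟩
    · rw [hn']
      exact hu.two_le
    · rw [hvl]
      exact hu.zero
    · rw [hvl]
      exact hu.one
    · rw [hn', hvl]
      exact hu.inj
    · intro e he
      rw [hm] at he
      exact hused _ (Or.inr (Or.inr ⟨e, he, Or.inl (by rw [hx])⟩))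
    · intro e he
      rw [hm] at he
      exact hused _ (Or.inr (Or.inr ⟨e, he, Or.inr (by rw [hy])⟩))
    · rw [hn']
      exact hwf.base_eq
    · rw [hn']
      exact hwf.H_eq
    · exact (hblock 0 (hused 0 (Or.inl rfl))).terminal (by omega)
    · exact (hblock 1 (hused 1 (Or.inr (Or.inl rfl)))).terminal le_rfl
    · intro a ha
      exact (hblock a ha).top_eq
    · intro a ha
      exact (hblock a ha).mono
    · intro h hh
      by_contra hneg
      -- Every level number below `H` belongs to some vertex.
      have hex : ∀ i ≤ σ.nats nCount 0, h < ∑ j ∈ range i, ((levelsOf σ').L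
          ((levelsOf σ').vl j) + 1) → 0 ≤ (levelsOf σ').cap h := by
        intro i
        induction i with
        | zero => simp
        | succ i ih =>
          intro hi hlt
          by_cases h2 : h < ∑ j ∈ range i, ((levelsOf σ').L ((levelsOf σ').vl j) + 1)
          · exact ih (by omega) h2
          · rw [sum_range_succ] at hlt
            rw [← hwf.base_eq i (by omega)] at h2 hlt
            have := (hwf.block i (by omega)).cap_nonneg (h - (levelsOf σ').base ((levelsOf σ').vl i))
              (by omega)
            rwa [Nat.add_sub_cancel' (not_lt.1 h2)] at this
      refine hneg (hex _ le_rfl ?_)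
      rw [← hwf.H_eq]
      exact hh
    · rw [hwf.B_eq]
      linarith
    · rintro a ⟨i, hi, rfl⟩
      rw [hvl]
      exact hQ' i (hn' ▸ hi)

end RealRAM


namespace Levels

open Function (update)

/-- The levels of `a` below the current one have been appended to `D`. -/
structure Building (D D' : Levels) (a : ℕ) : Prop where
  vl : D'.vl = D.vl
  m : D'.m = D.m
  x : D'.x = D.x
  y : D'.y = D.y
  w : D'.w = D.w
  base_eq : D'.base a = D.H
  base : ∀ b, b ≠ a → D'.base b = D.base b
  L : ∀ b, b ≠ a → D'.L b = D.L b
  H : D'.H = D.H + D'.L a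
  top : ∀ h < D.H, D'.top h = D.top h
  lev : ∀ h < D.H, D'.lev h = D.lev h
  cap : ∀ h < D.H, D'.cap h = D.cap h
  B : D'.B = D.B + ∑ j ∈ range (D'.L a), D'.cap (D.H + j)
  top_eq : ∀ j < D'.L a, D'.top (D.H + j) = 0
  mono : ∀ j < D'.L a, D'.lev (D.H + j) ≤ D'.lev (D.H + (j + 1))
  cap_nonneg : ∀ j < D'.L a, 0 ≤ D'.cap (D.H + j)
  terminal : a ≤ 1 → D'.L a = 0

/-- Start the list of levels of `a` with the level `0`. -/
noncomputable def start (D : Levels) (a : ℕ) : Levels :=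
  { D with base := update D.base a D.H, lev := update D.lev D.H 0, L := update D.L a 0 }

/-- Append a new level `b` of `a`, with the price `c` for going up to it. -/
noncomputable def grow (D : Levels) (a : ℕ) (b c : ℝ) : Levels :=
  { D with
    cap := update D.cap D.H c
    B := D.B + c
    top := update D.top D.H 0
    lev := update D.lev (D.H + 1) b
    H := D.H + 1
    L := update D.L a (D.L a + 1) }

/-- Complete the list of levels. -/
noncomputable def finish (D : Levels) : Levels :=
  { D with top := update D.top D.H 1, cap := update D.cap D.H 0, H := D.H + 1 }

variable {D D' : Levels} {a : ℕ}

theorem building_start (D : Levels) (a : ℕ) : Building D (D.start a) a := by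
  constructor <;> simp +contextual [start, Nat.ne_of_lt]

theorem Building.grow (h : Building D D' a) {b c : ℝ} (hb : D'.lev D'.H ≤ b) (hc : 0 ≤ c)
    (ha : 1 < a) : Building D (D'.grow a b c) a := by
  have hH := h.H
  have hL : (D'.grow a b c).L a = D'.L a + 1 := by simp [Levels.grow]
  have hcap : ∀ h' < D'.H, (D'.grow a b c).cap h' = D'.cap h' := fun h' hh =>
    Function.update_of_ne hh.ne _ _
  have hlev : ∀ h' < D'.H + 1, (D'.grow a b c).lev h' = D'.lev h' := fun h' hh =>
    Function.update_of_ne hh.ne _ _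
  have htop : ∀ h' < D'.H, (D'.grow a b c).top h' = D'.top h' := fun h' hh =>
    Function.update_of_ne hh.ne _ _
  have hcapH : (D'.grow a b c).cap D'.H = c := Function.update_self _ _ _
  have hlevH : (D'.grow a b c).lev (D'.H + 1) = b := Function.update_self _ _ _
  have htopH : (D'.grow a b c).top D'.H = 0 := Function.update_self _ _ _
  refine ⟨h.vl, h.m, h.x, h.y, h.w, h.base_eq, h.base, fun b' hb' => ?_, ?_, fun h' hh => ?_,
    fun h' hh => ?_, fun h' hh => ?_, ?_, ?_, ?_, ?_, fun h1 => absurd ha (not_lt.2 h1)⟩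
  · exact (Function.update_of_ne hb' _ _).trans (h.L b' hb')
  · rw [hL]
    show D'.H + 1 = _
    omega
  · rw [htop h' (by omega), h.top h' hh]
  · rw [hlev h' (by omega), h.lev h' hh]
  · rw [hcap h' (by omega), h.cap h' hh]
  · rw [hL, sum_range_succ, ← hH, hcapH, ← add_assoc]
    show D'.B + c = _
    rw [h.B]
    congr 2
    refine sum_congr rfl fun j hj => (hcap _ ?_).symm
    rw [mem_range] at hj
    omega
  · rw [hL]
    intro j hj
    rcases (Nat.lt_succ_iff.1 hj).eq_or_lt with rfl | hj
    · rw [← hH, htopH]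
    · rw [htop _ (by omega), h.top_eq j hj]
  · rw [hL]
    intro j hj
    rcases (Nat.lt_succ_iff.1 hj).eq_or_lt with rfl | hj
    · rw [← add_assoc, ← hH, hlevH, hlev _ (by omega)]
      exact hb
    · rw [hlev _ (by omega), hlev _ (by omega)]
      exact h.mono j hj
  · rw [hL]
    intro j hj
    rcases (Nat.lt_succ_iff.1 hj).eq_or_lt with rfl | hj
    · rw [← hH, hcapH]
      exact hc
    · rw [hcap _ (by omega)]
      exact h.cap_nonneg j hj

theorem Building.finish (h : Building D D' a) : AddBlock D D'.finish a := by
  have hH := h.H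
  have hcap : ∀ h' < D'.H, D'.finish.cap h' = D'.cap h' := fun h' hh =>
    Function.update_of_ne hh.ne _ _
  have htop : ∀ h' < D'.H, D'.finish.top h' = D'.top h' := fun h' hh =>
    Function.update_of_ne hh.ne _ _
  have hcapH : D'.finish.cap D'.H = 0 := Function.update_self _ _ _
  have htopH : D'.finish.top D'.H = 1 := Function.update_self _ _ _
  have hbase : D'.finish.base a = D.H := h.base_eq
  have hL : D'.finish.L a = D'.L a := rfl
  refine ⟨h.vl, h.m, h.x, h.y, h.w, h.base_eq, h.base, h.L, ?_, fun h' hh => ?_,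
    h.lev, fun h' hh => ?_, ?_, ⟨?_, ?_, ?_, h.terminal⟩⟩
  · show D'.H + 1 = D.H + (D'.L a + 1)
    omega
  · rw [htop h' (by omega), h.top h' hh]
  · rw [hcap h' (by omega), h.cap h' hh]
  · show D'.B = _
    rw [h.B]
    congr 1
    refine sum_congr rfl fun j hj => (hcap _ ?_).symm
    have : j < D'.L a := mem_range.1 hj
    omega
  · rw [hbase, hL]
    intro j hj
    rcases hj.eq_or_lt with rfl | hj
    · rw [← hH, htopH, if_pos rfl]
    · rw [htop _ (by omega), h.top_eq j hj, if_neg hj.ne]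
  · rw [hbase, hL]
    intro j i hji
    induction i, hji using Nat.le_induction with
    | base => exact fun _ => le_rfl
    | succ i hji ih => exact fun hi => (ih (by omega)).trans (h.mono i (by omega))
  · rw [hbase, hL]
    intro j hj
    rcases hj.eq_or_lt with rfl | hj
    · rw [← hH, hcapH]
    · rw [hcap _ (by omega)]
      exact h.cap_nonneg j hj

/-- The edges that are incident to `a`. -/
def incident (D : Levels) (a : ℕ) : Finset ℕ := {e ∈ range D.m | D.x e = a ∨ D.y e = a}

/-- The levels of `a` that have been created are `0` and the smallest positive weights of the edges
incident to `a`. -/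
structure WeightInv (D : Levels) (a : ℕ) : Prop where
  lev_zero : D.lev (D.base a) = 0
  cap_eq : ∀ j < D.L a, D.cap (D.base a + j) = D.lev (D.base a + (j + 1)) - D.lev (D.base a + j)
  weight : ∀ j < D.L a, ∃ e ∈ D.incident a, D.lev (D.base a + (j + 1)) = D.w e
  complete : ∀ e ∈ D.incident a, D.w e ≤ D.lev (D.base a + D.L a) →
    ∃ j ≤ D.L a, D.w e = D.lev (D.base a + j)
  card_le : D.L a + #{e ∈ D.incident a | D.lev (D.base a + D.L a) < D.w e} ≤ #(D.incident a)

/-- The levels of the vertices other than the terminals are `0` and the weights of the incident edges,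
and the prices are the differences of consecutive levels. -/
structure WeightLevels (D : Levels) (a : ℕ) : Prop where
  lev_zero : D.lev (D.base a) = 0
  cap_eq : ∀ j < D.L a, D.cap (D.base a + j) = D.lev (D.base a + (j + 1)) - D.lev (D.base a + j)
  weight : ∀ j < D.L a, ∃ e ∈ D.incident a, D.lev (D.base a + (j + 1)) = D.w e
  complete : 1 < a → ∀ e ∈ D.incident a, ∃ j ≤ D.L a, D.w e = D.lev (D.base a + j)
  L_le : D.L a ≤ #(D.incident a)

theorem WeightLevels.congr (h : WeightLevels D a) (hs : SameBlock D D' a) (hm : D'.m = D.m)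
    (hx : D'.x = D.x) (hy : D'.y = D.y) (hw : D'.w = D.w) : WeightLevels D' a := by
  have hinc : D'.incident a = D.incident a := by
    simp only [incident, hm, hx, hy]
  refine ⟨?_, ?_, ?_, ?_, ?_⟩
  · rw [hs.base, ← add_zero (D.base a), hs.lev 0 (Nat.zero_le _), add_zero, h.lev_zero]
  · rw [hs.base, hs.L]
    intro j hj
    rw [hs.cap j hj.le, hs.lev j hj.le, hs.lev (j + 1) hj, h.cap_eq j hj]
  · rw [hs.base, hs.L, hinc, hw]
    intro j hj
    rw [hs.lev (j + 1) hj]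
    exact h.weight j hj
  · rw [hs.base, hs.L, hinc, hw]
    intro ha e he
    obtain ⟨j, hj, hje⟩ := h.complete ha e he
    exact ⟨j, hj, by rw [hs.lev j hj, hje]⟩
  · rw [hs.L, hinc]
    exact h.L_le

theorem weightInv_start (D : Levels) (a : ℕ) (hw : ∀ e ∈ D.incident a, 0 ≤ D.w e) :
    WeightInv (D.start a) a := by
  have hinc : (D.start a).incident a = D.incident a := rfl
  have hL : (D.start a).L a = 0 := Function.update_self _ _ _
  have hb : (D.start a).base a = D.H := Function.update_self _ _ _
  have hl : (D.start a).lev D.H = 0 := Function.update_self _ _ _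
  refine ⟨by rw [hb, hl], fun j hj => ?_, fun j hj => ?_, ?_, ?_⟩
  · omega
  · omega
  · rw [hL, hb, hinc, add_zero, hl]
    intro e he hle
    refine ⟨0, le_rfl, ?_⟩
    rw [add_zero, hl]
    exact le_antisymm hle (hw e he)
  · rw [hL, zero_add, hinc]
    exact card_filter_le _ _

theorem WeightInv.grow (h : WeightInv D a) (hH : D.H = D.base a + D.L a) {e : ℕ}
    (he : e ∈ D.incident a) (hlt : D.lev D.H < D.w e)
    (hmin : ∀ e' ∈ D.incident a, D.lev D.H < D.w e' → D.w e ≤ D.w e') :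
    WeightInv (D.grow a (D.w e) (D.w e - D.lev D.H)) a := by
  set D' := D.grow a (D.w e) (D.w e - D.lev D.H) with hD'
  have hL : D'.L a = D.L a + 1 := Function.update_self _ _ _
  have hb : D'.base a = D.base a := rfl
  have hinc : D'.incident a = D.incident a := rfl
  have hcap : ∀ h' < D.H, D'.cap h' = D.cap h' := fun h' hh => Function.update_of_ne hh.ne _ _
  have hlev : ∀ h' < D.H + 1, D'.lev h' = D.lev h' := fun h' hh => Function.update_of_ne hh.ne _ _
  have hcapH : D'.cap D.H = D.w e - D.lev D.H := Function.update_self _ _ _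
  have hlevH : D'.lev (D.H + 1) = D.w e := Function.update_self _ _ _
  have hw : D'.w = D.w := rfl
  refine ⟨?_, ?_, ?_, ?_, ?_⟩
  · rw [hb, hlev _ (by omega), h.lev_zero]
  · rw [hb, hL]
    intro j hj
    rcases (Nat.lt_succ_iff.1 hj).eq_or_lt with rfl | hj
    · rw [← add_assoc, ← hH, hcapH, hlevH, hlev _ (by omega)]
    · rw [hcap _ (by omega), hlev _ (by omega), hlev _ (by omega), h.cap_eq j hj]
  · rw [hb, hL, hinc, hw]
    intro j hj
    rcases (Nat.lt_succ_iff.1 hj).eq_or_lt with rfl | hj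
    · rw [← add_assoc, ← hH, hlevH]
      exact ⟨e, he, rfl⟩
    · rw [hlev _ (by omega)]
      exact h.weight j hj
  · rw [hb, hL, hinc, hw, ← add_assoc, ← hH, hlevH]
    intro e' he' hle
    rcases le_or_gt (D.w e') (D.lev D.H) with h1 | h1
    · rw [hH] at h1
      obtain ⟨j, hj, hje⟩ := h.complete e' he' h1
      exact ⟨j, by omega, by rw [hlev _ (by omega), hje]⟩
    · refine ⟨D.L a + 1, le_rfl, ?_⟩
      rw [← add_assoc, ← hH, hlevH]
      exact le_antisymm hle (hmin e' he' h1)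
  · rw [hb, hL, hinc, hw, ← add_assoc, ← hH, hlevH]
    have h1 := h.card_le
    rw [← hH] at h1
    have h2 : #{e' ∈ D.incident a | D.w e < D.w e'} < #{e' ∈ D.incident a | D.lev D.H < D.w e'} := by
      refine card_lt_card ((ssubset_iff_of_subset ?_).2 ⟨e, ?_, ?_⟩)
      · intro e' he'
        rw [mem_filter] at he' ⊢
        exact ⟨he'.1, hlt.trans he'.2⟩
      · exact mem_filter.2 ⟨he, hlt⟩
      · simp
    omega

theorem WeightInv.finish (h : WeightInv D a) (hH : D.H = D.base a + D.L a)
    (hmax : 1 < a → ∀ e ∈ D.incident a, D.w e ≤ D.lev D.H) : WeightLevels D.finish a := by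
  refine ⟨h.lev_zero, fun j hj => ?_, h.weight, fun ha e he => ?_, ?_⟩
  · have hj' : j < D.L a := hj
    refine Eq.trans ?_ (h.cap_eq j hj)
    exact Function.update_of_ne (by show D.base a + j ≠ D.H; omega) _ _
  · have := hmax ha e he
    rw [hH] at this
    exact h.complete e he this
  · exact (Nat.le_add_right _ _).trans h.card_le

end Levels

namespace RealRAM

open Function (update)

/-- Equality of integers. -/
abbrev Test.natEq (e f : NatExpr) : Test := .and (.natLE e f) (.natLE f e)

/-- Find the smallest weight of an edge incident to the current vertex that exceeds the current
level. -/
def scanProg : Prog := .forLoop nJ (.cell nSize (.const 1))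
  (.ite (.and (.or (.natEq (.cell nEndA (.var nJ)) (.var nX))
        (.natEq (.cell nEndB (.var nJ)) (.var nX)))
      (.and (.realLT (.cell rLev (.var nHigh)) (.cell rWeight (.var nJ)))
        (.or (.natLE (.var nV) (.const 0))
          (.realLT (.cell rWeight (.var nJ)) (.var rBest)))))
    (.block [.setR rBest (.cell rWeight (.var nJ)), .setN nV (.const 1)]) .skip)

/-- Append a level `b` of the current vertex, with the price `c` for going up to it. -/
def growProg (b c : RealExpr) : Prog := .block [
  .setReal rCap (.var nHigh) c,
  .setR rInf (.add (.var rInf) (.cell rCap (.var nHigh))),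
  .setNat nTop (.var nHigh) (.const 0),
  .setReal rLev (.add (.var nHigh) (.const 1)) b,
  .setN nHigh (.add (.var nHigh) (.const 1)),
  .setNat nLast (.var nX) (.add (.cell nLast (.var nX)) (.const 1))]

/-- Start the list of levels of the current vertex with the level `0`. -/
def startProg : Prog := .block [
  .setN nX (.cell nUsed (.var nI)),
  .setNat nBase (.var nX) (.var nHigh),
  .setReal rLev (.var nHigh) (.const 0),
  .setNat nLast (.var nX) (.const 0)]

/-- Complete the list of levels of the current vertex. -/
def finishProg : Prog := .block [
  .setNat nTop (.var nHigh) (.const 1),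
  .setReal rCap (.var nHigh) (.const 0),
  .setN nHigh (.add (.var nHigh) (.const 1))]

/-- Create the levels of the current vertex for the discrete problem. -/
def weightLevelsProg : Prog := .block [
  startProg,
  .ite (.natLE (.var nX) (.const 1)) (.setN nK (.const 0)) (.setN nK (.const 1)),
  .while (.natLE (.const 1) (.var nK)) (.block [
    .setN nV (.const 0),
    scanProg,
    .setN nK (.var nV),
    .ite (.natLE (.var nV) (.const 0)) .skip
      (growProg (.var rBest) (.sub (.var rBest) (.cell rLev (.var nHigh))))]),
  finishProg]

theorem levelsOf_startProg {σ : State} {a : ℕ} (ha : σ.nats nUsed (σ.nats nI 0) = a) :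
    levelsOf (startProg.exec σ) = (levelsOf σ).start a ∧ (startProg.exec σ).nats nX 0 = a := by
  constructor <;>
  simp [startProg, Prog.block, Prog.exec, NatExpr.eval, RealExpr.eval, ha, State.nats_writeNat,
    State.reals_writeReal, levelsOf, Levels.start]

theorem levelsOf_finishProg (σ : State) : levelsOf (finishProg.exec σ) = (levelsOf σ).finish := by
  simp [finishProg, Prog.block, Prog.exec, NatExpr.eval, RealExpr.eval, State.nats_writeNat,
    State.reals_writeReal, levelsOf, Levels.finish]

theorem levelsOf_growProg {σ : State} {a : ℕ} (ha : σ.nats nX 0 = a) {b c : RealExpr} {r t : ℝ}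
    (hc : c.eval σ = t) (hb : b.eval (((σ.writeReal rCap (σ.nats nHigh 0) t).writeReal rInf 0
      (σ.reals rInf 0 + t)).writeNat nTop (σ.nats nHigh 0) 0) = r) :
    levelsOf ((growProg b c).exec σ) = (levelsOf σ).grow a r t := by
  simp [growProg, Prog.block, Prog.exec, NatExpr.eval, RealExpr.eval, State.nats_writeNat,
    State.reals_writeReal, levelsOf, Levels.grow, ha, hb, hc]

theorem ends_scanProg {σ : State} {a : ℕ} (ha : σ.nats nX 0 = a) (hV : σ.nats nV 0 = 0) :
    Ends scanProg σ (100 * (σ.nats nSize 1 + 1)) fun σ' =>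
      (σ'.nats nV 0 = 0 ∧ ∀ e ∈ (levelsOf σ).incident a,
        (levelsOf σ).w e ≤ (levelsOf σ).lev (levelsOf σ).H) ∨
      (σ'.nats nV 0 = 1 ∧ ∃ e ∈ (levelsOf σ).incident a, σ'.reals rBest 0 = (levelsOf σ).w e ∧
        (levelsOf σ).lev (levelsOf σ).H < (levelsOf σ).w e ∧ ∀ e' ∈ (levelsOf σ).incident a,
          (levelsOf σ).lev (levelsOf σ).H < (levelsOf σ).w e' →
            (levelsOf σ).w e ≤ (levelsOf σ).w e') := by
  set w := σ.reals rWeight with hw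
  set c := σ.reals rLev (σ.nats nHigh 0) with hc
  set Inc : ℕ → Prop := fun e => σ.nats nEndA e = a ∨ σ.nats nEndB e = a with hInc
  refine (Ends.forLoop_exec (n := σ.nats nSize 1) (fun k σ' =>
    (σ'.nats nV 0 = 0 ∧ ∀ e < k, Inc e → w e ≤ c) ∨
    (σ'.nats nV 0 = 1 ∧ ∃ e < k, Inc e ∧ σ'.reals rBest 0 = w e ∧ c < w e ∧
      ∀ e' < k, Inc e' → c < w e' → w e ≤ w e')) (by decide) (by decide) ?_ ?_ ?_ ?_).mono le_rfl ?_
  · intro σ' hf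
    simp only [NatExpr.eval]
    rw [hf.nats nSize (by decide)]
  · left
    rw [State.nats_writeNat_ne _ _ _ (by decide)]
    exact ⟨hV, fun e he => absurd he (Nat.not_lt_zero e)⟩
  · intro k σ₁ hk hf hkJ hI
    set σ₂ := Prog.exec _ σ₁ with hσ₂
    rw [State.nats_writeNat_ne _ _ _ (by decide), State.reals_writeNat]
    have hiff : (Test.and (.or (.natEq (.cell nEndA (.var nJ)) (.var nX))
        (.natEq (.cell nEndB (.var nJ)) (.var nX)))
      (.and (.realLT (.cell rLev (.var nHigh)) (.cell rWeight (.var nJ)))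
        (.or (.natLE (.var nV) (.const 0))
          (.realLT (.cell rWeight (.var nJ)) (.var rBest))))).holds σ₁ ↔
        Inc k ∧ c < w k ∧ (σ₁.nats nV 0 = 0 ∨ w k < σ₁.reals rBest 0) := by
      simp only [Test.holds, NatExpr.eval, RealExpr.eval, hkJ]
      rw [hf.nats nEndA (by decide), hf.nats nEndB (by decide), hf.nats nX (by decide),
        hf.nats nHigh (by decide), hf.reals rLev (by decide), hf.reals rWeight (by decide), ha]
      simp only [← le_antisymm_iff, Nat.le_zero, not_and_or, not_not, not_le]
      exact Iff.rfl
    by_cases ht : Inc k ∧ c < w k ∧ (σ₁.nats nV 0 = 0 ∨ w k < σ₁.reals rBest 0)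
    · have h1 : σ₂.nats nV 0 = 1 := by
        rw [hσ₂, Prog.exec, if_pos (hiff.2 ht)]
        simp [Prog.block, Prog.exec, NatExpr.eval]
      have h2 : σ₂.reals rBest 0 = w k := by
        rw [hσ₂, Prog.exec, if_pos (hiff.2 ht)]
        simp [Prog.block, Prog.exec, NatExpr.eval, RealExpr.eval, hkJ]
        rw [hf.reals rWeight (by decide)]
      refine Or.inr ⟨h1, k, Nat.lt_succ_self k, ht.1, h2, ht.2.1, fun e' he' hi hlt => ?_⟩
      rcases (Nat.lt_succ_iff.1 he').eq_or_lt with rfl | he'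
      · exact le_rfl
      · rcases hI with ⟨_, hI⟩ | ⟨h3, e, he, hie, hbe, hce, hmin⟩
        · exact absurd hlt (not_lt.2 (hI e' he' hi))
        · rcases ht.2.2 with h4 | h4
          · omega
          · rw [hbe] at h4
            exact h4.le.trans (hmin e' he' hi hlt)
    · have h1 : σ₂ = σ₁ := by
        rw [hσ₂, Prog.exec, if_neg (mt hiff.1 ht), Prog.exec]
      rw [h1]
      rcases hI with ⟨h3, hI⟩ | ⟨h3, e, he, hie, hbe, hce, hmin⟩
      · refine Or.inl ⟨h3, fun e' he' hi => ?_⟩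
        rcases (Nat.lt_succ_iff.1 he').eq_or_lt with rfl | he'
        · exact not_lt.1 fun hlt => ht ⟨hi, hlt, Or.inl h3⟩
        · exact hI e' he' hi
      · refine Or.inr ⟨h3, e, he.trans (Nat.lt_succ_self k), hie, hbe, hce, fun e' he' hi hlt => ?_⟩
        rcases (Nat.lt_succ_iff.1 he').eq_or_lt with rfl | he'
        · rw [← hbe]
          exact not_lt.1 fun h4 => ht ⟨hi, hlt, Or.inr h4⟩
        · exact hmin e' he' hi hlt
  · rw [mul_comm]
    refine Nat.mul_le_mul_right _ ?_
    decide
  · have hmem : ∀ e, e ∈ (levelsOf σ).incident a ↔ e < σ.nats nSize 1 ∧ Inc e := fun e => by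
      rw [Levels.incident, mem_filter, mem_range]
      exact Iff.rfl
    rintro σ' - (⟨h1, h2⟩ | ⟨h1, e, he, hie, hbe, hce, hmin⟩)
    · exact Or.inl ⟨h1, fun e he => h2 e ((hmem e).1 he).1 ((hmem e).1 he).2⟩
    · exact Or.inr ⟨h1, e, (hmem e).2 ⟨he, hie⟩, hbe, hce, fun e' he' hlt =>
        hmin e' ((hmem e').1 he').1 ((hmem e').1 he').2 hlt⟩

theorem ends_weightLevelsProg {σ : State} {a : ℕ} (ha : σ.nats nUsed (σ.nats nI 0) = a)
    (hw : ∀ e < σ.nats nSize 1, 0 ≤ σ.reals rWeight e) :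
    Ends weightLevelsProg σ (1000 * ((#((levelsOf σ).incident a) + 1) * (σ.nats nSize 1 + 1)))
      fun σ' => (levelsOf σ).AddBlock (levelsOf σ') a ∧ (levelsOf σ').WeightLevels a := by
  set D := levelsOf σ with hD
  set m := σ.nats nSize 1 with hm
  set d := #(D.incident a) with hd
  refine Ends.mono (B := 30 + (20 + (200 * ((d + 1) * (m + 1)) + 10 + 30))) ?_ (by nlinarith)
    fun _ _ h => h
  refine Ends.block_cons (Ends.of_exec (by decide) (by decide) ?_)
  obtain ⟨hlev₁, hX₁⟩ := levelsOf_startProg ha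
  have hf₁ : Frame startProg σ (startProg.exec σ) := Frame.exec (by decide) σ
  set σ₁ := startProg.exec σ with hσ₁
  refine Ends.block_cons (Ends.of_exec (by decide) (by decide) ?_)
  set P₂ : Prog := .ite (.natLE (.var nX) (.const 1)) (.setN nK (.const 0)) (.setN nK (.const 1))
    with hP₂
  set σ₂ := P₂.exec σ₁ with hσ₂
  have hf₂ : Frame P₂ σ₁ σ₂ := Frame.exec (by decide) σ₁
  have hlev₂ : levelsOf σ₂ = D.start a :=
    (hf₂.levelsOf_eq (by decide) (by decide)).trans hlev₁
  have hX₂ : σ₂.nats nX 0 = a := by rw [hf₂.nats nX (by decide), hX₁]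
  have hK₂ : σ₂.nats nK 0 = if a ≤ 1 then 0 else 1 := by
    rw [hσ₂, hP₂]
    by_cases h1 : a ≤ 1 <;> simp [Prog.exec, Test.holds, NatExpr.eval, hX₁, h1]
  have hm₂ : σ₂.nats nSize = σ.nats nSize := by
    rw [hf₂.nats nSize (by decide), hf₁.nats nSize (by decide)]
  clear_value σ₂
  have hpay : ∀ p q : ℕ, p + 1 ≤ q → 3 + (100 * (m + 1) + 80) + 4 + 1 + 200 * (m + 1) * (p + 1) ≤
      200 * (m + 1) * (q + 1) := by
    intro p q h
    have := Nat.mul_le_mul_left (200 * (m + 1)) (Nat.add_le_add_right h 1)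
    nlinarith
  have hinc : ∀ D', D.Building D' a → D'.incident a = D.incident a := fun D' h => by
    simp only [Levels.incident, h.m, h.x, h.y]
  refine Ends.block_cons ((Ends.while_loop 1 one_pos (fun σ' =>
    D.Building (levelsOf σ') a ∧ (levelsOf σ').WeightInv a ∧ σ'.nats nX 0 = a ∧
      σ'.nats nK 0 ≤ 1 ∧ (1 < a ∨ σ'.nats nK 0 = 0) ∧
      (σ'.nats nK 0 = 0 → 1 < a → ∀ e ∈ D.incident a, D.w e ≤
        (levelsOf σ').lev (levelsOf σ').H))
    (fun σ' => 200 * (m + 1) * (#{e ∈ D.incident a | (levelsOf σ').lev (levelsOf σ').H < D.w e} +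
      σ'.nats nK 0)) ?_ ?_ ?_).mono le_rfl ?_)
  · rw [hlev₂]
    refine ⟨D.building_start a, D.weightInv_start a fun e he => ?_, hX₂, ?_, ?_, ?_⟩
    · exact hw e (mem_range.1 (mem_filter.1 he).1)
    · rw [hK₂]
      split_ifs <;> simp
    · rw [hK₂]
      split_ifs with h1
      · exact Or.inr rfl
      · exact Or.inl (by omega)
    · intro h0 h1
      rw [hK₂, if_neg (by omega)] at h0
      exact absurd h0 one_ne_zero
  · rintro σ₃ hf₃ ⟨hb, hinv, hX, hK1, ha1, hfin⟩ ht
    have hK : σ₃.nats nK 0 = 1 := by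
      simp only [Test.holds, NatExpr.eval] at ht
      omega
    have ha1 : 1 < a := by
      rcases ha1 with h | h
      · exact h
      · omega
    have hm₃ : σ₃.nats nSize 1 = m := by rw [hf₃.nats nSize (by decide), hm₂]
    set D₃ := levelsOf σ₃ with hD₃
    have hinc₃ := hinc D₃ hb
    refine ⟨3 + (100 * (m + 1) + 80), ?_⟩
    refine Ends.block_cons (Ends.of_exec (by decide) (by decide) ?_)
    set σ₄ := Prog.exec (.setN nV (.const 0)) σ₃ with hσ₄
    have hf₄ : Frame (.setN nV (.const 0)) σ₃ σ₄ := Frame.exec (by decide) σ₃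
    have hlev₄ : levelsOf σ₄ = D₃ := hf₄.levelsOf_eq (by decide) (by decide)
    have hX₄ : σ₄.nats nX 0 = a := by rw [hf₄.nats nX (by decide), hX]
    have hscan := ends_scanProg (σ := σ₄) hX₄ (by simp [hσ₄, Prog.exec, NatExpr.eval])
    rw [hf₄.nats nSize (by decide), hm₃, hlev₄, hinc₃] at hscan
    clear_value σ₄
    refine Ends.block_cons (hscan.mono le_rfl ?_)
    intro σ₅ hf₅ h₅
    have hlev₅ : levelsOf σ₅ = D₃ := (hf₅.levelsOf_eq (by decide) (by decide)).trans hlev₄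
    have hX₅ : σ₅.nats nX 0 = a := by rw [hf₅.nats nX (by decide), hX₄]
    refine Ends.of_exec (by decide) (by decide) ?_
    set σ₆ := Prog.exec (.setN nK (.var nV)) σ₅ with hσ₆
    have hf₆ : Frame (.setN nK (.var nV)) σ₅ σ₆ := Frame.exec (by decide) σ₅
    have hlev₆ : levelsOf σ₆ = D₃ := (hf₆.levelsOf_eq (by decide) (by decide)).trans hlev₅
    have hX₆ : σ₆.nats nX 0 = a := by rw [hf₆.nats nX (by decide), hX₅]
    have hK₆ : σ₆.nats nK 0 = σ₅.nats nV 0 := by simp [hσ₆, Prog.exec, NatExpr.eval]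
    have hV₆ : σ₆.nats nV 0 = σ₅.nats nV 0 := by rw [hf₆.nats nV (by decide)]
    have hbest₆ : σ₆.reals rBest 0 = σ₅.reals rBest 0 := by rw [hf₆.reals rBest (by decide)]
    change _ ∧ _
    rw [show Prog.exec (.block [.setN nK (.var nV), .ite (.natLE (.var nV) (.const 0)) .skip
      (growProg (.var rBest) (.sub (.var rBest) (.cell rLev (.var nHigh))))]) σ₅ =
      Prog.exec (.ite (.natLE (.var nV) (.const 0)) .skip
      (growProg (.var rBest) (.sub (.var rBest) (.cell rLev (.var nHigh))))) σ₆ from rfl]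
    have hcost : Test.cost (.natLE (.const 1) (.var nK)) = 4 := by decide
    rw [hcost, one_mul]
    rcases h₅ with ⟨hV, hle⟩ | ⟨hV, e, he, hbe, hlt, hmin⟩
    · have hexec : Prog.exec (.ite (.natLE (.var nV) (.const 0)) .skip
          (growProg (.var rBest) (.sub (.var rBest) (.cell rLev (.var nHigh))))) σ₆ = σ₆ := by
        simp [Prog.exec, Test.holds, NatExpr.eval, hV₆, hV]
      rw [hexec, hlev₆, hK₆, hV, hK]
      refine ⟨⟨hb, hinv, hX₆, by omega, Or.inr rfl, fun _ _ e he => ?_⟩, ?_⟩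
      · have := hle e he
        rwa [hb.w] at this
      · ring_nf
        omega
    · set σ₇ := Prog.exec (.ite (.natLE (.var nV) (.const 0)) .skip
          (growProg (.var rBest) (.sub (.var rBest) (.cell rLev (.var nHigh))))) σ₆ with hσ₇
      have hexec : σ₇ =
          (growProg (.var rBest) (.sub (.var rBest) (.cell rLev (.var nHigh)))).exec σ₆ := by
        simp [hσ₇, Prog.exec, Test.holds, NatExpr.eval, hV₆, hV]
      have hf₇ : Frame (growProg (.var rBest) (.sub (.var rBest) (.cell rLev (.var nHigh))))
          σ₆ σ₇ := hexec ▸ Frame.exec (by decide) σ₆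
      have hlev₇ : levelsOf σ₇ = D₃.grow a (D₃.w e) (D₃.w e - D₃.lev D₃.H) := by
        rw [hexec, ← hlev₆]
        refine levelsOf_growProg hX₆ ?_ ?_
        · rw [hlev₆, ← hbe]
          simp only [RealExpr.eval, NatExpr.eval]
          rw [hbest₆, ← hlev₆]
          rfl
        · rw [hlev₆, ← hbe]
          simp [RealExpr.eval, NatExpr.eval, State.reals_writeReal, hbest₆]
      have hH₃ : D₃.H = D₃.base a + D₃.L a := by rw [hb.base_eq, hb.H]
      have hK₇ : σ₇.nats nK 0 = 1 := by rw [hf₇.nats nK (by decide), hK₆, hV]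
      have hlevH : (levelsOf σ₇).lev (levelsOf σ₇).H = D₃.w e := by
        rw [hlev₇]
        exact Function.update_self _ _ _
      rw [hlevH, hK₇, hK, hlev₇]
      refine ⟨⟨hb.grow hlt.le (by linarith) ha1, hinv.grow hH₃ (hinc₃ ▸ he) hlt (hinc₃ ▸ hmin),
        ?_, le_rfl, Or.inl ha1, fun h => absurd h one_ne_zero⟩, ?_⟩
      · rw [hf₇.nats nX (by decide), hX₆]
      · have hcard : #{e' ∈ D.incident a | D₃.w e < D.w e'} + 1 ≤
            #{e' ∈ D.incident a | D₃.lev D₃.H < D.w e'} := by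
          refine card_lt_card ((ssubset_iff_of_subset ?_).2 ⟨e, ?_, ?_⟩)
          · intro e' he'
            rw [mem_filter] at he' ⊢
            exact ⟨he'.1, hlt.trans he'.2⟩
          · exact mem_filter.2 ⟨he, hb.w ▸ hlt⟩
          · rw [hb.w]
            simp
        exact hpay _ _ hcard
  · have h1 : #{e ∈ D.incident a | (levelsOf σ₂).lev (levelsOf σ₂).H < D.w e} + σ₂.nats nK 0 ≤
        d + 1 := by
      refine Nat.add_le_add (card_filter_le _ _) ?_
      rw [hK₂]
      split_ifs <;> simp
    have h2 := Nat.mul_le_mul_left (200 * (m + 1)) h1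
    have hcost : Test.cost (.natLE (.const 1) (.var nK)) = 4 := by decide
    rw [hcost]
    nlinarith
  · rintro σ₃ - ⟨⟨hb, hinv, hX, hK1, ha1, hfin⟩, ht⟩
    have hK : σ₃.nats nK 0 = 0 := by
      simp only [Test.holds, NatExpr.eval] at ht
      omega
    refine Ends.of_exec (by decide) (by decide) ?_
    have : levelsOf (finishProg.exec σ₃) = (levelsOf σ₃).finish := levelsOf_finishProg σ₃
    change D.AddBlock (levelsOf (finishProg.exec σ₃)) a ∧
      (levelsOf (finishProg.exec σ₃)).WeightLevels a
    rw [this]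
    refine ⟨hb.finish, hinv.finish (by rw [hb.base_eq, hb.H]) fun h1 e he => ?_⟩
    rw [hinc _ hb] at he
    have := hfin hK h1 e he
    rwa [hb.w]

end RealRAM


/-! ### Problems with levels and instances -/

theorem Vertex.code_injective {n : ℕ} : Function.Injective (Vertex.code (n := n)) := by
  rintro (_ | _ | u) (_ | _ | v) h <;> simp only [Vertex.code] at h <;> first | rfl | omega | skip
  rw [Fin.ext (show (u : ℕ) = v by omega)]

namespace Levels

variable {n m : ℕ} {I : Instance (Fin n)} {ends : Fin m → Vertex (Fin n) × Vertex (Fin n)}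
  {D : Levels}

/-- The edges of the problem `D` are those of the instance `I`, in the order given by `ends`, and the
used vertices are the terminals and the vertices that are not isolated. -/
structure Represents (D : Levels) (I : Instance (Fin n))
    (ends : Fin m → Vertex (Fin n) × Vertex (Fin n)) : Prop where
  m_eq : D.m = m
  x : ∀ e : Fin m, D.x e = (ends e).1.code
  y : ∀ e : Fin m, D.y e = (ends e).2.code
  w : ∀ e : Fin m, D.w e = I.weight s((ends e).1, (ends e).2)
  used : ∀ a, D.Used a → a = 0 ∨ a = 1 ∨ ∃ e < D.m, D.x e = a ∨ D.y e = a

theorem Represents.used_lt (hr : D.Represents I ends) {a : ℕ} (ha : D.Used a) : a < n + 2 := by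
  have hcode : ∀ v : Vertex (Fin n), v.code < n + 2 := by
    rintro (_ | _ | v) <;> simp [Vertex.code]
  rcases hr.used a ha with rfl | rfl | ⟨e, he, h⟩
  · omega
  · omega
  · rw [hr.m_eq] at he
    have h1 := hr.x ⟨e, he⟩
    have h2 := hr.y ⟨e, he⟩
    rcases h with rfl | rfl
    · exact h1 ▸ hcode _
    · exact h2 ▸ hcode _

theorem Represents.exists_incident (hr : D.Represents I ends) (hends : I.IsEdgeList ends)
    {e : Sym2 (Vertex (Fin n))} {v : Fin n} (he : e ∈ I.graph.incidenceSet (Vertex.inner v)) :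
    ∃ e' ∈ D.incident (v + 2), D.w e' = I.weight e := by
  have h1 : e ∈ Set.range fun k => s((ends k).1, (ends k).2) := by
    rw [hends.2]
    exact he.1
  obtain ⟨k, rfl⟩ := h1
  refine ⟨k, mem_filter.2 ⟨mem_range.2 (hr.m_eq ▸ k.2), ?_⟩, hr.w k⟩
  rw [hr.x, hr.y]
  rcases Sym2.mem_iff.1 he.2 with h | h
  · exact Or.inl (by rw [← h]; rfl)
  · exact Or.inr (by rw [← h]; rfl)

theorem Represents.incident_weight (hr : D.Represents I ends) (hends : I.IsEdgeList ends)
    {e : ℕ} {v : Fin n} (he : e ∈ D.incident (v + 2)) :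
    ∃ e' ∈ I.graph.incidenceSet (Vertex.inner v), D.w e = I.weight e' := by
  rw [incident, mem_filter, mem_range, hr.m_eq] at he
  obtain ⟨hem, h⟩ := he
  refine ⟨_, ⟨?_, ?_⟩, hr.w ⟨e, hem⟩⟩
  · rw [← hends.2]
    exact ⟨⟨e, hem⟩, rfl⟩
  · have h1 := hr.x ⟨e, hem⟩
    have h2 := hr.y ⟨e, hem⟩
    have hc : (v : ℕ) + 2 = (Vertex.inner v).code := rfl
    rw [hc] at h
    rcases h with h | h
    · exact Sym2.mem_iff.2 (Or.inl (Vertex.code_injective (h.symm.trans h1)))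
    · exact Sym2.mem_iff.2 (Or.inr (Vertex.code_injective (h.symm.trans h2)))

theorem Represents.weight_nonneg (hr : D.Represents I ends) (hends : I.IsEdgeList ends) :
    ∀ e < D.m, 0 ≤ D.w e := by
  intro e he
  rw [hr.m_eq] at he
  rw [hr.w ⟨e, he⟩]
  refine I.weight_nonneg _ ?_
  rw [← hends.2]
  exact ⟨⟨e, he⟩, rfl⟩

variable (hD : D.WF) (hr : D.Represents I ends) (hends : I.IsEdgeList ends)

include hr hends in
theorem Represents.leftStep_iff {P : ℕ → ℝ} {p : Fin n → ℝ}
    (hP : ∀ e : Fin m, P (ends e).1.code = extendPower p (ends e).1 ∧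
      P (ends e).2.code = extendPower p (ends e).2) (a b : ℕ) :
    leftStep D.m D.x D.y D.w P a b ↔
      ∃ u v, Vertex.code u = a ∧ Vertex.code v = b ∧ (I.remaining p).Adj u v := by
  constructor
  · rintro ⟨e, he, h, hlt⟩
    rw [hr.m_eq] at he
    have hx := hr.x ⟨e, he⟩
    have hy := hr.y ⟨e, he⟩
    have hw := hr.w ⟨e, he⟩
    have hadj : I.graph.Adj (ends ⟨e, he⟩).1 (ends ⟨e, he⟩).2 := by
      rw [← SimpleGraph.mem_edgeSet, ← hends.2]
      exact ⟨⟨e, he⟩, rfl⟩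
    obtain ⟨h1, h2⟩ := hP ⟨e, he⟩
    simp only at hx hy hw
    have hrem : (I.remaining p).Adj (ends ⟨e, he⟩).1 (ends ⟨e, he⟩).2 := by
      refine ⟨hadj, ?_⟩
      rw [← h1, ← h2, ← hw, ← hx, ← hy]
      rcases h with ⟨rfl, rfl⟩ | ⟨rfl, rfl⟩
      · exact hlt
      · rw [add_comm]; exact hlt
    rcases h with ⟨rfl, rfl⟩ | ⟨rfl, rfl⟩
    · exact ⟨_, _, hx.symm, hy.symm, hrem⟩
    · exact ⟨_, _, hy.symm, hx.symm, hrem.symm⟩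
  · rintro ⟨u, v, rfl, rfl, hadj, hlt⟩
    have h1 : s(u, v) ∈ Set.range fun k => s((ends k).1, (ends k).2) := by
      rw [hends.2]
      exact hadj
    obtain ⟨e, he⟩ := h1
    have hw := hr.w e
    obtain ⟨h1, h2⟩ := hP e
    rw [show s((ends e).1, (ends e).2) = s(u, v) from he] at hw
    refine ⟨e, hr.m_eq ▸ e.2, ?_, ?_⟩
    · rw [hr.x, hr.y]
      rcases Sym2.eq_iff.1 he with ⟨h, h'⟩ | ⟨h, h'⟩
      · exact Or.inl ⟨by rw [h], by rw [h']⟩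
      · exact Or.inr ⟨by rw [h], by rw [h']⟩
    · rw [hw]
      rcases Sym2.eq_iff.1 he with ⟨rfl, rfl⟩ | ⟨rfl, rfl⟩
      · rw [h1, h2]; exact hlt
      · rw [h1, h2]; exact hlt

include hD hr hends in
/-- A choice of levels is feasible if and only if the corresponding power assignment is so. -/
theorem Represents.feasible_iff {k : ℕ → ℕ} {p : Fin n → ℝ}
    (hk : ∀ a, D.Used a → k a ≤ D.L a) (hp : ∀ v, 0 ≤ p v)
    (hzero : ∀ a ≤ 1, D.lev (D.base a) = 0)
    (hkp : ∀ v : Fin n, D.Used (v + 2) → D.lev (D.base (v + 2) + k (v + 2)) = p v) :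
    D.Feasible k ↔ I.IsFeasible p := by
  have hpow : ∀ v : Vertex (Fin n), D.Used v.code →
      D.lev (D.base v.code + k v.code) = extendPower p v := by
    have h01 : ∀ a ≤ 1, D.Used a → D.lev (D.base a + k a) = 0 := by
      intro a ha hu
      have h1 := hk a hu
      have h2 : D.L a = 0 := by
        interval_cases a
        · exact hD.L_zero
        · exact hD.L_one
      rw [show k a = 0 by omega, add_zero, hzero a ha]
    rintro (_ | _ | v) hu
    · exact h01 0 (by omega) hu
    · exact h01 1 (by omega) hu
    · exact hkp v hu
  have hstep := hr.leftStep_iff hends (P := fun a => D.lev (D.base a + k a)) (p := p) fun e =>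
    ⟨hpow _ (hr.x e ▸ hD.used_x e (hr.m_eq ▸ e.2)), hpow _ (hr.y e ▸ hD.used_y e (hr.m_eq ▸ e.2))⟩
  have hreach : Relation.ReflTransGen (leftStep D.m D.x D.y D.w fun a => D.lev (D.base a + k a)) 0 1
      ↔ (I.remaining p).Reachable Vertex.s Vertex.t := by
    rw [SimpleGraph.reachable_iff_reflTransGen]
    constructor
    · intro h
      have key : ∀ b, Relation.ReflTransGen
          (leftStep D.m D.x D.y D.w fun a => D.lev (D.base a + k a)) 0 b →
          ∃ v, Vertex.code v = b ∧ Relation.ReflTransGen (I.remaining p).Adj Vertex.s v := by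
        intro b hb
        induction hb with
        | refl => exact ⟨Vertex.s, rfl, .refl⟩
        | tail _ hbc ih =>
          obtain ⟨v, hv, hsv⟩ := ih
          obtain ⟨u, w, hu, hw, huw⟩ := (hstep _ _).1 hbc
          rw [← hv] at hu
          rw [Vertex.code_injective hu] at huw
          exact ⟨w, hw, hsv.tail huw⟩
      obtain ⟨v, hv, hsv⟩ := key 1 h
      have : v = Vertex.t := Vertex.code_injective (hv.trans rfl)
      rwa [← this]
    · intro h
      exact Relation.ReflTransGen.lift Vertex.code
        (fun u v huv => (hstep _ _).2 ⟨u, v, rfl, rfl, huv⟩) _ _ h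
  rw [Feasible, Instance.IsFeasible, hreach]
  exact ⟨fun h => ⟨hp, h.2⟩, fun h => ⟨hk, h.2⟩⟩

include hD hr in
open Classical in
/-- Sums over the used vertices are sums over `V`. -/
theorem Represents.sum_used {M : Type*} [AddCommMonoid M] (f : ℕ → M) (h₀ : f 0 = 0)
    (h₁ : f 1 = 0) :
    ∑ i ∈ range D.n, f (D.vl i) = ∑ v : Fin n, if D.Used (v + 2) then f (v + 2) else 0 := by
  have h2 : ∑ i ∈ range D.n, f (D.vl i) = ∑ a ∈ range (n + 2) with D.Used a, f a := by
    refine sum_bij (fun i _ => D.vl i) (fun i hi => ?_) (fun i hi j hj h => ?_) (fun a ha => ?_)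
      fun _ _ => rfl
    · have hu : D.Used (D.vl i) := ⟨i, mem_range.1 hi, rfl⟩
      exact mem_filter.2 ⟨mem_range.2 (hr.used_lt hu), hu⟩
    · exact hD.vl_inj i (mem_range.1 hi) j (mem_range.1 hj) h
    · obtain ⟨i, hi, hia⟩ := (mem_filter.1 ha).2
      exact ⟨i, mem_range.2 hi, hia⟩
  rw [h2, sum_filter, sum_range_succ', sum_range_succ']
  simp only [zero_add, h₀, h₁, ite_self, add_zero]
  exact (Fin.sum_univ_eq_sum_range (fun v => if D.Used (v + 1 + 1) then f (v + 1 + 1) else 0) n).symm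

theorem WeightLevels.lev_nonneg {a : ℕ} (h : D.WeightLevels a) (hD : D.WF) (ha : D.Used a) {j : ℕ}
    (hj : j ≤ D.L a) : 0 ≤ D.lev (D.base a + j) := by
  have := hD.lev_mono a ha 0 j (Nat.zero_le _) hj
  rwa [add_zero, h.lev_zero] at this

theorem WeightLevels.sum_cap {a : ℕ} (h : D.WeightLevels a) {j : ℕ} (hj : j ≤ D.L a) :
    ∑ i ∈ range j, D.cap (D.base a + i) = D.lev (D.base a + j) := by
  rw [sum_congr rfl fun i hi => h.cap_eq i ((mem_range.1 hi).trans_le hj),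
    sum_range_sub fun i => D.lev (D.base a + i), add_zero, h.lev_zero, sub_zero]

include hD hr hends in
/-- The cheapest choice of levels for the discrete problem costs `discreteOpt`. -/
theorem Represents.discreteOpt_eq (hQ : ∀ a, D.Used a → D.WeightLevels a) (hI : I.Solvable) :
    (∃ k, D.Feasible k) ∧ ∀ c, (∀ k, D.Feasible k → c ≤ D.cost k) →
      (∃ k, D.Feasible k ∧ D.cost k = c) → c = I.discreteOpt := by
  classical
  have hzero : ∀ a ≤ 1, D.lev (D.base a) = 0 := by
    intro a ha
    interval_cases a
    · exact (hQ 0 hD.used_zero).lev_zero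
    · exact (hQ 1 hD.used_one).lev_zero
  have hcost : ∀ k, (∀ a, D.Used a → k a ≤ D.L a) → D.cost k = ∑ v : Fin n,
      if D.Used (v + 2) then D.lev (D.base (v + 2) + k (v + 2)) else 0 := by
    intro k hk
    have h1 : D.cost k = ∑ i ∈ range D.n, D.lev (D.base (D.vl i) + k (D.vl i)) := by
      refine sum_congr rfl fun i hi => ?_
      have hu : D.Used (D.vl i) := ⟨i, mem_range.1 hi, rfl⟩
      exact (hQ _ hu).sum_cap (hk _ hu)
    have hk0 := hk 0 hD.used_zero
    have hk1 := hk 1 hD.used_one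
    rw [hD.L_zero] at hk0
    rw [hD.L_one] at hk1
    rw [h1, hr.sum_used hD (fun a => D.lev (D.base a + k a))]
    · rw [Nat.le_zero.1 hk0, add_zero, hzero 0 (by omega)]
    · rw [Nat.le_zero.1 hk1, add_zero, hzero 1 le_rfl]
  obtain ⟨⟨p, hpf, hpd, hp⟩, hleast⟩ := I.isLeast_discreteOpt hI
  obtain ⟨k, hkf, hkc⟩ : ∃ k, D.Feasible k ∧ D.cost k ≤ I.discreteOpt := by
    have hex : ∀ a, ∃ j, D.Used a → j ≤ D.L a ∧
        ∀ v : Fin n, a = v + 2 → D.lev (D.base a + j) = p v := by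
      intro a
      by_cases ha : ∃ v : Fin n, a = v + 2
      · obtain ⟨v, rfl⟩ := ha
        by_cases hu : D.Used (v + 2)
        · have key : ∃ j ≤ D.L (v + 2), D.lev (D.base (v + 2) + j) = p v := by
            rcases hpd v with h0 | ⟨e, he, hpe⟩
            · exact ⟨0, Nat.zero_le _, by rw [add_zero, (hQ _ hu).lev_zero, h0]⟩
            · obtain ⟨e', he', hw⟩ := hr.exists_incident hends he
              obtain ⟨j, hj, hje⟩ := (hQ _ hu).complete (by omega) e' he'
              exact ⟨j, hj, by rw [← hje, hw, hpe]⟩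
          obtain ⟨j, hj, hje⟩ := key
          exact ⟨j, fun _ => ⟨hj, fun u hu => by rw [hje, Fin.ext (show (u : ℕ) = v by omega)]⟩⟩
        · exact ⟨0, fun h => absurd h hu⟩
      · exact ⟨0, fun _ => ⟨Nat.zero_le _, fun v hv => absurd ⟨v, hv⟩ ha⟩⟩
    choose k hk using hex
    refine ⟨k, (hr.feasible_iff hD hends (fun a ha => (hk a ha).1) hpf.1 hzero
      fun v hv => (hk _ hv).2 v rfl).2 hpf, ?_⟩
    rw [hcost k fun a ha => (hk a ha).1, hp]
    refine sum_le_sum fun v _ => ?_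
    split_ifs with hu
    · exact ((hk _ hu).2 v rfl).le
    · exact hpf.1 v
  refine ⟨⟨k, hkf⟩, fun c hmin hc => le_antisymm ((hmin k hkf).trans hkc) ?_⟩
  obtain ⟨l, hlf, rfl⟩ := hc
  refine hleast ⟨fun v => if D.Used (v + 2) then D.lev (D.base (v + 2) + l (v + 2)) else 0, ?_, ?_,
    hcost l hlf.1⟩
  · refine (hr.feasible_iff hD hends hlf.1 (fun v => ?_) hzero fun v hv => ?_).1 hlf
    · split_ifs with hu
      · exact (hQ _ hu).lev_nonneg hD hu (hlf.1 _ hu)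
      · exact le_rfl
    · rw [if_pos hv]
  · intro v
    show (if D.Used (v + 2) then D.lev (D.base (v + 2) + l (v + 2)) else 0) = 0 ∨ _
    by_cases hu : D.Used (v + 2)
    · simp only [if_pos hu]
      rcases hj : l (v + 2) with _ | j
      · exact Or.inl (by rw [add_zero, (hQ _ hu).lev_zero])
      · have := hlf.1 _ hu
        obtain ⟨e, he, hle⟩ := (hQ _ hu).weight j (by omega)
        obtain ⟨e', he', hw⟩ := hr.incident_weight hends he
        exact Or.inr ⟨e', he', by rw [hle, hw]⟩
    · exact Or.inl (if_neg hu)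

end Levels


/-! ### Computing the discrete optimum -/

namespace Levels

variable {D : Levels}

theorem sum_card_fiber_le (U s : Finset ℕ) (f : ℕ → ℕ) : ∑ a ∈ U, #{e ∈ s | f e = a} ≤ #s := by
  rw [← card_biUnion]
  · exact card_le_card (biUnion_subset.2 fun a _ => filter_subset _ _)
  · intro a _ b _ hab
    rw [Function.onFun, disjoint_filter]
    rintro e _ rfl h
    exact hab h

theorem sum_card_incident_le (D : Levels) (U : Finset ℕ) : ∑ a ∈ U, #(D.incident a) ≤ 2 * D.m := by
  calc ∑ a ∈ U, #(D.incident a)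
      ≤ ∑ a ∈ U, (#{e ∈ range D.m | D.x e = a} + #{e ∈ range D.m | D.y e = a}) := by
        refine sum_le_sum fun a _ => ?_
        rw [incident, filter_or]
        exact card_union_le _ _
    _ ≤ #(range D.m) + #(range D.m) := by
        rw [sum_add_distrib]
        exact Nat.add_le_add (sum_card_fiber_le _ _ _) (sum_card_fiber_le _ _ _)
    _ = 2 * D.m := by rw [card_range, two_mul]

theorem card_incident_le (D : Levels) (a : ℕ) : #(D.incident a) ≤ D.m :=
  (card_filter_le _ _).trans (card_range _).le

theorem WF.sum_card_incident_le (hD : D.WF) : ∑ i ∈ range D.n, #(D.incident (D.vl i)) ≤ 2 * D.m := by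
  rw [← sum_image (f := fun a => #(D.incident a)) (g := D.vl) (s := range D.n)
    fun i hi j hj h => hD.vl_inj i (mem_range.1 hi) j (mem_range.1 hj) h]
  exact D.sum_card_incident_le _

theorem WF.H_le (hD : D.WF) (hL : ∀ a, D.Used a → D.L a ≤ #(D.incident a)) :
    D.H ≤ 2 * D.m + D.n := by
  rw [hD.H_eq, sum_add_distrib, sum_const, card_range, smul_eq_mul, mul_one]
  refine Nat.add_le_add_right (le_trans (sum_le_sum fun i hi => ?_) hD.sum_card_incident_le) _
  exact hL _ ⟨i, mem_range.1 hi, rfl⟩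

/-- In a simple graph, the sum over the edges of the smaller one of the degrees of the two ends is at
most `3 m h` for `h ^ 2 ≥ 2 m`: an edge with an end of degree at most `h` contributes at most `h`, and
there are at most `h` vertices of larger degree. -/
theorem WF.edgeSize_le (hD : D.WF) (hL : ∀ a, D.Used a → D.L a ≤ #(D.incident a))
    (hsimple : ∀ e < D.m, ∀ e' < D.m, D.x e = D.x e' → D.y e = D.y e' → e = e') {h : ℕ}
    (h0 : 0 < h) (hh : 2 * D.m ≤ h * h) : D.edgeSize D.m ≤ D.m + 3 * D.m * h := by
  classical
  set U := (range D.n).image D.vl with hU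
  have hmem : ∀ a, a ∈ U ↔ D.Used a := fun a => by
    simp [hU, Used]
  set d := fun a => #(D.incident a) with hd
  set V := {a ∈ U | h < d a} with hV
  have hVcard : #V ≤ h := by
    have h1 : #V * h ≤ ∑ a ∈ V, d a := by
      rw [← smul_eq_mul]
      exact card_nsmul_le_sum _ _ _ fun a ha => (mem_filter.1 ha).2.le
    have h2 := h1.trans ((D.sum_card_incident_le V).trans hh)
    exact Nat.le_of_mul_le_mul_right h2 h0
  have hterm : ∀ e ∈ range D.m, min (D.L (D.x e)) (D.L (D.y e)) ≤
      h + ∑ b ∈ V, if D.y e = b then d (D.x e) else 0 := by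
    intro e he
    rw [mem_range] at he
    have hux := hD.used_x e he
    have huy := hD.used_y e he
    rw [sum_ite_eq]
    split_ifs with hy
    · exact (min_le_left _ _).trans ((hL _ hux).trans (Nat.le_add_left _ _))
    · have : d (D.y e) ≤ h := by
        by_contra hlt
        exact hy (mem_filter.2 ⟨(hmem _).2 huy, not_le.1 hlt⟩)
      exact (min_le_right _ _).trans ((hL _ huy).trans this)
  have hrow : ∀ b ∈ V, ∑ e ∈ range D.m, (if D.y e = b then d (D.x e) else 0) ≤ 2 * D.m := by
    intro b _
    rw [← sum_filter, ← sum_image (f := d) (g := D.x)]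
    · exact D.sum_card_incident_le _
    · intro e he e' he' hx
      have he := mem_filter.1 (mem_coe.1 he)
      have he' := mem_filter.1 (mem_coe.1 he')
      exact hsimple e (mem_range.1 he.1) e' (mem_range.1 he'.1) hx (he.2.trans he'.2.symm)
  calc D.edgeSize D.m = ∑ e ∈ range D.m, min (D.L (D.x e)) (D.L (D.y e)) + D.m := by
        rw [edgeSize, sum_add_distrib, sum_const, card_range, smul_eq_mul, mul_one]
    _ ≤ ∑ e ∈ range D.m, (h + ∑ b ∈ V, if D.y e = b then d (D.x e) else 0) + D.m :=
        Nat.add_le_add_right (sum_le_sum hterm) _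
    _ = D.m * h + ∑ b ∈ V, (∑ e ∈ range D.m, if D.y e = b then d (D.x e) else 0) + D.m := by
        rw [sum_add_distrib, sum_const, card_range, smul_eq_mul, sum_comm]
    _ ≤ D.m * h + #V * (2 * D.m) + D.m := by
        gcongr
        rw [← smul_eq_mul]
        exact sum_le_card_nsmul _ _ _ hrow
    _ ≤ D.m + 3 * D.m * h := by
        have := Nat.mul_le_mul_right (2 * D.m) hVcard
        nlinarith

end Levels

namespace RealRAM

theorem flowBound_mono {κ K R N N' M M' : ℕ} (hN : N ≤ N') (hM : M ≤ M') :
    flowBound κ K R N M ≤ flowBound κ K R N' M' := by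
  unfold flowBound
  gcongr

variable {n m : ℕ} {I : Instance (Fin n)} {ends : Fin m → Vertex (Fin n) × Vertex (Fin n)}

/-- The memory holds the instance. -/
structure Holds (σ : State) (I : Instance (Fin n))
    (ends : Fin m → Vertex (Fin n) × Vertex (Fin n)) : Prop where
  n_eq : σ.nats nSize 0 = n
  m_eq : σ.nats nSize 1 = m
  endA : ∀ e : Fin m, σ.nats nEndA e = (ends e).1.code
  endB : ∀ e : Fin m, σ.nats nEndB e = (ends e).2.code
  weight : ∀ e : Fin m, σ.reals rWeight e = I.weight s((ends e).1, (ends e).2)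

theorem holds_input (I : Instance (Fin n)) (ends : Fin m → Vertex (Fin n) × Vertex (Fin n))
    (ε : ℝ) : Holds (I.input ends ε) I ends := by
  constructor <;> simp [Instance.input]

/-- The vertices that occur in the input, and the terminals. -/
def Occurring (σ : State) : Set ℕ :=
  {v | v = 0 ∨ v = 1 ∨ ∃ e < σ.nats nSize 1, σ.nats nEndA e = v ∨ σ.nats nEndB e = v}

theorem Holds.frame {P : Prog} {σ σ' : State} (h : Holds σ I ends) (hf : Frame P σ σ')
    (hn : ∀ a ∈ [nSize, nEndA, nEndB], a ∉ P.natWrites) (hr : rWeight ∉ P.realWrites) :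
    Holds σ' I ends ∧ Occurring σ' = Occurring σ := by
  have h0 := hf.nats nSize (hn _ (by decide))
  have h1 := hf.nats nEndA (hn _ (by decide))
  have h2 := hf.nats nEndB (hn _ (by decide))
  have h3 := hf.reals rWeight hr
  constructor
  · exact ⟨h0 ▸ h.n_eq, h0 ▸ h.m_eq, h1 ▸ h.endA, h2 ▸ h.endB, h3 ▸ h.weight⟩
  · simp only [Occurring, h0, h1, h2]

theorem Holds.represents {σ : State} (h : Holds σ I ends) (hu : UsedList σ (Occurring σ)) :
    (levelsOf σ).Represents I ends :=
  ⟨h.m_eq, h.endA, h.endB, h.weight, fun a ha => (hu.mem_iff a).2 ha⟩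

theorem Holds.simple {σ : State} (h : Holds σ I ends) (hends : I.IsEdgeList ends) :
    ∀ e < (levelsOf σ).m, ∀ e' < (levelsOf σ).m, (levelsOf σ).x e = (levelsOf σ).x e' →
      (levelsOf σ).y e = (levelsOf σ).y e' → e = e' := by
  intro e he e' he' hx hy
  have hm : (levelsOf σ).m = m := h.m_eq
  rw [hm] at he he'
  have hx' : (ends ⟨e, he⟩).1.code = (ends ⟨e', he'⟩).1.code :=
    (h.endA ⟨e, he⟩).symm.trans (hx.trans (h.endA ⟨e', he'⟩))
  have hy' : (ends ⟨e, he⟩).2.code = (ends ⟨e', he'⟩).2.code :=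
    (h.endB ⟨e, he⟩).symm.trans (hy.trans (h.endB ⟨e', he'⟩))
  have := hends.1 (a₁ := ⟨e, he⟩) (a₂ := ⟨e', he'⟩) (by
    simp only [Vertex.code_injective hx', Vertex.code_injective hy'])
  exact congrArg Fin.val this

/-- Compute the optimum of the discrete problem, which becomes the excess of the sink. -/
def discreteProg : Prog := .block [
  collectProg,
  levelsProg weightLevelsProg,
  .setR rQuant (.var rInf),
  solveProg]

/-- The threshold `K` for the number of highest active nodes and the degree threshold `h` occur in the
time bound, but not in the program. -/
theorem ends_discreteProg {σ : State} (hσ : Holds σ I ends) (hends : I.IsEdgeList ends)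
    (hI : I.Solvable) (hmark : ∀ v, σ.nats nMark v = 0) {h K B : ℕ} (h0 : 0 < h)
    (hh : 2 * m ≤ h * h) (hK : 0 < K)
    (hB : 200 * (flowBound 1 K 1 (8 * (m + 1)) (24 * (m + 1) + 4 * (m + 3 * m * h)) + K) ≤ K * B) :
    Ends discreteProg σ (40000 * ((m + 1) * (m + 1) * (h + 1)) + B) fun σ' =>
      σ'.reals rExc 1 = I.discreteOpt ∧ UsedList σ' (Occurring σ') ∧
        σ'.nats nCount 0 ≤ 2 * m + 2 := by
  have hm := hσ.m_eq
  refine Ends.mono (B := 200 * (m + 1) + (5000 * ((m + 1) * (m + 1)) + (4 +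
    (8000 * (m + 1) + 12000 * ((m + 1) * (m + 1) * (h + 1)) + B)))) ?_ ?_ fun _ _ h => h
  swap
  · have h1 : m + 1 ≤ (m + 1) * (m + 1) := Nat.le_mul_of_pos_left _ (Nat.succ_pos m)
    have h2 : (m + 1) * (m + 1) ≤ (m + 1) * (m + 1) * (h + 1) :=
      Nat.le_mul_of_pos_right _ (Nat.succ_pos h)
    omega
  have hcol := ends_collectProg hmark
  rw [hm] at hcol
  refine Ends.block_cons (hcol.mono le_rfl ?_)
  rintro σ₁ hf₁ ⟨hu₁, hcount₁⟩
  obtain ⟨hσ₁, hocc₁⟩ := hσ.frame hf₁ (by decide) (by decide)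
  have hu₁ : UsedList σ₁ (Occurring σ₁) := by
    rw [hocc₁, Occurring, hm]
    exact hu₁
  have hr₁ := hσ₁.represents hu₁
  have hinc : ∀ σ' : State, σ'.nats nSize = σ₁.nats nSize → σ'.nats nEndA = σ₁.nats nEndA →
      σ'.nats nEndB = σ₁.nats nEndB → (levelsOf σ').incident = (levelsOf σ₁).incident := by
    intro σ' h1 h2 h3
    funext a
    ext e
    rw [Levels.incident, Levels.incident, mem_filter, mem_filter, mem_range, mem_range]
    simp only [levelsOf, h1, h2, h3]
  have hw₁ : ∀ e < σ₁.nats nSize 1, 0 ≤ σ₁.reals rWeight e := hr₁.weight_nonneg hends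
  have hsumd : ∑ i ∈ range (σ₁.nats nCount 0), #((levelsOf σ₁).incident (σ₁.nats nUsed i)) ≤
      2 * m := by
    rw [← sum_image (f := fun a => #((levelsOf σ₁).incident a)) (g := σ₁.nats nUsed)
      fun i hi j hj h => hu₁.inj i (mem_range.1 hi) j (mem_range.1 hj) h]
    refine ((levelsOf σ₁).sum_card_incident_le _).trans_eq ?_
    rw [hr₁.m_eq]
  refine Ends.block_cons ((ends_levelsProg (σ := σ₁) (P := weightLevelsProg)
    (fun D a => D.WeightLevels a)
    (fun i => 1000 * ((#((levelsOf σ₁).incident (σ₁.nats nUsed i)) + 1) * (m + 1)))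
    (B := 5000 * ((m + 1) * (m + 1))) hu₁ (by decide) (by decide)
    (fun D D' a hs hm hx hy hw h => h.congr hs hm hx hy hw) ?_ ?_).mono le_rfl ?_)
  · intro i hi σ₂ hf₂ hiI
    have hused : σ₂.nats nUsed = σ₁.nats nUsed := hf₂.nats _ (by decide)
    have hsize : σ₂.nats nSize = σ₁.nats nSize := hf₂.nats _ (by decide)
    have := ends_weightLevelsProg (σ := σ₂) (a := σ₁.nats nUsed i) (by rw [hiI, hused]) (by
      rw [hsize, hf₂.reals rWeight (by decide)]
      exact hw₁)
    rw [hinc σ₂ hsize (hf₂.nats _ (by decide)) (hf₂.nats _ (by decide)), hsize, hσ₁.m_eq] at this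
    exact this
  · have h1 : ∑ i ∈ range (σ₁.nats nCount 0),
        (1000 * ((#((levelsOf σ₁).incident (σ₁.nats nUsed i)) + 1) * (m + 1)) + 14) =
        1000 * (m + 1) * ∑ i ∈ range (σ₁.nats nCount 0),
          #((levelsOf σ₁).incident (σ₁.nats nUsed i)) +
          (1000 * (m + 1) + 14) * σ₁.nats nCount 0 := by
      rw [mul_sum]
      rw [show (1000 * (m + 1) + 14) * σ₁.nats nCount 0 = ∑ i ∈ range (σ₁.nats nCount 0),
        (1000 * (m + 1) + 14) by rw [sum_const, card_range, smul_eq_mul, mul_comm],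
        ← sum_add_distrib]
      exact sum_congr rfl fun i _ => by ring
    rw [h1]
    have h2 := Nat.mul_le_mul_left (1000 * (m + 1)) hsumd
    have h3 := Nat.mul_le_mul_left (1000 * (m + 1) + 14) hcount₁
    nlinarith
  rintro σ₂ hf₂ ⟨hwf, hQ, -⟩
  obtain ⟨hσ₂, hocc₂⟩ := hσ₁.frame hf₂ (by decide) (by decide)
  have hu₂ : UsedList σ₂ (Occurring σ₂) := by
    rw [hocc₂]
    exact hu₁.congr fun a ha => hf₂.nats a (by revert a; decide)
  have hcount₂ : σ₂.nats nCount 0 ≤ 2 * m + 2 := by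
    rw [hf₂.nats nCount (by decide)]
    exact hcount₁
  refine Ends.block_cons (Ends.of_exec (by decide) (by decide) ?_)
  set P₃ : Prog := .setR rQuant (.var rInf) with hP₃
  set σ₃ := P₃.exec σ₂ with hσ₃def
  have hf₃ : Frame P₃ σ₂ σ₃ := Frame.exec (by decide) σ₂
  have hlev : levelsOf σ₃ = levelsOf σ₂ := hf₃.levelsOf_eq (by decide) (by decide)
  have hq₃ : σ₃.reals rQuant 0 = σ₃.reals rInf 0 := by
    simp [hσ₃def, hP₃, Prog.exec, RealExpr.eval, NatExpr.eval, State.reals_writeReal]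
  obtain ⟨hσ₃, hocc₃⟩ := hσ₂.frame hf₃ (by decide) (by decide)
  have hu₃ : UsedList σ₃ (Occurring σ₃) := by
    rw [hocc₃]
    exact hu₂.congr fun a ha => hf₃.nats a (by revert a; decide)
  have hcount₃ : σ₃.nats nCount 0 ≤ 2 * m + 2 := by
    rw [hf₃.nats nCount (by decide)]
    exact hcount₂
  clear_value σ₃
  rw [← hlev] at hwf hQ
  have hr₃ := hσ₃.represents hu₃
  obtain ⟨hex, hopt⟩ := hr₃.discreteOpt_eq hwf hends hQ hI
  have hL : ∀ a, (levelsOf σ₃).Used a → (levelsOf σ₃).L a ≤ #((levelsOf σ₃).incident a) :=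
    fun a ha => (hQ a ha).L_le
  have hm₃ : (levelsOf σ₃).m = m := hr₃.m_eq
  have hH : (levelsOf σ₃).H ≤ 4 * (m + 1) := by
    have h1 := hwf.H_le hL
    rw [hm₃] at h1
    have h2 : (levelsOf σ₃).n ≤ 2 * m + 2 := hcount₃
    omega
  have hE : (levelsOf σ₃).edgeSize m ≤ m + 3 * m * h := by
    have := hwf.edgeSize_le hL (hσ₃.simple hends) h0 (by rw [hm₃]; exact hh)
    rwa [hm₃] at this
  have hsolve := ends_solveProg (σ := σ₃) (κ := 1) (K := K) (R := 1) (B := B) (Λ := m) hwf hex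
    (by rw [hq₃]; exact hwf.B_pos) (by rw [hq₃, Nat.cast_one, one_mul]) (Or.inl le_rfl) hK
    (fun a ha => (hL a ha).trans (((levelsOf σ₃).card_incident_le a).trans hm₃.le)) (by
      refine le_trans (Nat.mul_le_mul_left _ (Nat.add_le_add_right (flowBound_mono ?_ ?_) _)) hB
      · omega
      · rw [hσ₃.m_eq]
        omega)
  rw [hσ₃.m_eq] at hsolve
  refine hsolve.mono ?_ ?_
  · have h1 : (m + 2) * ((levelsOf σ₃).edgeSize m + 1) ≤ (m + 2) * (m + 3 * m * h + 1) :=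
      Nat.mul_le_mul_left _ (Nat.add_le_add_right hE 1)
    have h2 : (m + 2) * (m + 3 * m * h + 1) ≤ 6 * ((m + 1) * (m + 1) * (h + 1)) := by
      nlinarith [Nat.zero_le (m * h), Nat.zero_le (m * m * h), Nat.zero_le (m * m), Nat.zero_le m,
        Nat.zero_le h]
    omega
  · rintro σ₄ hf₄ ⟨hcut, -⟩
    refine ⟨hopt _ hcut.le_cost hcut.exists_cost, ?_, ?_⟩
    · rw [(hσ₃.frame hf₄ (by decide) (by decide)).2]
      exact hu₃.congr fun a ha => hf₄.nats a (by revert a; decide)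
    · rw [hf₄.nats nCount (by decide)]
      exact hcount₃

/-- For `m` of the order `b ^ 4` and `K = b ^ 3`, the potential is `O(b ^ 14)`, and so the number of steps
is `O(b ^ 11)`, that is, `O(m ^ 2.75)`. -/
theorem flowBound_discrete_le {b m : ℕ} (hb : 1 ≤ b) (hm : m + 1 ≤ (b + 1) ^ 4) :
    200 * (flowBound 1 (b ^ 3) 1 (8 * (m + 1)) (24 * (m + 1) + 4 * (m + 3 * m * (8 * b ^ 2))) +
      b ^ 3) ≤ b ^ 3 * (7400000000 * b ^ 11) := by
  have h16 : m + 1 ≤ 16 * b ^ 4 := by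
    refine hm.trans ((Nat.pow_le_pow_left (show b + 1 ≤ 2 * b by omega) 4).trans_eq ?_)
    ring
  have hM : 24 * (m + 1) + 4 * (m + 3 * m * (8 * b ^ 2)) ≤ 2000 * b ^ 6 := by
    have h1 : b ^ 4 ≤ b ^ 6 := Nat.pow_le_pow_right hb (by norm_num)
    have h2 : m * b ^ 2 ≤ 16 * b ^ 4 * b ^ 2 := Nat.mul_le_mul_right _ (by omega)
    have h3 : 16 * b ^ 4 * b ^ 2 = 16 * b ^ 6 := by ring
    have h4 : 4 * (m + 3 * m * (8 * b ^ 2)) = 4 * m + 96 * (m * b ^ 2) := by ring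
    omega
  have hmono := flowBound_mono (κ := 1) (K := b ^ 3) (R := 1)
    (show 8 * (m + 1) ≤ 128 * b ^ 4 by omega) hM
  have hp : ∀ i ≤ 14, b ^ i ≤ b ^ 14 := fun i hi => Nat.pow_le_pow_right hb hi
  have key : flowBound 1 (b ^ 3) 1 (128 * b ^ 4) (2000 * b ^ 6) + b ^ 3 ≤ 37000000 * b ^ 14 := by
    have : flowBound 1 (b ^ 3) 1 (128 * b ^ 4) (2000 * b ^ 6) + b ^ 3 =
        32768000 * b ^ 14 + 2097152 * b ^ 12 + 256000 * b ^ 10 + 256000 * b ^ 13 + 16384 * b ^ 11 +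
        2000 * b ^ 9 + 32768 * b ^ 14 + 32768 * b ^ 11 + 128 * b ^ 4 + 128 * b ^ 10 + 128 * b ^ 7 +
        b ^ 6 + 2 * b ^ 3 := by
      unfold flowBound
      ring
    rw [this]
    have h1 := hp 12 (by norm_num)
    have h2 := hp 10 (by norm_num)
    have h3 := hp 13 (by norm_num)
    have h4 := hp 11 (by norm_num)
    have h5 := hp 9 (by norm_num)
    have h6 := hp 4 (by norm_num)
    have h7 := hp 7 (by norm_num)
    have h8 := hp 6 (by norm_num)
    have h9 := hp 3 (by norm_num)
    omega
  calc _ ≤ 200 * (37000000 * b ^ 14) := Nat.mul_le_mul_left _ (by omega)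
    _ = _ := by ring

theorem exists_pow_four_le {m : ℕ} (hm : 1 ≤ m) : ∃ b, 1 ≤ b ∧ b ^ 4 ≤ m ∧ m + 1 ≤ (b + 1) ^ 4 := by
  have hex : ∃ b, m + 1 ≤ (b + 1) ^ 4 := ⟨m, by
    calc m + 1 = (m + 1) ^ 1 := (pow_one _).symm
      _ ≤ _ := Nat.pow_le_pow_right (by omega) (by norm_num)⟩
  refine ⟨Nat.find hex, ?_, ?_, Nat.find_spec hex⟩
  · by_contra h
    have h0 : Nat.find hex = 0 := by omega
    have := Nat.find_spec hex
    rw [h0] at this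
    omega
  · rcases Nat.eq_zero_or_pos (Nat.find hex) with h0 | h0
    · rw [h0]
      omega
    · have := Nat.find_min hex (Nat.sub_one_lt_of_lt h0)
      rw [Nat.sub_add_cancel h0] at this
      omega

/-- `m ^ 2.75` is `O(m³ / log m)`, since `log m ≤ 4 log (b + 1) ≤ 4 b`. -/
theorem pow_eleven_le {b m : ℕ} (hb : 1 ≤ b) (hbm : b ^ 4 ≤ m) (hmb : m + 1 ≤ (b + 1) ^ 4)
    (hm : 2 ≤ m) : (b : ℝ) ^ 11 ≤ 4 * ((m : ℝ) ^ 3 / Real.log m) := by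
  have hlog : 0 < Real.log m := Real.log_pos (by exact_mod_cast hm)
  have hlog4 : Real.log m ≤ 4 * b := by
    calc Real.log m ≤ Real.log ((b + 1 : ℝ) ^ 4) := by
          refine Real.log_le_log (by positivity) ?_
          exact_mod_cast (Nat.le_succ m).trans hmb
      _ = 4 * Real.log (b + 1) := by rw [Real.log_pow]; norm_num
      _ ≤ 4 * b := by
          have := Real.log_le_sub_one_of_pos (show (0 : ℝ) < b + 1 by positivity)
          linarith
  rw [← mul_div_assoc, le_div_iff₀ hlog]
  have hbm' : (b : ℝ) ^ 4 ≤ m := by exact_mod_cast hbm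
  calc (b : ℝ) ^ 11 * Real.log m ≤ (b : ℝ) ^ 11 * (4 * b) := by gcongr
    _ = 4 * ((b : ℝ) ^ 4) ^ 3 := by ring
    _ ≤ 4 * (m : ℝ) ^ 3 := by gcongr

/-- The discrete optimum is computed in time `O(m³ / log m)`. -/
theorem exists_ends_discreteProg {σ : State} (hσ : Holds σ I ends) (hends : I.IsEdgeList ends)
    (hI : I.Solvable) (hmark : ∀ v, σ.nats nMark v = 0) :
    ∃ B : ℕ, (Ends discreteProg σ B fun σ' => σ'.reals rExc 1 = I.discreteOpt ∧
        UsedList σ' (Occurring σ') ∧ σ'.nats nCount 0 ≤ 2 * m + 2) ∧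
      (2 ≤ m → (B : ℝ) ≤ 40000000000 * ((m : ℝ) ^ 3 / Real.log m)) := by
  rcases Nat.eq_zero_or_pos m with rfl | hm
  · exact ⟨_, ends_discreteProg hσ hends hI hmark (h := 1) (K := 1) one_pos (by norm_num) one_pos
      (one_mul _).ge, fun h => absurd h (by norm_num)⟩
  · obtain ⟨b, hb, hbm, hmb⟩ := exists_pow_four_le hm
    have h16 : m + 1 ≤ 16 * b ^ 4 := by
      refine hmb.trans ((Nat.pow_le_pow_left (show b + 1 ≤ 2 * b by omega) 4).trans_eq ?_)
      ring
    -- Here `b` is about `m ^ (1 / 4)`, so that `h ^ 2 = 64 b ^ 4 ≥ 2 m` and `K = b ^ 3`.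
    refine ⟨_, ends_discreteProg hσ hends hI hmark (h := 8 * b ^ 2) (K := b ^ 3) (by positivity) ?_
      (by positivity) (flowBound_discrete_le hb hmb), fun hm2 => ?_⟩
    · calc 2 * m ≤ 64 * b ^ 4 := by omega
        _ = _ := by ring
    · have h1 : 40000 * ((m + 1) * (m + 1) * (8 * b ^ 2 + 1)) + 7400000000 * b ^ 11 ≤
          10000000000 * b ^ 11 := by
        have h2 : (m + 1) * (m + 1) * (8 * b ^ 2 + 1) ≤
            16 * b ^ 4 * (16 * b ^ 4) * (8 * b ^ 2 + b ^ 2) := by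
          have : 1 ≤ b ^ 2 := Nat.one_le_pow _ _ hb
          gcongr
        have h3 : 16 * b ^ 4 * (16 * b ^ 4) * (8 * b ^ 2 + b ^ 2) = 2304 * b ^ 10 := by ring
        have h4 : b ^ 10 ≤ b ^ 11 := Nat.pow_le_pow_right hb (by norm_num)
        omega
      have h2 := pow_eleven_le hb hbm hmb hm2
      have h3 : ((40000 * ((m + 1) * (m + 1) * (8 * b ^ 2 + 1)) + 7400000000 * b ^ 11 : ℕ) : ℝ) ≤
          10000000000 * (b : ℝ) ^ 11 := by exact_mod_cast h1
      linarith

end RealRAM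


namespace RealRAM

/-- The arrays that do not hold the input are zero. -/
theorem input_nats_eq_zero {n m : ℕ} (I : Instance (Fin n))
    (ends : Fin m → Vertex (Fin n) × Vertex (Fin n)) (ε : ℝ) {a : ℕ} (ha : 3 ≤ a) (i : ℕ) :
    (I.input ends ε).nats a i = 0 := by
  have h0 : a ≠ 0 := by omega
  have h1 : a ≠ 1 := by omega
  have h2 : a ≠ 2 := by omega
  simp [Instance.input, h0, h1, h2]

theorem exists_prog_discreteOpt : ∃ (P : Prog) (C : ℝ), ∀ (n m : ℕ) (I : Instance (Fin n))
      (ends : Fin m → Vertex (Fin n) × Vertex (Fin n)), I.IsEdgeList ends → I.Solvable →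
      ∃ (T : ℕ) (σ : State), Run P (I.input ends 0) T σ ∧
        σ.reals 2 0 = I.discreteOpt ∧
        (2 ≤ m → (T : ℝ) ≤ C * ((m : ℝ) ^ 3 / Real.log m)) := by
  refine ⟨.block [discreteProg, .setReal rOut (.const 0) (.cell rExc (.const 1))], 50000000000,
    fun n m I ends hends hI => ?_⟩
  obtain ⟨B, hB, hBm⟩ := exists_ends_discreteProg (holds_input I ends 0) hends hI
    fun v => input_nats_eq_zero I ends 0 le_rfl v
  have hE : Ends (.block [discreteProg, .setReal rOut (.const 0) (.cell rExc (.const 1))])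
      (I.input ends 0) (B + 10) fun σ => σ.reals 2 0 = I.discreteOpt := by
    refine Ends.block_cons (hB.mono le_rfl ?_)
    rintro σ - ⟨h, -⟩
    refine Ends.of_exec (by decide) (by decide) ?_
    simp [Prog.block, Prog.exec, RealExpr.eval, NatExpr.eval, h]
  obtain ⟨T, σ, hrun, hT, hout⟩ := hE
  refine ⟨T, σ, hrun, hout, fun hm => ?_⟩
  have hlog : Real.log m ≤ m := (Real.log_le_sub_one_of_pos (by positivity)).trans (by linarith)
  have hm2 : (2 : ℝ) ≤ m := by exact_mod_cast hm
  have hlog0 : 0 < Real.log m := Real.log_pos (by linarith)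
  have h1 : (1 : ℝ) ≤ (m : ℝ) ^ 3 / Real.log m := by
    rw [le_div_iff₀ hlog0]
    nlinarith [sq_nonneg (m : ℝ)]
  have h2 : (T : ℝ) ≤ B + 10 := by exact_mod_cast hT
  have := hBm hm
  linarith

end RealRAM


/-! ### Levels that are multiples of the unit power -/

namespace Levels

/-- The levels of `a` are the multiples `0, …, c` of `α` (only `0` for the terminals), and each step
has the price `1`. -/
structure UnitLevels (α : ℝ) (c : ℕ) (D : Levels) (a : ℕ) : Prop where
  L_eq : D.L a = if a ≤ 1 then 0 else c
  lev_eq : ∀ j ≤ D.L a, D.lev (D.base a + j) = j * α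
  cap_eq : ∀ j ≤ D.L a, D.cap (D.base a + j) = if j = D.L a then 0 else 1

variable {D D' : Levels} {a c : ℕ} {α : ℝ}

theorem UnitLevels.congr (h : UnitLevels α c D a) (hs : SameBlock D D' a) : UnitLevels α c D' a := by
  refine ⟨by rw [hs.L, h.L_eq], ?_, ?_⟩
  · rw [hs.base, hs.L]
    intro j hj
    rw [hs.lev j hj, h.lev_eq j hj]
  · rw [hs.base, hs.L]
    intro j hj
    rw [hs.cap j hj, h.cap_eq j hj]

variable {n m : ℕ} {I : Instance (Fin n)} {ends : Fin m → Vertex (Fin n) × Vertex (Fin n)}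
  {ε : ℝ} (hD : D.WF) (hr : D.Represents I ends) (hends : I.IsEdgeList ends)

include hD in
theorem UnitLevels.cap_eq_of_lt (hQ : ∀ a, D.Used a → D.UnitLevels α c a) {h : ℕ}
    (hh : h < D.H) : D.cap h = 0 ∨ D.cap h = 1 := by
  obtain ⟨a, j, ha, hj, rfl⟩ := hD.exists_level hh
  rw [(hQ a ha).cap_eq j hj]
  split_ifs <;> simp

theorem UnitLevels.cost_eq (hQ : ∀ a, D.Used a → D.UnitLevels α c a) {k : ℕ → ℕ}
    (hk : ∀ a, D.Used a → k a ≤ D.L a) : D.cost k = ((∑ i ∈ range D.n, k (D.vl i) : ℕ) : ℝ) := by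
  rw [cost, Nat.cast_sum]
  refine sum_congr rfl fun i hi => ?_
  have hu : D.Used (D.vl i) := ⟨i, mem_range.1 hi, rfl⟩
  have hki := hk _ hu
  rw [sum_congr rfl fun j hj => ?_, sum_const, card_range, nsmul_one]
  have hj' := mem_range.1 hj
  rw [(hQ _ hu).cap_eq j (by omega), if_neg (by omega)]

include hD in
theorem UnitLevels.H_le (hQ : ∀ a, D.Used a → D.UnitLevels α c a) : D.H ≤ D.n * (c + 1) := by
  rw [hD.H_eq, ← smul_eq_mul]
  refine (sum_le_card_nsmul _ _ (c + 1) fun i hi => ?_).trans_eq (by rw [card_range])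
  rw [(hQ _ ⟨i, mem_range.1 hi, rfl⟩).L_eq]
  split_ifs <;> omega

include hD in
theorem UnitLevels.edgeSize_le (hQ : ∀ a, D.Used a → D.UnitLevels α c a) :
    D.edgeSize D.m ≤ D.m * (c + 1) := by
  rw [edgeSize, ← smul_eq_mul]
  refine (sum_le_card_nsmul _ _ (c + 1) fun e he => ?_).trans_eq (by rw [card_range])
  have h1 := min_le_left (D.L (D.x e)) (D.L (D.y e))
  have h2 := (hQ _ (hD.used_x e (mem_range.1 he))).L_eq
  split_ifs at h2 <;> omega

include hD hr hends in
open Classical in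
/-- For the levels that are multiples of the unit power, cheapest choices correspond to minimum cuts of
the discretized graph. -/
theorem Represents.isMinCut (hI : I.Solvable) (hε : 0 < ε)
    (hQ : ∀ a, D.Used a → D.UnitLevels (I.unitPower ε) (copies (Fin n) ε) a) :
    (∃ k, D.Feasible k) ∧ ∀ k, D.Feasible k → (∀ l, D.Feasible l → D.cost k ≤ D.cost l) →
      ∃ K, I.IsMinCut ε K ∧ ∀ v : Fin n, I.cutPower ε K v =
        if D.Used (v + 2) then D.lev (D.base (v + 2) + k (v + 2)) else 0 := by
  set α := I.unitPower ε with hα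
  have hα0 : 0 ≤ α := I.unitPower_nonneg hI hε
  have hzero : ∀ a ≤ 1, D.lev (D.base a) = 0 := by
    intro a ha
    have hu : D.Used a := by
      interval_cases a
      · exact hD.used_zero
      · exact hD.used_one
    have := (hQ a hu).lev_eq 0 (Nat.zero_le _)
    rwa [add_zero, Nat.cast_zero, zero_mul] at this
  have hk01 : ∀ k : ℕ → ℕ, (∀ a, D.Used a → k a ≤ D.L a) → k 0 = 0 ∧ k 1 = 0 := by
    intro k hk
    have h0 := hk 0 hD.used_zero
    have h1 := hk 1 hD.used_one
    rw [hD.L_zero] at h0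
    rw [hD.L_one] at h1
    omega
  have hLc : ∀ v : Fin n, D.Used (v + 2) → D.L (v + 2) = copies (Fin n) ε := by
    intro v hv
    rw [(hQ _ hv).L_eq, if_neg (by omega)]
  have hcost : ∀ k, (∀ a, D.Used a → k a ≤ D.L a) → D.cost k =
      ((∑ v : Fin n, if D.Used (v + 2) then k (v + 2) else 0 : ℕ) : ℝ) := by
    intro k hk
    rw [UnitLevels.cost_eq hQ hk, hr.sum_used hD k (hk01 k hk).1 (hk01 k hk).2]
  -- Every choice of numbers of copies is a choice of levels for the used vertices.
  have hlift : ∀ l : Fin n → ℕ, (∀ v, l v ≤ copies (Fin n) ε) → I.IsFeasible (fun v => l v * α) →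
      ∃ k, D.Feasible k ∧ D.cost k ≤ ((∑ v, l v : ℕ) : ℝ) := by
    intro l hl hf
    set k : ℕ → ℕ := fun a => if h : 2 ≤ a ∧ a - 2 < n then l ⟨a - 2, h.2⟩ else 0 with hk
    have hkv : ∀ v : Fin n, k (v + 2) = l v := fun v => by
      rw [hk]
      simp only [Nat.add_sub_cancel, Nat.le_add_left, v.2, and_self, dite_true]
    have hkL : ∀ a, D.Used a → k a ≤ D.L a := by
      intro a ha
      by_cases h : 2 ≤ a ∧ a - 2 < n
      · obtain ⟨v, rfl⟩ : ∃ v : Fin n, a = v + 2 := ⟨⟨a - 2, h.2⟩, by simp; omega⟩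
        rw [hkv, hLc v ha]
        exact hl v
      · rw [hk]
        simp only [dif_neg h]
        exact Nat.zero_le _
    refine ⟨k, (hr.feasible_iff hD hends hkL hf.1 hzero fun v hv => ?_).2 hf, ?_⟩
    · rw [(hQ _ hv).lev_eq _ (hkL _ hv), hkv]
    · rw [hcost k hkL]
      refine Nat.cast_le.2 (sum_le_sum fun v _ => ?_)
      split_ifs
      · rw [hkv]
      · exact Nat.zero_le _
  constructor
  · obtain ⟨l, hl, hf, -⟩ := I.exists_levels hI hε
    obtain ⟨k, hk, -⟩ := hlift l hl hf
    exact ⟨k, hk⟩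
  intro k hk hmin
  set l : Fin n → ℕ := fun v => if D.Used (v + 2) then k (v + 2) else 0 with hl
  have hlc : ∀ v, l v ≤ copies (Fin n) ε := by
    intro v
    simp only [hl]
    split_ifs with hu
    · rw [← hLc v hu]
      exact hk.1 _ hu
    · exact Nat.zero_le _
  have hf : I.IsFeasible (fun v => l v * α) := by
    refine (hr.feasible_iff hD hends hk.1 (fun v => by positivity) hzero fun v hv => ?_).1 hk
    rw [(hQ _ hv).lev_eq _ (hk.1 _ hv)]
    simp only [hl, if_pos hv]
  refine ⟨Instance.initialCopies ε l,
    I.isMinCut_initialCopies hI hε hlc hf fun l' hl' hf' => ?_, fun v => ?_⟩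
  · obtain ⟨k', hk', hle⟩ := hlift l' hl' hf'
    have h1 := (hmin k' hk').trans hle
    rw [hcost k hk.1] at h1
    exact_mod_cast h1
  · have h1 := congrFun (I.cutPower_initialCopies (ε := ε) hlc) v
    refine Eq.trans ?_ (h1.trans ?_)
    · congr!
    · simp only [hl]
      split_ifs with hu
      · rw [(hQ _ hu).lev_eq _ (hk.1 _ hu)]
      · rw [Nat.cast_zero, zero_mul]

end Levels


/-! ### Unit levels and reading off a cut -/

namespace RealRAM

open Function (update)

/-- Compute the unit power and the number of copies. -/
def copiesProg : Prog := .block [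
  .setR rUnit (.div (.mul (.var rEps) (.cell rExc (.const 1)))
    (.mul (.const 2) (.ofNat (.var nSize)))),
  .setN nCopies (.const 0),
  .while (.realLT (.mul (.ofNat (.var nCopies)) (.var rEps))
      (.mul (.const 2) (.ofNat (.var nSize))))
    (.setN nCopies (.add (.var nCopies) (.const 1)))]

/-- Create the levels of the current vertex that are multiples of the unit power. -/
def unitLevelsProg : Prog := .block [
  startProg,
  .ite (.natLE (.var nX) (.const 1)) (.setN nK (.const 0)) (.setN nK (.var nCopies)),
  .forLoop nJ (.var nK)
    (growProg (.mul (.ofNat (.add (.var nJ) (.const 1))) (.var rUnit)) (.const 1)),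
  finishProg]

/-- Find a distance label that does not occur. -/
def gapProg : Prog := .block [
  .forLoop nI (.var nNodes) (.setNat nSeen (.cell nDist (.var nI)) (.const 1)),
  .setN nGap (.const 0),
  .while (.natLE (.const 1) (.cell nSeen (.var nGap))) (.setN nGap (.add (.var nGap) (.const 1)))]

/-- Find the level of the current vertex at which the minimum cut passes. -/
def readProg : Prog := .block [
  .setN nX (.cell nUsed (.var nI)),
  .setN nPos (.const 0),
  .while (.and
      (.natLT (.var nGap) (.cell nDist (.add (.cell nBase (.var nX)) (.var nPos))))
      (.natLE (.cell nDist (.add (.var nHigh) (.add (.cell nBase (.var nX)) (.var nPos))))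
        (.var nGap)))
    (.setN nPos (.add (.var nPos) (.const 1))),
  .ite (.natLE (.var nX) (.const 1)) .skip
    (.setReal rOut (.sub (.var nX) (.const 2))
      (.cell rLev (.add (.cell nBase (.var nX)) (.var nPos))))]

/-- Write the powers of the vertices to the output array. -/
def outputProg : Prog := .forLoop nI (.var nCount) readProg

theorem ends_copiesProg {σ : State} {n : ℕ} (hn : σ.nats nSize 0 = n) {ε : ℝ}
    (hε : σ.reals rEps 0 = ε) (h0 : 0 < ε) :
    Ends copiesProg σ (50 * (copies (Fin n) ε + 2)) fun σ' =>
      σ'.nats nCopies 0 = copies (Fin n) ε ∧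
        σ'.reals rUnit 0 = ε * σ.reals rExc 1 / (2 * Fintype.card (Fin n)) := by
  set c := copies (Fin n) ε with hc
  refine Ends.mono (B := 15 + (5 + 40 * (c + 1))) ?_ (by omega) fun _ _ h => h
  refine Ends.block_cons (Ends.of_exec (by decide) (by decide) ?_)
  refine Ends.block_cons (Ends.of_exec (by decide) (by decide) ?_)
  set P₀ : Prog := .seq (.setR rUnit (.div (.mul (.var rEps) (.cell rExc (.const 1)))
    (.mul (.const 2) (.ofNat (.var nSize))))) (.setN nCopies (.const 0)) with hP₀
  change Ends _ (P₀.exec σ) _ _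
  set σ₁ := P₀.exec σ with hσ₁
  have hf₁ : Frame P₀ σ σ₁ := Frame.exec (by rw [hP₀]; decide) σ
  have hU₁ : σ₁.reals rUnit 0 = ε * σ.reals rExc 1 / (2 * Fintype.card (Fin n)) := by
    simp [hσ₁, hP₀, Prog.exec, RealExpr.eval, NatExpr.eval, hn, hε]
  have hC₁ : σ₁.nats nCopies 0 = 0 := by
    simp [hσ₁, hP₀, Prog.exec, RealExpr.eval, NatExpr.eval]
  have hlt : ∀ k : ℕ, ((k : ℝ) * ε < 2 * n ↔ k < c) := by
    intro k
    rw [hc, copies, Nat.lt_ceil, lt_div_iff₀ h0, Fintype.card_fin]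
  have htest : ∀ σ₂ : State, σ₂.nats nSize = σ₁.nats nSize → σ₂.reals rEps = σ₁.reals rEps →
      ((Test.realLT (.mul (.ofNat (.var nCopies)) (.var rEps))
        (.mul (.const 2) (.ofNat (.var nSize)))).holds σ₂ ↔ σ₂.nats nCopies 0 < c) := by
    intro σ₂ h1 h2
    simp only [Test.holds, RealExpr.eval, NatExpr.eval]
    rw [h1, h2, hf₁.nats nSize (by rw [hP₀]; decide), hf₁.reals rEps (by rw [hP₀]; decide), hn, hε,
      not_le, ← hlt, Nat.cast_ofNat]
  clear_value σ₁
  refine (Ends.while_loop 1 one_pos (fun σ' => σ'.nats nCopies 0 ≤ c)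
    (fun σ' => 20 * (c - σ'.nats nCopies 0)) ?_ ?_ ?_).mono le_rfl ?_
  · rw [hC₁]
    exact Nat.zero_le _
  · intro σ₂ hf₂ hI ht
    have ht := (htest σ₂ (hf₂.nats _ (by decide)) (hf₂.reals _ (by decide))).1 ht
    refine ⟨6, Ends.of_exec (by decide) (by decide) ⟨?_, ?_⟩⟩
    · simp [Prog.exec, NatExpr.eval]
      omega
    · simp [Prog.exec, NatExpr.eval, Test.cost, RealExpr.cost, NatExpr.cost]
      omega
  · rw [hC₁]
    simp [Test.cost, RealExpr.cost, NatExpr.cost]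
    omega
  · rintro σ₂ hf₂ ⟨hle, ht⟩
    rw [htest σ₂ (hf₂.nats _ (by decide)) (hf₂.reals _ (by decide))] at ht
    refine ⟨by omega, ?_⟩
    rw [hf₂.reals rUnit (by decide), hU₁]

theorem ends_unitLevelsProg {σ : State} {a c : ℕ} {α : ℝ}
    (ha : σ.nats nUsed (σ.nats nI 0) = a) (hc : σ.nats nCopies 0 = c)
    (hα : σ.reals rUnit 0 = α) (h0 : 0 ≤ α) :
    Ends unitLevelsProg σ (200 * (c + 1)) fun σ' =>
      (levelsOf σ).AddBlock (levelsOf σ') a ∧ (levelsOf σ').UnitLevels α c a := by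
  set D := levelsOf σ with hD
  refine Ends.mono (B := 25 + (20 + (80 * (c + 1) + 20))) ?_ (by omega) fun _ _ h => h
  refine Ends.block_cons (Ends.of_exec (by decide) (by decide) ?_)
  obtain ⟨hlev₁, hX₁⟩ := levelsOf_startProg ha
  have hf₁ : Frame startProg σ (startProg.exec σ) := Frame.exec (by decide) σ
  set σ₁ := startProg.exec σ with hσ₁
  clear_value σ₁
  refine Ends.block_cons (Ends.of_exec (by decide) (by decide) ?_)
  set P₂ : Prog := .ite (.natLE (.var nX) (.const 1)) (.setN nK (.const 0))
    (.setN nK (.var nCopies)) with hP₂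
  set σ₂ := P₂.exec σ₁ with hσ₂
  have hf₂ : Frame P₂ σ₁ σ₂ := Frame.exec (by decide) σ₁
  have hlev₂ : levelsOf σ₂ = D.start a :=
    (hf₂.levelsOf_eq (by decide) (by decide)).trans hlev₁
  have hX₂ : σ₂.nats nX 0 = a := by rw [hf₂.nats nX (by decide), hX₁]
  have hC₁ : σ₁.nats nCopies 0 = c := by rw [hf₁.nats nCopies (by decide), hc]
  have hK₂ : σ₂.nats nK 0 = if a ≤ 1 then 0 else c := by
    rw [hσ₂, hP₂]
    by_cases h1 : a ≤ 1 <;> simp [Prog.exec, Test.holds, NatExpr.eval, hX₁, h1, hC₁]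
  have hα₂ : σ₂.reals rUnit 0 = α := by
    rw [hf₂.reals rUnit (by decide), hf₁.reals rUnit (by decide), hα]
  set d := if a ≤ 1 then 0 else c with hd
  have hdc : d ≤ c := by
    rw [hd]
    split_ifs <;> omega
  clear_value σ₂
  refine Ends.block_cons ((Ends.forLoop_exec (n := d) (fun j σ' =>
    D.Building (levelsOf σ') a ∧ (levelsOf σ').L a = j ∧
      (∀ i ≤ j, (levelsOf σ').lev (D.H + i) = i * α) ∧
      ∀ i < j, (levelsOf σ').cap (D.H + i) = 1) (by decide) (by decide) ?_ ?_ ?_ ?_).mono le_rfl ?_)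
  · intro σ' hf
    simp only [NatExpr.eval]
    rw [hf.nats nK (by decide), hK₂]
  · have : levelsOf (σ₂.writeNat nJ 0 0) = levelsOf σ₂ := by
      simp [levelsOf, State.nats_writeNat]
    rw [this, hlev₂]
    refine ⟨D.building_start a, Function.update_self _ _ _, fun i hi => ?_,
      fun i hi => absurd hi (Nat.not_lt_zero i)⟩
    rw [Nat.le_zero.1 hi, Nat.cast_zero, zero_mul]
    exact Function.update_self _ _ _
  · rintro j σ₃ hj hf₃ hjJ ⟨hb, hL, hlev, hcap⟩
    have ha1 : 1 < a := by
      by_contra h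
      rw [hd, if_pos (not_lt.1 h)] at hj
      omega
    have hX₃ : σ₃.nats nX 0 = a := by rw [hf₃.nats nX (by decide), hX₂]
    have hα₃ : σ₃.reals rUnit 0 = α := by rw [hf₃.reals rUnit (by decide), hα₂]
    set D₃ := levelsOf σ₃ with hD₃
    have hH₃ : D₃.H = D.H + j := by rw [hb.H, hL]
    have : levelsOf (((growProg (.mul (.ofNat (.add (.var nJ) (.const 1))) (.var rUnit))
        (.const 1)).exec σ₃).writeNat nJ 0 (j + 1)) = D₃.grow a ((j + 1 : ℕ) * α) 1 := by
      refine Eq.trans ?_ (levelsOf_growProg (σ := σ₃) (a := a)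
        (b := .mul (.ofNat (.add (.var nJ) (.const 1))) (.var rUnit)) (c := .const 1)
        (r := (j + 1 : ℕ) * α) (t := 1) hX₃ (by simp [RealExpr.eval]) ?_)
      · simp [levelsOf, State.nats_writeNat]
      · simp [RealExpr.eval, NatExpr.eval, hjJ, hα₃, State.nats_writeNat, State.reals_writeReal]
    rw [this]
    have hlevH : D₃.lev D₃.H = j * α := by rw [hH₃, hlev j le_rfl]
    refine ⟨hb.grow ?_ zero_le_one ha1, ?_, fun i hi => ?_, fun i hi => ?_⟩
    · rw [hlevH]
      push_cast
      linarith
    · rw [← hL]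
      exact Function.update_self _ _ _
    · show update D₃.lev (D₃.H + 1) ((j + 1 : ℕ) * α) (D.H + i) = i * α
      rcases hi.eq_or_lt with rfl | hi
      · rw [hH₃, add_assoc, Function.update_self]
      · rw [Function.update_of_ne (by omega), hlev i (by omega)]
    · show update D₃.cap D₃.H 1 (D.H + i) = 1
      rcases (Nat.lt_succ_iff.1 hi).eq_or_lt with rfl | hi
      · rw [hH₃, Function.update_self]
      · rw [Function.update_of_ne (by omega), hcap i hi]
  · rw [mul_comm]
    refine Nat.mul_le_mul ?_ (by omega)
    decide
  · rintro σ₃ - ⟨hb, hL, hlev, hcap⟩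
    refine Ends.of_exec (by decide) (by decide) ?_
    change D.AddBlock (levelsOf (finishProg.exec σ₃)) a ∧
      (levelsOf (finishProg.exec σ₃)).UnitLevels α c a
    rw [levelsOf_finishProg σ₃]
    have hbase : (levelsOf σ₃).finish.base a = D.H := hb.base_eq
    have hL' : (levelsOf σ₃).finish.L a = d := hL
    have hH₃ : (levelsOf σ₃).H = D.H + d := by rw [hb.H, hL]
    refine ⟨hb.finish, hL', ?_, ?_⟩
    · rw [hL', hbase]
      exact hlev
    · rw [hL', hbase]
      intro j hj
      show update (levelsOf σ₃).cap (levelsOf σ₃).H 0 (D.H + j) = _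
      rcases hj.eq_or_lt with rfl | hj
      · rw [hH₃, Function.update_self, if_pos rfl]
      · rw [Function.update_of_ne (by omega), hcap j hj, if_neg hj.ne]

/-- A label that does not occur is found in linear time by marking those that occur. -/
theorem ends_gapProg {σ : State} {N : ℕ} (hN : σ.nats nNodes 0 = N)
    (hseen : ∀ v, σ.nats nSeen v = 0) (hgap : ∃ g ≤ N, ∀ v < N, σ.nats nDist v ≠ g) :
    Ends gapProg σ (100 * (N + 1)) fun σ' => σ'.nats nGap 0 ≤ N ∧
      ∀ v < N, σ.nats nDist v ≠ σ'.nats nGap 0 := by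
  refine Ends.mono (B := 50 * (N + 1) + (3 + 20 * (N + 1))) ?_ (by omega) fun _ _ h => h
  refine Ends.block_cons ((Ends.forLoop_exec (n := N) (fun k σ' => ∀ g,
    σ'.nats nSeen g ≠ 0 ↔ ∃ v < k, σ.nats nDist v = g) (by decide) (by decide) ?_ ?_ ?_ ?_).mono
      le_rfl ?_)
  · intro σ' hf
    simp only [NatExpr.eval]
    rw [hf.nats nNodes (by decide), hN]
  · intro g
    rw [State.nats_writeNat_ne _ _ _ (by decide), hseen]
    simp
  · intro k σ₁ hk hf hkI hI g
    rw [State.nats_writeNat_ne _ _ _ (by decide)]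
    simp only [Prog.exec, NatExpr.eval, State.nats_writeNat_same, hkI]
    rw [hf.nats nDist (by decide), Function.update_apply]
    split_ifs with h
    · exact ⟨fun _ => ⟨k, Nat.lt_succ_self k, h.symm⟩, fun _ => one_ne_zero⟩
    · rw [hI g]
      constructor
      · rintro ⟨v, hv, hvg⟩
        exact ⟨v, by omega, hvg⟩
      · rintro ⟨v, hv, hvg⟩
        refine ⟨v, lt_of_le_of_ne (by omega) ?_, hvg⟩
        rintro rfl
        exact h hvg.symm
  · rw [mul_comm]
    refine Nat.mul_le_mul_right _ ?_
    decide
  intro σ₁ hf₁ hmark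
  refine Ends.block_cons (Ends.of_exec (by decide) (by decide) ?_)
  set P₂ : Prog := .setN nGap (.const 0) with hP₂
  set σ₂ := P₂.exec σ₁ with hσ₂
  have hf₂ : Frame P₂ σ₁ σ₂ := Frame.exec (by decide) σ₁
  have h0 : σ₂.nats nGap 0 = 0 := by simp [hσ₂, hP₂, Prog.exec, NatExpr.eval]
  obtain ⟨g₀, hg₀N, hg₀⟩ := hgap
  have hmark : ∀ g, σ₂.nats nSeen g ≠ 0 ↔ ∃ v < N, σ.nats nDist v = g := by
    rw [hf₂.nats nSeen (by decide)]
    exact hmark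
  clear_value σ₂
  refine (Ends.while_loop 1 one_pos (fun σ' => σ'.nats nGap 0 ≤ g₀)
    (fun σ' => 15 * (g₀ - σ'.nats nGap 0)) ?_ ?_ ?_).mono le_rfl ?_
  · rw [h0]
    exact Nat.zero_le _
  · intro σ₃ hf₃ hle ht
    simp only [Test.holds, NatExpr.eval] at ht
    have hne : σ₃.nats nGap 0 ≠ g₀ := by
      intro h
      rw [hf₃.nats nSeen (by decide), h] at ht
      obtain ⟨v, hv, hvg⟩ := (hmark g₀).1 (by omega)
      exact hg₀ v hv hvg
    refine ⟨6, Ends.of_exec (by decide) (by decide) ⟨?_, ?_⟩⟩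
    · simp [Prog.exec, NatExpr.eval]
      omega
    · simp [Prog.exec, NatExpr.eval, Test.cost, NatExpr.cost]
      omega
  · rw [h0]
    simp [Test.cost, NatExpr.cost]
    omega
  · rintro σ₃ hf₃ ⟨hle, ht⟩
    simp only [Test.holds, NatExpr.eval] at ht
    rw [hf₃.nats nSeen (by decide)] at ht
    refine ⟨hle.trans hg₀N, fun v hv h => ?_⟩
    have := (hmark (σ₃.nats nGap 0)).2 ⟨v, hv, h⟩
    omega

/-- The first level of `a` at which the cut of the nodes with a label above `g` does not pass. -/
noncomputable def readLevel (D : Levels) (d : ℕ → ℕ) (g a : ℕ) : ℕ :=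
  sInf {j | g < d (D.base a + j) → g < d (D.H + (D.base a + j))}

theorem ends_readProg {σ : State} {a : ℕ} (ha : σ.nats nUsed (σ.nats nI 0) = a)
    (htop : σ.nats nGap 0 < σ.nats nDist (σ.nats nBase a + σ.nats nLast a) →
      σ.nats nGap 0 < σ.nats nDist (σ.nats nHigh 0 + (σ.nats nBase a + σ.nats nLast a))) :
    Ends readProg σ (60 * (σ.nats nLast a + 2)) fun σ' => σ'.reals rOut =
      if a ≤ 1 then σ.reals rOut else update (σ.reals rOut) (a - 2)
        ((levelsOf σ).lev ((levelsOf σ).base a +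
          readLevel (levelsOf σ) (σ.nats nDist) (σ.nats nGap 0) a)) := by
  set g := σ.nats nGap 0 with hg
  set d := σ.nats nDist with hd
  set D := levelsOf σ with hD
  set L := σ.nats nLast a with hL
  refine Ends.mono (B := 5 + (3 + (40 * (L + 1) + 20))) ?_ (by omega) fun _ _ h => h
  refine Ends.block_cons (Ends.of_exec (by decide) (by decide) ?_)
  refine Ends.block_cons (Ends.of_exec (by decide) (by decide) ?_)
  set P₀ : Prog := .seq (.setN nX (.cell nUsed (.var nI))) (.setN nPos (.const 0)) with hP₀
  change Ends _ (P₀.exec σ) _ _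
  set σ₁ := P₀.exec σ with hσ₁
  have hf₁ : Frame P₀ σ σ₁ := Frame.exec (by rw [hP₀]; decide) σ
  have hX₁ : σ₁.nats nX 0 = a := by
    simp [hσ₁, hP₀, Prog.exec, NatExpr.eval, ha, State.nats_writeNat]
  have hpos₁ : σ₁.nats nPos 0 = 0 := by
    simp [hσ₁, hP₀, Prog.exec, NatExpr.eval, State.nats_writeNat]
  have hd₁ : σ₁.nats nDist = d := hf₁.nats _ (by rw [hP₀]; decide)
  have hb₁ : σ₁.nats nBase = D.base := hf₁.nats _ (by rw [hP₀]; decide)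
  have hH₁ : σ₁.nats nHigh 0 = D.H := congrFun (hf₁.nats nHigh (by rw [hP₀]; decide)) 0
  have hg₁ : σ₁.nats nGap 0 = g := congrFun (hf₁.nats nGap (by rw [hP₀]; decide)) 0
  have hl₁ : σ₁.reals rLev = D.lev := hf₁.reals _ (by rw [hP₀]; decide)
  have ho₁ : σ₁.reals rOut = σ.reals rOut := hf₁.reals _ (by rw [hP₀]; decide)
  clear_value σ₁
  have htop' : g < d (D.base a + L) → g < d (D.H + (D.base a + L)) := htop
  refine Ends.block_cons ((Ends.while_loop 1 one_pos (fun σ' => σ'.nats nPos 0 ≤ L ∧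
      ∀ j < σ'.nats nPos 0, ¬ (g < d (D.base a + j) → g < d (D.H + (D.base a + j))))
    (fun σ' => 40 * (L - σ'.nats nPos 0)) ?_ ?_ ?_).mono le_rfl ?_)
  · rw [hpos₁]
    exact ⟨Nat.zero_le _, fun j hj => absurd hj (Nat.not_lt_zero j)⟩
  · rintro σ₂ hf₂ ⟨hle, hI⟩ ht
    simp only [Test.holds, NatExpr.eval] at ht
    rw [hf₂.nats nDist (by decide), hf₂.nats nBase (by decide), hf₂.nats nX (by decide),
      hf₂.nats nHigh (by decide), hf₂.nats nGap (by decide), hX₁, hd₁, hb₁, hH₁, hg₁, not_le] at ht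
    have hnot : ¬ (g < d (D.base a + σ₂.nats nPos 0) →
        g < d (D.H + (D.base a + σ₂.nats nPos 0))) := fun h => absurd (h ht.1) (not_lt.2 ht.2)
    have hne : σ₂.nats nPos 0 ≠ L := by
      intro h
      rw [h] at hnot
      exact hnot htop'
    refine ⟨6, Ends.of_exec (by decide) (by decide) ⟨⟨?_, ?_⟩, ?_⟩⟩
    · simp [Prog.exec, NatExpr.eval]
      omega
    · intro j hj
      simp only [Prog.exec, NatExpr.eval, State.nats_writeNat_same, Function.update_self] at hj
      rcases (Nat.lt_succ_iff.1 hj).eq_or_lt with rfl | hj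
      · exact hnot
      · exact hI j hj
    · simp [Prog.exec, NatExpr.eval, Test.cost, NatExpr.cost]
      omega
  · rw [hpos₁]
    simp [Test.cost, NatExpr.cost]
    omega
  · rintro σ₂ hf₂ ⟨⟨hle, hI⟩, ht⟩
    simp only [Test.holds, NatExpr.eval] at ht
    rw [hf₂.nats nDist (by decide), hf₂.nats nBase (by decide), hf₂.nats nX (by decide),
      hf₂.nats nHigh (by decide), hf₂.nats nGap (by decide), hX₁, hd₁, hb₁, hH₁, hg₁, not_le] at ht
    have hread : readLevel D d g a = σ₂.nats nPos 0 := by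
      refine le_antisymm (Nat.sInf_le fun h => not_le.1 fun h' => ht ⟨h, h'⟩) ?_
      by_contra hlt
      exact hI _ (not_le.1 hlt) (Nat.sInf_mem (s := {j | g < d (D.base a + j) →
        g < d (D.H + (D.base a + j))}) ⟨L, htop'⟩)
    have hX₂ : σ₂.nats nX 0 = a := by rw [hf₂.nats nX (by decide), hX₁]
    refine Ends.of_exec (by decide) (by decide) ?_
    rw [hread]
    by_cases h1 : a ≤ 1
    · simp only [Prog.block, Prog.exec, Test.holds, NatExpr.eval, hX₂, h1, if_true]
      rw [hf₂.reals rOut (by decide), ho₁]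
    · simp only [Prog.block, Prog.exec, Test.holds, NatExpr.eval, RealExpr.eval, hX₂, h1, if_false,
        State.reals_writeReal_same]
      rw [hf₂.reals rOut (by decide), hf₂.reals rLev (by decide), hf₂.nats nBase (by decide), ho₁,
        hl₁, hb₁]

theorem ends_outputProg {σ : State} (hD : (levelsOf σ).WF)
    (hout : ∀ v, σ.reals rOut v = 0)
    (htop : ∀ a, (levelsOf σ).Used a →
      σ.nats nGap 0 < σ.nats nDist (σ.nats nBase a + σ.nats nLast a) →
      σ.nats nGap 0 < σ.nats nDist (σ.nats nHigh 0 + (σ.nats nBase a + σ.nats nLast a))) :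
    Ends outputProg σ (200 * ((levelsOf σ).H + 1)) fun σ' => ∀ v,
      ((levelsOf σ).Used (v + 2) → σ'.reals rOut v = (levelsOf σ).lev ((levelsOf σ).base (v + 2) +
          readLevel (levelsOf σ) (σ.nats nDist) (σ.nats nGap 0) (v + 2))) ∧
      (¬ (levelsOf σ).Used (v + 2) → σ'.reals rOut v = 0) := by
  set D := levelsOf σ with hDdef
  set f : ℕ → ℝ := fun a => D.lev (D.base a + readLevel D (σ.nats nDist) (σ.nats nGap 0) a) with hf
  refine (Ends.forLoop (n := D.n) (fun i σ' => ∀ v,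
    ((∃ i' < i, D.vl i' = v + 2) → σ'.reals rOut v = f (v + 2)) ∧
    ((¬ ∃ i' < i, D.vl i' = v + 2) → σ'.reals rOut v = 0))
    (fun i => 60 * (D.L (D.vl i) + 2)) (by decide) ?_ ?_ ?_ ?_).mono le_rfl ?_
  · intro σ' hf'
    simp only [NatExpr.eval]
    rw [hf'.nats nCount (by decide)]
    rfl
  · intro v
    rw [State.reals_writeNat]
    exact ⟨fun ⟨i', hi', _⟩ => absurd hi' (Nat.not_lt_zero i'), fun _ => hout v⟩
  · intro i σ₁ hi hf₁ hiI hI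
    have hlev₁ : levelsOf σ₁ = D := hf₁.levelsOf_eq (by decide) (by decide)
    have hu : D.Used (D.vl i) := ⟨i, hi, rfl⟩
    have h1 := ends_readProg (σ := σ₁) (a := D.vl i) (by
      rw [hiI, hf₁.nats nUsed (by decide)]
      rfl) (by
      rw [hf₁.nats nGap (by decide), hf₁.nats nDist (by decide), hf₁.nats nBase (by decide),
        hf₁.nats nLast (by decide), hf₁.nats nHigh (by decide)]
      exact htop _ hu)
    rw [hlev₁, hf₁.nats nGap (by decide), hf₁.nats nDist (by decide),
      hf₁.nats nLast (by decide)] at h1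
    refine h1.mono le_rfl fun σ₂ _ hσ₂ v => ?_
    rw [State.reals_writeNat, hσ₂]
    have hsucc : (∃ i' < i + 1, D.vl i' = v + 2) ↔ (∃ i' < i, D.vl i' = v + 2) ∨ D.vl i = v + 2 := by
      constructor
      · rintro ⟨i', hi', h⟩
        rcases (Nat.lt_succ_iff.1 hi').eq_or_lt with rfl | hi'
        · exact Or.inr h
        · exact Or.inl ⟨i', hi', h⟩
      · rintro (⟨i', hi', h⟩ | h)
        · exact ⟨i', by omega, h⟩
        · exact ⟨i, Nat.lt_succ_self i, h⟩
    rw [hsucc]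
    by_cases hv : D.vl i = v + 2
    · rw [hv, if_neg (by omega), Nat.add_sub_cancel, Function.update_self]
      exact ⟨fun _ => rfl, fun h => absurd (Or.inr rfl) h⟩
    · have : (if D.vl i ≤ 1 then σ₁.reals rOut else update (σ₁.reals rOut) (D.vl i - 2)
          (D.lev (D.base (D.vl i) + readLevel D (σ.nats nDist) (σ.nats nGap 0) (D.vl i)))) v =
          σ₁.reals rOut v := by
        split_ifs with h
        · rfl
        · exact Function.update_of_ne (by omega) _ _
      rw [this]
      simpa only [hv, or_false] using hI v
  · have h1 : ∀ i ∈ range D.n, 60 * (D.L (D.vl i) + 2) + (NatExpr.cost (.var nCount) + 12) ≤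
        200 * (D.L (D.vl i) + 1) := by
      intro i _
      simp only [NatExpr.cost]
      omega
    have h2 := sum_le_sum h1
    rw [← mul_sum, ← hD.H_eq] at h2
    simp only [NatExpr.cost] at h2 ⊢
    omega
  · intro σ' _ h v
    exact h v

end RealRAM


/-! ### The approximation scheme -/

namespace RealRAM

variable {n m : ℕ} {I : Instance (Fin n)} {ends : Fin m → Vertex (Fin n) × Vertex (Fin n)} {ε : ℝ}

/-- Compute the powers of a minimum cut of the discretized graph. -/
def approxProg : Prog := .block [
  discreteProg,
  copiesProg,
  levelsProg unitLevelsProg,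
  .setR rQuant (.const 1),
  solveProg,
  gapProg,
  outputProg]

/-- With unit quanta, the running time is linear in the size of the discretized graph times the number
of nodes. -/
theorem flowBound_unit_le {H E W : ℕ} (hW : 1 ≤ W) (hH : H ≤ W) (hHH : H * H ≤ 2 * W)
    (hE : E ≤ W) (hHE : H * E ≤ W) : flowBound 0 1 (H + 1) (2 * H) (6 * H + 4 * E) + 1 ≤ 99 * W := by
  have : flowBound 0 1 (H + 1) (2 * H) (6 * H + 4 * E) =
      36 * (H * H) + 8 * (H * E) + 12 * H + 4 * E + 2 := by
    unfold flowBound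
    ring
  omega

/-- A choice of levels that a program reads off from the labels is a cheapest one. -/
theorem CutLabels.readLevel_spec {D : Levels} {d : ℕ → ℕ} {c : ℝ} (h : CutLabels D d c) {g : ℕ}
    (hg : g ≤ 2 * D.H) (hne : ∀ v < 2 * D.H, d v ≠ g) :
    D.Feasible (readLevel D d g) ∧ D.cost (readLevel D d g) = c := by
  refine h.read g hg hne _ (fun a _ j hj => ?_) fun a ha => ?_
  · exact Classical.not_imp.1 (Nat.notMem_of_lt_sInf hj)
  · exact Nat.sInf_mem (s := {j | g < d (D.base a + j) → g < d (D.H + (D.base a + j))})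
      ⟨_, (h.closed g hg hne).top a ha⟩

theorem UsedList.count_le {σ : State} (hu : UsedList σ (Occurring σ)) (hσ : Holds σ I ends) :
    σ.nats nCount 0 ≤ n + 2 := by
  have h := card_le_card_of_injOn (s := range (σ.nats nCount 0)) (t := range (n + 2)) (σ.nats nUsed)
    (fun i hi => mem_coe.2 (mem_range.2 ((hσ.represents hu).used_lt
      ⟨i, mem_range.1 (mem_coe.1 hi), rfl⟩)))
    fun i hi j hj => hu.inj i (mem_range.1 (mem_coe.1 hi)) j (mem_range.1 (mem_coe.1 hj))
  rwa [card_range, card_range] at h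

/-- The infinite capacity of a problem whose prices are `0` and `1` is a natural number, and it exceeds
the number of levels by at most one. -/
theorem _root_.Levels.UnitLevels.exists_sum_eq {D : Levels} {α : ℝ} {c : ℕ} (hD : D.WF)
    (hQ : ∀ a, D.Used a → D.UnitLevels α c a) :
    ∃ z ≤ D.H, ∑ h ∈ range D.H, (if D.top h = 0 then D.cap h else 0) = (z : ℝ) := by
  classical
  refine ⟨∑ h ∈ range D.H, if D.top h = 0 ∧ D.cap h = 1 then 1 else 0, ?_, ?_⟩
  · refine (sum_le_card_nsmul _ _ 1 fun h _ => ?_).trans_eq (by simp)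
    split_ifs <;> simp
  · rw [Nat.cast_sum]
    refine sum_congr rfl fun h hh => ?_
    rcases Levels.UnitLevels.cap_eq_of_lt hD hQ (mem_range.1 hh) with h1 | h1 <;> simp [h1]

/-- The number of steps after the computation of `Z` is linear in the number of pairs of a vertex and an
edge times the square of the number of copies. -/
theorem exists_ends_approxProg (hends : I.IsEdgeList ends) (hI : I.Solvable) (hε : 0 < ε) :
    ∃ B : ℕ, (Ends approxProg (I.input ends ε)
        (B + 30000 * ((n + 2) * (m + 1) * ((copies (Fin n) ε + 1) * (copies (Fin n) ε + 1))))
        fun σ => ∃ K, I.IsMinCut ε K ∧ ∀ v : Fin n, σ.reals rOut v = I.cutPower ε K v) ∧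
      (2 ≤ m → (B : ℝ) ≤ 40000000000 * ((m : ℝ) ^ 3 / Real.log m)) := by
  set σ := I.input ends ε with hσdef
  have hσ : Holds σ I ends := holds_input I ends ε
  have hzero : ∀ a, 3 ≤ a → ∀ i, σ.nats a i = 0 := fun a ha i => input_nats_eq_zero I ends ε ha i
  have hout : ∀ v, σ.reals rOut v = 0 := fun v => by simp [hσdef, Instance.input]
  have hεσ : σ.reals rEps 0 = ε := by simp [hσdef, Instance.input]
  obtain ⟨B, hB, hBm⟩ := exists_ends_discreteProg hσ hends hI (hzero _ (by decide))
  refine ⟨B, ?_, hBm⟩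
  clear_value σ
  set c := copies (Fin n) ε with hc
  set W := (n + 2) * (m + 1) * ((c + 1) * (c + 1)) with hW
  -- There are at most `(n + 2) * (c + 1)` levels in total.
  have hX : (n + 2) * (c + 1) ≤ W := by
    calc (n + 2) * (c + 1) = (n + 2) * 1 * (1 * (c + 1)) := by ring
      _ ≤ _ := by rw [hW]; gcongr <;> omega
  have hY : 2 * (m + 1) * ((c + 1) * (c + 1)) ≤ W := by
    rw [hW]
    gcongr
    omega
  have hX2 : 2 * (c + 1) ≤ (n + 2) * (c + 1) := Nat.mul_le_mul_right _ (by omega)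
  refine Ends.mono (B := B + (50 * (c + 2) + ((n + 2) * (200 * (c + 1) + 14) + 20 + (4 +
    ((1000 * ((n + 2) * (c + 1) + 1) + 2000 * W + 19800 * W) +
      (100 * (2 * ((n + 2) * (c + 1)) + 1) + 200 * ((n + 2) * (c + 1) + 1))))))) ?_ ?_
      fun _ _ h => h
  swap
  · have : (n + 2) * (200 * (c + 1) + 14) = 200 * ((n + 2) * (c + 1)) + 14 * (n + 2) := by ring
    have : n + 2 ≤ (n + 2) * (c + 1) := Nat.le_mul_of_pos_right _ (Nat.succ_pos c)
    omega
  refine Ends.block_cons (hB.mono le_rfl ?_)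
  rintro σ₁ hf₁ ⟨hZ, hu₁, hcount₁⟩
  obtain ⟨hσ₁, -⟩ := hσ.frame hf₁ (by decide) (by decide)
  have hεσ₁ : σ₁.reals rEps 0 = ε := by rw [hf₁.reals rEps (by decide), hεσ]
  refine Ends.block_cons ((ends_copiesProg hσ₁.n_eq hεσ₁ hε).mono le_rfl ?_)
  rintro σ₂ hf₂ ⟨hc₂, hα₂⟩
  have hα₂ : σ₂.reals rUnit 0 = I.unitPower ε := by rw [hα₂, hZ]; rfl
  obtain ⟨hσ₂, hocc₂⟩ := hσ₁.frame hf₂ (by decide) (by decide)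
  have hu₂ : UsedList σ₂ (Occurring σ₂) := by
    rw [hocc₂]
    exact hu₁.congr fun a ha => hf₂.nats a (by revert a; decide)
  have hcount₂ : σ₂.nats nCount 0 ≤ 2 * m + 2 := by
    rw [hf₂.nats nCount (by decide)]
    exact hcount₁
  have hcount₂' := hu₂.count_le hσ₂
  refine Ends.block_cons ((ends_levelsProg (σ := σ₂) (P := unitLevelsProg)
    (fun D a => D.UnitLevels (I.unitPower ε) c a) (fun _ => 200 * (c + 1))
    (B := (n + 2) * (200 * (c + 1) + 14) + 20) hu₂ (by decide) (by decide)
    (fun D D' a hs _ _ _ _ h => h.congr hs) ?_ ?_).mono le_rfl ?_)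
  · intro i _ σ' hf' hiI
    refine ends_unitLevelsProg ?_ ?_ ?_ (I.unitPower_nonneg hI hε)
    · rw [hiI, hf'.nats nUsed (by decide)]
    · rw [hf'.nats nCopies (by decide), hc₂]
    · rw [hf'.reals rUnit (by decide), hα₂]
  · rw [sum_const, card_range, smul_eq_mul]
    gcongr
  rintro σ₃ hf₃ ⟨hwf, hQ, hinf⟩
  obtain ⟨hσ₃, hocc₃⟩ := hσ₂.frame hf₃ (by decide) (by decide)
  have hu₃ : UsedList σ₃ (Occurring σ₃) := by
    rw [hocc₃]
    exact hu₂.congr fun a ha => hf₃.nats a (by revert a; decide)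
  have hcount₃ := hf₃.nats nCount (by decide)
  refine Ends.block_cons (Ends.of_exec (by decide) (by decide) ?_)
  set P₄ : Prog := .setR rQuant (.const 1) with hP₄
  set σ₄ := P₄.exec σ₃ with hσ₄def
  have hf₄ : Frame P₄ σ₃ σ₄ := Frame.exec (by decide) σ₃
  have hlev : levelsOf σ₄ = levelsOf σ₃ := hf₄.levelsOf_eq (by decide) (by decide)
  have hq₄ : σ₄.reals rQuant 0 = 1 := by
    simp [hσ₄def, hP₄, Prog.exec, RealExpr.eval, NatExpr.eval]
  obtain ⟨hσ₄, hocc₄⟩ := hσ₃.frame hf₄ (by decide) (by decide)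
  have hu₄ : UsedList σ₄ (Occurring σ₄) := by
    rw [hocc₄]
    exact hu₃.congr fun a ha => hf₄.nats a (by revert a; decide)
  have hcount₄ : σ₄.nats nCount 0 = σ₂.nats nCount 0 := by
    rw [hf₄.nats nCount (by decide), hcount₃]
  have hseen₄ : σ₄.nats nSeen = σ.nats nSeen := by
    rw [hf₄.nats nSeen (by decide), hf₃.nats nSeen (by decide), hf₂.nats nSeen (by decide),
      hf₁.nats nSeen (by decide)]
  have hout₄ : σ₄.reals rOut = σ.reals rOut := by
    rw [hf₄.reals rOut (by decide), hf₃.reals rOut (by decide), hf₂.reals rOut (by decide),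
      hf₁.reals rOut (by decide)]
  clear_value σ₄
  rw [← hlev] at hwf hQ hinf
  have hr₄ := hσ₄.represents hu₄
  obtain ⟨hex, hmin⟩ := hr₄.isMinCut hwf hends hI hε hQ
  set D := levelsOf σ₄ with hD
  have hHn : D.H ≤ (n + 2) * (c + 1) := by
    refine (Levels.UnitLevels.H_le hwf hQ).trans (Nat.mul_le_mul_right _ ?_)
    exact hcount₄.le.trans hcount₂'
  -- Only vertices that are not isolated have levels; this is needed if `n` is larger than `m`.
  have hHm : D.H ≤ (2 * m + 2) * (c + 1) := by
    refine (Levels.UnitLevels.H_le hwf hQ).trans (Nat.mul_le_mul_right _ ?_)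
    exact hcount₄.le.trans hcount₂
  have hE : D.edgeSize m ≤ m * (c + 1) := by
    have := Levels.UnitLevels.edgeSize_le hwf hQ
    rwa [hr₄.m_eq] at this
  obtain ⟨z, hzH, hz⟩ := Levels.UnitLevels.exists_sum_eq hwf hQ
  rw [hz] at hinf
  have hinf : σ₄.reals rInf 0 = ((1 + z : ℕ) : ℝ) := by
    rw [Nat.cast_add, Nat.cast_one]
    exact hinf
  have hsolve := ends_solveProg (σ := σ₄) (κ := 0) (K := 1) (R := D.H + 1) (B := 19800 * W)
    (Λ := c) hwf hex (by rw [hq₄]; exact one_pos) (by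
      rw [hinf, hq₄, mul_one]
      exact Nat.cast_le.2 (by omega))
    (Or.inr ⟨hq₄, ⟨((1 + z : ℕ) : ℤ), by rw [hinf, Int.cast_natCast]⟩, fun h hh => by
      rcases Levels.UnitLevels.cap_eq_of_lt hwf hQ hh with h0 | h1
      · exact ⟨0, h0.trans Int.cast_zero.symm⟩
      · exact ⟨1, h1.trans Int.cast_one.symm⟩⟩) one_pos (fun a ha => by
      have h1 : σ₄.nats nLast a = _ := (hQ a ha).L_eq
      rw [h1]
      split_ifs <;> omega) (by
      rw [hσ₄.m_eq, ← hD]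
      have := flowBound_unit_le (H := D.H) (E := D.edgeSize m) (W := W) (by omega) (by omega) ?_ ?_ ?_
      · omega
      · calc D.H * D.H ≤ (n + 2) * (c + 1) * ((2 * m + 2) * (c + 1)) := Nat.mul_le_mul hHn hHm
          _ = 2 * W := by rw [hW]; ring
      · refine hE.trans (le_trans ?_ hY)
        calc m * (c + 1) = m * (1 * (c + 1)) := by ring
          _ ≤ _ := by gcongr <;> omega
      · calc D.H * D.edgeSize m ≤ (n + 2) * (c + 1) * (m * (c + 1)) := Nat.mul_le_mul hHn hE
          _ = (n + 2) * m * ((c + 1) * (c + 1)) := by ring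
          _ ≤ W := by rw [hW]; gcongr; omega)
  rw [hσ₄.m_eq, ← hD] at hsolve
  refine Ends.block_cons (hsolve.mono ?_ ?_)
  · have h1 : (c + 2) * (D.edgeSize m + 1) ≤ W := by
      calc (c + 2) * (D.edgeSize m + 1) ≤ (2 * (c + 1)) * ((m + 1) * (c + 1)) := by
            refine Nat.mul_le_mul (by omega) ?_
            have : (m + 1) * (c + 1) = m * (c + 1) + (c + 1) := by ring
            omega
        _ = 2 * (m + 1) * ((c + 1) * (c + 1)) := by ring
        _ ≤ W := hY
    omega
  rintro σ₅ hf₅ ⟨hcut, hN₅⟩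
  have hseen₅ : ∀ v, σ₅.nats nSeen v = 0 := by
    intro v
    rw [hf₅.nats nSeen (by decide), hseen₄]
    exact hzero _ (by decide) v
  refine Ends.block_cons ((ends_gapProg hN₅ hseen₅ hcut.exists_gap).mono (by omega) ?_)
  rintro σ₆ hf₆ ⟨hg, hne⟩
  have hlev₆ : levelsOf σ₆ = D :=
    (hf₆.levelsOf_eq (by decide) (by decide)).trans (hf₅.levelsOf_eq (by decide) (by decide))
  have hdist₆ : σ₆.nats nDist = σ₅.nats nDist := hf₆.nats _ (by decide)
  have hlast₆ : σ₆.nats nLast = D.L := congrArg Levels.L hlev₆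
  have hbase₆ : σ₆.nats nBase = D.base := congrArg Levels.base hlev₆
  have hH₆ : σ₆.nats nHigh 0 = D.H := congrArg Levels.H hlev₆
  have houtput := ends_outputProg (σ := σ₆) (hlev₆ ▸ hwf) (fun v => by
    rw [hf₆.reals rOut (by decide), hf₅.reals rOut (by decide), hout₄, hout]) (fun a ha => by
    rw [hlev₆] at ha
    rw [hdist₆, hlast₆, hbase₆, hH₆]
    exact (hcut.closed _ hg hne).top a ha)
  rw [hlev₆, hdist₆] at houtput
  refine houtput.mono (by omega) fun σ₇ _ h₇ => ?_
  obtain ⟨hfeas, hcost⟩ := hcut.readLevel_spec hg hne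
  obtain ⟨K, hK, hpow⟩ := hmin _ hfeas fun l hl => hcost.le.trans (hcut.le_cost l hl)
  refine ⟨K, hK, fun v => ?_⟩
  rw [hpow]
  split_ifs with hv
  · exact (h₇ v).1 hv
  · exact (h₇ v).2 hv

/-- A graph with two edges has a vertex besides the terminals. -/
theorem pos_of_two_le (hends : I.IsEdgeList ends) (hm : 2 ≤ m) : 1 ≤ n := by
  by_contra h
  obtain rfl : n = 0 := by omega
  have hst : ∀ k, s((ends k).1, (ends k).2) = s(Vertex.s, Vertex.t) := by
    intro k
    have hadj : I.graph.Adj (ends k).1 (ends k).2 := by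
      rw [← SimpleGraph.mem_edgeSet, ← hends.2]
      exact ⟨k, rfl⟩
    revert hadj
    rcases (ends k).1 with _ | _ | v <;> rcases (ends k).2 with _ | _ | v' <;> intro hadj
    · exact absurd rfl hadj.ne
    · rfl
    · exact v'.elim0
    · exact Sym2.eq_swap
    · exact absurd rfl hadj.ne
    · exact v'.elim0
    all_goals exact v.elim0
  have := hends.1 (a₁ := ⟨0, by omega⟩) (a₂ := ⟨1, by omega⟩) ((hst _).trans (hst _).symm)
  simp at this

/-- Since `c + 1 ≤ 4 n / min ε 1`, the time is `O(n³ m ε ^ (-2))` for `ε ≤ 1`. -/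
theorem discretized_size_le (hn : 1 ≤ n) (hm : 2 ≤ m) (hε : 0 < ε) :
    (((n + 2) * (m + 1) * ((copies (Fin n) ε + 1) * (copies (Fin n) ε + 1)) : ℕ) : ℝ) ≤
      72 * ((n : ℝ) ^ 3 * m * (min ε 1) ^ (-(5 / 2) : ℝ)) := by
  set δ := min ε 1 with hδ
  have hδ0 : 0 < δ := lt_min hε one_pos
  have hδ1 : δ ≤ 1 := min_le_right _ _
  have hn' : (1 : ℝ) ≤ n := by exact_mod_cast hn
  have hm' : (2 : ℝ) ≤ m := by exact_mod_cast hm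
  have hc : ((copies (Fin n) ε : ℕ) : ℝ) + 1 ≤ 4 * n / δ := by
    have h1 : ((copies (Fin n) ε : ℕ) : ℝ) < 2 * n / ε + 1 := by
      rw [copies, Fintype.card_fin]
      exact Nat.ceil_lt_add_one (by positivity)
    have h2 : 2 * n / ε ≤ 2 * n / δ := by
      gcongr
      exact min_le_left _ _
    have h3 : 2 ≤ 2 * n / δ := by
      rw [le_div_iff₀ hδ0]
      nlinarith
    have h4 : 4 * n / δ = 2 * n / δ + 2 * n / δ := by ring
    linarith
  have hpow : (δ ^ 2)⁻¹ ≤ δ ^ (-(5 / 2) : ℝ) := by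
    rw [← Real.rpow_natCast, ← Real.rpow_neg hδ0.le]
    exact Real.rpow_le_rpow_of_exponent_ge hδ0 hδ1 (by norm_num)
  push_cast
  calc ((n : ℝ) + 2) * (m + 1) * ((copies (Fin n) ε + 1) * (copies (Fin n) ε + 1))
      ≤ (3 * n) * (3 / 2 * m) * (4 * n / δ * (4 * n / δ)) := by
        gcongr <;> linarith
    _ = 72 * ((n : ℝ) ^ 3 * m * (δ ^ 2)⁻¹) := by
        field_simp
        ring
    _ ≤ _ := by gcongr

end RealRAM

/-- 1. The discrete optimum `Z` satisfies `Z / 2 ≤ OPT ≤ Z` (and both optima are attained).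
2. A minimum vertex cut of the graph with `⌈2 n / ε⌉` removable copies per vertex yields a feasible
   solution of power sum at most `(1 + ε) OPT`.
3. `Z` is computable in time `O(m³ / log m)`.
4. There is a program that, given the instance and `ε`, outputs a solution as in 2, in time
   `O(n³ m ε^(-2.5) + m³ / log m)` for `ε ≤ 1` (and in the time bound for `ε = 1` if `ε > 1`). -/
theorem mainTheorem3 :
    (∀ (V : Type*) [Fintype V] (I : Instance V), I.Solvable →
      IsLeast I.costs I.opt ∧ IsLeast I.discreteCosts I.discreteOpt ∧
        I.discreteOpt / 2 ≤ I.opt ∧ I.opt ≤ I.discreteOpt) ∧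
    (∀ (V : Type*) [Fintype V] [DecidableEq V] (I : Instance V), I.Solvable →
      ∀ ε : ℝ, 0 < ε → (∃ K, I.IsMinCut ε K) ∧ ∀ K, I.IsMinCut ε K →
        I.IsFeasible (I.cutPower ε K) ∧ ∑ v, I.cutPower ε K v = I.unitPower ε * #K ∧
          ∑ v, I.cutPower ε K v ≤ (1 + ε) * I.opt) ∧
    (∃ (P : RealRAM.Prog) (C : ℝ), ∀ (n m : ℕ) (I : Instance (Fin n))
      (ends : Fin m → Vertex (Fin n) × Vertex (Fin n)), I.IsEdgeList ends → I.Solvable →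
      ∃ (T : ℕ) (σ : RealRAM.State), RealRAM.Run P (I.input ends 0) T σ ∧
        σ.reals 2 0 = I.discreteOpt ∧
        (2 ≤ m → (T : ℝ) ≤ C * ((m : ℝ) ^ 3 / Real.log m))) ∧
    (∃ (P : RealRAM.Prog) (C : ℝ), ∀ (n m : ℕ) (I : Instance (Fin n))
      (ends : Fin m → Vertex (Fin n) × Vertex (Fin n)), I.IsEdgeList ends → I.Solvable →
      ∀ ε : ℝ, 0 < ε → ∃ (T : ℕ) (σ : RealRAM.State), RealRAM.Run P (I.input ends ε) T σ ∧
        (∃ K, I.IsMinCut ε K ∧ ∀ v : Fin n, σ.reals 2 v = I.cutPower ε K v) ∧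
        I.IsFeasible (fun v => σ.reals 2 v) ∧
        ∑ v : Fin n, σ.reals 2 v ≤ (1 + ε) * I.opt ∧
        (2 ≤ m → (T : ℝ) ≤
          C * ((n : ℝ) ^ 3 * m * (min ε 1) ^ (-(5 / 2) : ℝ) + (m : ℝ) ^ 3 / Real.log m))) := by
  refine ⟨fun V _ I hI => ⟨I.isLeast_opt hI, I.isLeast_discreteOpt hI, ?_, I.opt_le_discreteOpt hI⟩,
    fun V _ _ I hI ε hε => ⟨I.exists_isMinCut hI hε, fun K hK => hK.cutPower_spec hI hε⟩,
    RealRAM.exists_prog_discreteOpt, RealRAM.approxProg, 40000000000,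
    fun n m I ends hends hI ε hε => ?_⟩
  · linarith [I.discreteOpt_le_two_mul_opt hI]
  obtain ⟨B, ⟨T, σ, hrun, hT, K, hK, hout⟩, hBm⟩ := RealRAM.exists_ends_approxProg hends hI hε
  obtain ⟨hfeas, -, hle⟩ := hK.cutPower_spec hI hε
  have hp : (fun v : Fin n => σ.reals 2 v) = I.cutPower ε K := funext hout
  refine ⟨T, σ, hrun, ⟨K, hK, hout⟩, by rw [hp]; exact hfeas, ?_, fun hm => ?_⟩
  · rw [sum_congr rfl fun v _ => hout v]
    exact hle
  · have h1 := hBm hm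
    have h2 := RealRAM.discretized_size_le (ε := ε) (RealRAM.pos_of_two_le hends hm) hm hε
    have h3 : (T : ℝ) ≤ B + 30000 * (((n + 2) * (m + 1) *
        ((copies (Fin n) ε + 1) * (copies (Fin n) ε + 1)) : ℕ) : ℝ) := by exact_mod_cast hT
    have h4 : 0 ≤ (n : ℝ) ^ 3 * m * (min ε 1) ^ (-(5 / 2) : ℝ) := by positivity
    linarith
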